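/- \textbf{Setting.} For each $n$ let $(Y_i,T_i,X_i)_{i\le n}$ be i.i.d. with $T_i\in\{0,1\}$, running variable $X_i\in\mathbb R$ and cutoff $0$. Let $\mathcal F_H(B)$ be the set of functions $f_1(x)1\{x\ge 0\}-f_0(x)1\{x<0\}$ with $f_0,f_1:\mathbb R\to\mathbb R$ differentiable and $f_0',f_1'$ Lipschitz with constant $B$ (that is, $\|f_w''\|_\infty\le B$), and let $\mathcal F_H^0(B)$ be its members with a non-zero jump at $0$. Fix $B_Y,B_T>0$, $\alpha\in(0,1)$ and a law $P_X$ of $X_i$. Let $\mathcal F$ be the set of pairs $(\mu_Y,\mu_T)\in\mathcal F_H(B_Y)\times\mathcal F_H^0(B_T)$ with $\mu_T(X_i)\in[0,1]$ almost surely. To every $(\mu_Y,\mu_T)\in\mathcal F$ there belongs one population, not depending on $n$, in which $X_i$ has law $P_X$, $E(Y_i|X_i)=\mu_Y(X_i)$ and $E(T_i|X_i)=\mu_T(X_i)$. For $c\in\mathbb R$ put $M_i(c)=Y_i-cT_i$ and $\sigma^2_{M,i}(c)=V(M_i(c)|X_i)$. ``$A_n=B_n(1+o_P(1))$ uniformly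 over $\mathcal F$'' means $\sup_{\mathcal F}P(|A_n-B_n|>\varepsilon|B_n|)\to0$ for every $\varepsilon>0$. \textbf{Bandwidths and standard deviation.} For a kernel $K$ put $\widetilde x_i=(1,X_i)'$, $Q_+=\sum_iK(X_i/h)\widetilde x_i\widetilde x_i'1\{X_i\ge0\}$, $Q_-=\sum_iK(X_i/h)\widetilde x_i\widetilde x_i'1\{X_i<0\}$ and $$w_i(h)=e_1'Q_+^{-1}\widetilde x_iK(X_i/h)1\{X_i\ge0\}-e_1'Q_-^{-1}\widetilde x_iK(X_i/h)1\{X_i<0\},$$ where $e_1=(1,0)'$. These are the weights of the local linear estimator of the jump; call $h>0$ admissible if $Q_+$ and $Q_-$ are invertible. Put $s_M(h,c)=(\sum_iw_i(h)^2\sigma^2_{M,i}(c))^{1/2}$, $\bar b_M(h,c)=-\frac{B_Y+|c|B_T}{2}\sum_iw_i(h)X_i^2\,\mathrm{sign}(X_i)$ and $r_M=\bar b_M/s_M$. Let $\mathrm{cv}_{1-\alpha}(r)$ be the $(1-\alpha)$-quantile of $|N(r,1)|$, and let $h_M(c)$ be a minimizer of $\mathrm{cv}_{1-\alpha}(r_M(h,c))\,s_M(h,c)$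 over the admissible $h$ (any choice of a minimizer, as a function of $X_1,\dots,X_n$, whenever one exists). The empirical bandwidth $\widehat h_M(c)$ is a function of the sample that is admissible with probability tending to one, uniformly over $\mathcal F$. \textbf{Standard error.} Fix $R$. Let $r(j,i)$ be the rank of $|X_j-X_i|$ among the elements of the set $\{|X_s-X_i|:s\ne i,\ X_sX_i>0\}$, let $\mathcal R_i$ be the set of $j\neq i$ with $X_jX_i>0$ and $r(j,i)\le Q_i$, with $Q_i$ the smallest integer for which this set has at least $R$ elements. Let $\widetilde X_j=(1,X_j)$ for all $j$ if $X$ takes at least two distinct values on $\mathcal R_i$, and $\widetilde X_j=1$ for all $j$ otherwise; put $A_i=\sum_{j\in\mathcal R_i}\widetilde X_j'\widetilde X_j$, $\widehat M_i(c)=\widetilde X_iA_i^{-1}\sum_{j\in\mathcal R_i}\widetilde X_j'M_j(c)$, $H_i=\widetilde X_iA_i^{-1}\widetilde X_i'$, and $$\widehat\sigma^2_{M,i}(c)=\frac{(M_i(c)-\widehat M_i(c))^2}{1+H_i},\qquad \widehat s_M(h,c)=\Big(\sum_iw_i(h)^2\widehat\sigma^2_{M,i}(c)\Big)^{1/2}.$$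 \textbf{Assumptions.} (1) For some $q>2$ and every $c\in\mathbb R$, $E(|M_i(c)-E(M_i(c)|X_i)|^q\,|\,X_i=x)$ is bounded, and for every $c$, $V(M_i(c)|X_i=x)$ is bounded and bounded away from zero, uniformly over $x$ in the support of $X_i$ and over $\mathcal F$; $K$ is a continuous, unimodal, symmetric density that vanishes outside $[-1,1]$. (2) One of the following holds. (LL1) $R\ge1$, and over some open neighborhood of $0$ the support of $X_i$ is $\{\pm x_1,\dots,\pm x_k\}$ with distinct $x_j>0$ and $k\ge2$; moreover $k\ge3$ or the whole support is finite. (LL2) $R\ge2$; $X_i$ has a density that is bounded and bounded away from zero over an open neighborhood of $0$; and for every $c$, uniformly over $\mathcal F$, $V(M_i(c)|X_i=x)$ is Lipschitz continuous in $x$ on each side of the cutoff and $E((M_i(c)-E(M_i(c)|X_i))^4|X_i=x)$ is bounded in $x$. \textbf{Theorem.} For every $c\in\mathbb R$: if $\widehat h_M(c)=h_M(c)(1+o_P(1))$ uniformly over $\mathcal F$, then $\widehat s_M(\widehat h_M(c),c)=s_M(h_M(c),c)(1+o_P(1))$ uniformly over $\mathcal F$. -/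

import Mathlib

open MeasureTheory ProbabilityTheory Filter Topology Set
open scoped ENNReal

noncomputable section

namespace FuzzyRD

/-! ### Smoothness classes -/

/-- Second-order Hölder condition `‖f''‖_∞ ≤ B`: `f` is differentiable and its derivative is
Lipschitz with constant `B` (hence `f''` exists almost everywhere and is bounded by `B`). -/
def SecondDerivBounded (B : ℝ) (f : ℝ → ℝ) : Prop :=
  Differentiable ℝ f ∧ ∀ x y : ℝ, |deriv f x - deriv f y| ≤ B * |x - y|

/-- The class of functions `f₁(x) 1{x ≥ 0} - f₀(x) 1{x < 0}` with `‖f_w''‖_∞ ≤ B`. -/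
def holderClass (B : ℝ) : Set (ℝ → ℝ) :=
  {f | ∃ f₀ f₁ : ℝ → ℝ, SecondDerivBounded B f₀ ∧ SecondDerivBounded B f₁ ∧
    ∀ x, f x = if 0 ≤ x then f₁ x else - f₀ x}

/-- The jump `f₊ - f₋` at the cutoff zero. -/
def jump (f : ℝ → ℝ) : ℝ := Function.rightLim f 0 - Function.leftLim f 0

/-- Members of `holderClass B` whose jump exceeds `δ` in absolute value. -/
def holderClassJump (B δ : ℝ) : Set (ℝ → ℝ) :=
  {f | f ∈ holderClass B ∧ δ < |jump f|}

/-- The pairs `(μ_Y, μ_T)` in `F_H(B_Y) × F_H^0(B_T)` that are pairs of conditional expectation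
functions of an outcome and a binary treatment when the running variable has law `PX`:
`μ_T(X) ∈ [0, 1]` with probability one. -/
def regClass (BY BT : ℝ) (PX : Measure ℝ) : Set ((ℝ → ℝ) × (ℝ → ℝ)) :=
  {m | m.1 ∈ holderClass BY ∧ m.2 ∈ holderClassJump BT 0 ∧ ∀ᵐ x ∂PX, m.2 x ∈ Icc (0 : ℝ) 1}

/-! ### Populations and samples -/

/-- One observation `(X, (Y, T))`. -/
abbrev Obs : Type := ℝ × (ℝ × ℝ)

/-- The constructed outcome `M(c) = Y - c T`, as a function of `(Y, T)`. -/
def outcome (c : ℝ) (yt : ℝ × ℝ) : ℝ := yt.1 - c * yt.2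

/-- `κ m` is the conditional law of `(Y, T)` given `X` in the population belonging to
`m = (μ_Y, μ_T)`: the treatment is binary, and `μ_Y`, `μ_T` are the conditional means. -/
def IsPopulation (PX : Measure ℝ) (κ : (ℝ → ℝ) × (ℝ → ℝ) → Kernel ℝ (ℝ × ℝ))
    (F : Set ((ℝ → ℝ) × (ℝ → ℝ))) : Prop :=
  ∀ m ∈ F, ∀ᵐ x ∂PX,
    (∀ᵐ yt ∂(κ m x), yt.2 = 0 ∨ yt.2 = 1) ∧
    Integrable (fun yt : ℝ × ℝ => yt.1) (κ m x) ∧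
    ∫ yt, yt.1 ∂(κ m x) = m.1 x ∧ ∫ yt, yt.2 ∂(κ m x) = m.2 x

/-- Law of an i.i.d. sample of size `n` from the population belonging to `m`. -/
def sampleLaw (PX : Measure ℝ) (κ : (ℝ → ℝ) × (ℝ → ℝ) → Kernel ℝ (ℝ × ℝ))
    (m : (ℝ → ℝ) × (ℝ → ℝ)) (n : ℕ) : Measure (Fin n → Obs) :=
  Measure.pi fun _ => PX ⊗ₘ κ m

/-- The realizations of the running variable. -/
def runVar {n : ℕ} (S : Fin n → Obs) : Fin n → ℝ := fun i => (S i).1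

/-- The realizations of `M(c)`. -/
def sampleOutcome (c : ℝ) {n : ℕ} (S : Fin n → Obs) : Fin n → ℝ := fun i => outcome c (S i).2

/-- The conditional mean `E(M(c) | X = x)`. -/
def condMean (κm : Kernel ℝ (ℝ × ℝ)) (c x : ℝ) : ℝ := ∫ yt, outcome c yt ∂(κm x)

/-- The conditional variance `V(M(c) | X = x)`. -/
def condVariance (κm : Kernel ℝ (ℝ × ℝ)) (c x : ℝ) : ℝ := variance (outcome c) (κm x)

/-- The conditional absolute central moment of order `q` of `M(c)` given `X = x`. -/
def condCentralMoment (κm : Kernel ℝ (ℝ × ℝ)) (c q x : ℝ) : ℝ≥0∞ :=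
  ∫⁻ yt, ENNReal.ofReal (|outcome c yt - condMean κm c x| ^ q) ∂(κm x)

/-! ### Assumptions -/

/-- Continuous, unimodal, symmetric density that vanishes outside `[-1, 1]`
(for a symmetric function, unimodality means that it is nonincreasing on `[0, ∞)`). -/
structure IsRegKernel (K : ℝ → ℝ) : Prop where
  continuous : Continuous K
  nonneg : ∀ t, 0 ≤ K t
  integral_eq_one : ∫ t, K t = 1
  symm : ∀ t, K (-t) = K t
  unimodal : AntitoneOn K (Ici 0)
  support : ∀ t, 1 < |t| → K t = 0

/-- Moment conditions, uniform over the support of `X` and over the class `F`. -/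
structure MomentConditions (PX : Measure ℝ) (κ : (ℝ → ℝ) × (ℝ → ℝ) → Kernel ℝ (ℝ × ℝ))
    (F : Set ((ℝ → ℝ) × (ℝ → ℝ))) : Prop where
  moment : ∃ q : ℝ, 2 < q ∧ ∀ c : ℝ, ∃ C : ℝ, ∀ m ∈ F, ∀ᵐ x ∂PX,
    condCentralMoment (κ m) c q x ≤ ENNReal.ofReal C
  variance : ∀ c : ℝ, ∃ lo hi : ℝ, 0 < lo ∧ ∀ m ∈ F, ∀ᵐ x ∂PX,
    condVariance (κ m) c x ∈ Icc lo hi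

/-- Discrete running variable: over an open neighborhood of the cutoff the support is
`{±x₁, …, ±x_k}` with `0 < x₁ < … < x_k`. Moreover `k ≥ 2`, so that a line can be fitted on
each side, and, unless the whole support is finite, `k ≥ 3`, so that on each side the three
support points closest to the cutoff exist and belong to the discrete part. -/
def DiscreteRunning (PX : Measure ℝ) : Prop :=
  ∃ (δ : ℝ) (s : Finset ℝ), 0 < δ ∧ (∀ x ∈ s, 0 < x) ∧
    PX.support ∩ Ioo (-δ) δ = {x | |x| ∈ s} ∧
    2 ≤ s.card ∧ (PX.support.Finite ∨ 3 ≤ s.card)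

/-- Continuous running variable. The Lipschitz condition on the conditional variance is only
imposed between points on the same side of the cutoff, up to null sets. -/
structure ContinuousRunning (PX : Measure ℝ) (κ : (ℝ → ℝ) × (ℝ → ℝ) → Kernel ℝ (ℝ × ℝ))
    (F : Set ((ℝ → ℝ) × (ℝ → ℝ))) : Prop where
  density : ∃ f : ℝ → ℝ≥0∞, Measurable f ∧ PX = volume.withDensity f ∧
    ∃ δ lo hi : ℝ, 0 < δ ∧ 0 < lo ∧
      ∀ᵐ x ∂(volume.restrict (Ioo (-δ) δ)), f x ∈ Icc (ENNReal.ofReal lo) (ENNReal.ofReal hi)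
  lipschitz : ∀ c : ℝ, ∃ L : ℝ, ∀ m ∈ F, ∀ᵐ x ∂PX, ∀ᵐ y ∂PX, 0 < x * y →
    |condVariance (κ m) c x - condVariance (κ m) c y| ≤ L * |x - y|
  fourth_moment : ∀ c : ℝ, ∃ C : ℝ, ∀ m ∈ F, ∀ᵐ x ∂PX,
    condCentralMoment (κ m) c 4 x ≤ ENNReal.ofReal C

/-! ### Local linear weights -/

/-- The regressor `(1, x)`. -/
def lin (x : ℝ) : Fin 2 → ℝ := ![1, x]

/-- Indicator of the treated side `x ≥ 0`. -/
def indPos (x : ℝ) : ℝ := if 0 ≤ x then 1 else 0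

/-- Indicator of the untreated side `x < 0`. -/
def indNeg (x : ℝ) : ℝ := if x < 0 then 1 else 0

/-- `Q = ∑ K(X_i / h) (1, X_i)(1, X_i)' 1{X_i on the given side}`. -/
def gram (K : ℝ → ℝ) (side : ℝ → ℝ) {n : ℕ} (X : Fin n → ℝ) (h : ℝ) :
    Matrix (Fin 2) (Fin 2) ℝ :=
  ∑ i, (K (X i / h) * side (X i)) • Matrix.vecMulVec (lin (X i)) (lin (X i))

/-- One-sided local linear weight `e₁' Q⁻¹ (1, X_i)' K(X_i / h) 1{X_i on the given side}`. -/
def sideWeight (K : ℝ → ℝ) (side : ℝ → ℝ) {n : ℕ} (X : Fin n → ℝ) (h : ℝ) (i : Fin n) : ℝ :=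
  ((gram K side X h)⁻¹.mulVec (lin (X i))) 0 * (K (X i / h) * side (X i))

/-- The local linear weights `w_i(h)` of the jump estimator. -/
def weight (K : ℝ → ℝ) {n : ℕ} (X : Fin n → ℝ) (h : ℝ) (i : Fin n) : ℝ :=
  sideWeight K indPos X h i - sideWeight K indNeg X h i

/-- The bandwidths at which the local linear estimator of the jump is well defined. -/
def admissible (K : ℝ → ℝ) {n : ℕ} (X : Fin n → ℝ) : Set ℝ :=
  {h | 0 < h ∧ (gram K indPos X h).det ≠ 0 ∧ (gram K indNeg X h).det ≠ 0}

/-! ### Infeasible bandwidth and standard deviation -/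

/-- Worst-case bias `-(B_Y + |c| B_T)/2 · ∑ w_i(h) X_i² sign(X_i)`. -/
def biasBound (BY BT : ℝ) (K : ℝ → ℝ) (c : ℝ) {n : ℕ} (X : Fin n → ℝ) (h : ℝ) : ℝ :=
  -((BY + |c| * BT) / 2) * ∑ i, weight K X h i * X i ^ 2 * Real.sign (X i)

/-- Conditional standard deviation `s_M(h, c) = (∑ w_i(h)² V(M_i(c) | X_i))^{1/2}`. -/
def stdDev (K : ℝ → ℝ) (κm : Kernel ℝ (ℝ × ℝ)) (c : ℝ) {n : ℕ} (X : Fin n → ℝ) (h : ℝ) : ℝ :=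
  Real.sqrt (∑ i, weight K X h i ^ 2 * condVariance κm c (X i))

/-- `cv_{1-α}(r)`: the `(1-α)`-quantile of the absolute value of a `N(r, 1)` variable. -/
def critVal (α r : ℝ) : ℝ :=
  sInf {t : ℝ | ENNReal.ofReal (1 - α) ≤ gaussianReal r 1 {z | |z| ≤ t}}

/-- The (scaled) length `cv_{1-α}(r_M(h, c)) s_M(h, c)` of the auxiliary confidence interval,
where `r_M(h, c)` is the ratio of the worst-case bias to the standard deviation. -/
def ciLength (BY BT α : ℝ) (K : ℝ → ℝ) (κm : Kernel ℝ (ℝ × ℝ)) (c : ℝ) {n : ℕ}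
    (X : Fin n → ℝ) (h : ℝ) : ℝ :=
  critVal α (biasBound BY BT K c X h / stdDev K κm c X h) * stdDev K κm c X h

/-- The set of minimizers of the length over the admissible bandwidths. -/
def optimalBandwidths (BY BT α : ℝ) (K : ℝ → ℝ) (κm : Kernel ℝ (ℝ × ℝ)) (c : ℝ) {n : ℕ}
    (X : Fin n → ℝ) : Set ℝ :=
  {h | h ∈ admissible K X ∧
    ∀ h' ∈ admissible K X, ciLength BY BT α K κm c X h ≤ ciLength BY BT α K κm c X h'}

/-! ### Nearest-neighbor variance estimator -/

/-- The other units on the same side of the cutoff as unit `i`. -/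
def candidates {n : ℕ} (X : Fin n → ℝ) (i : Fin n) : Finset (Fin n) :=
  Finset.univ.filter fun s => s ≠ i ∧ 0 < X s * X i

/-- The rank `r(j, i)` of `|X_j - X_i|` among the elements of the set
`{|X_s - X_i| : s ≠ i, X_s X_i > 0}` (equal distances have equal rank). -/
def distRank {n : ℕ} (X : Fin n → ℝ) (j i : Fin n) : ℕ :=
  (((candidates X i).image fun s => |X s - X i|).filter fun d => d ≤ |X j - X i|).card

/-- The candidates of rank at most `Q`. -/
def withinRank {n : ℕ} (X : Fin n → ℝ) (i : Fin n) (Q : ℕ) : Finset (Fin n) :=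
  (candidates X i).filter fun j => distRank X j i ≤ Q

/-- `𝓡_i`: the candidates of rank at most `Q_i`, with `Q_i` the smallest integer for which there
are at least `R` of them. -/
def neighbors (R : ℕ) {n : ℕ} (X : Fin n → ℝ) (i : Fin n) : Finset (Fin n) :=
  withinRank X i (sInf {Q : ℕ | R ≤ (withinRank X i Q).card})

/-- The matrix `∑_{j ∈ N} Z_j' Z_j` of a linear regression on `Z` over the index set `N`. -/
def regMatrix {ι : Type} [Fintype ι] {n : ℕ} (Z : Fin n → ι → ℝ) (N : Finset (Fin n)) :
    Matrix ι ι ℝ :=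
  ∑ j ∈ N, Matrix.vecMulVec (Z j) (Z j)

/-- The best linear prediction of `M_i` from the units in `N`. -/
def linPred {ι : Type} [Fintype ι] [DecidableEq ι] {n : ℕ} (Z : Fin n → ι → ℝ)
    (N : Finset (Fin n)) (M : Fin n → ℝ) (i : Fin n) : ℝ :=
  dotProduct (Z i) ((regMatrix Z N)⁻¹.mulVec (∑ j ∈ N, M j • Z j))

/-- The leverage `H_i = Z_i (∑_{j ∈ N} Z_j' Z_j)⁻¹ Z_i'`. -/
def leverage {ι : Type} [Fintype ι] [DecidableEq ι] {n : ℕ} (Z : Fin n → ι → ℝ)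
    (N : Finset (Fin n)) (i : Fin n) : ℝ :=
  dotProduct (Z i) ((regMatrix Z N)⁻¹.mulVec (Z i))

/-- The scaled squared prediction error `(M_i - M̂_i)² / (1 + H_i)`. -/
def scaledSqError {ι : Type} [Fintype ι] [DecidableEq ι] {n : ℕ} (Z : Fin n → ι → ℝ)
    (N : Finset (Fin n)) (M : Fin n → ℝ) (i : Fin n) : ℝ :=
  1 / (1 + leverage Z N i) * (M i - linPred Z N M i) ^ 2

/-- The variance estimator `σ̂²_{M,i}`: the regressors are `(1, X)` if `X` takes at least two
distinct values among the neighbors, and only the constant `1` otherwise. -/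
def nnVariance (R : ℕ) {n : ℕ} (X M : Fin n → ℝ) (i : Fin n) : ℝ :=
  if 2 ≤ ((neighbors R X i).image X).card then
    scaledSqError (fun j => lin (X j)) (neighbors R X i) M i
  else
    scaledSqError (fun _ => (![1] : Fin 1 → ℝ)) (neighbors R X i) M i

/-- The standard error `ŝ_M(h, c) = (∑ w_i(h)² σ̂²_{M,i}(c))^{1/2}`. -/
def stdErr (R : ℕ) (K : ℝ → ℝ) (c : ℝ) {n : ℕ} (S : Fin n → Obs) (h : ℝ) : ℝ :=
  Real.sqrt (∑ i, weight K (runVar S) h i ^ 2 * nnVariance R (runVar S) (sampleOutcome c S) i)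

/-! ### Uniform convergence in probability -/

/-- The events `E m n` have probability tending to zero, uniformly over `m ∈ F`. -/
def UnifNegligible (PX : Measure ℝ) (κ : (ℝ → ℝ) × (ℝ → ℝ) → Kernel ℝ (ℝ × ℝ))
    (F : Set ((ℝ → ℝ) × (ℝ → ℝ)))
    (E : (ℝ → ℝ) × (ℝ → ℝ) → (n : ℕ) → Set (Fin n → Obs)) : Prop :=
  Tendsto (fun n => ⨆ m ∈ F, sampleLaw PX κ m n (E m n)) atTop (𝓝 0)

/-- `A = B (1 + o_P(1))` uniformly over `m ∈ F`. -/
def UnifRatioConsistent (PX : Measure ℝ) (κ : (ℝ → ℝ) × (ℝ → ℝ) → Kernel ℝ (ℝ × ℝ))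
    (F : Set ((ℝ → ℝ) × (ℝ → ℝ)))
    (A B : (ℝ → ℝ) × (ℝ → ℝ) → (n : ℕ) → (Fin n → Obs) → ℝ) : Prop :=
  ∀ ε : ℝ, 0 < ε →
    UnifNegligible PX κ F fun m n => {S | ε * |B m n S| < |A m n S - B m n S|}

end FuzzyRD

end

open FuzzyRD

/-! The comparison is made for squares. With g the empirical and h the optimal bandwidth, ŝ² - s² is
the sum of ∑ w_i(g)² (σ̂_i² - σ_i²) and ∑ (w_i(g)² - w_i(h)²) σ_i². One-sided weights sum to one, so
by Cauchy-Schwarz s² is at least a constant over the number N of observations in use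
(`one_le_card_mul_sum_weight_sq`). Both sums therefore have to be o(1/N). The work consists in
locating h, in controlling how the weights react to the bandwidth, and in separating g, which may
depend on the outcomes, from σ̂_i².

To locate h, note that the interval length is bias plus standard deviation up to constants
(`exists_ciLength_bounds`). With distances y_i = |X_i| and kernel masses k_i, the one-sided bias
functional is the average of the products y_i y_j with weights proportional to k_i k_j (y_i - y_j)²
(`two_mul_llDet`, `llDet_mul_llBias`). This yields lower bounds for the bias from mere counts of
observations.

Discrete case. Let x₁ < x₂ < x₃ be the smallest distances in the support. Each one-sided bias
functional is at least x₁ x₂, with equality if no mass lies beyond x₂, while a fixed kernel mass at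
x₃ costs a fixed amount of bias. Standard deviations vanish at the bandwidths in question, so an
optimal h puts almost no mass on x₃ (`exists_optimalBandwidths_discrete`). The bandwidth itself need
not be unique, but its weights are: they are close to those of the lines through the two nearest
points (`exists_abs_weight_sub_lineW_le`), and so are the weights at g, by uniform continuity of the
kernel. Among ties σ̂_i² averages to the sample variance, which obeys a weak law with moments of
order q/2 > 1 (`unifNegligible_nnVariance_atPoint`). Weights are constant among ties, so the
randomness of g does no harm.

Continuous case. Let r = n^(-1/5). With high probability all relevant counts near the cutoff are of
order n r, and then h is of exact order r: smaller bandwidths have too large a variance, larger ones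
too large a bias (`exists_localization`). The weights are O(1/(n r)) and Lipschitz in the kernel
masses (`exists_weight_bounds`), so g can be replaced by a point of a finite nonrandom net. At a
fixed bandwidth one conditions on X (`sampleLaw_le_of_ae`). The σ̂_i² are then normalized squares of
linear forms in independent errors, each observation enters boundedly many of them, and Chebyshev's
inequality applies (`measure_abs_sum_nnError_sub_ge_le`).

The regression functions enter only through constants common to the whole class, which gives
uniformity. -/

namespace FuzzyRD

/-! ### Regression kernels -/

namespace IsRegKernel

variable {K : ℝ → ℝ}

lemma apply_abs (hK : IsRegKernel K) (t : ℝ) : K |t| = K t := by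
  rcases abs_cases t with ⟨h, _⟩ | ⟨h, _⟩ <;> rw [h]
  exact hK.symm t

lemma le_apply_of_abs_le (hK : IsRegKernel K) {s t : ℝ} (h : |s| ≤ |t|) : K t ≤ K s := by
  rw [← hK.apply_abs t, ← hK.apply_abs s]
  exact hK.unimodal (abs_nonneg s) (abs_nonneg t) h

lemma le_apply_zero (hK : IsRegKernel K) (t : ℝ) : K t ≤ K 0 :=
  hK.le_apply_of_abs_le (by simp)

lemma apply_zero_pos (hK : IsRegKernel K) : 0 < K 0 := by
  rcases (hK.nonneg 0).lt_or_eq with h | h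
  · exact h
  · have h0 : K = fun _ => 0 := by
      funext t
      exact le_antisymm (h ▸ hK.le_apply_zero t) (hK.nonneg t)
    have := hK.integral_eq_one
    rw [h0] at this
    simp at this

/-- By unimodality the kernel is positive on an interval around zero, and by continuity it vanishes
at the endpoints. The exact endpoint `a`, possibly below 1, decides which support points of a
discrete variable receive mass. -/
lemma exists_cutoff (hK : IsRegKernel K) :
    ∃ a : ℝ, 0 < a ∧ a ≤ 1 ∧ (∀ t, |t| < a → 0 < K t) ∧ ∀ t, a ≤ |t| → K t = 0 := by
  set A : Set ℝ := {t | 0 ≤ t ∧ 0 < K t} with hA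
  have hbd : ∀ t ∈ A, t ≤ 1 := by
    rintro t ⟨h0, h1⟩
    by_contra! h
    have := hK.support t (by rwa [abs_of_nonneg h0])
    linarith
  have hne : A.Nonempty := ⟨0, le_refl _, hK.apply_zero_pos⟩
  have hbdd : BddAbove A := ⟨1, hbd⟩
  have hpos : 0 < sSup A := by
    have h1 : ∀ᶠ t in 𝓝 (0 : ℝ), 0 < K t :=
      hK.continuous.continuousAt.eventually (lt_mem_nhds hK.apply_zero_pos)
    obtain ⟨ε, hε, hball⟩ := Metric.eventually_nhds_iff.1 h1
    have : ε / 2 ∈ A := ⟨by positivity, hball (by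
      rw [Real.dist_eq, sub_zero, abs_of_pos (by positivity)]; linarith)⟩
    exact lt_of_lt_of_le (by positivity) (le_csSup hbdd this)
  have hlt : ∀ t, |t| < sSup A → 0 < K t := by
    intro t ht
    obtain ⟨s, hs, hts⟩ := exists_lt_of_lt_csSup hne ht
    exact hs.2.trans_le (hK.le_apply_of_abs_le (by rw [abs_of_nonneg hs.1]; exact hts.le))
  have hgt : ∀ t, sSup A < t → K t = 0 := by
    intro t ht
    by_contra h
    have : t ∈ A := ⟨by linarith, lt_of_le_of_ne (hK.nonneg t) (Ne.symm h)⟩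
    exact absurd (le_csSup hbdd this) (not_le.2 ht)
  have hsup : K (sSup A) = 0 := by
    have h1 : Tendsto K (𝓝[>] (sSup A)) (𝓝 (K (sSup A))) :=
      hK.continuous.continuousAt.mono_left nhdsWithin_le_nhds
    have h2 : Tendsto K (𝓝[>] (sSup A)) (𝓝 0) :=
      tendsto_const_nhds.congr' (by
        filter_upwards [self_mem_nhdsWithin] with t ht
        exact (hgt t ht).symm)
    exact tendsto_nhds_unique h1 h2
  refine ⟨sSup A, hpos, csSup_le hne hbd, hlt, fun t ht => ?_⟩
  rw [← hK.apply_abs]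
  rcases ht.lt_or_eq with h | h
  · exact hgt _ h
  · rw [← h, hsup]

lemma exists_lower_bound (hK : IsRegKernel K) :
    ∃ t₀ κ : ℝ, 0 < t₀ ∧ t₀ ≤ 1 ∧ 0 < κ ∧ ∀ t, |t| ≤ t₀ → κ ≤ K t := by
  obtain ⟨a, ha, ha1, hpos, -⟩ := hK.exists_cutoff
  refine ⟨a / 2, K (a / 2), by positivity, by linarith, hpos _ ?_, fun t ht => ?_⟩
  · rw [abs_of_pos (by positivity)]; linarith
  · exact hK.le_apply_of_abs_le (by rwa [abs_of_pos (show 0 < a / 2 by positivity)])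

lemma apply_eq_zero (hK : IsRegKernel K) {t : ℝ} (ht : 1 ≤ |t|) : K t = 0 := by
  obtain ⟨a, ha, ha1, -, h0⟩ := hK.exists_cutoff
  exact h0 t (ha1.trans ht)

lemma uniformContinuous (hK : IsRegKernel K) : UniformContinuous K := by
  refine hK.continuous.uniformContinuous_of_tendsto_cocompact (x := 0) ?_
  refine tendsto_const_nhds.congr' ?_
  have h : (Icc (-1 : ℝ) 1)ᶜ ∈ cocompact ℝ := isCompact_Icc.compl_mem_cocompact
  filter_upwards [h] with t ht
  refine (hK.support t ?_).symm
  by_contra! h'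
  exact ht (abs_le.1 h')

/-- The kernel weights at two bandwidths whose ratio is close to one are uniformly close. -/
lemma exists_modulus (hK : IsRegKernel K) {ω : ℝ} (hω : 0 < ω) :
    ∃ δ : ℝ, 0 < δ ∧ δ ≤ 1 / 2 ∧ ∀ g h : ℝ, 0 < g → |h - g| ≤ δ * g →
      ∀ y : ℝ, |K (y / h) - K (y / g)| ≤ ω := by
  obtain ⟨η, hη, huc⟩ := Metric.uniformContinuous_iff.1 hK.uniformContinuous ω hω
  -- The bound 1/2 keeps `h` in `[g/2, 2g]`, so both kernels vanish once `|y| > 2g`. For `|y| ≤ 2g`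
  -- the bound `η/8` makes the two arguments differ by at most `η/2`.
  refine ⟨min (1 / 2) (η / 8), by positivity, min_le_left _ _, fun g h hg hgh y => ?_⟩
  have h1 : |h - g| ≤ 1 / 2 * g :=
    hgh.trans (mul_le_mul_of_nonneg_right (min_le_left _ _) hg.le)
  have h2 : |h - g| ≤ η / 8 * g :=
    hgh.trans (mul_le_mul_of_nonneg_right (min_le_right _ _) hg.le)
  have hh : g / 2 ≤ h := by have := (abs_le.1 h1).1; linarith
  have hh' : h ≤ 2 * g := by have := (abs_le.1 h1).2; linarith
  have hh0 : 0 < h := by linarith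
  rcases le_or_gt |y| (2 * g) with hy | hy
  · have key : |y / h - y / g| ≤ η / 2 := by
      have e : y / h - y / g = y * (g - h) / (h * g) := by field_simp
      rw [e, abs_div, abs_mul, abs_of_pos (mul_pos hh0 hg), div_le_iff₀ (by positivity),
        abs_sub_comm]
      calc |y| * |h - g| ≤ (2 * g) * (η / 8 * g) := by gcongr
        _ = η / 2 * (g / 2 * g) := by ring
        _ ≤ η / 2 * (h * g) := by gcongr
    have := huc (a := y / h) (b := y / g) (by rw [Real.dist_eq]; linarith)
    rw [Real.dist_eq] at this
    exact this.le
  · have e1 : K (y / h) = 0 := hK.apply_eq_zero (by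
      rw [abs_div, abs_of_pos hh0, le_div_iff₀ hh0]; linarith)
    have e2 : K (y / g) = 0 := hK.apply_eq_zero (by
      rw [abs_div, abs_of_pos hg, le_div_iff₀ hg]; linarith)
    rw [e1, e2]; simpa using hω.le

end IsRegKernel

/-! ### The critical value -/

/-- The levels whose coverage under `N(r, 1)` is at least `1 - α`. -/
def coverSet (α r : ℝ) : Set ℝ :=
  {t : ℝ | ENNReal.ofReal (1 - α) ≤ gaussianReal r 1 {z | |z| ≤ t}}

lemma gaussianReal_apply_shift (r : ℝ) (s : Set ℝ) (hs : MeasurableSet s) :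
    gaussianReal r 1 s = gaussianReal 0 1 {z | z + r ∈ s} := by
  have h := gaussianReal_map_add_const (μ := 0) (v := 1) r
  rw [zero_add] at h
  rw [← h, Measure.map_apply (by fun_prop) hs]
  rfl

lemma measurableSet_abs_le (t : ℝ) : MeasurableSet {z : ℝ | |z| ≤ t} :=
  measurableSet_le (by fun_prop) measurable_const

/-- By the triangle inequality. This makes `critVal` Lipschitz with constant one in the
noncentrality. -/
lemma coverSet_shift {α r r' t : ℝ} (ht : t ∈ coverSet α r) : t + |r - r'| ∈ coverSet α r' := by
  rw [coverSet, mem_ofPred_eq, gaussianReal_apply_shift _ _ (measurableSet_abs_le _)] at ht ⊢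
  refine ht.trans (measure_mono fun z hz => ?_)
  simp only [mem_ofPred_eq] at hz ⊢
  calc |z + r'| = |(z + r) - (r - r')| := by ring_nf
    _ ≤ |z + r| + |r - r'| := abs_sub _ _
    _ ≤ t + |r - r'| := by linarith

lemma coverSet_nonneg {α r t : ℝ} (hα : α ∈ Ioo (0 : ℝ) 1) (ht : t ∈ coverSet α r) : 0 ≤ t := by
  by_contra! h
  have e : {z : ℝ | |z| ≤ t} = ∅ := by
    ext z
    simp only [mem_ofPred_eq, mem_empty_iff_false, iff_false, not_le]
    exact h.trans_le (abs_nonneg z)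
  rw [coverSet, mem_ofPred_eq, e, measure_empty, nonpos_iff_eq_zero,
    ENNReal.ofReal_eq_zero] at ht
  linarith [hα.2]

lemma exists_central_mass {p : ℝ} (hp : p < 1) :
    ∃ C : ℝ, 0 < C ∧ ENNReal.ofReal p < gaussianReal 0 1 {z : ℝ | |z| < C} := by
  have hmono : Monotone fun n : ℕ => {z : ℝ | |z| < n} := fun a b hab z hz => by
    have hz' : |z| < (a : ℝ) := hz
    have hab' : (a : ℝ) ≤ b := by exact_mod_cast hab
    exact hz'.trans_le hab'
  have hun : (⋃ n : ℕ, {z : ℝ | |z| < n}) = univ := by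
    ext z
    simpa using exists_nat_gt |z|
  have ht := tendsto_measure_iUnion_atTop (μ := gaussianReal 0 1) hmono
  rw [hun, measure_univ] at ht
  have h1 : ENNReal.ofReal p < 1 := by simpa using hp
  obtain ⟨n, hn, hn1⟩ := ((ht.eventually (lt_mem_nhds h1)).and (eventually_ge_atTop 1)).exists
  exact ⟨n, by exact_mod_cast hn1, hn⟩

lemma coverSet_nonempty {α : ℝ} (hα : α ∈ Ioo (0 : ℝ) 1) (r : ℝ) : (coverSet α r).Nonempty := by
  obtain ⟨C, hC, h⟩ := exists_central_mass (p := 1 - α) (by linarith [hα.1])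
  have : C ∈ coverSet α 0 := h.le.trans (measure_mono fun z (hz : |z| < C) => hz.le)
  exact ⟨_, coverSet_shift (r' := r) this⟩

lemma critVal_le_add {α : ℝ} (hα : α ∈ Ioo (0 : ℝ) 1) (r r' : ℝ) :
    critVal α r ≤ critVal α r' + |r - r'| := by
  rw [← sub_le_iff_le_add]
  refine le_csInf (coverSet_nonempty hα r') fun t ht => ?_
  rw [sub_le_iff_le_add]
  refine csInf_le ⟨0, fun s hs => coverSet_nonneg hα hs⟩ ?_
  rw [abs_sub_comm]
  exact coverSet_shift ht

lemma continuous_critVal {α : ℝ} (hα : α ∈ Ioo (0 : ℝ) 1) : Continuous (critVal α) := by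
  refine LipschitzWith.continuous (K := 1) (LipschitzWith.of_dist_le_mul fun r r' => ?_)
  rw [Real.dist_eq, Real.dist_eq, NNReal.coe_one, one_mul, abs_le]
  have h1 := critVal_le_add hα r r'
  have h2 := critVal_le_add hα r' r
  rw [abs_sub_comm] at h2
  constructor <;> linarith

/-- If `t < |r| - C`, then `[-t, t]` misses the interval of radius `C` around `r`. That interval has
mass above `α` under N(r, 1), so the coverage is below `1 - α`. -/
lemma exists_critVal_ge {α : ℝ} (hα : α ∈ Ioo (0 : ℝ) 1) :
    ∃ C : ℝ, 0 < C ∧ ∀ r, |r| - C ≤ critVal α r := by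
  obtain ⟨C, hC, h⟩ := exists_central_mass (p := α) hα.2
  refine ⟨C, hC, fun r => le_csInf (coverSet_nonempty hα r) fun t ht => ?_⟩
  by_contra! hlt
  have hsub : {z : ℝ | z + r ∈ {z : ℝ | |z| ≤ t}} ⊆ {z : ℝ | |z| < C}ᶜ := by
    intro z hz hz'
    simp only [mem_ofPred_eq] at hz hz'
    have : |r| ≤ |z + r| + |z| := by
      calc |r| = |(z + r) - z| := by ring_nf
        _ ≤ _ := abs_sub _ _
    linarith
  have hm : MeasurableSet {z : ℝ | |z| < C} := measurableSet_lt (by fun_prop) measurable_const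
  replace ht : ENNReal.ofReal (1 - α) ≤ gaussianReal r 1 {z | |z| ≤ t} := ht
  rw [gaussianReal_apply_shift _ _ (measurableSet_abs_le _)] at ht
  have h2 := ht.trans (measure_mono hsub)
  rw [prob_compl_eq_one_sub hm] at h2
  have h3 : ENNReal.ofReal (1 - α) + gaussianReal 0 1 {z : ℝ | |z| < C} ≤ 1 := by
    calc _ ≤ (1 - gaussianReal 0 1 {z : ℝ | |z| < C}) + gaussianReal 0 1 {z : ℝ | |z| < C} := by
          gcongr
      _ = 1 := tsub_add_cancel_of_le prob_le_one
  have h4 : ENNReal.ofReal (1 - α) + ENNReal.ofReal α = 1 := by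
    rw [← ENNReal.ofReal_add (by linarith [hα.2]) hα.1.le]; simp
  rw [← h4] at h3
  have h5 := (ENNReal.add_le_add_iff_left ENNReal.ofReal_ne_top).1 h3
  exact absurd h (not_lt.2 h5)

/-- The normal density is at most one, so `[-t, t]` has mass at most `2t`, which forces `t ≥ (1 - α)
/ 2`. -/
lemma exists_critVal_pos {α : ℝ} (hα : α ∈ Ioo (0 : ℝ) 1) :
    ∃ c : ℝ, 0 < c ∧ ∀ r, c ≤ critVal α r := by
  have hden : ∀ r t : ℝ, gaussianReal r 1 {z | |z| ≤ t} ≤ ENNReal.ofReal (2 * t) := by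
    intro r t
    rw [gaussianReal_apply _ (by norm_num)]
    calc ∫⁻ x in {z | |z| ≤ t}, gaussianPDF r 1 x ≤ ∫⁻ x in {z | |z| ≤ t}, 1 := by
          refine lintegral_mono fun x => ?_
          rw [gaussianPDF, ← ENNReal.ofReal_one]
          refine ENNReal.ofReal_le_ofReal ?_
          rw [gaussianPDFReal]
          have h1 : (Real.sqrt (2 * Real.pi * (1 : NNReal)))⁻¹ ≤ 1 := by
            refine inv_le_one_of_one_le₀ ?_
            rw [Real.one_le_sqrt]
            have := Real.pi_gt_three
            simp only [NNReal.coe_one]; linarith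
          have h2 : Real.exp (-(x - r) ^ 2 / (2 * (1 : NNReal))) ≤ 1 := by
            rw [Real.exp_le_one_iff]
            have := sq_nonneg (x - r)
            simp only [NNReal.coe_one]; linarith
          exact mul_le_one₀ h1 (Real.exp_pos _).le h2
      _ = ENNReal.ofReal (2 * t) := by
          rw [setLIntegral_one]
          have : {z : ℝ | |z| ≤ t} = Icc (-t) t := by
            ext z; simp [abs_le]
          rw [this, Real.volume_Icc]
          congr 1; ring
  refine ⟨(1 - α) / 2, by linarith [hα.2], fun r => le_csInf (coverSet_nonempty hα r)
    fun t ht => ?_⟩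
  have h1 := le_trans ht (hden r t)
  have h0 := coverSet_nonneg hα ht
  have h2 := (ENNReal.ofReal_le_ofReal_iff (by linarith)).1 h1
  linarith

lemma critVal_le {α : ℝ} (hα : α ∈ Ioo (0 : ℝ) 1) (r : ℝ) : critVal α r ≤ critVal α 0 + |r| := by
  simpa using critVal_le_add hα r 0

/-- Up to constants, the length of the confidence interval is the sum of bias and
standard deviation. -/
lemma exists_ciLength_bounds {α : ℝ} (hα : α ∈ Ioo (0 : ℝ) 1) :
    ∃ c C : ℝ, 0 < c ∧ 0 < C ∧ ∀ b s : ℝ, 0 ≤ b → 0 < s →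
      c * (b + s) ≤ critVal α (b / s) * s ∧ critVal α (b / s) * s ≤ C * (b + s) ∧
      b - C * s ≤ critVal α (b / s) * s ∧ critVal α (b / s) * s ≤ b + C * s := by
  obtain ⟨C₁, hC₁, h₁⟩ := exists_critVal_ge hα
  obtain ⟨c₀, hc₀, h₀⟩ := exists_critVal_pos hα
  have hC0 := h₀ 0
  set C := max C₁ (critVal α 0) + 1 with hC
  have hCC : C₁ ≤ C := by rw [hC]; linarith [le_max_left C₁ (critVal α 0)]
  have hC2 : critVal α 0 ≤ C := by rw [hC]; linarith [le_max_right C₁ (critVal α 0)]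
  have hC3 : 1 ≤ C := by rw [hC]; linarith [le_max_left C₁ (critVal α 0)]
  -- With q the length, q ≥ b - C₁ s and q ≥ c₀ s give c₀ b ≤ c₀ q + C q. Adding c₀ s ≤ q yields c₀
  -- (b + s) ≤ (c₀ + C + 1) q.
  refine ⟨c₀ / (c₀ + C + 1), C, by positivity, by positivity, fun b s hb hs => ?_⟩
  have hbs : b / s * s = b := div_mul_cancel₀ b hs.ne'
  have habs : |b / s| = b / s := abs_of_nonneg (by positivity)
  have k1 := mul_le_mul_of_nonneg_right (h₁ (b / s)) hs.le
  have k2 := mul_le_mul_of_nonneg_right (h₀ (b / s)) hs.le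
  have k3 := mul_le_mul_of_nonneg_right (critVal_le hα (b / s)) hs.le
  rw [habs, sub_mul, hbs] at k1
  rw [habs, add_mul, hbs] at k3
  have k4 := mul_le_mul_of_nonneg_right hCC hs.le
  have k5 := mul_le_mul_of_nonneg_right hC2 hs.le
  refine ⟨?_, ?_, by linarith, by linarith⟩
  · rw [div_mul_eq_mul_div, div_le_iff₀ (by positivity)]
    set q := critVal α (b / s) * s
    have hq : 0 ≤ q := le_trans (by positivity) k2
    have : c₀ * b ≤ c₀ * (q + C₁ * s) := by gcongr; linarith
    have h6 : c₀ * (C₁ * s) ≤ C * q := by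
      calc c₀ * (C₁ * s) = C₁ * (c₀ * s) := by ring
        _ ≤ C * q := by gcongr
    nlinarith
  · nlinarith

/-! ### Algebra of local linear weights -/

section LocalLinear

variable {ι : Type*} [Fintype ι]

/-- The weighted power sum `∑ k_i y_i ^ p`. -/
noncomputable def powSum (k y : ι → ℝ) (p : ℕ) : ℝ := ∑ i, k i * y i ^ p

/-- The determinant of the weighted Gram matrix of the regressors `(1, y_i)`. -/
noncomputable def llDet (k y : ι → ℝ) : ℝ := powSum k y 0 * powSum k y 2 - powSum k y 1 ^ 2

/-- The weights of the intercept in a weighted linear regression on `(1, y_i)`. -/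
noncomputable def llW (k y : ι → ℝ) (i : ι) : ℝ := k i * (powSum k y 2 - powSum k y 1 * y i) / llDet k y

/-- Minus the intercept of the weighted linear fit to `y ^ 2`. -/
noncomputable def llBias (k y : ι → ℝ) : ℝ := -∑ i, llW k y i * y i ^ 2

variable {k y : ι → ℝ}

lemma sum_llW_mul_pow (p : ℕ) : ∑ i, llW k y i * y i ^ p =
    (powSum k y 2 * powSum k y p - powSum k y 1 * powSum k y (p + 1)) / llDet k y := by
  have e : ∀ i, llW k y i * y i ^ p =
      (powSum k y 2 * (k i * y i ^ p) - powSum k y 1 * (k i * y i ^ (p + 1))) / llDet k y := by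
    intro i
    rw [llW]; ring
  simp_rw [e]
  rw [← Finset.sum_div, Finset.sum_sub_distrib, ← Finset.mul_sum, ← Finset.mul_sum]
  rfl

lemma sum_llW (hD : llDet k y ≠ 0) : ∑ i, llW k y i = 1 := by
  have h := sum_llW_mul_pow (k := k) (y := y) 0
  simp only [pow_zero, mul_one, zero_add] at h
  rw [h, div_eq_one_iff_eq hD, llDet]; ring

lemma sum_llW_mul : ∑ i, llW k y i * y i = 0 := by
  have h := sum_llW_mul_pow (k := k) (y := y) 1
  simp only [pow_one] at h
  rw [h, mul_comm, sub_self, zero_div]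

lemma sum_sum_mul_pow (a b : ℕ) :
    ∑ i, ∑ j, k i * k j * (y i ^ a * y j ^ b) = powSum k y a * powSum k y b := by
  rw [powSum, powSum, Finset.sum_mul_sum]
  exact Finset.sum_congr rfl fun i _ => Finset.sum_congr rfl fun j _ => by ring

/-- Lagrange's identity: the determinant is a sum of nonnegative contributions of pairs, and any two
separated groups of points bound it from below. -/
lemma two_mul_llDet : 2 * llDet k y = ∑ i, ∑ j, k i * k j * (y i - y j) ^ 2 := by
  have e : ∀ i j, k i * k j * (y i - y j) ^ 2 = k i * k j * (y i ^ 2 * y j ^ 0)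
      - 2 * (k i * k j * (y i ^ 1 * y j ^ 1)) + k i * k j * (y i ^ 0 * y j ^ 2) := by
    intro i j; ring
  simp_rw [e, Finset.sum_add_distrib, Finset.sum_sub_distrib, ← Finset.mul_sum, sum_sum_mul_pow]
  rw [llDet]; ring

/-- The bias functional is (S₁ S₃ - S₂²) / D in power sums, and symmetrizing the numerator gives the
double sum. Divided by `two_mul_llDet`, it exhibits the bias as a weighted average of the products
`y i * y j`. -/
lemma llDet_mul_llBias (hD : llDet k y ≠ 0) : 2 * llDet k y * llBias k y =
    ∑ i, ∑ j, k i * k j * (y i * y j * (y i - y j) ^ 2) := by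
  have e : ∀ i j, k i * k j * (y i * y j * (y i - y j) ^ 2) = k i * k j * (y i ^ 3 * y j ^ 1)
      - 2 * (k i * k j * (y i ^ 2 * y j ^ 2)) + k i * k j * (y i ^ 1 * y j ^ 3) := by
    intro i j; ring
  simp_rw [e, Finset.sum_add_distrib, Finset.sum_sub_distrib, ← Finset.mul_sum, sum_sum_mul_pow]
  rw [llBias, sum_llW_mul_pow]
  field_simp
  ring

lemma llDet_nonneg (hk : ∀ i, 0 ≤ k i) : 0 ≤ llDet k y := by
  have : 0 ≤ 2 * llDet k y := by
    rw [two_mul_llDet]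
    exact Finset.sum_nonneg fun i _ => Finset.sum_nonneg fun j _ =>
      mul_nonneg (mul_nonneg (hk i) (hk j)) (sq_nonneg _)
  linarith

lemma sum_sum_le_of_subset {F : ι → ι → ℝ} (hF : ∀ i j, 0 ≤ F i j) (P Q : Finset ι) :
    ∑ i ∈ P, ∑ j ∈ Q, F i j ≤ ∑ i, ∑ j, F i j :=
  (Finset.sum_le_sum fun i _ => Finset.sum_le_univ_sum_of_nonneg (hF i)).trans
    (Finset.sum_le_univ_sum_of_nonneg fun i => Finset.sum_nonneg fun j _ => hF i j)

/-- Two well separated groups of points bound the determinant from below. -/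
lemma llDet_ge (hk : ∀ i, 0 ≤ k i) {κ g : ℝ} (hκ : 0 ≤ κ) (hg : 0 ≤ g) (P Q : Finset ι)
    (hP : ∀ i ∈ P, κ ≤ k i) (hQ : ∀ i ∈ Q, κ ≤ k i) (hPQ : ∀ i ∈ P, ∀ j ∈ Q, g ≤ y j - y i) :
    κ ^ 2 * g ^ 2 * P.card * Q.card ≤ 2 * llDet k y := by
  rw [two_mul_llDet]
  refine le_trans ?_ (sum_sum_le_of_subset (fun i j =>
    mul_nonneg (mul_nonneg (hk i) (hk j)) (sq_nonneg (y i - y j))) P Q)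
  have : ∀ i ∈ P, ∀ j ∈ Q, κ ^ 2 * g ^ 2 ≤ k i * k j * (y i - y j) ^ 2 := by
    intro i hi j hj
    have h1 : κ * κ ≤ k i * k j := mul_le_mul (hP i hi) (hQ j hj) hκ (hk i)
    have h2 : g ^ 2 ≤ (y i - y j) ^ 2 := by
      rw [← neg_sub, neg_sq]
      exact pow_le_pow_left₀ hg (hPQ i hi j hj) 2
    calc κ ^ 2 * g ^ 2 = κ * κ * g ^ 2 := by ring
      _ ≤ _ := mul_le_mul h1 h2 (sq_nonneg _) (mul_nonneg (hk i) (hk j))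
  calc κ ^ 2 * g ^ 2 * P.card * Q.card = ∑ i ∈ P, ∑ j ∈ Q, κ ^ 2 * g ^ 2 := by
        simp only [Finset.sum_const, nsmul_eq_mul]; ring
    _ ≤ _ := Finset.sum_le_sum fun i hi => Finset.sum_le_sum fun j hj => this i hi j hj

/-- The masses `k` are bounded by `K₀` and vanish outside at most `N` points of `[0, h]`. -/
structure MassBound (k y : ι → ℝ) (K₀ N h : ℝ) (T : Finset ι) : Prop where
  nonneg : ∀ i, 0 ≤ k i
  le : ∀ i, k i ≤ K₀
  y_nonneg : ∀ i, 0 ≤ y i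
  y_le : ∀ i ∈ T, y i ≤ h
  eq_zero : ∀ i ∉ T, k i = 0
  card_le : (T.card : ℝ) ≤ N
  h_nonneg : 0 ≤ h
  K_nonneg : 0 ≤ K₀

namespace MassBound

variable {K₀ N h : ℝ} {T : Finset ι}

lemma N_nonneg (H : MassBound k y K₀ N h T) : 0 ≤ N := le_trans (Nat.cast_nonneg _) H.card_le

lemma powSum_eq (H : MassBound k y K₀ N h T) (p : ℕ) :
    powSum k y p = ∑ i ∈ T, k i * y i ^ p := by
  rw [powSum]
  refine (Finset.sum_subset (Finset.subset_univ T) fun i _ hi => ?_).symm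
  rw [H.eq_zero i hi, zero_mul]

lemma powSum_nonneg (H : MassBound k y K₀ N h T) (p : ℕ) : 0 ≤ powSum k y p :=
  Finset.sum_nonneg fun i _ => mul_nonneg (H.nonneg i) (pow_nonneg (H.y_nonneg i) _)

lemma powSum_le (H : MassBound k y K₀ N h T) (p : ℕ) : powSum k y p ≤ K₀ * N * h ^ p := by
  have h0 := H.h_nonneg
  have hK := H.K_nonneg
  rw [H.powSum_eq]
  calc ∑ i ∈ T, k i * y i ^ p ≤ ∑ i ∈ T, K₀ * h ^ p := Finset.sum_le_sum fun i hi =>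
        mul_le_mul (H.le i) (pow_le_pow_left₀ (H.y_nonneg i) (H.y_le i hi) _)
          (pow_nonneg (H.y_nonneg i) _) hK
    _ = K₀ * T.card * h ^ p := by rw [Finset.sum_const, nsmul_eq_mul]; ring
    _ ≤ _ := by gcongr; exact H.card_le

lemma llW_eq_zero (H : MassBound k y K₀ N h T) {i : ι} (hi : i ∉ T) : llW k y i = 0 := by
  rw [llW, H.eq_zero i hi, zero_mul, zero_div]

lemma abs_num_le (H : MassBound k y K₀ N h T) {i : ι} (hi : i ∈ T) :
    |powSum k y 2 - powSum k y 1 * y i| ≤ K₀ * N * h ^ 2 := by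
  have h1 := H.powSum_nonneg 1
  have h2 := H.powSum_nonneg 2
  have h3 := H.powSum_le 1
  have h4 := H.powSum_le 2
  have hy := H.y_nonneg i
  have h5 : powSum k y 1 * y i ≤ K₀ * N * h ^ 1 * h := by
    gcongr
    · exact h1.trans h3
    · exact H.y_le i hi
  rw [abs_le]
  constructor <;> nlinarith [mul_nonneg h1 hy]

/-- Bound for a weight in terms of its mass. -/
lemma abs_llW_le_mass (H : MassBound k y K₀ N h T) (hD : 0 < llDet k y) (i : ι) :
    |llW k y i| ≤ k i * (K₀ * N * h ^ 2) / llDet k y := by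
  by_cases hi : i ∈ T
  · rw [llW, abs_div, abs_mul, abs_of_pos hD, abs_of_nonneg (H.nonneg i)]
    gcongr
    · exact H.nonneg i
    · exact H.abs_num_le hi
  · rw [H.llW_eq_zero hi, abs_zero]
    have := H.nonneg i
    have := H.K_nonneg
    have := H.N_nonneg
    positivity

/-- The numerator of a weight is at most `K₀ * (K₀ * N * h ^ 2)`. A determinant of its natural order
`N ^ 2 * h ^ 2` thus makes every weight O(1/N). -/
lemma abs_llW_le (H : MassBound k y K₀ N h T) (hN : 0 < N) (hh : 0 < h) {d : ℝ} (hd : 0 < d)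
    (hD : d * N ^ 2 * h ^ 2 ≤ llDet k y) (i : ι) : |llW k y i| ≤ K₀ ^ 2 / d / N := by
  have hK := H.K_nonneg
  have hD0 : 0 < llDet k y := lt_of_lt_of_le (by positivity) hD
  refine (H.abs_llW_le_mass hD0 i).trans ?_
  calc k i * (K₀ * N * h ^ 2) / llDet k y ≤ K₀ * (K₀ * N * h ^ 2) / (d * N ^ 2 * h ^ 2) := by
        gcongr
        exact H.le i
    _ = K₀ ^ 2 / d / N := by field_simp

/-- The weights sum to one over at most `N` points, so Cauchy-Schwarz applies. This is the source of
the lower bounds on the standard deviation. -/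
lemma one_le_card_mul_sum_sq (H : MassBound k y K₀ N h T) (hD : llDet k y ≠ 0) :
    1 ≤ N * ∑ i, llW k y i ^ 2 := by
  have h1 : ∑ i ∈ T, llW k y i = 1 := by
    rw [← sum_llW hD]
    exact Finset.sum_subset (Finset.subset_univ T) fun i _ hi => H.llW_eq_zero hi
  have h2 := sq_sum_le_card_mul_sum_sq (s := T) (f := llW k y)
  rw [h1, one_pow] at h2
  have h3 : ∑ i ∈ T, llW k y i ^ 2 ≤ ∑ i, llW k y i ^ 2 :=
    Finset.sum_le_univ_sum_of_nonneg fun i => sq_nonneg _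
  exact h2.trans (mul_le_mul H.card_le h3 (Finset.sum_nonneg fun i _ => sq_nonneg _) H.N_nonneg)

lemma powSum_sub_le {k' : ι → ℝ} {ω : ℝ} (hω : 0 ≤ ω) (H : MassBound k y K₀ N h T)
    (H' : MassBound k' y K₀ N h T) (hkk : ∀ i, |k i - k' i| ≤ ω) (p : ℕ) :
    |powSum k y p - powSum k' y p| ≤ ω * N * h ^ p := by
  have h0 := H.h_nonneg
  rw [H.powSum_eq, H'.powSum_eq, ← Finset.sum_sub_distrib]
  calc |∑ i ∈ T, (k i * y i ^ p - k' i * y i ^ p)|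
      ≤ ∑ i ∈ T, |k i * y i ^ p - k' i * y i ^ p| := Finset.abs_sum_le_sum_abs _ _
    _ ≤ ∑ i ∈ T, ω * h ^ p := Finset.sum_le_sum fun i hi => by
        rw [← sub_mul, abs_mul, abs_of_nonneg (pow_nonneg (H.y_nonneg i) p)]
        exact mul_le_mul (hkk i) (pow_le_pow_left₀ (H.y_nonneg i) (H.y_le i hi) _)
          (pow_nonneg (H.y_nonneg i) _) hω
    _ = ω * T.card * h ^ p := by rw [Finset.sum_const, nsmul_eq_mul]; ring
    _ ≤ _ := by gcongr; exact H.card_le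

/-- Lipschitz dependence of the weights on the masses. -/
lemma abs_llW_sub_le {k' : ι → ℝ} {ω : ℝ} (hω : 0 ≤ ω) (H : MassBound k y K₀ N h T)
    (H' : MassBound k' y K₀ N h T) (hkk : ∀ i, |k i - k' i| ≤ ω) (hN : 0 < N) (hh : 0 < h)
    {d : ℝ} (hd : 0 < d) (hD : d * N ^ 2 * h ^ 2 ≤ llDet k y)
    (hD' : d * N ^ 2 * h ^ 2 ≤ llDet k' y) (i : ι) :
    |llW k y i - llW k' y i| ≤ ω * (3 * K₀ / d + 4 * K₀ ^ 3 / d ^ 2) / N := by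
  have hK := H.K_nonneg
  have hD0 : 0 < llDet k y := lt_of_lt_of_le (by positivity) hD
  have hD0' : 0 < llDet k' y := lt_of_lt_of_le (by positivity) hD'
  by_cases hi : i ∈ T
  swap
  · rw [H.llW_eq_zero hi, H'.llW_eq_zero hi, sub_zero, abs_zero]
    positivity
  set A := powSum k y 2 - powSum k y 1 * y i with hA
  set A' := powSum k' y 2 - powSum k' y 1 * y i with hA'
  -- Quotient rule. The changes of the mass and of the bracket contribute `K₀ / d` and `2 * K₀ / d`,
  -- the change of the determinant contributes `4 * K₀ ^ 3 / d ^ 2`.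
  have e : llW k y i - llW k' y i = ((k i - k' i) * A + k' i * (A - A')) / llDet k y
      + k' i * A' * (llDet k' y - llDet k y) / (llDet k y * llDet k' y) := by
    rw [llW, llW, ← hA, ← hA']; field_simp; ring
  have d0 := powSum_sub_le hω H H' hkk 0
  have d1 := powSum_sub_le hω H H' hkk 1
  have d2 := powSum_sub_le hω H H' hkk 2
  have hAA : |A - A'| ≤ 2 * ω * N * h ^ 2 := by
    have e1 : A - A' = (powSum k y 2 - powSum k' y 2)
      - (powSum k y 1 - powSum k' y 1) * y i := by rw [hA, hA']; ring
    rw [e1]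
    refine (abs_sub _ _).trans ?_
    rw [abs_mul, abs_of_nonneg (H.y_nonneg i)]
    have : |powSum k y 1 - powSum k' y 1| * y i ≤ ω * N * h ^ 1 * h :=
      mul_le_mul d1 (H.y_le i hi) (H.y_nonneg i) (by positivity)
    linarith
  have hDD : |llDet k' y - llDet k y| ≤ 4 * K₀ * ω * N ^ 2 * h ^ 2 := by
    have e1 : llDet k' y - llDet k y =
        -((powSum k y 0 - powSum k' y 0) * powSum k y 2)
        - powSum k' y 0 * (powSum k y 2 - powSum k' y 2)
        + (powSum k y 1 - powSum k' y 1) * (powSum k y 1 + powSum k' y 1) := by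
      rw [llDet, llDet]; ring
    rw [e1]
    refine (abs_add_le _ _).trans ((add_le_add (abs_sub _ _) le_rfl).trans ?_)
    rw [abs_neg, abs_mul, abs_mul, abs_mul, abs_of_nonneg (H.powSum_nonneg 2),
      abs_of_nonneg (H'.powSum_nonneg 0),
      abs_of_nonneg (add_nonneg (H.powSum_nonneg 1) (H'.powSum_nonneg 1))]
    have t1 := mul_le_mul d0 (H.powSum_le 2) (H.powSum_nonneg 2) (by positivity)
    have t2 := mul_le_mul (H'.powSum_le 0) d2 (abs_nonneg _) (by positivity)
    have t3 := mul_le_mul d1 (add_le_add (H.powSum_le 1) (H'.powSum_le 1))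
      (add_nonneg (H.powSum_nonneg 1) (H'.powSum_nonneg 1)) (by positivity)
    refine (add_le_add (add_le_add t1 t2) t3).trans (le_of_eq ?_)
    ring
  rw [e]
  refine (abs_add_le _ _).trans ?_
  have b1 : |((k i - k' i) * A + k' i * (A - A')) / llDet k y| ≤
      (ω * (K₀ * N * h ^ 2) + K₀ * (2 * ω * N * h ^ 2)) / (d * N ^ 2 * h ^ 2) := by
    rw [abs_div, abs_of_pos hD0]
    refine div_le_div₀ (by positivity) ?_ (by positivity) hD
    refine (abs_add_le _ _).trans ?_
    rw [abs_mul, abs_mul, abs_of_nonneg (H'.nonneg i)]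
    exact add_le_add (mul_le_mul (hkk i) (H.abs_num_le hi) (abs_nonneg _) hω)
      (mul_le_mul (H'.le i) hAA (abs_nonneg _) hK)
  have b2 : |k' i * A' * (llDet k' y - llDet k y) / (llDet k y * llDet k' y)| ≤
      (K₀ * (K₀ * N * h ^ 2) * (4 * K₀ * ω * N ^ 2 * h ^ 2)) /
        ((d * N ^ 2 * h ^ 2) * (d * N ^ 2 * h ^ 2)) := by
    rw [abs_div, abs_of_pos (mul_pos hD0 hD0')]
    refine div_le_div₀ (by positivity) ?_ (by positivity) (mul_le_mul hD hD' (by positivity) hD0.le)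
    rw [abs_mul, abs_mul, abs_of_nonneg (H'.nonneg i)]
    exact mul_le_mul (mul_le_mul (H'.le i) (H'.abs_num_le hi) (abs_nonneg _) hK) hDD
      (abs_nonneg _) (by positivity)
  refine (add_le_add b1 b2).trans (le_of_eq ?_)
  field_simp
  ring

end MassBound

/-- The bias functional is a weighted average of the products `y_i y_j`. -/
lemma le_llBias (hk : ∀ i, 0 ≤ k i) (hD : 0 < llDet k y) {b : ℝ}
    (h : ∀ i j, k i ≠ 0 → k j ≠ 0 → y i ≠ y j → b ≤ y i * y j) : b ≤ llBias k y := by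
  have h1 := llDet_mul_llBias hD.ne'
  have h2 := two_mul_llDet (k := k) (y := y)
  have h3 : b * (2 * llDet k y) ≤ 2 * llDet k y * llBias k y := by
    rw [h1, h2, Finset.mul_sum]
    refine Finset.sum_le_sum fun i _ => ?_
    rw [Finset.mul_sum]
    refine Finset.sum_le_sum fun j _ => ?_
    by_cases hi : k i = 0
    · simp [hi]
    by_cases hj : k j = 0
    · simp [hj]
    by_cases hij : y i = y j
    · simp [hij]
    have := h i j hi hj hij
    have h5 : 0 ≤ k i * k j * (y i - y j) ^ 2 := by have := hk i; have := hk j; positivity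
    nlinarith
  nlinarith

lemma llBias_nonneg (hk : ∀ i, 0 ≤ k i) (hy : ∀ i, 0 ≤ y i) (hD : 0 < llDet k y) :
    0 ≤ llBias k y :=
  le_llBias hk hD fun i j _ _ _ => mul_nonneg (hy i) (hy j)

lemma llBias_le (hk : ∀ i, 0 ≤ k i) (hy : ∀ i, 0 ≤ y i) (hD : 0 < llDet k y) {h : ℝ}
    (hh : 0 ≤ h) (H : ∀ i, k i ≠ 0 → y i ≤ h) : llBias k y ≤ h ^ 2 := by
  have h1 := llDet_mul_llBias hD.ne'
  have h2 := two_mul_llDet (k := k) (y := y)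
  have h3 : 2 * llDet k y * llBias k y ≤ h ^ 2 * (2 * llDet k y) := by
    rw [h1, h2, Finset.mul_sum]
    refine Finset.sum_le_sum fun i _ => ?_
    rw [Finset.mul_sum]
    refine Finset.sum_le_sum fun j _ => ?_
    by_cases hi : k i = 0
    · simp [hi]
    by_cases hj : k j = 0
    · simp [hj]
    have h4 : y i * y j ≤ h * h := mul_le_mul (H i hi) (H j hj) (hy j) hh
    have h5 : 0 ≤ k i * k j * (y i - y j) ^ 2 := by have := hk i; have := hk j; positivity
    nlinarith
  nlinarith

end LocalLinear

/-! ### Lower bounds for the bias functional -/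

section LocalLinear

variable {ι : Type*} [Fintype ι] {k y : ι → ℝ}

set_option maxHeartbeats 1000000 in
/-- If the number of points below `3u` is comparable to the numbers of points in `[u, 2u]` and in
`[3u, 4u]`, then the bias functional is at least of the order `u ^ 2`. -/
lemma sq_le_mul_llBias (hk : ∀ i, 0 ≤ k i) (hy : ∀ i, 0 ≤ y i) {K₀ κ u ρ : ℝ}
    (hkK : ∀ i, k i ≤ K₀) (hκ : 0 < κ) (hu : 0 < u) (hρ : 0 ≤ ρ) (L P Q : Finset ι)
    (hL : ∀ i, k i ≠ 0 → y i < 3 * u → i ∈ L)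
    (hP : ∀ i ∈ P, κ ≤ k i ∧ u ≤ y i ∧ y i ≤ 2 * u)
    (hQ : ∀ i ∈ Q, κ ≤ k i ∧ 3 * u ≤ y i)
    (hP0 : 0 < P.card) (hQ0 : 0 < Q.card)
    (hLP : (L.card : ℝ) ≤ ρ * P.card) (hLQ : (L.card : ℝ) ≤ ρ * Q.card) (hD : 0 < llDet k y) :
    u ^ 2 ≤ (1 + 18 * ρ * K₀ / κ + 18 * ρ ^ 2 * K₀ ^ 2 / κ ^ 2) * llBias k y := by
  classical
  have hP0' : (0 : ℝ) < P.card := by exact_mod_cast hP0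
  have hQ0' : (0 : ℝ) < Q.card := by exact_mod_cast hQ0
  obtain ⟨p, hp⟩ := Finset.card_pos.1 hP0
  have hK0 : 0 < K₀ := hκ.trans_le ((hP p hp).1.trans (hkK p))
  set F : ι → ι → ℝ := fun i j => k i * k j * (y i - y j) ^ 2 with hF
  have hF0 : ∀ i j, 0 ≤ F i j := fun i j =>
    mul_nonneg (mul_nonneg (hk i) (hk j)) (sq_nonneg _)
  have hFs : ∀ i j, F i j = F j i := fun i j => by simp only [hF]; ring
  set Bg := Finset.univ.filter fun i => u ≤ y i with hBg
  set Sm := Finset.univ.filter fun i => ¬ u ≤ y i with hSm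
  set Fa := Finset.univ.filter fun i => 3 * u ≤ y i with hFa
  set Ne := Finset.univ.filter fun i => ¬ 3 * u ≤ y i with hNe
  set W := ∑ i ∈ Bg, ∑ j ∈ Bg, F i j with hW
  have hPBg : P ⊆ Bg := fun i hi => Finset.mem_filter.2 ⟨Finset.mem_univ _, (hP i hi).2.1⟩
  have hQBg : Q ⊆ Bg := fun i hi => Finset.mem_filter.2 ⟨Finset.mem_univ _, by
    have := (hQ i hi).2; linarith⟩
  have hFaBg : Fa ⊆ Bg := fun i hi => by
    rw [hFa, Finset.mem_filter] at hi
    exact Finset.mem_filter.2 ⟨Finset.mem_univ _, by linarith [hi.2]⟩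
  have sub_le : ∀ A B : Finset ι, A ⊆ Bg → B ⊆ Bg → ∑ i ∈ A, ∑ j ∈ B, F i j ≤ W :=
    fun A B hA hB => (Finset.sum_le_sum fun i _ => Finset.sum_le_sum_of_subset_of_nonneg hB
      fun j _ _ => hF0 i j).trans (Finset.sum_le_sum_of_subset_of_nonneg hA
      fun i _ _ => Finset.sum_nonneg fun j _ => hF0 i j)
  have hW0 : 0 ≤ W := Finset.sum_nonneg fun i _ => Finset.sum_nonneg fun j _ => hF0 i j
  -- Pairs of points beyond `u` have products at least `u ^ 2`. It remains to show that these pairs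
  -- account for a fixed share of the determinant.
  have hVW : u ^ 2 * W ≤ 2 * llDet k y * llBias k y := by
    rw [llDet_mul_llBias hD.ne', hW, Finset.mul_sum]
    refine le_trans ?_ (sum_sum_le_of_subset (fun i j => mul_nonneg (mul_nonneg (hk i) (hk j))
      (mul_nonneg (mul_nonneg (hy i) (hy j)) (sq_nonneg _))) Bg Bg)
    refine Finset.sum_le_sum fun i hi => ?_
    rw [Finset.mul_sum]
    refine Finset.sum_le_sum fun j hj => ?_
    have h1 : u * u ≤ y i * y j := mul_le_mul (Finset.mem_filter.1 hi).2
      (Finset.mem_filter.1 hj).2 hu.le (hy i)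
    have h2 := mul_le_mul_of_nonneg_right h1 (hF0 i j)
    simp only [hF] at h2 ⊢
    linarith
  have split : 2 * llDet k y ≤ W + 2 * ∑ i ∈ Sm, ∑ j, F i j := by
    rw [two_mul_llDet, ← Finset.sum_filter_add_sum_filter_not Finset.univ (fun i => u ≤ y i)]
    have e1 : ∑ i ∈ Bg, ∑ j, F i j = W + ∑ i ∈ Bg, ∑ j ∈ Sm, F i j := by
      rw [hW, ← Finset.sum_add_distrib]
      exact Finset.sum_congr rfl fun i _ =>
        (Finset.sum_filter_add_sum_filter_not Finset.univ (fun i => u ≤ y i) _).symm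
    have e2 : ∑ i ∈ Bg, ∑ j ∈ Sm, F i j ≤ ∑ i ∈ Sm, ∑ j, F i j := by
      rw [Finset.sum_comm]
      refine Finset.sum_le_sum fun i _ => ?_
      rw [Finset.sum_congr rfl fun j _ => hFs j i]
      exact Finset.sum_le_univ_sum_of_nonneg (hF0 i)
    change ∑ i ∈ Bg, ∑ j, F i j + ∑ i ∈ Sm, ∑ j, F i j ≤ _
    linarith
  have split2 : ∑ i ∈ Sm, ∑ j, F i j =
      ∑ i ∈ Sm, ∑ j ∈ Fa, F i j + ∑ i ∈ Sm, ∑ j ∈ Ne, F i j := by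
    rw [← Finset.sum_add_distrib]
    exact Finset.sum_congr rfl fun i _ =>
      (Finset.sum_filter_add_sum_filter_not Finset.univ (fun i => 3 * u ≤ y i) _).symm
  have card_bound : ∀ A : Finset ι, (∀ i ∈ A, y i < 3 * u) → ∑ i ∈ A, k i ≤ K₀ * L.card := by
    intro A hA
    calc ∑ i ∈ A, k i ≤ ∑ i ∈ L, k i := by
          rw [← Finset.sum_filter_add_sum_filter_not A (fun i => i ∈ L)]
          have : ∑ i ∈ A with i ∉ L, k i = 0 := Finset.sum_eq_zero fun i hi => by
            rw [Finset.mem_filter] at hi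
            by_contra h
            exact hi.2 (hL i h (hA i hi.1))
          rw [this, add_zero]
          exact Finset.sum_le_sum_of_subset_of_nonneg (fun i hi => (Finset.mem_filter.1 hi).2)
            fun i _ _ => hk i
      _ ≤ ∑ i ∈ L, K₀ := Finset.sum_le_sum fun i _ => hkK i
      _ = K₀ * L.card := by rw [Finset.sum_const, nsmul_eq_mul]; ring
  have hSmlt : ∀ i ∈ Sm, y i < u := fun i hi => not_le.1 (Finset.mem_filter.1 hi).2
  have hSmk := card_bound Sm fun i hi => by linarith [hSmlt i hi]
  have hNek := card_bound Ne fun i hi => not_le.1 (Finset.mem_filter.1 hi).2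
  -- Pairs of points below `3u` contribute at most `9u²` times squared mass of `L`, whereas `P × Q`
  -- alone contributes `κ² u² |P| |Q|` to `W`.
  have near : ∑ i ∈ Sm, ∑ j ∈ Ne, F i j ≤ 9 * ρ ^ 2 * K₀ ^ 2 / κ ^ 2 * W := by
    have h1 : ∑ i ∈ Sm, ∑ j ∈ Ne, F i j ≤ (9 * u ^ 2) * ((K₀ * L.card) * (K₀ * L.card)) := by
      calc ∑ i ∈ Sm, ∑ j ∈ Ne, F i j ≤ ∑ i ∈ Sm, ∑ j ∈ Ne, (9 * u ^ 2) * (k i * k j) := by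
            refine Finset.sum_le_sum fun i hi => Finset.sum_le_sum fun j hj => ?_
            have h2 : y i < u := hSmlt i hi
            have h3 : y j < 3 * u := not_le.1 (Finset.mem_filter.1 hj).2
            have h4 : (y i - y j) ^ 2 ≤ 9 * u ^ 2 := by
              have := hy i; have := hy j
              nlinarith [abs_le.2 (show -(3 * u) ≤ y i - y j ∧ y i - y j ≤ 3 * u by
                constructor <;> linarith), sq_abs (y i - y j), abs_nonneg (y i - y j)]
            have h5 : 0 ≤ k i * k j := mul_nonneg (hk i) (hk j)
            simp only [hF]
            nlinarith
        _ = (9 * u ^ 2) * ((∑ i ∈ Sm, k i) * ∑ j ∈ Ne, k j) := by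
            rw [Finset.sum_mul_sum, Finset.mul_sum]
            exact Finset.sum_congr rfl fun i _ => by rw [Finset.mul_sum]
        _ ≤ _ := by
            refine mul_le_mul_of_nonneg_left ?_ (by positivity)
            exact mul_le_mul hSmk hNek (Finset.sum_nonneg fun i _ => hk i) (by positivity)
    have h2 : κ ^ 2 * u ^ 2 * (P.card * Q.card) ≤ W := by
      refine le_trans ?_ (sub_le P Q hPBg hQBg)
      calc κ ^ 2 * u ^ 2 * (P.card * Q.card) = ∑ i ∈ P, ∑ j ∈ Q, κ * κ * u ^ 2 := by
            simp only [Finset.sum_const, nsmul_eq_mul]; ring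
        _ ≤ _ := by
            refine Finset.sum_le_sum fun i hi => Finset.sum_le_sum fun j hj => ?_
            obtain ⟨a1, a2, a3⟩ := hP i hi
            obtain ⟨b1, b2⟩ := hQ j hj
            simp only [hF]
            refine mul_le_mul (mul_le_mul a1 b1 hκ.le (hk i)) ?_ (sq_nonneg _)
              (mul_nonneg (hk i) (hk j))
            nlinarith
    have h3 : (L.card : ℝ) * L.card ≤ (ρ * P.card) * (ρ * Q.card) :=
      mul_le_mul hLP hLQ (Nat.cast_nonneg _) (by positivity)
    refine h1.trans ?_
    calc (9 * u ^ 2) * ((K₀ * L.card) * (K₀ * L.card))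
        = 9 * K₀ ^ 2 * u ^ 2 * (L.card * L.card) := by ring
      _ ≤ 9 * K₀ ^ 2 * u ^ 2 * ((ρ * P.card) * (ρ * Q.card)) := by gcongr
      _ = 9 * ρ ^ 2 * K₀ ^ 2 / κ ^ 2 * (κ ^ 2 * u ^ 2 * (P.card * Q.card)) := by
          field_simp
      _ ≤ _ := by gcongr
  -- A partner beyond `3u` is within `y j` of a point below `u` and at least `y j / 3` away from the
  -- points of `P`. Hence the small points can be exchanged for those of `P` at the cost of a factor
  -- 9.
  have far : ∑ i ∈ Sm, ∑ j ∈ Fa, F i j ≤ 9 * ρ * K₀ / κ * W := by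
    set Z := ∑ j ∈ Fa, k j * y j ^ 2 with hZ
    have hZ0 : 0 ≤ Z := Finset.sum_nonneg fun j _ => mul_nonneg (hk j) (sq_nonneg _)
    have h1 : ∑ i ∈ Sm, ∑ j ∈ Fa, F i j ≤ K₀ * L.card * Z := by
      calc ∑ i ∈ Sm, ∑ j ∈ Fa, F i j ≤ ∑ i ∈ Sm, ∑ j ∈ Fa, k i * (k j * y j ^ 2) := by
            refine Finset.sum_le_sum fun i hi => Finset.sum_le_sum fun j hj => ?_
            have h2 : y i < u := hSmlt i hi
            have h3 : 3 * u ≤ y j := (Finset.mem_filter.1 hj).2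
            have h4 : (y i - y j) ^ 2 ≤ y j ^ 2 := by
              have := hy i
              nlinarith
            have h5 : 0 ≤ k i * k j := mul_nonneg (hk i) (hk j)
            simp only [hF]
            nlinarith
        _ = (∑ i ∈ Sm, k i) * Z := by rw [hZ, Finset.sum_mul_sum]
        _ ≤ _ := mul_le_mul_of_nonneg_right hSmk hZ0
    have h2 : κ * P.card / 9 * Z ≤ W := by
      refine le_trans ?_ (sub_le P Fa hPBg hFaBg)
      calc κ * P.card / 9 * Z = ∑ i ∈ P, ∑ j ∈ Fa, κ * (k j * (y j ^ 2 / 9)) := by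
            rw [Finset.sum_const, nsmul_eq_mul, ← Finset.mul_sum, hZ, Finset.mul_sum,
              Finset.mul_sum, Finset.mul_sum]
            exact Finset.sum_congr rfl fun j _ => by ring
        _ ≤ _ := by
            refine Finset.sum_le_sum fun i hi => Finset.sum_le_sum fun j hj => ?_
            obtain ⟨a1, a2, a3⟩ := hP i hi
            have h3 : 3 * u ≤ y j := (Finset.mem_filter.1 hj).2
            simp only [hF]
            rw [mul_assoc (k i)]
            refine mul_le_mul a1 (mul_le_mul_of_nonneg_left ?_ (hk j))
              (mul_nonneg (hk j) (by positivity)) (hk i)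
            nlinarith
    refine h1.trans ?_
    calc K₀ * L.card * Z ≤ K₀ * (ρ * P.card) * Z := by gcongr
      _ = 9 * ρ * K₀ / κ * (κ * P.card / 9 * Z) := by field_simp
      _ ≤ _ := by gcongr
  have tot : 2 * llDet k y ≤ (1 + 18 * ρ * K₀ / κ + 18 * ρ ^ 2 * K₀ ^ 2 / κ ^ 2) * W := by
    rw [split2] at split
    refine split.trans ?_
    have e : (1 + 18 * ρ * K₀ / κ + 18 * ρ ^ 2 * K₀ ^ 2 / κ ^ 2) * W =
      W + 2 * (9 * ρ * K₀ / κ * W + 9 * ρ ^ 2 * K₀ ^ 2 / κ ^ 2 * W) := by ring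
    rw [e]; linarith
  set A := 1 + 18 * ρ * K₀ / κ + 18 * ρ ^ 2 * K₀ ^ 2 / κ ^ 2 with hA
  have hA0 : 0 ≤ A := by positivity
  have fin : u ^ 2 * (2 * llDet k y) ≤ A * llBias k y * (2 * llDet k y) := by
    calc u ^ 2 * (2 * llDet k y) ≤ u ^ 2 * (A * W) := by gcongr
      _ = A * (u ^ 2 * W) := by ring
      _ ≤ A * (2 * llDet k y * llBias k y) := by gcongr
      _ = _ := by ring
  exact le_of_mul_le_mul_right fin (by positivity)

/-! Two leading groups of points, as in the case of a discrete running variable. -/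

/-- The masses are positive on `G₁`, `G₂`, where `y` equals `x₁ < x₂`, and the masses are constant
on each group; all other points with positive mass have `y ≥ x₃ > x₂`. -/
structure TwoGroups (k y : ι → ℝ) (G₁ G₂ : Finset ι) (x₁ x₂ x₃ : ℝ) : Prop where
  nonneg : ∀ i, 0 ≤ k i
  x₁_pos : 0 < x₁
  lt₁₂ : x₁ < x₂
  lt₂₃ : x₂ < x₃
  y₁ : ∀ i ∈ G₁, y i = x₁
  y₂ : ∀ i ∈ G₂, y i = x₂
  k₁ : ∀ i ∈ G₁, ∀ j ∈ G₁, k i = k j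
  k₂ : ∀ i ∈ G₂, ∀ j ∈ G₂, k i = k j
  other : ∀ i, i ∉ G₁ → i ∉ G₂ → k i ≠ 0 → x₃ ≤ y i

namespace TwoGroups

variable {G₁ G₂ : Finset ι} {x₁ x₂ x₃ : ℝ}

lemma disjoint (H : TwoGroups k y G₁ G₂ x₁ x₂ x₃) : Disjoint G₁ G₂ := by
  rw [Finset.disjoint_left]
  intro i h1 h2
  have := H.y₁ i h1
  have := H.y₂ i h2
  have := H.lt₁₂
  linarith

/-- Only the first group has a distance below `x₂`, so two distinct distances that carry mass have a
product of at least `x₁ * x₂`, and the bias functional averages such products. -/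
lemma mul_le_llBias (H : TwoGroups k y G₁ G₂ x₁ x₂ x₃) (hD : 0 < llDet k y) :
    x₁ * x₂ ≤ llBias k y := by
  have h1 := H.x₁_pos
  have h2 := H.lt₁₂
  have h3 := H.lt₂₃
  have key : ∀ i, k i ≠ 0 → y i = x₁ ∨ x₂ ≤ y i := by
    intro i hi
    by_cases a : i ∈ G₁
    · exact Or.inl (H.y₁ i a)
    by_cases b : i ∈ G₂
    · exact Or.inr (H.y₂ i b).ge
    · exact Or.inr (h3.le.trans (H.other i a b hi))
  refine le_llBias H.nonneg hD fun i j hi hj hij => ?_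
  rcases key i hi with a | a <;> rcases key j hj with b | b
  · exact absurd (a.trans b.symm) hij
  · rw [a]; gcongr
  · rw [b, mul_comm]; gcongr
  · have h4 : 0 ≤ x₂ := by linarith
    exact mul_le_mul (h2.le.trans a) b h4 (h4.trans a)

/-- Mass on a third group increases the bias functional by a definite amount. -/
lemma add_le_llBias (H : TwoGroups k y G₁ G₂ x₁ x₂ x₃) (hD : 0 < llDet k y) {K₀ τ ρ : ℝ}
    (hkK : ∀ i, k i ≤ K₀) (hτ : 0 < τ) (hρ : 0 ≤ ρ) (G₃ : Finset ι)
    (h₃ : ∀ i ∈ G₃, y i = x₃ ∧ τ ≤ k i) (hG₃ : 0 < G₃.card)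
    (hcard : (G₂.card : ℝ) ≤ ρ * G₃.card) :
    x₁ * x₂ + x₁ * (x₃ - x₂) / (1 + 2 * ρ * K₀ / τ) ≤ llBias k y := by
  classical
  have h1 := H.x₁_pos
  have h2 := H.lt₁₂
  have h3 := H.lt₂₃
  obtain ⟨p, hp⟩ := Finset.card_pos.1 hG₃
  have hK0 : 0 < K₀ := hτ.trans_le ((h₃ p hp).2.trans (hkK p))
  set F : ι → ι → ℝ := fun i j => k i * k j * (y i - y j) ^ 2 with hF
  have hF0 : ∀ i j, 0 ≤ F i j := fun i j =>
    mul_nonneg (mul_nonneg (H.nonneg i) (H.nonneg j)) (sq_nonneg _)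
  have hFs : ∀ i j, F i j = F j i := fun i j => by simp only [hF]; ring
  -- The pairs not contained in the two leading groups. When the distances differ, their products
  -- exceed `x₁ * x₂` by at least `x₁ * (x₃ - x₂)`, so only their share of the determinant is
  -- needed.
  set a : ι → ι → ℝ := fun i j => if i ∈ G₁ ∪ G₂ ∧ j ∈ G₁ ∪ G₂ then 0 else F i j with ha
  have ha0 : ∀ i j, 0 ≤ a i j := fun i j => by
    simp only [ha]; split_ifs
    · exact le_rfl
    · exact hF0 i j
  set A := ∑ i, ∑ j, a i j with hA
  have hG13 : ∀ i ∈ G₃, i ∉ G₁ ∪ G₂ := by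
    intro i hi hi'
    have := (h₃ i hi).1
    rcases Finset.mem_union.1 hi' with h | h
    · have := H.y₁ i h; linarith
    · have := H.y₂ i h; linarith
  have key : ∀ i, k i ≠ 0 → (i ∈ G₁ ∧ y i = x₁) ∨ (i ∈ G₂ ∧ y i = x₂) ∨
      (i ∉ G₁ ∪ G₂ ∧ x₃ ≤ y i) := by
    intro i hi
    by_cases a : i ∈ G₁
    · exact Or.inl ⟨a, H.y₁ i a⟩
    by_cases b : i ∈ G₂
    · exact Or.inr (Or.inl ⟨b, H.y₂ i b⟩)
    · exact Or.inr (Or.inr ⟨by simp [a, b], H.other i a b hi⟩)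
  have hterm : ∀ i j, x₁ * x₂ * F i j + x₁ * (x₃ - x₂) * a i j ≤
      k i * k j * (y i * y j * (y i - y j) ^ 2) := by
    intro i j
    have e : k i * k j * (y i * y j * (y i - y j) ^ 2) = y i * y j * F i j := by
      simp only [hF]; ring
    rw [e]
    by_cases hi : k i = 0
    · have : F i j = 0 := by simp [hF, hi]
      simp [ha, this]
    by_cases hj : k j = 0
    · have : F i j = 0 := by simp [hF, hj]
      simp [ha, this]
    have hFij := hF0 i j
    have x13 : x₁ * x₃ = x₁ * x₂ + x₁ * (x₃ - x₂) := by ring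
    have fin : ∀ z, x₁ * x₃ ≤ z → x₁ * x₂ * F i j + x₁ * (x₃ - x₂) * a i j ≤ z * F i j := by
      intro z hz
      have hle : a i j ≤ F i j := by
        simp only [ha]; split_ifs
        · exact hFij
        · exact le_rfl
      have : x₁ * (x₃ - x₂) * a i j ≤ x₁ * (x₃ - x₂) * F i j :=
        mul_le_mul_of_nonneg_left hle (mul_nonneg h1.le (by linarith))
      nlinarith
    have zero : ∀ z, y i = y j → x₁ * x₂ * F i j + x₁ * (x₃ - x₂) * a i j ≤ z * F i j := by
      intro z hz
      have : F i j = 0 := by simp [hF, hz]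
      simp [ha, this]
    rcases key i hi with ⟨m1, e1⟩ | ⟨m1, e1⟩ | ⟨m1, e1⟩ <;>
      rcases key j hj with ⟨m2, e2⟩ | ⟨m2, e2⟩ | ⟨m2, e2⟩
    · exact zero _ (e1.trans e2.symm)
    · have : a i j = 0 := by simp [ha, m1, m2]
      rw [this, e1, e2]; simp
    · refine fin _ ?_
      rw [e1]; gcongr
    · have : a i j = 0 := by simp [ha, m1, m2]
      rw [this, e1, e2, mul_comm x₂ x₁]; simp
    · exact zero _ (e1.trans e2.symm)
    · refine fin _ ?_
      rw [e1]; exact mul_le_mul h2.le e2 (by linarith) (by linarith)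
    · refine fin _ ?_
      rw [e2, mul_comm (y i)]; gcongr
    · refine fin _ ?_
      rw [e2, mul_comm (y i)]; exact mul_le_mul h2.le e1 (by linarith) (by linarith)
    · refine fin _ ?_
      exact mul_le_mul (by linarith) e2 (by linarith) (by linarith)
  have hV : x₁ * x₂ * (2 * llDet k y) + x₁ * (x₃ - x₂) * A ≤ 2 * llDet k y * llBias k y := by
    rw [llDet_mul_llBias hD.ne', two_mul_llDet, hA, Finset.mul_sum, Finset.mul_sum,
      ← Finset.sum_add_distrib]
    refine Finset.sum_le_sum fun i _ => ?_
    rw [Finset.mul_sum, Finset.mul_sum, ← Finset.sum_add_distrib]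
    exact Finset.sum_le_sum fun j _ => hterm i j
  have hsum : 2 * llDet k y = A + ∑ i ∈ G₁ ∪ G₂, ∑ j ∈ G₁ ∪ G₂, F i j := by
    have e : ∀ i j, F i j = a i j +
        (if i ∈ G₁ ∪ G₂ then (if j ∈ G₁ ∪ G₂ then F i j else 0) else 0) := by
      intro i j
      simp only [ha]
      by_cases p : i ∈ G₁ ∪ G₂ <;> by_cases q : j ∈ G₁ ∪ G₂ <;> simp only [p, q, and_self,
        and_true, and_false, if_true, if_false, add_zero, zero_add]
    rw [two_mul_llDet]
    change ∑ i, ∑ j, F i j = _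
    rw [Finset.sum_congr rfl fun i _ => Finset.sum_congr rfl fun j _ => e i j]
    simp_rw [Finset.sum_add_distrib]
    rw [← hA]
    congr 1
    rw [← Finset.sum_filter_add_sum_filter_not Finset.univ (fun i => i ∈ G₁ ∪ G₂)]
    have z : ∑ i with i ∉ G₁ ∪ G₂, ∑ j, (if i ∈ G₁ ∪ G₂ then
        (if j ∈ G₁ ∪ G₂ then F i j else 0) else 0) = 0 :=
      Finset.sum_eq_zero fun i hi => by
        rw [Finset.mem_filter] at hi
        simp only [hi.2, if_false, Finset.sum_const_zero]
    rw [z, add_zero, Finset.filter_mem_eq_inter, Finset.univ_inter]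
    refine Finset.sum_congr rfl fun i hi => ?_
    simp only [hi, if_true]
    rw [← Finset.sum_filter, Finset.filter_mem_eq_inter, Finset.univ_inter]
  have h12 : ∑ i ∈ G₁ ∪ G₂, ∑ j ∈ G₁ ∪ G₂, F i j = 2 * ∑ i ∈ G₁, ∑ j ∈ G₂, F i j := by
    have z1 : ∑ i ∈ G₁, ∑ j ∈ G₁, F i j = 0 := Finset.sum_eq_zero fun i hi =>
      Finset.sum_eq_zero fun j hj => by simp [hF, H.y₁ i hi, H.y₁ j hj]
    have z2 : ∑ i ∈ G₂, ∑ j ∈ G₂, F i j = 0 := Finset.sum_eq_zero fun i hi =>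
      Finset.sum_eq_zero fun j hj => by simp [hF, H.y₂ i hi, H.y₂ j hj]
    have z3 : ∑ i ∈ G₂, ∑ j ∈ G₁, F i j = ∑ i ∈ G₁, ∑ j ∈ G₂, F i j := by
      rw [Finset.sum_comm]
      exact Finset.sum_congr rfl fun i _ => Finset.sum_congr rfl fun j _ => hFs _ _
    rw [Finset.sum_union H.disjoint]
    simp_rw [Finset.sum_union H.disjoint, Finset.sum_add_distrib]
    rw [z1, z2, z3]; ring
  have hA13 : ∑ i ∈ G₁, ∑ j ∈ G₃, F i j ≤ A := by
    refine le_trans (le_of_eq ?_) (sum_sum_le_of_subset ha0 G₁ G₃)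
    refine Finset.sum_congr rfl fun i _ => Finset.sum_congr rfl fun j hj => ?_
    simp only [ha, hG13 j hj, and_false, if_false]
  set S := ∑ i ∈ G₁, k i with hS
  have hS0 : 0 ≤ S := Finset.sum_nonneg fun i _ => H.nonneg i
  have f12 : ∑ i ∈ G₁, ∑ j ∈ G₂, F i j ≤ S * (K₀ * (x₃ - x₁) ^ 2 * G₂.card) := by
    rw [hS, Finset.sum_mul]
    refine Finset.sum_le_sum fun i hi => ?_
    calc ∑ j ∈ G₂, F i j ≤ ∑ j ∈ G₂, k i * (K₀ * (x₃ - x₁) ^ 2) := by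
          refine Finset.sum_le_sum fun j hj => ?_
          simp only [hF]
          rw [mul_assoc, H.y₁ i hi, H.y₂ j hj]
          refine mul_le_mul_of_nonneg_left ?_ (H.nonneg i)
          refine mul_le_mul (hkK j) ?_ (sq_nonneg _) hK0.le
          nlinarith
      _ = _ := by rw [Finset.sum_const, nsmul_eq_mul]; ring
  have f13 : S * (τ * (x₃ - x₁) ^ 2 * G₃.card) ≤ ∑ i ∈ G₁, ∑ j ∈ G₃, F i j := by
    rw [hS, Finset.sum_mul]
    refine Finset.sum_le_sum fun i hi => ?_
    calc k i * (τ * (x₃ - x₁) ^ 2 * G₃.card) = ∑ j ∈ G₃, k i * (τ * (x₃ - x₁) ^ 2) := by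
          rw [Finset.sum_const, nsmul_eq_mul]; ring
      _ ≤ ∑ j ∈ G₃, F i j := by
          refine Finset.sum_le_sum fun j hj => ?_
          simp only [hF]
          rw [mul_assoc, H.y₁ i hi, (h₃ j hj).1]
          refine mul_le_mul_of_nonneg_left ?_ (H.nonneg i)
          refine mul_le_mul (h₃ j hj).2 (by nlinarith) (sq_nonneg _) (H.nonneg j)
  -- The same points of the first group, paired with the third group instead of the second:
  -- distances only grow, masses are at least `τ`, and the cardinalities compare through `ρ`.
  have f12' : ∑ i ∈ G₁, ∑ j ∈ G₂, F i j ≤ ρ * K₀ / τ * A := by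
    refine f12.trans ?_
    calc S * (K₀ * (x₃ - x₁) ^ 2 * G₂.card) ≤ S * (K₀ * (x₃ - x₁) ^ 2 * (ρ * G₃.card)) := by
          gcongr
      _ = ρ * K₀ / τ * (S * (τ * (x₃ - x₁) ^ 2 * G₃.card)) := by field_simp
      _ ≤ _ := by
          refine mul_le_mul_of_nonneg_left (f13.trans hA13) (by positivity)
  have hDA : 2 * llDet k y ≤ (1 + 2 * ρ * K₀ / τ) * A := by
    rw [hsum, h12]
    have : (1 + 2 * ρ * K₀ / τ) * A = A + 2 * (ρ * K₀ / τ * A) := by ring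
    rw [this]; linarith
  set B := 1 + 2 * ρ * K₀ / τ with hB
  have hB0 : 0 < B := by positivity
  have hx : 0 ≤ x₁ * (x₃ - x₂) := mul_nonneg h1.le (by linarith)
  have e1 : x₁ * (x₃ - x₂) / B * (2 * llDet k y) ≤ x₁ * (x₃ - x₂) * A := by
    rw [div_mul_eq_mul_div, div_le_iff₀ hB0]
    calc x₁ * (x₃ - x₂) * (2 * llDet k y) ≤ x₁ * (x₃ - x₂) * (B * A) := by gcongr
      _ = _ := by ring
  have : (x₁ * x₂ + x₁ * (x₃ - x₂) / B) * (2 * llDet k y) ≤ llBias k y * (2 * llDet k y) := by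
    nlinarith
  exact le_of_mul_le_mul_right this (by positivity)

/-- The sum of squared weights is small if both leading groups have substantial mass. -/
lemma mul_sum_sq_le (H : TwoGroups k y G₁ G₂ x₁ x₂ x₃) (hD : 0 < llDet k y) {K₀ κ m : ℝ}
    (hkK : ∀ i, k i ≤ K₀) (hκ : 0 < κ) (hm : 0 < m) (hκ₁ : ∀ i ∈ G₁, κ ≤ k i)
    (hκ₂ : ∀ i ∈ G₂, κ ≤ k i) (hm₁ : m ≤ G₁.card) (hm₂ : m ≤ G₂.card) :
    κ * (x₂ - x₁) ^ 2 * m * ∑ i, llW k y i ^ 2 ≤ K₀ * (x₁ ^ 2 + x₂ ^ 2) := by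
  have h1 := H.x₁_pos
  have h2 := H.lt₁₂
  set S₁ := powSum k y 1 with hS₁
  set S₂ := powSum k y 2 with hS₂
  set D := llDet k y with hDdef
  -- The mass-weighted squared numerators sum to S₂ D. Since `k i ≤ K₀`, the sum of squared weights
  -- is at most K₀ S₂ / D, and D has to be compared with S₂.
  have hid : ∑ i, k i * (S₂ - S₁ * y i) ^ 2 = S₂ * D := by
    have e : ∀ i, k i * (S₂ - S₁ * y i) ^ 2 = S₂ ^ 2 * (k i * y i ^ 0)
        - 2 * S₁ * S₂ * (k i * y i ^ 1) + S₁ ^ 2 * (k i * y i ^ 2) := by intro i; ring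
    simp_rw [e, Finset.sum_add_distrib, Finset.sum_sub_distrib, ← Finset.mul_sum]
    change S₂ ^ 2 * powSum k y 0 - 2 * S₁ * S₂ * S₁ + S₁ ^ 2 * S₂ = S₂ * D
    rw [hDdef, llDet, ← hS₁, ← hS₂]; ring
  have hup : ∑ i, llW k y i ^ 2 ≤ K₀ * S₂ / D := by
    calc ∑ i, llW k y i ^ 2 ≤ ∑ i, K₀ / D ^ 2 * (k i * (S₂ - S₁ * y i) ^ 2) := by
          refine Finset.sum_le_sum fun i _ => ?_
          have e : llW k y i ^ 2 = k i * (k i * (S₂ - S₁ * y i) ^ 2) / D ^ 2 := by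
            rw [llW, div_pow, mul_pow, ← hS₁, ← hS₂, ← hDdef]; ring
          rw [e, div_mul_eq_mul_div]
          refine div_le_div_of_nonneg_right ?_ (by positivity)
          exact mul_le_mul_of_nonneg_right (hkK i) (mul_nonneg (H.nonneg i) (sq_nonneg _))
      _ = K₀ * S₂ / D := by rw [← Finset.mul_sum, hid]; field_simp
  have hlow : κ * m * ((S₂ - S₁ * x₁) ^ 2 + (S₂ - S₁ * x₂) ^ 2) ≤ S₂ * D := by
    classical
    rw [← hid]
    refine le_trans ?_ (Finset.sum_le_univ_sum_of_nonneg (s := G₁ ∪ G₂) fun i =>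
      mul_nonneg (H.nonneg i) (sq_nonneg _))
    rw [Finset.sum_union H.disjoint, mul_add]
    have g : ∀ (G : Finset ι) (x : ℝ), (∀ i ∈ G, y i = x) → (∀ i ∈ G, κ ≤ k i) → m ≤ G.card →
        κ * m * (S₂ - S₁ * x) ^ 2 ≤ ∑ i ∈ G, k i * (S₂ - S₁ * y i) ^ 2 := by
      intro G x hy hk hm
      calc κ * m * (S₂ - S₁ * x) ^ 2 ≤ κ * G.card * (S₂ - S₁ * x) ^ 2 := by gcongr
        _ = ∑ i ∈ G, κ * (S₂ - S₁ * x) ^ 2 := by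
            rw [Finset.sum_const, nsmul_eq_mul]; ring
        _ ≤ _ := Finset.sum_le_sum fun i hi => by
            rw [hy i hi]; exact mul_le_mul_of_nonneg_right (hk i hi) (sq_nonneg _)
    exact add_le_add (g G₁ x₁ H.y₁ hκ₁ hm₁) (g G₂ x₂ H.y₂ hκ₂ hm₂)
  -- Cauchy-Schwarz applied to S₂ (x₂ - x₁) = x₂ (S₂ - S₁ x₁) - x₁ (S₂ - S₁ x₂). The square in the
  -- hint is the defect in Lagrange's identity.
  have hcs : S₂ ^ 2 * (x₂ - x₁) ^ 2 ≤
      (x₁ ^ 2 + x₂ ^ 2) * ((S₂ - S₁ * x₁) ^ 2 + (S₂ - S₁ * x₂) ^ 2) := by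
    nlinarith [sq_nonneg (x₂ * (S₂ - S₁ * x₂) + x₁ * (S₂ - S₁ * x₁))]
  have hS₂0 : 0 < S₂ := by
    refine lt_of_le_of_ne (Finset.sum_nonneg fun i _ =>
      mul_nonneg (H.nonneg i) (sq_nonneg (y i))) fun h => ?_
    have : D ≤ 0 := by
      rw [hDdef, llDet, ← hS₂, ← h, mul_zero]
      nlinarith [sq_nonneg (powSum k y 1)]
    linarith
  have hfin : κ * (x₂ - x₁) ^ 2 * m * S₂ ≤ (x₁ ^ 2 + x₂ ^ 2) * D := by
    have : κ * (x₂ - x₁) ^ 2 * m * S₂ * S₂ ≤ (x₁ ^ 2 + x₂ ^ 2) * D * S₂ := by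
      calc κ * (x₂ - x₁) ^ 2 * m * S₂ * S₂ = κ * m * (S₂ ^ 2 * (x₂ - x₁) ^ 2) := by ring
        _ ≤ κ * m * ((x₁ ^ 2 + x₂ ^ 2) * ((S₂ - S₁ * x₁) ^ 2 + (S₂ - S₁ * x₂) ^ 2)) := by gcongr
        _ = (x₁ ^ 2 + x₂ ^ 2) * (κ * m * ((S₂ - S₁ * x₁) ^ 2 + (S₂ - S₁ * x₂) ^ 2)) := by ring
        _ ≤ (x₁ ^ 2 + x₂ ^ 2) * (S₂ * D) := by gcongr
        _ = _ := by ring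
    exact le_of_mul_le_mul_right this hS₂0
  by_cases hK0 : 0 ≤ K₀
  · calc κ * (x₂ - x₁) ^ 2 * m * ∑ i, llW k y i ^ 2
        ≤ κ * (x₂ - x₁) ^ 2 * m * (K₀ * S₂ / D) := by gcongr
      _ = K₀ / D * (κ * (x₂ - x₁) ^ 2 * m * S₂) := by ring
      _ ≤ K₀ / D * ((x₁ ^ 2 + x₂ ^ 2) * D) := by gcongr
      _ = _ := by field_simp
  · exfalso
    have : 0 < G₁.card := by
      have : (0 : ℝ) < G₁.card := hm.trans_le hm₁
      exact_mod_cast this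
    obtain ⟨i, hi⟩ := Finset.card_pos.1 this
    linarith [H.nonneg i, hkK i]

/-- The weights of the line through the two leading groups. -/
noncomputable def interpW (G₁ G₂ : Finset ι) (x₁ x₂ : ℝ) [DecidableEq ι] (i : ι) : ℝ :=
  if i ∈ G₁ then x₂ / (x₂ - x₁) / G₁.card else if i ∈ G₂ then -x₁ / (x₂ - x₁) / G₂.card else 0

/-- If the weights outside the two leading groups are small, then the weights are close to
those of the line through the two groups. -/
lemma abs_llW_sub_interpW_le [DecidableEq ι] (H : TwoGroups k y G₁ G₂ x₁ x₂ x₃)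
    (hD : llDet k y ≠ 0) {e Y m : ℝ} (hm : 0 < m) (hm₁ : m ≤ G₁.card) (hm₂ : m ≤ G₂.card)
    (hy : ∀ i, k i ≠ 0 → 0 ≤ y i ∧ y i ≤ Y)
    (he : ∑ i ∈ (G₁ ∪ G₂)ᶜ, |llW k y i| ≤ e) (i : ι) (hi : i ∈ G₁ ∪ G₂) :
    |llW k y i - interpW G₁ G₂ x₁ x₂ i| ≤ (x₂ + Y) * e / ((x₂ - x₁) * m) := by
  have h1 := H.x₁_pos
  have h2 := H.lt₁₂
  have hx : 0 < x₂ - x₁ := by linarith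
  set o₀ := ∑ i ∈ (G₁ ∪ G₂)ᶜ, llW k y i with ho₀
  set o₁ := ∑ i ∈ (G₁ ∪ G₂)ᶜ, llW k y i * y i with ho₁
  set W₁ := ∑ i ∈ G₁, llW k y i with hW₁
  set W₂ := ∑ i ∈ G₂, llW k y i with hW₂
  -- The weights have total one and first moment zero. These two equations determine the group
  -- totals up to the outside remainders `o₀`, `o₁`; within a group, equal masses and distances make
  -- the weights equal.
  have s0 : W₁ + W₂ + o₀ = 1 := by
    rw [← sum_llW hD, ← Finset.sum_add_sum_compl (G₁ ∪ G₂), Finset.sum_union H.disjoint]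
  have s1 : W₁ * x₁ + W₂ * x₂ + o₁ = 0 := by
    rw [← sum_llW_mul (k := k) (y := y), ← Finset.sum_add_sum_compl (G₁ ∪ G₂),
      Finset.sum_union H.disjoint, hW₁, hW₂, Finset.sum_mul, Finset.sum_mul]
    congr 2
    · exact Finset.sum_congr rfl fun i hi => by rw [H.y₁ i hi]
    · exact Finset.sum_congr rfl fun i hi => by rw [H.y₂ i hi]
  have b0 : |o₀| ≤ e := (Finset.abs_sum_le_sum_abs _ _).trans he
  have he0 : 0 ≤ e := (abs_nonneg _).trans b0
  have b1 : |o₁| ≤ Y * e := by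
    refine (Finset.abs_sum_le_sum_abs _ _).trans ?_
    rcases (Finset.univ.filter fun i => k i ≠ 0).eq_empty_or_nonempty with hemp | ⟨p, hp⟩
    · exfalso
      apply hD
      have : ∀ i, k i = 0 := fun i => by
        by_contra h
        have : i ∈ Finset.univ.filter fun i => k i ≠ 0 := by simp [h]
        rw [hemp] at this; simp at this
      simp [llDet, powSum, this]
    have hY : 0 ≤ Y := by
      have := hy p (Finset.mem_filter.1 hp).2
      linarith
    calc ∑ i ∈ (G₁ ∪ G₂)ᶜ, |llW k y i * y i| ≤ ∑ i ∈ (G₁ ∪ G₂)ᶜ, Y * |llW k y i| := by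
          refine Finset.sum_le_sum fun i _ => ?_
          by_cases hki : k i = 0
          · simp [llW, hki]
          · rw [abs_mul, abs_of_nonneg (hy i hki).1, mul_comm]
            exact mul_le_mul_of_nonneg_right (hy i hki).2 (abs_nonneg _)
      _ ≤ Y * e := by rw [← Finset.mul_sum]; gcongr
  have c1 : ∀ i ∈ G₁, llW k y i * G₁.card = W₁ := fun i hi => by
    rw [hW₁, Finset.sum_congr rfl fun j hj => show llW k y j = llW k y i by
      rw [llW, llW, H.k₁ j hj i hi, H.y₁ i hi, H.y₁ j hj]]
    rw [Finset.sum_const, nsmul_eq_mul, mul_comm]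
  have c2 : ∀ i ∈ G₂, llW k y i * G₂.card = W₂ := fun i hi => by
    rw [hW₂, Finset.sum_congr rfl fun j hj => show llW k y j = llW k y i by
      rw [llW, llW, H.k₂ j hj i hi, H.y₂ i hi, H.y₂ j hj]]
    rw [Finset.sum_const, nsmul_eq_mul, mul_comm]
  have e1 : W₁ = (x₂ * (1 - o₀) + o₁) / (x₂ - x₁) := by
    rw [eq_div_iff hx.ne']; linear_combination x₂ * s0 - s1
  have e2 : W₂ = (-x₁ * (1 - o₀) - o₁) / (x₂ - x₁) := by
    rw [eq_div_iff hx.ne']; linear_combination (-x₁) * s0 + s1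
  rw [Finset.mem_union] at hi
  by_cases hi1 : i ∈ G₁
  · have hc : (0 : ℝ) < G₁.card := hm.trans_le hm₁
    have e3 : llW k y i - interpW G₁ G₂ x₁ x₂ i = (-x₂ * o₀ + o₁) / ((x₂ - x₁) * G₁.card) := by
      rw [interpW, if_pos hi1, eq_div_of_mul_eq hc.ne' (c1 i hi1), e1]
      field_simp; ring
    rw [e3, abs_div, abs_of_pos (mul_pos hx hc)]
    refine div_le_div₀ (by linarith [mul_nonneg (h1.trans h2).le he0, (abs_nonneg _).trans b1])
      ?_ (by positivity) (by gcongr)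
    refine (abs_add_le _ _).trans ?_
    rw [abs_mul, abs_neg, abs_of_pos (h1.trans h2), add_mul]
    exact add_le_add (mul_le_mul_of_nonneg_left b0 (by linarith)) b1
  · have hi2 : i ∈ G₂ := hi.resolve_left hi1
    have hc : (0 : ℝ) < G₂.card := hm.trans_le hm₂
    have e3 : llW k y i - interpW G₁ G₂ x₁ x₂ i = (x₁ * o₀ - o₁) / ((x₂ - x₁) * G₂.card) := by
      rw [interpW, if_neg hi1, if_pos hi2, eq_div_of_mul_eq hc.ne' (c2 i hi2), e2]
      field_simp; ring
    rw [e3, abs_div, abs_of_pos (mul_pos hx hc)]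
    refine div_le_div₀ (by linarith [mul_nonneg (h1.trans h2).le he0, (abs_nonneg _).trans b1])
      ?_ (by positivity) (by gcongr)
    refine (abs_sub _ _).trans ?_
    rw [abs_mul, abs_of_pos h1, add_mul]
    exact add_le_add (mul_le_mul h2.le b0 (abs_nonneg _) (by linarith)) b1

end TwoGroups

end LocalLinear

/-! ### The weights of the jump estimator on each side of the cutoff -/

/-- `side` is the indicator of a set on which `|x| = e x` with a fixed sign `e`. -/
structure IsSide (side : ℝ → ℝ) (e : ℝ) : Prop where
  sq : e * e = 1
  cases : ∀ x, side x = 0 ∨ side x = 1 ∧ |x| = e * x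

lemma isSide_indPos : IsSide indPos 1 := by
  refine ⟨by norm_num, fun x => ?_⟩
  by_cases h : 0 ≤ x
  · exact Or.inr ⟨if_pos h, by rw [abs_of_nonneg h, one_mul]⟩
  · exact Or.inl (if_neg h)

lemma isSide_indNeg : IsSide indNeg (-1) := by
  refine ⟨by norm_num, fun x => ?_⟩
  by_cases h : x < 0
  · exact Or.inr ⟨if_pos h, by rw [abs_of_neg h]; ring⟩
  · exact Or.inl (if_neg h)

lemma IsSide.nonneg {side : ℝ → ℝ} {e : ℝ} (hs : IsSide side e) (x : ℝ) : 0 ≤ side x := by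
  rcases hs.cases x with h | ⟨h, -⟩ <;> rw [h]
  exact zero_le_one

lemma IsSide.le_one {side : ℝ → ℝ} {e : ℝ} (hs : IsSide side e) (x : ℝ) : side x ≤ 1 := by
  rcases hs.cases x with h | ⟨h, -⟩ <;> rw [h]
  exact zero_le_one

section Weights

variable {n : ℕ}

/-- The kernel masses of the observations on one side. -/
noncomputable def mass (K : ℝ → ℝ) (side : ℝ → ℝ) (X : Fin n → ℝ) (h : ℝ) (i : Fin n) : ℝ :=
  K (X i / h) * side (X i)

/-- Distances to the cutoff. -/
noncomputable def dist₀ (X : Fin n → ℝ) (i : Fin n) : ℝ := |X i|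

variable {K side : ℝ → ℝ} {e : ℝ} {X : Fin n → ℝ} {h : ℝ}

lemma mass_mul_dist₀ (hs : IsSide side e) (i : Fin n) :
    mass K side X h i * dist₀ X i = e * (mass K side X h i * X i) := by
  rw [mass, dist₀]
  rcases hs.cases (X i) with h0 | ⟨h1, h2⟩
  · rw [h0]; ring
  · rw [h1, h2]; ring

lemma powSum_mass_one (hs : IsSide side e) : powSum (mass K side X h) (dist₀ X) 1 =
    e * ∑ i, mass K side X h i * X i := by
  rw [powSum, Finset.mul_sum]
  exact Finset.sum_congr rfl fun i _ => by rw [pow_one, mass_mul_dist₀ hs]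

lemma powSum_mass_two : powSum (mass K side X h) (dist₀ X) 2 =
    ∑ i, mass K side X h i * X i ^ 2 :=
  Finset.sum_congr rfl fun i _ => by rw [dist₀, sq_abs]

lemma gram_apply (a b : Fin 2) : gram K side X h a b =
    ∑ i, mass K side X h i * (lin (X i) a * lin (X i) b) := by
  rw [gram, Matrix.sum_apply]
  rfl

lemma det_gram (hs : IsSide side e) :
    (gram K side X h).det = llDet (mass K side X h) (dist₀ X) := by
  rw [Matrix.det_fin_two, gram_apply, gram_apply, gram_apply, gram_apply, llDet,
    powSum_mass_one hs, powSum_mass_two, mul_pow, sq e, hs.sq]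
  simp only [lin, Matrix.cons_val_zero, Matrix.cons_val_one, mul_one, one_mul, powSum, pow_zero,
    sq]

/-- Replacing `X` by `|X|` on one side at most flips the sign of the slope regressor, which leaves
the intercept weights unchanged. Both sides of the cutoff then fall under one theory with
nonnegative distances. -/
lemma sideWeight_eq_llW (hs : IsSide side e) (i : Fin n) :
    sideWeight K side X h i = llW (mass K side X h) (dist₀ X) i := by
  have e1 : (gram K side X h)⁻¹.mulVec (lin (X i)) 0 =
      (powSum (mass K side X h) (dist₀ X) 2 - (∑ j, mass K side X h j * X j) * X i) /
        llDet (mass K side X h) (dist₀ X) := by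
    rw [Matrix.inv_def, Ring.inverse_eq_inv', det_gram hs, Matrix.adjugate_fin_two,
      powSum_mass_two]
    simp only [Matrix.mulVec, dotProduct, Fin.sum_univ_two, Matrix.smul_apply, Matrix.of_apply,
      Matrix.cons_val_zero, Matrix.cons_val_one, Matrix.cons_val', Matrix.cons_val_fin_one,
      smul_eq_mul, gram_apply, lin, mul_one, one_mul]
    rw [div_eq_inv_mul, mul_sub]
    simp only [sq]; ring
  rw [sideWeight, e1, llW, powSum_mass_one hs]
  change _ / _ * mass K side X h i = _
  have h2 := mass_mul_dist₀ (K := K) (X := X) (h := h) hs i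
  have h3 := hs.sq
  set m := mass K side X h i
  set P := powSum (mass K side X h) (dist₀ X) 2
  set Q := ∑ j, mass K side X h j * X j
  rw [div_mul_eq_mul_div]
  congr 1
  have : m * (P - e * Q * dist₀ X i) = m * P - e * Q * (m * dist₀ X i) := by ring
  rw [this, h2]
  linear_combination Q * (m * X i) * h3

/-- The local linear weights to the right of the cutoff, in terms of distances to it. -/
noncomputable def wPos (K : ℝ → ℝ) (X : Fin n → ℝ) (h : ℝ) : Fin n → ℝ := llW (mass K indPos X h) (dist₀ X)

/-- The local linear weights to the left of the cutoff, in terms of distances to it. -/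
noncomputable def wNeg (K : ℝ → ℝ) (X : Fin n → ℝ) (h : ℝ) : Fin n → ℝ := llW (mass K indNeg X h) (dist₀ X)

lemma weight_eq (i : Fin n) : weight K X h i = wPos K X h i - wNeg K X h i := by
  rw [weight, sideWeight_eq_llW isSide_indPos, sideWeight_eq_llW isSide_indNeg]; rfl

lemma wPos_eq_zero {i : Fin n} (hi : X i < 0) : wPos K X h i = 0 := by
  rw [wPos, llW, mass, indPos, if_neg (not_le.2 hi), mul_zero, zero_mul, zero_div]

lemma wNeg_eq_zero {i : Fin n} (hi : 0 ≤ X i) : wNeg K X h i = 0 := by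
  rw [wNeg, llW, mass, indNeg, if_neg (not_lt.2 hi), mul_zero, zero_mul, zero_div]

lemma weight_sq (i : Fin n) : weight K X h i ^ 2 = wPos K X h i ^ 2 + wNeg K X h i ^ 2 := by
  rw [weight_eq]
  rcases lt_or_ge (X i) 0 with hi | hi
  · rw [wPos_eq_zero hi]; ring
  · rw [wNeg_eq_zero hi]; ring

/-- The sign in the bias bound cancels the minus sign of the left weights, so the biases of the two
sides add up and cannot offset each other. -/
lemma biasBound_eq (BY BT c : ℝ) : biasBound BY BT K c X h = (BY + |c| * BT) / 2 *
    (llBias (mass K indPos X h) (dist₀ X) + llBias (mass K indNeg X h) (dist₀ X)) := by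
  have e : ∀ i, weight K X h i * X i ^ 2 * Real.sign (X i) =
      wPos K X h i * dist₀ X i ^ 2 + wNeg K X h i * dist₀ X i ^ 2 := by
    intro i
    rw [weight_eq, dist₀, sq_abs]
    rcases lt_trichotomy (X i) 0 with hi | hi | hi
    · rw [wPos_eq_zero hi, Real.sign_of_neg hi]; ring
    · rw [hi]; simp
    · rw [wNeg_eq_zero hi.le, Real.sign_of_pos hi]; ring
  rw [biasBound, Finset.sum_congr rfl fun i _ => e i, Finset.sum_add_distrib, llBias, llBias]
  change _ * (∑ i, wPos K X h i * _ + ∑ i, wNeg K X h i * _) = _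
  rw [wPos, wNeg]; ring

lemma mem_admissible_iff : h ∈ admissible K X ↔ 0 < h ∧
    llDet (mass K indPos X h) (dist₀ X) ≠ 0 ∧ llDet (mass K indNeg X h) (dist₀ X) ≠ 0 := by
  rw [← det_gram isSide_indPos, ← det_gram isSide_indNeg]; rfl

lemma mass_nonneg (hK : IsRegKernel K) (hs : IsSide side e) (i : Fin n) :
    0 ≤ mass K side X h i := mul_nonneg (hK.nonneg _) (hs.nonneg _)

lemma mass_le (hK : IsRegKernel K) (hs : IsSide side e) (i : Fin n) :
    mass K side X h i ≤ K 0 :=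
  (mul_le_mul (hK.le_apply_zero _) (hs.le_one _) (hs.nonneg _) (hK.nonneg 0)).trans_eq (mul_one _)

lemma dist₀_nonneg (i : Fin n) : 0 ≤ dist₀ X i := abs_nonneg _

/-- The points of one side with `a ≤ |x| ≤ b`. -/
noncomputable def shell (side : ℝ → ℝ) (X : Fin n → ℝ) (a b : ℝ) : Finset (Fin n) :=
  Finset.univ.filter fun i => side (X i) = 1 ∧ a ≤ |X i| ∧ |X i| ≤ b

lemma mem_shell {a b : ℝ} {i : Fin n} :
    i ∈ shell side X a b ↔ side (X i) = 1 ∧ a ≤ |X i| ∧ |X i| ≤ b := by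
  simp [shell]

lemma mass_eq_of_side {i : Fin n} (hi : side (X i) = 1) : mass K side X h i = K (X i / h) := by
  rw [mass, hi, mul_one]

lemma side_eq_one_of_mass_ne_zero (hs : IsSide side e) {i : Fin n} (hi : mass K side X h i ≠ 0) :
    side (X i) = 1 := by
  rcases hs.cases (X i) with h0 | ⟨h1, -⟩
  · exact absurd (by rw [mass, h0, mul_zero]) hi
  · exact h1

lemma mass_eq_zero (hK : IsRegKernel K) (hh : 0 < h) {i : Fin n} (hi : h ≤ |X i|) :
    mass K side X h i = 0 := by
  rw [mass, hK.apply_eq_zero, zero_mul]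
  rwa [abs_div, abs_of_pos hh, le_div_iff₀ hh, one_mul]

/-- The range `H` may exceed the bandwidth, so that two bandwidths share one bounding set, as
`MassBound.abs_llW_sub_le` requires. -/
lemma massBound (hK : IsRegKernel K) (hs : IsSide side e) (hh : 0 < h) {H : ℝ} (hH : h ≤ H)
    {N : ℝ} (hN : ((shell side X 0 H).card : ℝ) ≤ N) :
    MassBound (mass K side X h) (dist₀ X) (K 0) N H (shell side X 0 H) where
  nonneg := mass_nonneg hK hs
  le := mass_le hK hs
  y_nonneg := dist₀_nonneg
  y_le i hi := (mem_shell.1 hi).2.2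
  eq_zero i hi := by
    by_contra h0
    refine hi (mem_shell.2 ⟨side_eq_one_of_mass_ne_zero hs h0, abs_nonneg _, ?_⟩)
    by_contra! h1
    exact h0 (mass_eq_zero hK hh (hH.trans h1.le))
  card_le := hN
  h_nonneg := hh.le.trans hH
  K_nonneg := hK.nonneg 0

lemma continuousAt_mass (hK : IsRegKernel K) (hh : h ≠ 0) (i : Fin n) :
    ContinuousAt (fun h => mass K side X h i) h := by
  unfold mass
  refine ContinuousAt.mul ?_ continuousAt_const
  exact hK.continuous.continuousAt.comp (continuousAt_const.div continuousAt_id hh)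

lemma continuousAt_powSum_mass (hK : IsRegKernel K) (hh : h ≠ 0) (p : ℕ) :
    ContinuousAt (fun h => powSum (mass K side X h) (dist₀ X) p) h := by
  unfold powSum
  exact tendsto_finsetSum _ fun i _ => (continuousAt_mass hK hh i).mul continuousAt_const

lemma continuousAt_llW_mass (hK : IsRegKernel K) (hh : h ≠ 0)
    (hD : llDet (mass K side X h) (dist₀ X) ≠ 0) (i : Fin n) :
    ContinuousAt (fun h => llW (mass K side X h) (dist₀ X) i) h := by
  have h0 := continuousAt_powSum_mass (side := side) (X := X) hK hh 0
  have h1 := continuousAt_powSum_mass (side := side) (X := X) hK hh 1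
  have h2 := continuousAt_powSum_mass (side := side) (X := X) hK hh 2
  unfold llW
  refine ((continuousAt_mass hK hh i).mul (h2.sub (h1.mul continuousAt_const))).div ?_ hD
  unfold llDet
  exact (h0.mul h2).sub (h1.pow 2)

lemma continuousAt_weight (hK : IsRegKernel K) (hh : h ∈ admissible K X) (i : Fin n) :
    ContinuousAt (fun h => weight K X h i) h := by
  obtain ⟨h0, h1, h2⟩ := mem_admissible_iff.1 hh
  have e : (fun h => weight K X h i) = fun h => wPos K X h i - wNeg K X h i := by
    funext h; exact weight_eq i
  rw [e]
  exact (continuousAt_llW_mass hK h0.ne' h1 i).sub (continuousAt_llW_mass hK h0.ne' h2 i)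

lemma continuousAt_stdDev (hK : IsRegKernel K) (hh : h ∈ admissible K X)
    (κm : Kernel ℝ (ℝ × ℝ)) (c : ℝ) : ContinuousAt (fun h => stdDev K κm c X h) h := by
  unfold stdDev
  refine Real.continuous_sqrt.continuousAt.comp ?_
  exact tendsto_finsetSum _ fun i _ => ((continuousAt_weight hK hh i).pow 2).mul continuousAt_const

lemma continuousAt_ciLength (hK : IsRegKernel K) (hh : h ∈ admissible K X)
    {α : ℝ} (hα : α ∈ Ioo (0 : ℝ) 1) (BY BT : ℝ) (κm : Kernel ℝ (ℝ × ℝ)) (c : ℝ)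
    (hpos : stdDev K κm c X h ≠ 0) :
    ContinuousAt (fun h => ciLength BY BT α K κm c X h) h := by
  have hs := continuousAt_stdDev hK hh κm c
  unfold ciLength
  refine ContinuousAt.mul ?_ hs
  refine (continuous_critVal hα).continuousAt.comp (ContinuousAt.div ?_ hs hpos)
  unfold biasBound
  refine continuousAt_const.mul ?_
  exact tendsto_finsetSum _ fun i _ =>
    ((continuousAt_weight hK hh i).mul continuousAt_const).mul continuousAt_const

/-- A minimizer exists if the length on an interval of admissible bandwidths attains a smaller
value than at any admissible bandwidth outside of it. -/
lemma optimalBandwidths_nonempty (hK : IsRegKernel K) {α : ℝ} (hα : α ∈ Ioo (0 : ℝ) 1)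
    (BY BT : ℝ) (κm : Kernel ℝ (ℝ × ℝ)) (c : ℝ) {h₁ h₂ h₀ : ℝ} (h₀m : h₀ ∈ Icc h₁ h₂)
    (hadm : ∀ h ∈ Icc h₁ h₂, h ∈ admissible K X)
    (hpos : ∀ h ∈ Icc h₁ h₂, stdDev K κm c X h ≠ 0)
    (hout : ∀ h ∈ admissible K X, h ∉ Icc h₁ h₂ →
      ciLength BY BT α K κm c X h₀ ≤ ciLength BY BT α K κm c X h) :
    (optimalBandwidths BY BT α K κm c X).Nonempty := by
  obtain ⟨h, hm, hmin⟩ := isCompact_Icc.exists_isMinOn (f := fun h => ciLength BY BT α K κm c X h)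
    ⟨h₀, h₀m⟩ fun h hh =>
      (continuousAt_ciLength hK (hadm h hh) hα BY BT κm c (hpos h hh)).continuousWithinAt
  refine ⟨h, hadm h hm, fun h' hh' => ?_⟩
  by_cases hin : h' ∈ Icc h₁ h₂
  · exact hmin hin
  · exact le_trans (hmin h₀m) (hout h' hh' hin)

/-- The variance of a sum of squared errors relative to the conditional variance bounds. -/
lemma stdDev_sq {κm : Kernel ℝ (ℝ × ℝ)} {c : ℝ} :
    stdDev K κm c X h ^ 2 = ∑ i, weight K X h i ^ 2 * condVariance κm c (X i) :=
  Real.sq_sqrt (Finset.sum_nonneg fun _ _ => mul_nonneg (sq_nonneg _) (variance_nonneg _ _))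

lemma sum_weight_sq : ∑ i, weight K X h i ^ 2 =
    ∑ i, wPos K X h i ^ 2 + ∑ i, wNeg K X h i ^ 2 := by
  rw [← Finset.sum_add_distrib]
  exact Finset.sum_congr rfl fun i _ => weight_sq i

lemma stdDev_sq_bounds {κm : Kernel ℝ (ℝ × ℝ)} {c lo hi : ℝ}
    (hvar : ∀ i, condVariance κm c (X i) ∈ Icc lo hi) :
    lo * ∑ i, weight K X h i ^ 2 ≤ stdDev K κm c X h ^ 2 ∧
      stdDev K κm c X h ^ 2 ≤ hi * ∑ i, weight K X h i ^ 2 := by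
  rw [stdDev_sq, Finset.mul_sum, Finset.mul_sum]
  constructor
  · exact Finset.sum_le_sum fun i _ => by
      rw [mul_comm]; exact mul_le_mul_of_nonneg_left (hvar i).1 (sq_nonneg _)
  · exact Finset.sum_le_sum fun i _ => by
      rw [mul_comm hi]; exact mul_le_mul_of_nonneg_left (hvar i).2 (sq_nonneg _)

lemma stdDev_nonneg {κm : Kernel ℝ (ℝ × ℝ)} {c : ℝ} : 0 ≤ stdDev K κm c X h := Real.sqrt_nonneg _

end Weights

/-- Divide `A - B` by `√A + √B ≥ √B`. A negative `A` has root zero and is possible only if `ε ≥ 1`.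
-/
lemma abs_sqrt_sub_sqrt_le {A B ε : ℝ} (hB : 0 < B) (h : |A - B| ≤ ε * B) :
    |√A - √B| ≤ ε * √B := by
  have hε : 0 ≤ ε := by
    by_contra! hlt
    have := (abs_nonneg _).trans h
    nlinarith
  have hsB := Real.sqrt_pos.2 hB
  rcases le_or_gt 0 A with hA | hA
  · have e : (√A - √B) * (√A + √B) = A - B := by
      nlinarith [Real.mul_self_sqrt hA, Real.mul_self_sqrt hB.le]
    have h1 : |√A - √B| * √B ≤ ε * √B * √B := by
      rw [mul_assoc, Real.mul_self_sqrt hB.le]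
      refine le_trans ?_ h
      rw [← e, abs_mul, abs_of_nonneg (add_nonneg (Real.sqrt_nonneg A) hsB.le)]
      exact mul_le_mul_of_nonneg_left (by linarith [Real.sqrt_nonneg A]) (abs_nonneg _)
    exact le_of_mul_le_mul_right h1 hsB
  · rw [Real.sqrt_eq_zero_of_nonpos hA.le, zero_sub, abs_neg, abs_of_pos hsB]
    have : B ≤ ε * B := by
      rw [abs_of_neg (by linarith)] at h
      linarith
    have h1 : 1 ≤ ε := by
      by_contra! hlt; nlinarith
    nlinarith

/-! ### Uniformly negligible events -/

section Negligible

variable {PX : Measure ℝ} {κ : (ℝ → ℝ) × (ℝ → ℝ) → Kernel ℝ (ℝ × ℝ)}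
  {F : Set ((ℝ → ℝ) × (ℝ → ℝ))} {E E' : (ℝ → ℝ) × (ℝ → ℝ) → (n : ℕ) → Set (Fin n → Obs)}

lemma unifNegligible_iff : UnifNegligible PX κ F E ↔
    ∀ ε : ℝ≥0∞, 0 < ε → ∀ᶠ n in atTop, ∀ m ∈ F, sampleLaw PX κ m n (E m n) ≤ ε := by
  rw [UnifNegligible, ENNReal.tendsto_nhds_zero]
  refine forall₂_congr fun ε _ => eventually_congr (Eventually.of_forall fun n => ?_)
  simp only [iSup_le_iff]

/-- Monotonicity of the outer measure: no event has to be measurable, so arbitrary functions of the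
sample are admitted as bandwidths, and inclusion is needed only almost surely and for large `n`. -/
lemma UnifNegligible.mono (h : UnifNegligible PX κ F E')
    (hsub : ∀ᶠ n in atTop, ∀ m ∈ F, ∀ᵐ S ∂(sampleLaw PX κ m n), S ∈ E m n → S ∈ E' m n) :
    UnifNegligible PX κ F E := by
  rw [unifNegligible_iff] at h ⊢
  intro ε hε
  filter_upwards [h ε hε, hsub] with n h1 h2 m hm
  exact (measure_mono_ae (h2 m hm)).trans (h1 m hm)

lemma UnifNegligible.union (h : UnifNegligible PX κ F E) (h' : UnifNegligible PX κ F E') :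
    UnifNegligible PX κ F fun m n => E m n ∪ E' m n := by
  rw [unifNegligible_iff] at h h' ⊢
  intro ε hε
  have hε2 : 0 < ε / 2 := ENNReal.half_pos hε.ne'
  filter_upwards [h _ hε2, h' _ hε2] with n h1 h2 m hm
  calc _ ≤ _ := measure_union_le _ _
    _ ≤ ε / 2 + ε / 2 := add_le_add (h1 m hm) (h2 m hm)
    _ = ε := ENNReal.add_halves ε

lemma unifNegligible_empty : UnifNegligible PX κ F fun _ _ => ∅ := by
  rw [unifNegligible_iff]
  intro ε _
  exact Eventually.of_forall fun n m _ => by simp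

lemma UnifNegligible.biUnion {β : Type*} (s : Finset β)
    {G : β → (ℝ → ℝ) × (ℝ → ℝ) → (n : ℕ) → Set (Fin n → Obs)}
    (h : ∀ b ∈ s, UnifNegligible PX κ F (G b)) :
    UnifNegligible PX κ F fun m n => ⋃ b ∈ s, G b m n := by
  classical
  induction s using Finset.induction_on with
  | empty => simpa using unifNegligible_empty
  | insert b s _ ih =>
    have h1 := (h b (Finset.mem_insert_self _ _)).union
      (ih fun b' hb' => h b' (Finset.mem_insert_of_mem hb'))
    simpa only [Finset.set_biUnion_insert] using h1

lemma unifNegligible_of_bound (u : ℕ → ℝ) (hu : Tendsto u atTop (𝓝 0))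
    (h : ∀ᶠ n in atTop, ∀ m ∈ F, sampleLaw PX κ m n (E m n) ≤ ENNReal.ofReal (u n)) :
    UnifNegligible PX κ F E := by
  rw [unifNegligible_iff]
  intro ε hε
  have h0 : Tendsto (fun n => ENNReal.ofReal (u n)) atTop (𝓝 0) := by
    simpa using ENNReal.tendsto_ofReal hu
  filter_upwards [h, h0.eventually (ge_mem_nhds hε)] with n h1 h2 m hm
  exact (h1 m hm).trans h2

end Negligible

/-! ### Laws of large numbers on product spaces -/

lemma pi_chebyshev {n : ℕ} {Ω : Fin n → Type*} {mΩ : ∀ i, MeasurableSpace (Ω i)}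
    (μ : ∀ i, Measure (Ω i)) [∀ i, IsProbabilityMeasure (μ i)] {f : ∀ i, Ω i → ℝ}
    (hf : ∀ i, MemLp (f i) 2 (μ i)) {t : ℝ} (ht : 0 < t) :
    Measure.pi μ {ω | t ≤ |∑ i, f i (ω i) - ∑ i, ∫ x, f i x ∂(μ i)|} ≤
      ENNReal.ofReal ((∑ i, Var[f i; μ i]) / t ^ 2) := by
  have hm : MemLp (∑ i, fun ω : ∀ i, Ω i => f i (ω i)) 2 (Measure.pi μ) :=
    memLp_finsetSum' _ fun i _ => (hf i).comp_measurePreserving (measurePreserving_eval _ i)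
  have h1 := meas_ge_le_variance_div_sq hm ht
  rw [variance_sum_pi hf] at h1
  have h2 : ∫ ω, (∑ i, fun ω : ∀ i, Ω i => f i (ω i)) ω ∂(Measure.pi μ) =
      ∑ i, ∫ x, f i x ∂(μ i) := by
    simp only [Finset.sum_apply]
    rw [integral_finsetSum]
    · refine Finset.sum_congr rfl fun i _ => ?_
      exact MeasureTheory.integral_comp_eval (hf i).aestronglyMeasurable
    · intro i _
      exact ((hf i).comp_measurePreserving (measurePreserving_eval _ i)).integrable one_le_two
  rw [h2] at h1
  simpa only [Finset.sum_apply] using h1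

section Sample

variable {PX : Measure ℝ} [IsProbabilityMeasure PX]
  {κ : (ℝ → ℝ) × (ℝ → ℝ) → Kernel ℝ (ℝ × ℝ)} [∀ m, IsMarkovKernel (κ m)]

lemma ae_sampleLaw {m : (ℝ → ℝ) × (ℝ → ℝ)} {p : ℝ → Prop} (hp : ∀ᵐ x ∂PX, p x) (n : ℕ) :
    ∀ᵐ S ∂(sampleLaw PX κ m n), ∀ i, p (runVar S i) := by
  rw [ae_all_iff]
  intro i
  have h1 : ∀ᵐ z ∂(PX ⊗ₘ κ m), p z.1 := by
    refine ae_of_ae_map (f := Prod.fst) (by fun_prop) ?_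
    have : (PX ⊗ₘ κ m).map Prod.fst = PX := Measure.fst_compProd PX (κ m)
    rw [this]
    exact hp
  exact (Measure.tendsto_eval_ae_ae (μ := fun _ : Fin n => PX ⊗ₘ κ m) (i := i)) h1

/-- Chebyshev's inequality for the number of observations in a set. -/
lemma sampleLaw_count (m : (ℝ → ℝ) × (ℝ → ℝ)) (n : ℕ) {I : Set ℝ} (hI : MeasurableSet I)
    [DecidablePred (· ∈ I)] {t : ℝ} (ht : 0 < t) :
    sampleLaw PX κ m n {S | t ≤ |((Finset.univ.filter fun i => runVar S i ∈ I).card : ℝ)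
      - n * PX.real I|} ≤ ENNReal.ofReal (n * PX.real I / t ^ 2) := by
  set f : Obs → ℝ := fun z => I.indicator 1 z.1 with hf
  have hfm : Measurable f := (measurable_one.indicator hI).comp measurable_fst
  have hf01 : ∀ z, 0 ≤ f z ∧ f z ≤ 1 := fun z => by
    by_cases h : z.1 ∈ I <;> simp [hf, h]
  have hL : MemLp f 2 (PX ⊗ₘ κ m) := by
    refine MemLp.of_bound hfm.aestronglyMeasurable 1 (Eventually.of_forall fun z => ?_)
    rw [Real.norm_eq_abs, abs_of_nonneg (hf01 z).1]; exact (hf01 z).2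
  have hint : ∫ z, f z ∂(PX ⊗ₘ κ m) = PX.real I := by
    have h1 : (PX ⊗ₘ κ m).map Prod.fst = PX := Measure.fst_compProd PX (κ m)
    calc ∫ z, f z ∂(PX ⊗ₘ κ m) = ∫ x, I.indicator 1 x ∂((PX ⊗ₘ κ m).map Prod.fst) :=
          (integral_map (by fun_prop)
            (measurable_one.indicator hI).aestronglyMeasurable).symm
      _ = PX.real I := by rw [h1, integral_indicator_one hI]
  have hvar : Var[f; PX ⊗ₘ κ m] ≤ PX.real I := by
    refine (variance_le_expectation_sq hfm.aestronglyMeasurable).trans (le_of_eq ?_)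
    rw [← hint]
    refine integral_congr_ae (Eventually.of_forall fun z => ?_)
    by_cases h : z.1 ∈ I <;> simp [hf, h]
  have key := pi_chebyshev (fun _ : Fin n => PX ⊗ₘ κ m) (f := fun _ => f) (fun _ => hL) ht
  have hsum : ∀ S : Fin n → Obs, ∑ i, f (S i) =
      ((Finset.univ.filter fun i => runVar S i ∈ I).card : ℝ) := by
    intro S
    rw [Finset.card_filter]
    push_cast
    refine Finset.sum_congr rfl fun i _ => ?_
    by_cases h : (S i).1 ∈ I
    · simp [hf, h, runVar]
    · simp [hf, h, runVar]
  simp only [hsum, Finset.sum_const, Finset.card_univ, Fintype.card_fin, nsmul_eq_mul, hint] at key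
  refine key.trans (ENNReal.ofReal_le_ofReal ?_)
  gcongr

end Sample

/-- A weak law of large numbers under a moment of order `p > 1`, uniform over the distribution. -/
lemma exists_uniform_wlln {Z : Type*} [MeasurableSpace Z] {p C τ : ℝ} (hp : 1 < p) (hτ : 0 < τ)
    {ε : ℝ} (hε : 0 < ε) :
    ∃ N : ℕ, ∀ n : ℕ, N ≤ n → ∀ (ν : Measure Z) [IsProbabilityMeasure ν] (φ : Z → ℝ),
      Measurable φ → (∀ z, 0 ≤ φ z) → ∫⁻ z, ENNReal.ofReal (φ z ^ p) ∂ν ≤ ENNReal.ofReal C →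
      Measure.pi (fun _ : Fin n => ν) {S | τ * n < |∑ i, φ (S i) - n * ∫ z, φ z ∂ν|} ≤
        ENNReal.ofReal ε := by
  set C' := max C 0 with hC'
  have hC0 : 0 ≤ C' := le_max_right _ _
  have hlim : Tendsto (fun T : ℝ => C' * T ^ (-(p - 1))) atTop (𝓝 0) := by
    simpa using (tendsto_rpow_neg_atTop (show 0 < p - 1 by linarith)).const_mul C'
  -- Truncation level. Above `T` one has φ ≤ T^(-(p-1)) φ^p, so the tail mean is at most C'
  -- T^(-(p-1)). The bound `τ / 4` is for the bias of truncation, `τ * ε / 8` for Markov's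
  -- inequality applied to the tail sum.
  obtain ⟨T, hT1, hT⟩ := ((hlim.eventually (gt_mem_nhds (show 0 < min (τ / 4) (τ * ε / 8) by
    positivity))).and (eventually_gt_atTop 0)).exists
  have hTτ : C' * T ^ (-(p - 1)) < τ / 4 := hT1.trans_le (min_le_left _ _)
  have hTε : C' * T ^ (-(p - 1)) < τ * ε / 8 := hT1.trans_le (min_le_right _ _)
  obtain ⟨N, hN⟩ := exists_nat_gt (8 * T ^ 2 * 4 / (τ ^ 2 * ε) + 1)
  refine ⟨N, fun n hn ν _ φ hφ hφ0 hφp => ?_⟩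
  have hnN : (N : ℝ) ≤ n := by exact_mod_cast hn
  have hN0 : 0 ≤ 8 * T ^ 2 * 4 / (τ ^ 2 * ε) := by positivity
  have hn0 : (0 : ℝ) < n := by linarith
  set A : Set Z := {z | φ z ≤ T} with hA
  have hAm : MeasurableSet A := measurableSet_le hφ measurable_const
  set φ₁ := A.indicator φ with hφ₁
  set φ₂ := Aᶜ.indicator φ with hφ₂
  have hφ₁m : Measurable φ₁ := hφ.indicator hAm
  have hφ₂m : Measurable φ₂ := hφ.indicator hAm.compl
  have hsplit : ∀ z, φ z = φ₁ z + φ₂ z := fun z => by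
    by_cases h : z ∈ A <;> simp [hφ₁, hφ₂, h]
  have h10 : ∀ z, 0 ≤ φ₁ z := fun z => Set.indicator_nonneg (fun z _ => hφ0 z) z
  have h20 : ∀ z, 0 ≤ φ₂ z := fun z => Set.indicator_nonneg (fun z _ => hφ0 z) z
  have h1T : ∀ z, φ₁ z ≤ T := fun z => by
    by_cases h : z ∈ A
    · rw [hφ₁, Set.indicator_of_mem h]; exact h
    · rw [hφ₁, Set.indicator_of_notMem h]; exact hT.le
  have h2p : ∀ z, φ₂ z ≤ T ^ (-(p - 1)) * φ z ^ p := fun z => by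
    by_cases h : z ∈ A
    · simp only [hφ₂, mem_compl_iff, h, not_true_eq_false, not_false_eq_true,
        Set.indicator_of_notMem]
      have := hφ0 z
      positivity
    · have hz : T < φ z := not_le.1 h
      have hz0 : 0 < φ z := hT.trans hz
      simp only [hφ₂, mem_compl_iff, h, not_false_eq_true, Set.indicator_of_mem]
      rw [Real.rpow_neg hT.le, inv_mul_eq_div, le_div_iff₀ (by positivity)]
      calc φ z * T ^ (p - 1) ≤ φ z * φ z ^ (p - 1) := by
            gcongr
        _ = φ z ^ p := by
            rw [← Real.rpow_one_add' hz0.le (by linarith)]; congr 1; ring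
  have hφ₂int : ∫⁻ z, ENNReal.ofReal (φ₂ z) ∂ν ≤ ENNReal.ofReal (C' * T ^ (-(p - 1))) := by
    calc ∫⁻ z, ENNReal.ofReal (φ₂ z) ∂ν
        ≤ ∫⁻ z, ENNReal.ofReal (T ^ (-(p - 1))) * ENNReal.ofReal (φ z ^ p) ∂ν := by
          refine lintegral_mono fun z => ?_
          rw [← ENNReal.ofReal_mul (by positivity)]
          exact ENNReal.ofReal_le_ofReal (h2p z)
      _ = ENNReal.ofReal (T ^ (-(p - 1))) * ∫⁻ z, ENNReal.ofReal (φ z ^ p) ∂ν :=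
          lintegral_const_mul' _ _ ENNReal.ofReal_ne_top
      _ ≤ ENNReal.ofReal (T ^ (-(p - 1))) * ENNReal.ofReal C' := by
          gcongr
          exact hφp.trans (ENNReal.ofReal_le_ofReal (le_max_left _ _))
      _ = _ := by rw [← ENNReal.ofReal_mul (by positivity), mul_comm]
  have hi₂ : Integrable φ₂ ν := by
    refine ⟨hφ₂m.aestronglyMeasurable, ?_⟩
    rw [hasFiniteIntegral_iff_ofReal (Eventually.of_forall h20)]
    exact hφ₂int.trans_lt ENNReal.ofReal_lt_top
  have hL₁ : MemLp φ₁ 2 ν := MemLp.of_bound hφ₁m.aestronglyMeasurable T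
    (Eventually.of_forall fun z => by
      rw [Real.norm_eq_abs, abs_of_nonneg (h10 z)]; exact h1T z)
  have hi₁ : Integrable φ₁ ν := hL₁.integrable one_le_two
  have hint : ∫ z, φ z ∂ν = ∫ z, φ₁ z ∂ν + ∫ z, φ₂ z ∂ν := by
    rw [← integral_add hi₁ hi₂]
    exact integral_congr_ae (Eventually.of_forall hsplit)
  have hb₂ : ∫ z, φ₂ z ∂ν ≤ C' * T ^ (-(p - 1)) := by
    rw [integral_eq_lintegral_of_nonneg_ae (Eventually.of_forall h20) hφ₂m.aestronglyMeasurable]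
    exact ENNReal.toReal_le_of_le_ofReal (by positivity) hφ₂int
  have hb₂0 : 0 ≤ ∫ z, φ₂ z ∂ν := integral_nonneg h20
  set μ := Measure.pi (fun _ : Fin n => ν) with hμ
  -- The centering of the tail uses at most `τ * n / 4`, so a large deviation requires one of `τ * n
  -- / 2` in the truncated part or a tail sum of `τ * n / 4`.
  have hE : {S : Fin n → Z | τ * n < |∑ i, φ (S i) - n * ∫ z, φ z ∂ν|} ⊆
      {S | τ * n / 2 ≤ |∑ i, φ₁ (S i) - ∑ _i : Fin n, ∫ z, φ₁ z ∂ν|} ∪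
      {S | ENNReal.ofReal (τ * n / 4) ≤ ∑ i, ENNReal.ofReal (φ₂ (S i))} := by
    intro S hS
    by_contra hcon
    rw [mem_union, not_or] at hcon
    obtain ⟨c1, c2⟩ := hcon
    simp only [mem_ofPred_eq, not_le] at c1 c2 hS
    rw [← ENNReal.ofReal_sum_of_nonneg (fun i _ => h20 _),
      ENNReal.ofReal_lt_ofReal_iff (by positivity)] at c2
    have h0 : 0 ≤ ∑ i, φ₂ (S i) := Finset.sum_nonneg fun i _ => h20 _
    simp only [Finset.sum_const, Finset.card_univ, Fintype.card_fin, nsmul_eq_mul] at c1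
    have e : ∑ i, φ (S i) - n * ∫ z, φ z ∂ν = (∑ i, φ₁ (S i) - n * ∫ z, φ₁ z ∂ν)
        + (∑ i, φ₂ (S i) - n * ∫ z, φ₂ z ∂ν) := by
      rw [hint, Finset.sum_congr rfl fun i _ => hsplit (S i), Finset.sum_add_distrib]; ring
    rw [e] at hS
    have h3 : |∑ i, φ₂ (S i) - n * ∫ z, φ₂ z ∂ν| ≤ τ * n / 4 := by
      have h4 : (n : ℝ) * ∫ z, φ₂ z ∂ν ≤ τ * n / 4 := by
        calc (n : ℝ) * ∫ z, φ₂ z ∂ν ≤ n * (τ / 4) := by gcongr; linarith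
          _ = _ := by ring
      have h5 : 0 ≤ (n : ℝ) * ∫ z, φ₂ z ∂ν := by positivity
      rw [abs_le]; constructor <;> linarith
    have := abs_add_le (∑ i, φ₁ (S i) - n * ∫ z, φ₁ z ∂ν) (∑ i, φ₂ (S i) - n * ∫ z, φ₂ z ∂ν)
    have : 0 < τ * n := by positivity
    linarith
  have hP₁ : μ {S | τ * n / 2 ≤ |∑ i, φ₁ (S i) - ∑ _i : Fin n, ∫ z, φ₁ z ∂ν|} ≤
      ENNReal.ofReal (ε / 2) := by
    refine (pi_chebyshev (fun _ : Fin n => ν) (f := fun _ => φ₁) (fun _ => hL₁)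
      (show 0 < τ * n / 2 by positivity)).trans (ENNReal.ofReal_le_ofReal ?_)
    have hv : Var[φ₁; ν] ≤ T ^ 2 := by
      refine (variance_le_expectation_sq hφ₁m.aestronglyMeasurable).trans ?_
      calc ∫ z, (φ₁ ^ 2) z ∂ν ≤ ∫ _, T ^ 2 ∂ν := by
            refine integral_mono_of_nonneg (Eventually.of_forall fun z => by
              simp only [Pi.pow_apply, Pi.zero_apply]; positivity) (integrable_const _)
              (Eventually.of_forall fun z => ?_)
            simp only [Pi.pow_apply]
            have := h10 z
            have := h1T z
            gcongr
        _ = T ^ 2 := by simp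
    simp only [Finset.sum_const, Finset.card_univ, Fintype.card_fin, nsmul_eq_mul]
    rw [div_le_iff₀ (by positivity)]
    have h6 : 8 * T ^ 2 * 4 / (τ ^ 2 * ε) ≤ n := by linarith
    rw [div_le_iff₀ (by positivity)] at h6
    calc (n : ℝ) * Var[φ₁; ν] ≤ n * T ^ 2 := by gcongr
      _ ≤ n * (n * (τ ^ 2 * ε) / 8) := by gcongr; linarith [sq_nonneg T]
      _ = ε / 2 * (τ * n / 2) ^ 2 := by ring
  have hP₂ : μ {S | ENNReal.ofReal (τ * n / 4) ≤ ∑ i, ENNReal.ofReal (φ₂ (S i))} ≤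
      ENNReal.ofReal (ε / 2) := by
    have hmeas : Measurable fun S : Fin n → Z => ∑ i, ENNReal.ofReal (φ₂ (S i)) :=
      Finset.measurable_sum _ fun i _ =>
        (hφ₂m.comp (measurable_pi_apply i)).ennreal_ofReal
    refine (meas_ge_le_lintegral_div hmeas.aemeasurable
      (by simp only [ne_eq, ENNReal.ofReal_eq_zero, not_le]; positivity)
      ENNReal.ofReal_ne_top).trans ?_
    rw [lintegral_finsetSum (f := fun i (S : Fin n → Z) => ENNReal.ofReal (φ₂ (S i))) _
      fun i _ => (hφ₂m.comp (measurable_pi_apply i)).ennreal_ofReal]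
    have h7 : ∀ i : Fin n, ∫⁻ S, ENNReal.ofReal (φ₂ (S i)) ∂μ ≤
        ENNReal.ofReal (C' * T ^ (-(p - 1))) := fun i => by
      have : ∫⁻ S, ENNReal.ofReal (φ₂ (S i)) ∂μ = ∫⁻ z, ENNReal.ofReal (φ₂ z) ∂ν :=
        (measurePreserving_eval (fun _ : Fin n => ν) i).lintegral_comp hφ₂m.ennreal_ofReal
      rw [this]; exact hφ₂int
    refine ENNReal.div_le_of_le_mul ?_
    refine (Finset.sum_le_sum fun i _ => h7 i).trans ?_
    rw [Finset.sum_const, Finset.card_univ, Fintype.card_fin, nsmul_eq_mul,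
      ← ENNReal.ofReal_natCast, ← ENNReal.ofReal_mul (by positivity),
      ← ENNReal.ofReal_mul (by positivity)]
    refine ENNReal.ofReal_le_ofReal ?_
    calc (n : ℝ) * (C' * T ^ (-(p - 1))) ≤ n * (τ * ε / 8) := by gcongr
      _ = ε / 2 * (τ * n / 4) := by ring
  calc μ _ ≤ _ := measure_mono hE
    _ ≤ _ := measure_union_le _ _
    _ ≤ ENNReal.ofReal (ε / 2) + ENNReal.ofReal (ε / 2) := add_le_add hP₁ hP₂
    _ = ENNReal.ofReal ε := by
      rw [← ENNReal.ofReal_add (by positivity) (by positivity), add_halves]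

/-! ### Deterministic analysis of discrete designs -/

section Discrete

variable {n : ℕ}

/-- The observations on one side at distance `z` from the cutoff. -/
noncomputable def grp (side : ℝ → ℝ) (X : Fin n → ℝ) (z : ℝ) : Finset (Fin n) :=
  Finset.univ.filter fun i => side (X i) = 1 ∧ |X i| = z

lemma mem_grp {side : ℝ → ℝ} {X : Fin n → ℝ} {z : ℝ} {i : Fin n} :
    i ∈ grp side X z ↔ side (X i) = 1 ∧ |X i| = z := by simp [grp]

/-- A sample in which the distances to the cutoff are `x₁ < x₂ < x₃` or at least `x₄`, and a
fraction of at least `p` of the observations is at each of `±x₁`, `±x₂`, and, unless there are no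
further points, also at one of `±x₃`. -/
structure DiscreteDesign (X : Fin n → ℝ) (x₁ x₂ x₃ x₄ p : ℝ) : Prop where
  x₁_pos : 0 < x₁
  lt₁₂ : x₁ < x₂
  lt₂₃ : x₂ < x₃
  lt₃₄ : x₃ < x₄
  p_pos : 0 < p
  n_pos : 0 < n
  values : ∀ i, |X i| = x₁ ∨ |X i| = x₂ ∨ |X i| = x₃ ∨ x₄ ≤ |X i|
  card_pos₁ : p * n ≤ (grp indPos X x₁).card
  card_pos₂ : p * n ≤ (grp indPos X x₂).card
  card_neg₁ : p * n ≤ (grp indNeg X x₁).card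
  card_neg₂ : p * n ≤ (grp indNeg X x₂).card
  third : (∀ i, |X i| = x₁ ∨ |X i| = x₂) ∨ p * n ≤ (grp indPos X x₃).card ∨
    p * n ≤ (grp indNeg X x₃).card

variable {K side : ℝ → ℝ} {e : ℝ} {X : Fin n → ℝ} {h x₁ x₂ x₃ x₄ p : ℝ}

lemma DiscreteDesign.twoGroups (H : DiscreteDesign X x₁ x₂ x₃ x₄ p) (hK : IsRegKernel K)
    (hs : IsSide side e) :
    TwoGroups (mass K side X h) (dist₀ X) (grp side X x₁) (grp side X x₂) x₁ x₂ x₃ where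
  nonneg := mass_nonneg hK hs
  x₁_pos := H.x₁_pos
  lt₁₂ := H.lt₁₂
  lt₂₃ := H.lt₂₃
  y₁ i hi := (mem_grp.1 hi).2
  y₂ i hi := (mem_grp.1 hi).2
  k₁ i hi j hj := by
    obtain ⟨a, b⟩ := mem_grp.1 hi
    obtain ⟨a', b'⟩ := mem_grp.1 hj
    rw [mass_eq_of_side a, mass_eq_of_side a', ← hK.apply_abs, ← hK.apply_abs (X j / h), abs_div,
      abs_div, b, b']
  k₂ i hi j hj := by
    obtain ⟨a, b⟩ := mem_grp.1 hi
    obtain ⟨a', b'⟩ := mem_grp.1 hj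
    rw [mass_eq_of_side a, mass_eq_of_side a', ← hK.apply_abs, ← hK.apply_abs (X j / h), abs_div,
      abs_div, b, b']
  other i h1 h2 h3 := by
    have hside := side_eq_one_of_mass_ne_zero hs h3
    rcases H.values i with a | a | a | a
    · exact absurd (mem_grp.2 ⟨hside, a⟩) h1
    · exact absurd (mem_grp.2 ⟨hside, a⟩) h2
    · exact a.ge
    · exact H.lt₃₄.le.trans a

lemma DiscreteDesign.far_of_notMem (H : DiscreteDesign X x₁ x₂ x₃ x₄ p) {i : Fin n}
    (hi : i ∉ grp side X x₁ ∪ grp side X x₂) (hside : side (X i) = 1) : x₃ ≤ |X i| := by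
  rw [Finset.mem_union, not_or, mem_grp, mem_grp] at hi
  rcases H.values i with a | a | a | a
  · exact absurd ⟨hside, a⟩ hi.1
  · exact absurd ⟨hside, a⟩ hi.2
  · exact a.ge
  · exact H.lt₃₄.le.trans a

lemma DiscreteDesign.card_grp (H : DiscreteDesign X x₁ x₂ x₃ x₄ p)
    (hside : side = indPos ∨ side = indNeg) :
    p * n ≤ (grp side X x₁).card ∧ p * n ≤ (grp side X x₂).card := by
  rcases hside with rfl | rfl
  · exact ⟨H.card_pos₁, H.card_pos₂⟩
  · exact ⟨H.card_neg₁, H.card_neg₂⟩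

lemma DiscreteDesign.pn_pos (H : DiscreteDesign X x₁ x₂ x₃ x₄ p) : 0 < p * n := by
  have := H.n_pos
  have := H.p_pos
  positivity

lemma isSide_of (hside : side = indPos ∨ side = indNeg) : ∃ e, IsSide side e := by
  rcases hside with rfl | rfl
  · exact ⟨_, isSide_indPos⟩
  · exact ⟨_, isSide_indNeg⟩

lemma card_shell_le {a b : ℝ} : ((shell side X a b).card : ℝ) ≤ n := by
  have := Finset.card_le_univ (shell side X a b)
  rw [Fintype.card_fin] at this
  exact_mod_cast this

/-- If no mass is put on points beyond the second group, the weights are those of the line through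
the first two groups. -/
lemma DiscreteDesign.llW_eq (H : DiscreteDesign X x₁ x₂ x₃ x₄ p) (hK : IsRegKernel K)
    (hside : side = indPos ∨ side = indNeg)
    (hfar : ∀ i, x₃ ≤ |X i| → mass K side X h i = 0)
    (hD : llDet (mass K side X h) (dist₀ X) ≠ 0) :
    llW (mass K side X h) (dist₀ X) =
      TwoGroups.interpW (grp side X x₁) (grp side X x₂) x₁ x₂ ∧
    llBias (mass K side X h) (dist₀ X) = x₁ * x₂ := by
  obtain ⟨e, hs⟩ := isSide_of hside
  have T := H.twoGroups (h := h) hK hs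
  have hx1 := H.x₁_pos
  have hx2 := H.lt₁₂
  have hzero : ∀ i, i ∉ grp side X x₁ ∪ grp side X x₂ → mass K side X h i = 0 := by
    intro i hi
    rcases hs.cases (X i) with h0 | ⟨h1, -⟩
    · rw [mass, h0, mul_zero]
    · exact hfar i (H.far_of_notMem hi h1)
  have hw0 : ∀ i, i ∉ grp side X x₁ ∪ grp side X x₂ →
      llW (mass K side X h) (dist₀ X) i = 0 := fun i hi => by
    rw [llW, hzero i hi, zero_mul, zero_div]
  obtain ⟨c1, c2⟩ := H.card_grp hside
  have hval : ∀ i, mass K side X h i ≠ 0 → dist₀ X i = x₁ ∨ dist₀ X i = x₂ := by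
    intro i hi
    have hi' : i ∈ grp side X x₁ ∪ grp side X x₂ := by
      by_contra hc
      exact hi (hzero i hc)
    rcases Finset.mem_union.1 hi' with h | h
    · exact Or.inl (mem_grp.1 h).2
    · exact Or.inr (mem_grp.1 h).2
  refine ⟨funext fun i => ?_, ?_⟩
  · by_cases hi : i ∈ grp side X x₁ ∪ grp side X x₂
    · have h1 := T.abs_llW_sub_interpW_le hD (e := 0) (Y := x₂) H.pn_pos c1 c2
        (fun i hi => ⟨dist₀_nonneg i, by
          rcases hval i hi with h | h <;> rw [h]
          exact hx2.le⟩)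
        (le_of_eq (Finset.sum_eq_zero fun i hi => by
          rw [hw0 i (Finset.mem_compl.1 hi), abs_zero])) i hi
      rw [mul_zero, zero_div] at h1
      exact sub_eq_zero.1 (abs_nonpos_iff.1 h1)
    · rw [hw0 i hi]
      rw [Finset.mem_union, not_or] at hi
      rw [TwoGroups.interpW, if_neg hi.1, if_neg hi.2]
  · have h0 := sum_llW hD
    have h1 := sum_llW_mul (k := mass K side X h) (y := dist₀ X)
    -- The polynomial (y - x₁)(y - x₂) vanishes wherever there is mass. Expanding it with the
    -- moments one and zero of the weights gives the second moment -x₁ x₂ exactly.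
    have h2 : ∑ i, llW (mass K side X h) (dist₀ X) i *
        ((dist₀ X i - x₁) * (dist₀ X i - x₂)) = 0 := by
      refine Finset.sum_eq_zero fun i _ => ?_
      by_cases hi : mass K side X h i = 0
      · rw [llW, hi, zero_mul, zero_div, zero_mul]
      · rcases hval i hi with h | h <;> rw [h] <;> ring
    have e2 : ∑ i, llW (mass K side X h) (dist₀ X) i * ((dist₀ X i - x₁) * (dist₀ X i - x₂)) =
        ∑ i, llW (mass K side X h) (dist₀ X) i * dist₀ X i ^ 2
        - (x₁ + x₂) * ∑ i, llW (mass K side X h) (dist₀ X) i * dist₀ X i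
        + x₁ * x₂ * ∑ i, llW (mass K side X h) (dist₀ X) i := by
      rw [Finset.mul_sum, Finset.mul_sum, ← Finset.sum_sub_distrib, ← Finset.sum_add_distrib]
      exact Finset.sum_congr rfl fun i _ => by ring
    rw [e2, h1, h0] at h2
    rw [llBias]; linarith

/-- The weights of the lines through the first two groups on either side. -/
noncomputable def lineW (X : Fin n → ℝ) (x₁ x₂ : ℝ) (i : Fin n) : ℝ :=
  TwoGroups.interpW (grp indPos X x₁) (grp indPos X x₂) x₁ x₂ i -
    TwoGroups.interpW (grp indNeg X x₁) (grp indNeg X x₂) x₁ x₂ i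

lemma abs_interpW_le (H : DiscreteDesign X x₁ x₂ x₃ x₄ p)
    (hside : side = indPos ∨ side = indNeg) (i : Fin n) :
    |TwoGroups.interpW (grp side X x₁) (grp side X x₂) x₁ x₂ i| ≤ x₂ / (x₂ - x₁) / p / n := by
  obtain ⟨c1, c2⟩ := H.card_grp hside
  have h0 := H.pn_pos
  have h1 := H.x₁_pos
  have h2 := H.lt₁₂
  have h3 : 0 < x₂ - x₁ := by linarith
  have hp := H.p_pos
  have h4 : 0 < x₂ := h1.trans h2
  have key : ∀ c : ℝ, p * n ≤ c → x₂ / (x₂ - x₁) / c ≤ x₂ / (x₂ - x₁) / p / n := by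
    intro c hc
    rw [div_div _ p]
    gcongr
  rw [TwoGroups.interpW]
  split_ifs
  · rw [abs_of_nonneg (by positivity)]
    exact key _ c1
  · rw [neg_div, neg_div, abs_neg, abs_of_nonneg (by positivity)]
    refine le_trans ?_ (key _ c2)
    gcongr
  · rw [abs_zero]; positivity

/-- If the masses beyond the second group are small and vanish beyond the third, then the weights
are close to those of the line through the first two groups. -/
lemma exists_abs_weight_sub_lineW_le (hK : IsRegKernel K) (h₁ : 0 < x₁) (h₂ : x₁ < x₂)
    (h₃ : x₂ < x₃) (hp : 0 < p) :
    ∃ C : ℝ, 0 < C ∧ ∀ (n : ℕ) (X : Fin n → ℝ), DiscreteDesign X x₁ x₂ x₃ x₄ p →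
      ∀ h ∈ admissible K X, ∀ τ : ℝ, 0 ≤ τ →
        (∀ i, x₃ ≤ |X i| → K (X i / h) ≤ τ) → (∀ i, x₄ ≤ |X i| → K (X i / h) = 0) →
        ∀ i, |weight K X h i - lineW X x₁ x₂ i| ≤ C * τ / n := by
  obtain ⟨a, ha, ha1, hapos, hazero⟩ := hK.exists_cutoff
  have hx₂ : 0 < x₂ := by linarith
  have hx₃ : 0 < x₃ := by linarith
  -- For bandwidths above `x₃ / a`, points up to `x₂` have kernel argument below `a * x₂ / x₃ < a`,
  -- so `κ₀` bounds their masses from below.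
  set κ₀ := K (a * x₂ / x₃) with hκ₀
  have hκ0 : 0 < κ₀ := hapos _ (by
    rw [abs_of_pos (by positivity), div_lt_iff₀ hx₃]; gcongr)
  have hK0 := hK.apply_zero_pos
  set d := κ₀ ^ 2 * (x₂ - x₁) ^ 2 * p ^ 2 / 2 with hd
  have hx21 : 0 < x₂ - x₁ := by linarith
  have hd0 : 0 < d := by positivity
  set C₁ := K 0 * x₃ ^ 2 / d with hC₁
  set C₂ := C₁ + (x₂ + x₃) * C₁ / ((x₂ - x₁) * p) with hC₂
  have hC₁0 : 0 < C₁ := by positivity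
  have hC₂0 : 0 < C₂ := by positivity
  refine ⟨2 * C₂, by positivity, fun n X H h hh τ hτ hfar hvfar => ?_⟩
  obtain ⟨hh0, hDp, hDn⟩ := mem_admissible_iff.1 hh
  have hn : (0 : ℝ) < n := by exact_mod_cast H.n_pos
  have main : ∀ side, (side = indPos ∨ side = indNeg) →
      llDet (mass K side X h) (dist₀ X) ≠ 0 → ∀ i, |llW (mass K side X h) (dist₀ X) i -
        TwoGroups.interpW (grp side X x₁) (grp side X x₂) x₁ x₂ i| ≤ C₂ * τ / n := by
    intro side hside hD i
    obtain ⟨e, hs⟩ := isSide_of hside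
    -- For small bandwidths the mass at `x₂`, and with it the determinant, may be arbitrarily small,
    -- but then nothing lies beyond `x₂` and the weights are exact. For larger ones the determinant
    -- is of order n² and perturbation bounds apply.
    rcases le_or_gt h (x₃ / a) with hle | hgt
    · have := (H.llW_eq hK hside (h := h) (fun i hi => by
        rw [mass, hazero, zero_mul]
        rw [abs_div, abs_of_pos hh0, le_div_iff₀ hh0]
        calc a * h ≤ a * (x₃ / a) := by gcongr
          _ = x₃ := by field_simp
          _ ≤ _ := hi) hD).1
      rw [this, sub_self, abs_zero]
      positivity
    · have T := H.twoGroups (h := h) hK hs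
      obtain ⟨c1, c2⟩ := H.card_grp hside
      have hlow : ∀ z, 0 < z → z ≤ x₂ → ∀ i ∈ grp side X z, κ₀ ≤ mass K side X h i := by
        intro z hz hz2 i hi
        obtain ⟨s1, s2⟩ := mem_grp.1 hi
        rw [mass_eq_of_side s1]
        refine hK.le_apply_of_abs_le ?_
        rw [abs_div, abs_of_pos hh0, s2, abs_of_pos (by positivity), div_le_div_iff₀ hh0 hx₃]
        rw [div_lt_iff₀ ha] at hgt
        calc z * x₃ ≤ x₂ * (h * a) := by gcongr
          _ = _ := by ring
      have hDge : d * n ^ 2 ≤ llDet (mass K side X h) (dist₀ X) := by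
        have h5 := llDet_ge (y := dist₀ X) (mass_nonneg (X := X) (h := h) hK hs) hκ0.le hx21.le
          (grp side X x₁) (grp side X x₂)
          (hlow x₁ h₁ h₂.le) (hlow x₂ (h₁.trans h₂) le_rfl)
          (fun i hi j hj => by rw [T.y₁ i hi, T.y₂ j hj])
        have h6 : (p * n) * (p * n) ≤
            ((grp side X x₁).card : ℝ) * (grp side X x₂).card :=
          mul_le_mul c1 c2 H.pn_pos.le (Nat.cast_nonneg _)
        have h7 : κ₀ ^ 2 * (x₂ - x₁) ^ 2 * ((p * n) * (p * n)) ≤ κ₀ ^ 2 * (x₂ - x₁) ^ 2 *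
            (((grp side X x₁).card : ℝ) * (grp side X x₂).card) := by gcongr
        rw [hd]; linarith
      have hDpos : 0 < llDet (mass K side X h) (dist₀ X) := lt_of_lt_of_le (by positivity) hDge
      have MB : MassBound (mass K side X h) (dist₀ X) (K 0) n x₃ (shell side X 0 x₃) :=
        { nonneg := mass_nonneg hK hs
          le := mass_le hK hs
          y_nonneg := dist₀_nonneg
          y_le := fun i hi => (mem_shell.1 hi).2.2
          eq_zero := fun i hi => by
            rcases hs.cases (X i) with h0 | ⟨h1, -⟩
            · rw [mass, h0, mul_zero]
            · have : x₄ ≤ |X i| := by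
                rcases H.values i with a | a | a | a
                · exact absurd (mem_shell.2 ⟨h1, abs_nonneg _, by rw [a]; linarith⟩) hi
                · exact absurd (mem_shell.2 ⟨h1, abs_nonneg _, by rw [a]; linarith⟩) hi
                · exact absurd (mem_shell.2 ⟨h1, abs_nonneg _, a.le⟩) hi
                · exact a
              rw [mass, hvfar i this, zero_mul]
          card_le := card_shell_le
          h_nonneg := hx₃.le
          K_nonneg := hK0.le }
      have hother : ∀ i, i ∉ grp side X x₁ ∪ grp side X x₂ →
          |llW (mass K side X h) (dist₀ X) i| ≤ C₁ * τ / n := by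
        intro i hi
        have hm : mass K side X h i ≤ τ := by
          rcases hs.cases (X i) with h0 | ⟨h1, -⟩
          · rw [mass, h0, mul_zero]; exact hτ
          · rw [mass_eq_of_side h1]; exact hfar i (H.far_of_notMem hi h1)
        refine (MB.abs_llW_le_mass hDpos i).trans ?_
        calc mass K side X h i * (K 0 * n * x₃ ^ 2) / llDet (mass K side X h) (dist₀ X)
            ≤ τ * (K 0 * n * x₃ ^ 2) / (d * n ^ 2) := by gcongr
          _ = C₁ * τ / n := by rw [hC₁]; field_simp
      by_cases hi : i ∈ grp side X x₁ ∪ grp side X x₂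
      · have h8 := T.abs_llW_sub_interpW_le hD (e := C₁ * τ) (Y := x₃) H.pn_pos c1 c2
          (fun i hi => ⟨dist₀_nonneg i, by
            by_contra hc
            exact hi (MB.eq_zero i fun hm => hc (mem_shell.1 hm).2.2)⟩)
          ?_ i hi
        · refine h8.trans ?_
          have : (x₂ + x₃) * (C₁ * τ) / ((x₂ - x₁) * (p * n)) =
              (x₂ + x₃) * C₁ / ((x₂ - x₁) * p) * τ / n := by field_simp
          rw [this]
          gcongr
          rw [hC₂]; linarith
        · calc ∑ i ∈ (grp side X x₁ ∪ grp side X x₂)ᶜ, |llW (mass K side X h) (dist₀ X) i|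
              ≤ ∑ i ∈ (grp side X x₁ ∪ grp side X x₂)ᶜ, C₁ * τ / n :=
                Finset.sum_le_sum fun i hi => hother i (Finset.mem_compl.1 hi)
            _ = ((grp side X x₁ ∪ grp side X x₂)ᶜ.card : ℝ) * (C₁ * τ / n) := by
                rw [Finset.sum_const, nsmul_eq_mul]
            _ ≤ n * (C₁ * τ / n) := by
                gcongr
                have := Finset.card_le_univ (grp side X x₁ ∪ grp side X x₂)ᶜ
                rwa [Fintype.card_fin] at this
            _ = C₁ * τ := by field_simp
      · have h9 := hother i hi
        rw [Finset.mem_union, not_or] at hi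
        rw [TwoGroups.interpW, if_neg hi.1, if_neg hi.2, sub_zero]
        refine h9.trans ?_
        gcongr
        rw [hC₂]
        have : 0 ≤ (x₂ + x₃) * C₁ / ((x₂ - x₁) * p) := by
          have : 0 < x₂ := by linarith
          positivity
        linarith
  intro i
  have e1 : weight K X h i - lineW X x₁ x₂ i =
      (llW (mass K indPos X h) (dist₀ X) i -
        TwoGroups.interpW (grp indPos X x₁) (grp indPos X x₂) x₁ x₂ i) -
      (llW (mass K indNeg X h) (dist₀ X) i -
        TwoGroups.interpW (grp indNeg X x₁) (grp indNeg X x₂) x₁ x₂ i) := by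
    rw [weight_eq, lineW, wPos, wNeg]; ring
  rw [e1]
  refine (abs_sub _ _).trans ((add_le_add (main _ (Or.inl rfl) hDp i)
    (main _ (Or.inr rfl) hDn i)).trans (le_of_eq ?_))
  ring

/-- In discrete designs of sufficient size, an optimal bandwidth exists, and optimal bandwidths
put almost no mass on points beyond the second group. -/
lemma exists_optimalBandwidths_discrete (hK : IsRegKernel K) (h₁ : 0 < x₁) (h₂ : x₁ < x₂)
    (h₃ : x₂ < x₃) (hp : 0 < p) {BY BT α : ℝ} (hBY : 0 < BY) (hBT : 0 < BT)
    (hα : α ∈ Ioo (0 : ℝ) 1) (c : ℝ) {lo hi τ : ℝ} (hlo : 0 < lo) (hτ : 0 < τ) :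
    ∃ N : ℕ, ∀ (n : ℕ) (X : Fin n → ℝ), N ≤ n → DiscreteDesign X x₁ x₂ x₃ x₄ p →
      ∀ κm : Kernel ℝ (ℝ × ℝ), (∀ i, condVariance κm c (X i) ∈ Icc lo hi) →
        (optimalBandwidths BY BT α K κm c X).Nonempty ∧
        ∀ h ∈ optimalBandwidths BY BT α K κm c X, ∀ i, x₃ ≤ |X i| → K (X i / h) ≤ τ := by
  obtain ⟨a, ha, ha1, hapos, hazero⟩ := hK.exists_cutoff
  obtain ⟨_, C, -, hC, hbounds⟩ := exists_ciLength_bounds hα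
  have hx₂ : 0 < x₂ := by linarith
  have hx₃ : 0 < x₃ := by linarith
  have hx21 : 0 < x₂ - x₁ := by linarith
  have hK0 := hK.apply_zero_pos
  set B := (BY + |c| * BT) / 2 with hB
  have hB0 : 0 < B := by positivity
  -- The largest bandwidth guaranteed to put no mass beyond the second group; it still puts mass on
  -- `x₂`.
  set g := x₃ / a with hg
  have hg0 : 0 < g := by positivity
  set κ₀ := K (x₂ / g) with hκ₀
  have hκ0 : 0 < κ₀ := hapos _ (by
    rw [abs_of_pos (by positivity), div_lt_iff₀ hg0, hg]
    calc x₂ < x₃ := h₃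
      _ = a * (x₃ / a) := by field_simp)
  -- The second entry ensures that every bandwidth above `2 * g` puts mass at least `τ'` on `x₃`.
  -- The search for a minimizer is thereby confined to the compact interval `[g, 2 * g]`.
  set τ' := min τ (K (x₃ / (2 * g))) with hτ'
  have hτ0 : 0 < τ' := lt_min hτ (hapos _ (by
    rw [abs_of_pos (by positivity), hg, div_lt_iff₀ (by positivity)]
    have : a * (2 * (x₃ / a)) = 2 * x₃ := by field_simp
    rw [this]; linarith))
  -- The bias added by mass `τ'` at the third group, from `add_le_llBias` with cardinality ratio `1
  -- / p`. `N` is then chosen so that `C` times the standard deviation is below `b / 2` at all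
  -- bandwidths from `g` on.
  set b := B * (x₁ * (x₃ - x₂) / (1 + 2 * (1 / p) * K 0 / τ')) with hb
  have hx32 : 0 < x₃ - x₂ := by linarith
  have hb0 : 0 < b := by positivity
  set V := |hi| * (2 * (K 0 * (x₁ ^ 2 + x₂ ^ 2) / (κ₀ * (x₂ - x₁) ^ 2 * p))) with hV
  have hV0 : 0 ≤ V := by positivity
  obtain ⟨N, hN⟩ := exists_nat_gt (V * (2 * C / b) ^ 2)
  refine ⟨N, fun n X hNn H κm hvar => ?_⟩
  have hn : (0 : ℝ) < n := by exact_mod_cast H.n_pos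
  have hNn' : (N : ℝ) ≤ n := by exact_mod_cast hNn
  have hpos : ∀ h ∈ admissible K X, 0 < stdDev K κm c X h := by
    intro h hh
    obtain ⟨hh0, hDp, hDn⟩ := mem_admissible_iff.1 hh
    refine lt_of_le_of_ne stdDev_nonneg fun h0 => ?_
    have h5 := (stdDev_sq_bounds (K := K) (h := h) hvar).1
    rw [← h0, sum_weight_sq] at h5
    have hMB : MassBound (mass K indPos X h) (dist₀ X) (K 0) n h (shell indPos X 0 h) :=
      massBound hK isSide_indPos hh0 le_rfl card_shell_le
    have h6 := hMB.one_le_card_mul_sum_sq hDp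
    have h7 : 0 < ∑ i, wPos K X h i ^ 2 := by
      by_contra! hc
      have : (n : ℝ) * ∑ i, wPos K X h i ^ 2 ≤ 0 := mul_nonpos_of_nonneg_of_nonpos hn.le hc
      rw [wPos] at this
      linarith
    have h8 : 0 ≤ ∑ i, wNeg K X h i ^ 2 := Finset.sum_nonneg fun i _ => sq_nonneg _
    have : 0 < lo * (∑ i, wPos K X h i ^ 2 + ∑ i, wNeg K X h i ^ 2) := by positivity
    norm_num at h5
    linarith
  have hDpos : ∀ h ∈ admissible K X, ∀ side, (side = indPos ∨ side = indNeg) →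
      0 < llDet (mass K side X h) (dist₀ X) := by
    intro h hh side hside
    obtain ⟨e, hs⟩ := isSide_of hside
    obtain ⟨-, hDp, hDn⟩ := mem_admissible_iff.1 hh
    refine lt_of_le_of_ne (llDet_nonneg (mass_nonneg hK hs)) (Ne.symm ?_)
    rcases hside with rfl | rfl
    · exact hDp
    · exact hDn
  -- masses at bandwidths of at least `g`
  have hlow : ∀ h, g ≤ h → ∀ side z, 0 < z → z ≤ x₂ →
      ∀ i ∈ grp side X z, κ₀ ≤ mass K side X h i := by
    intro h hh side z hz hz2 i hi
    obtain ⟨s1, s2⟩ := mem_grp.1 hi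
    rw [mass_eq_of_side s1]
    refine hK.le_apply_of_abs_le ?_
    rw [abs_div, abs_of_pos (hg0.trans_le hh), s2, abs_of_pos (by positivity)]
    gcongr
  have hadm : ∀ h, g ≤ h → h ∈ admissible K X := by
    intro h hh
    have main : ∀ side, (side = indPos ∨ side = indNeg) →
        llDet (mass K side X h) (dist₀ X) ≠ 0 := by
      intro side hside
      obtain ⟨e, hs⟩ := isSide_of hside
      have T := H.twoGroups (h := h) hK hs
      obtain ⟨c1, c2⟩ := H.card_grp hside
      have h5 := llDet_ge (y := dist₀ X) (mass_nonneg (X := X) (h := h) hK hs) hκ0.le hx21.le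
        (grp side X x₁) (grp side X x₂)
        (hlow h hh side x₁ h₁ h₂.le) (hlow h hh side x₂ hx₂ le_rfl)
        (fun i hi j hj => by rw [T.y₁ i hi, T.y₂ j hj])
      have h6 := H.pn_pos.trans_le c1
      have h7 := H.pn_pos.trans_le c2
      have h8 : 0 < κ₀ ^ 2 * (x₂ - x₁) ^ 2 * (grp side X x₁).card * (grp side X x₂).card := by
        positivity
      intro h0
      rw [h0] at h5
      linarith
    exact mem_admissible_iff.2 ⟨hg0.trans_le hh, main _ (Or.inl rfl), main _ (Or.inr rfl)⟩
  have hVs : ∀ h, g ≤ h → C * stdDev K κm c X h < b / 2 := by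
    intro h hh
    have hadmh := hadm h hh
    have main : ∀ side, (side = indPos ∨ side = indNeg) →
        ∑ i, llW (mass K side X h) (dist₀ X) i ^ 2 ≤
          K 0 * (x₁ ^ 2 + x₂ ^ 2) / (κ₀ * (x₂ - x₁) ^ 2 * p) / n := by
      intro side hside
      obtain ⟨e, hs⟩ := isSide_of hside
      have T := H.twoGroups (h := h) hK hs
      obtain ⟨c1, c2⟩ := H.card_grp hside
      have h5 := T.mul_sum_sq_le (hDpos h hadmh side hside) (mass_le hK hs) hκ0 H.pn_pos
        (hlow h hh side x₁ h₁ h₂.le) (hlow h hh side x₂ hx₂ le_rfl) c1 c2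
      rw [div_div, le_div_iff₀ (by positivity)]
      refine le_trans (le_of_eq ?_) h5
      ring
    have h9 : stdDev K κm c X h ^ 2 ≤ V / n := by
      refine (stdDev_sq_bounds (K := K) (h := h) hvar).2.trans ?_
      rw [sum_weight_sq]
      have m1 := main _ (Or.inl rfl)
      have m2 := main _ (Or.inr rfl)
      rw [wPos, wNeg]
      calc hi * _ ≤ |hi| * (K 0 * (x₁ ^ 2 + x₂ ^ 2) / (κ₀ * (x₂ - x₁) ^ 2 * p) / n +
            K 0 * (x₁ ^ 2 + x₂ ^ 2) / (κ₀ * (x₂ - x₁) ^ 2 * p) / n) := by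
            refine mul_le_mul (le_abs_self hi) (add_le_add m1 m2) ?_ (abs_nonneg _)
            exact add_nonneg (Finset.sum_nonneg fun i _ => sq_nonneg _)
              (Finset.sum_nonneg fun i _ => sq_nonneg _)
        _ = V / n := by rw [hV]; ring
    have h10 : (C * stdDev K κm c X h) ^ 2 < (b / 2) ^ 2 := by
      have h11 : V * (2 * C / b) ^ 2 < n := by linarith
      rw [mul_pow]
      calc C ^ 2 * stdDev K κm c X h ^ 2 ≤ C ^ 2 * (V / n) := by gcongr
        _ = V * (2 * C / b) ^ 2 / n * (b / 2) ^ 2 := by field_simp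
        _ < 1 * (b / 2) ^ 2 := by
            have : V * (2 * C / b) ^ 2 / n < 1 := by rwa [div_lt_one hn]
            gcongr
        _ = _ := one_mul _
    exact lt_of_pow_lt_pow_left₀ 2 (by positivity) h10
  -- bandwidths that put no mass beyond the second group
  have hbias : ∀ h ∈ admissible K X, B * (2 * (x₁ * x₂)) ≤ biasBound BY BT K c X h := by
    intro h hh
    rw [biasBound_eq]
    have b1 := (H.twoGroups (h := h) hK isSide_indPos).mul_le_llBias (hDpos h hh _ (Or.inl rfl))
    have b2 := (H.twoGroups (h := h) hK isSide_indNeg).mul_le_llBias (hDpos h hh _ (Or.inr rfl))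
    gcongr
    linarith
  have hexact : ∀ h ∈ admissible K X, (∀ i, x₃ ≤ |X i| → K (X i / h) = 0) →
      (∀ i, weight K X h i = lineW X x₁ x₂ i) ∧
      biasBound BY BT K c X h = B * (2 * (x₁ * x₂)) := by
    intro h hh hfar
    obtain ⟨hh0, hDp, hDn⟩ := mem_admissible_iff.1 hh
    have q1 := H.llW_eq hK (Or.inl rfl) (h := h) (fun i hi => by
      rw [mass, hfar i hi, zero_mul]) hDp
    have q2 := H.llW_eq hK (Or.inr rfl) (h := h) (fun i hi => by
      rw [mass, hfar i hi, zero_mul]) hDn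
    refine ⟨fun i => ?_, ?_⟩
    · rw [weight_eq, wPos, wNeg, q1.1, q2.1, lineW]
    · rw [biasBound_eq, q1.2, q2.2, two_mul]
  -- All these bandwidths have the same weights and hence the same length, so minimizers need not be
  -- unique and only their weights can be pinned down.
  have hconst : ∀ h ∈ admissible K X, (∀ i, x₃ ≤ |X i| → K (X i / h) = 0) →
      ∀ h' ∈ admissible K X, (∀ i, x₃ ≤ |X i| → K (X i / h') = 0) →
      ciLength BY BT α K κm c X h = ciLength BY BT α K κm c X h' := by
    intro h hh hf h' hh' hf'
    have q := hexact h hh hf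
    have q' := hexact h' hh' hf'
    have hs : stdDev K κm c X h = stdDev K κm c X h' := by
      unfold stdDev
      congr 1
      exact Finset.sum_congr rfl fun i _ => by rw [q.1, q'.1]
    unfold ciLength
    rw [q.2, q'.2, hs]
  have hsmall : ∀ h, 0 < h → h ≤ g → ∀ i, x₃ ≤ |X i| → K (X i / h) = 0 := by
    intro h hh hle i hi
    refine hazero _ ?_
    rw [abs_div, abs_of_pos hh, le_div_iff₀ hh]
    calc a * h ≤ a * g := by gcongr
      _ = x₃ := by rw [hg]; field_simp
      _ ≤ _ := hi
  have hgadm := hadm g le_rfl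
  have hlen_g : ciLength BY BT α K κm c X g ≤ B * (2 * (x₁ * x₂)) + b / 2 := by
    have q := hexact g hgadm (hsmall g hg0 le_rfl)
    have := (hbounds (biasBound BY BT K c X g) (stdDev K κm c X g)
      ((by positivity : (0 : ℝ) ≤ B * (2 * (x₁ * x₂))).trans (hbias g hgadm))
      (hpos g hgadm)).2.2.2
    rw [q.2] at this
    unfold ciLength
    rw [q.2]
    linarith [hVs g le_rfl]
  -- Without a third group all admissible bandwidths have the same length, and `g` is a minimizer.
  rcases H.third with hno | hthird
  · have hvac : ∀ i, ¬ x₃ ≤ |X i| := by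
      intro i hi
      rcases hno i with h | h <;> linarith
    refine ⟨⟨g, hgadm, fun h' hh' => ?_⟩, fun h _ i hi => absurd hi (hvac i)⟩
    exact (hconst g hgadm (fun i hi => absurd hi (hvac i)) h' hh'
      (fun i hi => absurd hi (hvac i))).le
  -- At `g` the length exceeds the minimal bias by at most `b / 2`. At `h` the bias exceeds the
  -- minimum by `b`, of which noncentrality can recover less than `b / 2`.
  have hlarge : ∀ h, h ∈ admissible K X → τ' ≤ K (x₃ / h) →
      ciLength BY BT α K κm c X g < ciLength BY BT α K κm c X h := by
    intro h hh hτh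
    have hh0 : 0 < h := hh.1
    have hgh : g ≤ h := by
      by_contra! hc
      have : K (x₃ / h) = 0 := hazero _ (by
        rw [abs_of_pos (by positivity), le_div_iff₀ hh0]
        calc a * h ≤ a * g := by gcongr
          _ = x₃ := by rw [hg]; field_simp)
      linarith
    have hthird' : ∀ side, (side = indPos ∨ side = indNeg) → p * n ≤ (grp side X x₃).card →
        x₁ * x₂ + x₁ * (x₃ - x₂) / (1 + 2 * (1 / p) * K 0 / τ') ≤
          llBias (mass K side X h) (dist₀ X) := by
      intro side hside hcard
      obtain ⟨e, hs⟩ := isSide_of hside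
      refine (H.twoGroups (h := h) hK hs).add_le_llBias (hDpos h hh side hside) (mass_le hK hs)
        hτ0 (by positivity) (grp side X x₃) (fun i hi => ?_) ?_ ?_
      · obtain ⟨s1, s2⟩ := mem_grp.1 hi
        refine ⟨s2, ?_⟩
        rwa [mass_eq_of_side s1, ← hK.apply_abs, abs_div, s2, abs_of_pos hh0]
      · have := H.pn_pos.trans_le hcard
        exact_mod_cast this
      · have h5 : ((grp side X x₂).card : ℝ) ≤ n := by
          have := Finset.card_le_univ (grp side X x₂)
          rw [Fintype.card_fin] at this
          exact_mod_cast this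
        refine h5.trans ?_
        rw [one_div, inv_mul_eq_div, le_div_iff₀ hp]
        linarith
    have hbig : B * (2 * (x₁ * x₂)) + b ≤ biasBound BY BT K c X h := by
      rw [biasBound_eq, hb, ← mul_add]
      have b1 := (H.twoGroups (h := h) hK isSide_indPos).mul_le_llBias
        (hDpos h hh _ (Or.inl rfl))
      have b2 := (H.twoGroups (h := h) hK isSide_indNeg).mul_le_llBias
        (hDpos h hh _ (Or.inr rfl))
      refine mul_le_mul_of_nonneg_left ?_ hB0.le
      rcases hthird with h5 | h5
      · have := hthird' _ (Or.inl rfl) h5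
        linarith
      · have := hthird' _ (Or.inr rfl) h5
        linarith
    have h6 := (hbounds (biasBound BY BT K c X h) (stdDev K κm c X h)
      ((by positivity : (0 : ℝ) ≤ B * (2 * (x₁ * x₂))).trans (hbias h hh))
      (hpos h hh)).2.2.1
    have h7 := hVs h hgh
    refine hlen_g.trans_lt ?_
    unfold ciLength
    linarith
  have hfarτ : ∀ h, 2 * g < h → τ' ≤ K (x₃ / h) := by
    intro h hh
    refine (min_le_right _ _).trans (hK.le_apply_of_abs_le ?_)
    have : 0 < h := by linarith
    rw [abs_of_pos (by positivity), abs_of_pos (by positivity)]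
    gcongr
  refine ⟨?_, fun h hh i hi => ?_⟩
  · refine optimalBandwidths_nonempty hK hα BY BT κm c (h₁ := g) (h₂ := 2 * g) (h₀ := g)
      ⟨le_rfl, by linarith⟩ (fun h hh => hadm h hh.1) (fun h hh => (hpos h (hadm h hh.1)).ne')
      fun h hh hout => ?_
    rcases lt_or_ge h g with hlt | hge
    · exact (hconst g hgadm (hsmall g hg0 le_rfl) h hh (hsmall h hh.1 hlt.le)).le
    · have : 2 * g < h := by
        by_contra! hc
        exact hout ⟨hge, hc⟩
      exact (hlarge h hh (hfarτ h this)).le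
  · have h5 : K (x₃ / h) < τ' := by
      by_contra! hc
      exact absurd (hh.2 g hgadm) (not_le.2 (hlarge h hh.1 hc))
    have hh0 : 0 < h := hh.1.1
    refine le_trans (hK.le_apply_of_abs_le ?_) (h5.le.trans (min_le_left _ _))
    rw [abs_div, abs_div, abs_of_pos hx₃]
    gcongr

end Discrete

/-! ### The variance estimator at ties -/

section Ties

variable {n : ℕ}

lemma mem_candidates {X : Fin n → ℝ} {i s : Fin n} :
    s ∈ candidates X i ↔ s ≠ i ∧ 0 < X s * X i := by simp [candidates]

lemma mem_withinRank {X : Fin n → ℝ} {i s : Fin n} {Q : ℕ} :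
    s ∈ withinRank X i Q ↔ s ∈ candidates X i ∧ distRank X s i ≤ Q := by simp [withinRank]

lemma one_le_distRank {X : Fin n → ℝ} {i j : Fin n} (hj : j ∈ candidates X i) :
    1 ≤ distRank X j i := by
  rw [distRank, Nat.one_le_iff_ne_zero, Finset.card_ne_zero]
  exact ⟨|X j - X i|, Finset.mem_filter.2 ⟨Finset.mem_image_of_mem _ hj, le_rfl⟩⟩

/-- The neighbors of an observation with sufficiently many ties are the tied observations. -/
lemma neighbors_of_ties {R : ℕ} (hR : 1 ≤ R) {X : Fin n → ℝ} {i : Fin n} (hi : X i ≠ 0)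
    {G : Finset (Fin n)} (hG : ∀ j, j ∈ G ↔ X j = X i) (hcard : R + 1 ≤ G.card) :
    neighbors R X i = G.erase i := by
  have hiG : i ∈ G := (hG i).2 rfl
  have hcard' : R ≤ (G.erase i).card := by
    rw [Finset.card_erase_of_mem hiG]; omega
  have hcand : ∀ j ∈ G.erase i, j ∈ candidates X i := fun j hj => by
    obtain ⟨h1, h2⟩ := Finset.mem_erase.1 hj
    refine mem_candidates.2 ⟨h1, ?_⟩
    rw [(hG j).1 h2]
    exact mul_self_pos.2 hi
  obtain ⟨k, hk⟩ := Finset.card_pos.1 (lt_of_lt_of_le hR hcard')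
  have hkX : X k = X i := (hG k).1 (Finset.mem_of_mem_erase hk)
  have h1 : withinRank X i 1 = G.erase i := by
    ext j
    rw [mem_withinRank]
    constructor
    · rintro ⟨hj, hr⟩
      refine Finset.mem_erase.2 ⟨(mem_candidates.1 hj).1, (hG j).2 ?_⟩
      by_contra hne
      have hd : 0 < |X j - X i| := abs_pos.2 (sub_ne_zero.2 hne)
      have : 1 < distRank X j i := by
        rw [distRank, Finset.one_lt_card]
        refine ⟨0, ?_, |X j - X i|, ?_, hd.ne⟩
        · refine Finset.mem_filter.2 ⟨Finset.mem_image.2 ⟨k, hcand k hk, ?_⟩, hd.le⟩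
          rw [hkX, sub_self, abs_zero]
        · exact Finset.mem_filter.2 ⟨Finset.mem_image_of_mem _ hj, le_rfl⟩
      omega
    · intro hj
      refine ⟨hcand j hj, ?_⟩
      rw [distRank, Finset.card_le_one]
      have hz : X j = X i := (hG j).1 (Finset.mem_of_mem_erase hj)
      rw [hz, sub_self, abs_zero]
      intro a ha b hb
      obtain ⟨ha1, ha2⟩ := Finset.mem_filter.1 ha
      obtain ⟨hb1, hb2⟩ := Finset.mem_filter.1 hb
      obtain ⟨s, -, rfl⟩ := Finset.mem_image.1 ha1
      obtain ⟨t, -, rfl⟩ := Finset.mem_image.1 hb1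
      exact (le_antisymm ha2 (abs_nonneg _)).trans (le_antisymm hb2 (abs_nonneg _)).symm
  have h0 : withinRank X i 0 = ∅ := by
    rw [Finset.eq_empty_iff_forall_notMem]
    intro j hj
    obtain ⟨a, b⟩ := mem_withinRank.1 hj
    have := one_le_distRank a
    omega
  have hQ : sInf {Q : ℕ | R ≤ (withinRank X i Q).card} = 1 := by
    refine le_antisymm (Nat.sInf_le ?_) ?_
    · change R ≤ (withinRank X i 1).card
      rwa [h1]
    · rw [Nat.one_le_iff_ne_zero]
      intro hz
      -- An infimum of zero means that `0` is attained or, by convention, that the set is empty.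
      -- Ranks start at one, and rank one already suffices, so neither happens.
      rcases Nat.sInf_eq_zero.1 hz with h | h
      · change R ≤ (withinRank X i 0).card at h
        rw [h0, Finset.card_empty] at h
        omega
      · have : 1 ∈ {Q : ℕ | R ≤ (withinRank X i Q).card} := by
          change R ≤ (withinRank X i 1).card
          rwa [h1]
        rw [h] at this
        exact this
  rw [neighbors, hQ, h1]

/-- With m tied units the prediction is the leave-one-out mean, the error is m/(m-1) times the
deviation from the full mean, and the leverage is 1/(m-1). Averaged over the group, this is the
unbiased sample variance. -/
lemma nnVariance_of_ties {R : ℕ} (hR : 1 ≤ R) {X : Fin n → ℝ} (M : Fin n → ℝ) {i : Fin n}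
    (hi : X i ≠ 0) {G : Finset (Fin n)} (hG : ∀ j, j ∈ G ↔ X j = X i)
    (hcard : R + 1 ≤ G.card) :
    nnVariance R X M i =
      (G.card : ℝ) / (G.card - 1) * (M i - (∑ j ∈ G, M j) / G.card) ^ 2 := by
  have hiG : i ∈ G := (hG i).2 rfl
  rw [nnVariance, neighbors_of_ties hR hi hG hcard]
  have hone : ¬ 2 ≤ ((G.erase i).image X).card := by
    have : (G.erase i).image X ⊆ {X i} := fun x hx => by
      obtain ⟨j, hj, rfl⟩ := Finset.mem_image.1 hx
      exact Finset.mem_singleton.2 ((hG j).1 (Finset.mem_of_mem_erase hj))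
    have := Finset.card_le_card this
    rw [Finset.card_singleton] at this
    omega
  rw [if_neg hone]
  set m : ℝ := (G.card : ℝ) with hm
  have hc1 : ((G.erase i).card : ℝ) = m - 1 := by
    rw [Finset.card_erase_of_mem hiG, Nat.cast_sub (by omega), Nat.cast_one]
  have hm2 : 2 ≤ m := by
    have : 2 ≤ G.card := by omega
    rw [hm]; exact_mod_cast this
  have hreg : (regMatrix (fun _ => (![1] : Fin 1 → ℝ)) (G.erase i) : Matrix (Fin 1) (Fin 1) ℝ) =
      !![m - 1] := by
    ext a b
    rw [regMatrix, Matrix.sum_apply]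
    fin_cases a; fin_cases b
    simp [Matrix.vecMulVec, ← hc1]
  have hinv : (!![m - 1] : Matrix (Fin 1) (Fin 1) ℝ)⁻¹ = !![(m - 1)⁻¹] := by
    rw [Matrix.inv_def, Matrix.adjugate_fin_one, Matrix.det_fin_one, Ring.inverse_eq_inv']
    ext a b
    fin_cases a; fin_cases b
    simp
  have hlev : leverage (fun _ => (![1] : Fin 1 → ℝ)) (G.erase i) i = (m - 1)⁻¹ := by
    rw [leverage, hreg, hinv]
    simp [Matrix.mulVec, dotProduct]
  have hpred : linPred (fun _ => (![1] : Fin 1 → ℝ)) (G.erase i) M i =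
      (m - 1)⁻¹ * (∑ j ∈ G, M j - M i) := by
    rw [linPred, hreg, hinv, ← Finset.sum_erase_eq_sub hiG]
    simp [Matrix.mulVec, dotProduct]
  rw [scaledSqError, hlev, hpred]
  have : m - 1 ≠ 0 := by linarith
  have : m ≠ 0 := by linarith
  have h3 : 1 + (m - 1)⁻¹ = m / (m - 1) := by field_simp; ring
  rw [h3]
  field_simp
  ring

/-- Sums of the variance estimator over a group of ties. -/
lemma sum_nnVariance_of_ties {R : ℕ} (hR : 1 ≤ R) {X : Fin n → ℝ} (M : Fin n → ℝ) {z : ℝ}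
    (hz : z ≠ 0) {G : Finset (Fin n)} (hG : ∀ j, j ∈ G ↔ X j = z)
    (hcard : R + 1 ≤ G.card) (μ : ℝ) :
    ∑ i ∈ G, nnVariance R X M i = (G.card : ℝ) / (G.card - 1) *
      (∑ i ∈ G, (M i - μ) ^ 2 - (∑ i ∈ G, (M i - μ)) ^ 2 / G.card) := by
  have h1 : ∀ i ∈ G, nnVariance R X M i = (G.card : ℝ) / (G.card - 1) *
      ((M i - μ) ^ 2 - 2 * ((∑ j ∈ G, (M j - μ)) / G.card) * (M i - μ) +
        ((∑ j ∈ G, (M j - μ)) / G.card) ^ 2) := by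
    intro i hi
    have hXi := (hG i).1 hi
    rw [nnVariance_of_ties hR M (by rwa [hXi]) (by rwa [hXi]) hcard]
    have hc : (G.card : ℝ) ≠ 0 := by
      have : G.card ≠ 0 := by omega
      exact_mod_cast this
    rw [Finset.sum_sub_distrib, Finset.sum_const, nsmul_eq_mul]
    congr 1
    field_simp
    ring
  rw [Finset.sum_congr rfl h1, ← Finset.mul_sum, Finset.sum_add_distrib, Finset.sum_sub_distrib,
    ← Finset.mul_sum, Finset.sum_const, nsmul_eq_mul]
  have hc : (G.card : ℝ) ≠ 0 := by
    have : G.card ≠ 0 := by omega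
    exact_mod_cast this
  congr 1
  field_simp
  ring

lemma leverage_nonneg {ι : Type} [Fintype ι] [DecidableEq ι] {Z : Fin n → ι → ℝ}
    {N : Finset (Fin n)} {i : Fin n} : 0 ≤ leverage Z N i := by
  have hps : (regMatrix Z N).PosSemidef := by
    unfold regMatrix
    refine Matrix.posSemidef_sum _ fun j _ => ?_
    have := Matrix.posSemidef_vecMulVec_self_star (Z j)
    simpa using this
  have := hps.inv.dotProduct_mulVec_nonneg (Z i)
  simpa [leverage] using this

lemma nnVariance_nonneg {R : ℕ} {X M : Fin n → ℝ} {i : Fin n} : 0 ≤ nnVariance R X M i := by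
  rw [nnVariance]
  split_ifs <;>
  · rw [scaledSqError]
    exact mul_nonneg (one_div_nonneg.2 (add_nonneg zero_le_one leverage_nonneg)) (sq_nonneg _)

end Ties

/-! ### Atoms of the running variable -/

/-- Removing the finitely many other support points from `U` leaves a neighborhood of `z`. It has
positive measure, and up to a null set it is `{z}`. -/
lemma measure_singleton_ne_zero {PX : Measure ℝ} {z : ℝ} {U : Set ℝ} (hz : z ∈ PX.support)
    (hU : IsOpen U) (hzU : z ∈ U) (hfin : (PX.support ∩ U).Finite) : PX {z} ≠ 0 := by
  have hV : U \ ((PX.support ∩ U) \ {z}) ∈ 𝓝 z :=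
    (hU.sdiff (hfin.sdiff).isClosed).mem_nhds ⟨hzU, fun h => h.2 rfl⟩
  have h1 : 0 < PX (U \ ((PX.support ∩ U) \ {z})) :=
    (Measure.mem_support_iff_forall z).1 hz _ hV
  intro h0
  refine h1.ne' (measure_mono_null (t := {z} ∪ PX.supportᶜ) ?_
    (measure_union_null h0 Measure.measure_compl_support))
  rintro x ⟨hx1, hx2⟩
  by_cases hx : x ∈ PX.support
  · left
    by_contra hne
    exact hx2 ⟨⟨hx, hx1⟩, hne⟩
  · exact Or.inr hx

/-- The support points closest to the cutoff. -/
lemma DiscreteRunning.exists_points {PX : Measure ℝ} (h : DiscreteRunning PX) :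
    ∃ x₁ x₂ x₃ x₄ : ℝ, 0 < x₁ ∧ x₁ < x₂ ∧ x₂ < x₃ ∧ x₃ < x₄ ∧
      (∀ᵐ x ∂PX, |x| = x₁ ∨ |x| = x₂ ∨ |x| = x₃ ∨ x₄ ≤ |x|) ∧
      PX {x₁} ≠ 0 ∧ PX {x₂} ≠ 0 ∧ PX {-x₁} ≠ 0 ∧ PX {-x₂} ≠ 0 ∧
      ((∀ᵐ x ∂PX, |x| = x₁ ∨ |x| = x₂) ∨ PX {x₃} ≠ 0 ∨ PX {-x₃} ≠ 0) := by
  classical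
  obtain ⟨δ, s, hδ, hspos, hsupp, hcard, hfin⟩ := h
  have hsδ : ∀ x ∈ s, x < δ := fun x hx => by
    have : x ∈ {x | |x| ∈ s} := by
      change |x| ∈ s
      rwa [abs_of_pos (hspos x hx)]
    rw [← hsupp] at this
    exact this.2.2
  have hsmem : ∀ x, |x| ∈ s → x ∈ PX.support ∩ Ioo (-δ) δ := fun x hx => by
    rw [hsupp]; exact hx
  have hsfin : (PX.support ∩ Ioo (-δ) δ).Finite := by
    rw [hsupp]
    refine ((s : Set ℝ).toFinite.union ((s : Set ℝ).toFinite.image fun x => -x)).subset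
      fun x hx => ?_
    have hx' : |x| ∈ s := hx
    rcases abs_cases x with ⟨e, -⟩ | ⟨e, -⟩ <;> rw [e] at hx'
    · exact Or.inl hx'
    · exact Or.inr ⟨-x, hx', neg_neg x⟩
  have hatom : ∀ x, |x| ∈ s → PX {x} ≠ 0 := fun x hx =>
    measure_singleton_ne_zero (hsmem x hx).1 isOpen_Ioo (hsmem x hx).2 hsfin
  -- the distances of all relevant support points
  obtain ⟨t, D, hst, htD, htsupp, htatom, htlarge⟩ : ∃ (t : Finset ℝ) (D : ℝ), s ⊆ t ∧
      (∀ x ∈ t, x < D) ∧ (∀ x ∈ PX.support, |x| ∈ t ∨ D ≤ |x|) ∧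
      (∀ x ∈ t, PX {x} ≠ 0 ∨ PX {-x} ≠ 0) ∧ (∀ x ∈ t, x ∉ s → δ ≤ x) ∧
      (s.card = 2 → ∀ x ∈ PX.support, |x| ∈ t) := by
    rcases hfin with hfin | h3
    · refine ⟨hfin.toFinset.image fun x => |x|,
        (hfin.toFinset.image fun x => |x|).sup' ?_ id + 1, ?_, ?_, ?_, ?_, ?_, ?_⟩
      · obtain ⟨x, hx⟩ := Finset.card_pos.1 (show 0 < s.card by omega)
        refine ⟨|x|, Finset.mem_image_of_mem _ (hfin.mem_toFinset.2 (hsmem x ?_).1)⟩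
        rwa [abs_of_pos (hspos x hx)]
      · intro x hx
        refine Finset.mem_image.2 ⟨x, hfin.mem_toFinset.2 (hsmem x ?_).1,
          abs_of_pos (hspos x hx)⟩
        rwa [abs_of_pos (hspos x hx)]
      · intro x hx
        exact lt_of_le_of_lt (Finset.le_sup' (f := id) hx) (lt_add_one _)
      · exact fun x hx => Or.inl (Finset.mem_image_of_mem _ (hfin.mem_toFinset.2 hx))
      · intro x hx
        obtain ⟨y, hy, rfl⟩ := Finset.mem_image.1 hx
        have hy' := hfin.mem_toFinset.1 hy
        have := measure_singleton_ne_zero hy' isOpen_univ (mem_univ y)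
          (by rwa [inter_univ])
        rcases abs_cases y with ⟨e, -⟩ | ⟨e, -⟩ <;> rw [e]
        · exact Or.inl this
        · rw [neg_neg]; exact Or.inr this
      · intro x hx hxs
        obtain ⟨y, hy, rfl⟩ := Finset.mem_image.1 hx
        by_contra! hc
        have : y ∈ PX.support ∩ Ioo (-δ) δ := ⟨hfin.mem_toFinset.1 hy, abs_lt.1 hc⟩
        rw [hsupp] at this
        exact hxs this
      · exact fun _ x hx => Finset.mem_image_of_mem _ (hfin.mem_toFinset.2 hx)
    -- Here `s` has at least three points, so the three smallest distances are in the discrete part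
    -- and all other support points are at distance at least `δ`.
    · refine ⟨s, δ, Finset.Subset.refl s, hsδ, fun x hx => ?_, fun x hx => Or.inl (hatom x ?_),
        fun x hx hxs => absurd hx hxs, fun h => by omega⟩
      · by_cases hxδ : |x| < δ
        · have : x ∈ PX.support ∩ Ioo (-δ) δ := ⟨hx, abs_lt.1 hxδ⟩
          rw [hsupp] at this
          exact Or.inl this
        · exact Or.inr (not_lt.1 hxδ)
      · rwa [abs_of_pos (hspos x hx)]
  obtain ⟨htl, ht2⟩ := htlarge
  have hs1 : s.Nonempty := Finset.card_pos.1 (by omega)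
  set x₁ := s.min' hs1 with hx₁
  have hx₁s : x₁ ∈ s := s.min'_mem hs1
  have hs2 : (s.erase x₁).Nonempty := Finset.card_pos.1 (by
    rw [Finset.card_erase_of_mem hx₁s]; omega)
  set x₂ := (s.erase x₁).min' hs2 with hx₂
  have hx₂s' : x₂ ∈ s.erase x₁ := Finset.min'_mem _ hs2
  have hx₂s : x₂ ∈ s := Finset.mem_of_mem_erase hx₂s'
  have h12 : x₁ < x₂ := lt_of_le_of_ne (s.min'_le _ hx₂s) (Finset.ne_of_mem_erase hx₂s').symm
  have h1pos := hspos x₁ hx₁s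
  have h2pos := hspos x₂ hx₂s
  have abs1 : |x₁| = x₁ := abs_of_pos h1pos
  have abs2 : |x₂| = x₂ := abs_of_pos h2pos
  have A1 := hatom x₁ (by rwa [abs1])
  have A2 := hatom x₂ (by rwa [abs2])
  have A3 := hatom (-x₁) (by rwa [abs_neg, abs1])
  have A4 := hatom (-x₂) (by rwa [abs_neg, abs2])
  set u := (t.erase x₁).erase x₂ with hu
  have hgt : ∀ x ∈ u, x₂ < x := by
    intro x hx
    obtain ⟨hne2, hx'⟩ := Finset.mem_erase.1 hx
    obtain ⟨hne1, hxt⟩ := Finset.mem_erase.1 hx'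
    by_cases hxs : x ∈ s
    · exact lt_of_le_of_ne (Finset.min'_le _ _ (Finset.mem_erase.2 ⟨hne1, hxs⟩)) hne2.symm
    · exact (hsδ x₂ hx₂s).trans_le (htl x hxt hxs)
  have hsplit : ∀ x ∈ t, x = x₁ ∨ x = x₂ ∨ x ∈ u := by
    intro x hx
    by_cases e1 : x = x₁
    · exact Or.inl e1
    by_cases e2 : x = x₂
    · exact Or.inr (Or.inl e2)
    · exact Or.inr (Or.inr (Finset.mem_erase.2 ⟨e2, Finset.mem_erase.2 ⟨e1, hx⟩⟩))
  have hae : ∀ᵐ x ∂PX, x ∈ PX.support := Measure.support_mem_ae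
  rcases u.eq_empty_or_nonempty with hemp | hne
  · have hs2' : s.card = 2 := by
      refine le_antisymm ?_ hcard
      have : s ⊆ {x₁, x₂} := fun x hx => by
        rcases hsplit x (hst hx) with h | h | h
        · simp [h]
        · simp [h]
        · rw [hemp] at h; simp at h
      exact (Finset.card_le_card this).trans Finset.card_le_two
    have hall : ∀ᵐ x ∂PX, |x| = x₁ ∨ |x| = x₂ := by
      filter_upwards [hae] with x hx
      rcases hsplit _ (ht2 hs2' x hx) with h | h | h
      · exact Or.inl h
      · exact Or.inr h
      · rw [hemp] at h; simp at h
    -- With only two distances in the support, `x₂ + 1` and `x₂ + 2` are placeholders at which there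
    -- are almost surely no observations.
    refine ⟨x₁, x₂, x₂ + 1, x₂ + 2, h1pos, h12, by linarith, by linarith, ?_, A1, A2, A3, A4,
      Or.inl hall⟩
    filter_upwards [hall] with x hx
    tauto
  · set x₃ := u.min' hne with hx₃
    have hx₃u : x₃ ∈ u := u.min'_mem hne
    have hx₃t : x₃ ∈ t := Finset.mem_of_mem_erase (Finset.mem_of_mem_erase hx₃u)
    -- The candidates for `x₄`: the next distance, or the threshold `D` that all remaining support
    -- points exceed. Inserting `D` keeps the set nonempty.
    set v := insert D (u.erase x₃) with hv
    have hvne : v.Nonempty := Finset.insert_nonempty _ _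
    refine ⟨x₁, x₂, x₃, v.min' hvne, h1pos, h12, hgt x₃ hx₃u, ?_, ?_, A1, A2, A3, A4,
      Or.inr (htatom x₃ hx₃t)⟩
    · rcases Finset.mem_insert.1 (v.min'_mem hvne) with h | h
      · rw [h]; exact htD x₃ hx₃t
      · obtain ⟨a, b⟩ := Finset.mem_erase.1 h
        exact lt_of_le_of_ne (u.min'_le _ b) a.symm
    · filter_upwards [hae] with x hx
      rcases htsupp x hx with h | h
      · rcases hsplit _ h with h | h | h
        · exact Or.inl h
        · exact Or.inr (Or.inl h)
        · by_cases e3 : |x| = x₃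
          · exact Or.inr (Or.inr (Or.inl e3))
          · exact Or.inr (Or.inr (Or.inr (v.min'_le _
              (Finset.mem_insert_of_mem (Finset.mem_erase.2 ⟨e3, h⟩)))))
      · exact Or.inr (Or.inr (Or.inr ((v.min'_le _ (Finset.mem_insert_self _ _)).trans h)))

/-! ### Laws of large numbers at an atom -/

lemma measurable_outcome (c : ℝ) : Measurable (outcome c) := by
  unfold outcome; fun_prop

/-- An infinite extended variance is turned into `0` by `variance`, which the positive lower bound
excludes. The bounds on `condVariance` thus supply square integrability. -/
lemma evariance_outcome_ne_top {κm : Kernel ℝ (ℝ × ℝ)} {c x lo hi : ℝ} (hlo : 0 < lo)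
    (h : condVariance κm c x ∈ Icc lo hi) : evariance (outcome c) (κm x) ≠ ∞ := by
  intro h0
  have h1 := h.1
  rw [condVariance, variance, h0, ENNReal.toReal_top] at h1
  linarith

lemma memLp_outcome {κm : Kernel ℝ (ℝ × ℝ)} [IsMarkovKernel κm] {c x lo hi : ℝ} (hlo : 0 < lo)
    (h : condVariance κm c x ∈ Icc lo hi) : MemLp (outcome c) 2 (κm x) :=
  (evariance_lt_top_iff_memLp (measurable_outcome c).aestronglyMeasurable).1
    (evariance_outcome_ne_top hlo h).lt_top

section Atom

variable {PX : Measure ℝ} [IsProbabilityMeasure PX] {κm : Kernel ℝ (ℝ × ℝ)} [IsMarkovKernel κm]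

lemma lintegral_atom (z : ℝ) {g : ℝ × ℝ → ℝ≥0∞} (hg : Measurable g) :
    ∫⁻ w, ({z} : Set ℝ).indicator (fun _ => g w.2) w.1 ∂(PX ⊗ₘ κm) =
      PX {z} * ∫⁻ yt, g yt ∂(κm z) := by
  have hm : Measurable fun w : Obs => ({z} : Set ℝ).indicator (fun _ => g w.2) w.1 := by
    have : (fun w : Obs => ({z} : Set ℝ).indicator (fun _ => g w.2) w.1) =
        (Prod.fst ⁻¹' {z}).indicator (fun w => g w.2) := by
      funext w
      simp only [Set.indicator, mem_preimage]
    rw [this]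
    exact (hg.comp measurable_snd).indicator (measurable_fst (measurableSet_singleton z))
  rw [Measure.lintegral_compProd hm]
  have : ∀ x, ∫⁻ yt, ({z} : Set ℝ).indicator (fun _ => g yt) x ∂(κm x) =
      ({z} : Set ℝ).indicator (fun _ => ∫⁻ yt, g yt ∂(κm z)) x := by
    intro x
    by_cases hx : x = z
    · simp [hx]
    · simp [hx]
  simp only [this]
  rw [lintegral_indicator_const (measurableSet_singleton z), mul_comm]

/-- The residual of an observation at the atom `z`. -/
noncomputable def atomResidual (κm : Kernel ℝ (ℝ × ℝ)) (c z : ℝ) (w : Obs) : ℝ :=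
  ({z} : Set ℝ).indicator (fun _ => outcome c w.2 - condMean κm c z) w.1

lemma measurable_atomResidual (c z : ℝ) : Measurable (atomResidual κm c z) := by
  have : atomResidual κm c z =
      (Prod.fst ⁻¹' {z}).indicator (fun w => outcome c w.2 - condMean κm c z) := by
    funext w
    simp only [atomResidual, Set.indicator, mem_preimage]
  rw [this]
  exact (((measurable_outcome c).comp measurable_snd).sub_const _).indicator
    (measurable_fst (measurableSet_singleton z))

lemma lintegral_atomResidual_sq (c z : ℝ) :
    ∫⁻ w, ENNReal.ofReal (atomResidual κm c z w ^ 2) ∂(PX ⊗ₘ κm) =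
      PX {z} * evariance (outcome c) (κm z) := by
  rw [evariance_eq_lintegral_ofReal, ← lintegral_atom (κm := κm) z (by
    have := measurable_outcome c
    fun_prop)]
  refine lintegral_congr fun w => ?_
  by_cases hw : w.1 = z
  · simp [atomResidual, hw, condMean]
  · simp [atomResidual, hw]

lemma integral_atomResidual_sq (c z : ℝ) :
    ∫ w, atomResidual κm c z w ^ 2 ∂(PX ⊗ₘ κm) = PX.real {z} * condVariance κm c z := by
  rw [integral_eq_lintegral_of_nonneg_ae (Eventually.of_forall fun w => sq_nonneg _)
    ((measurable_atomResidual c z).pow_const 2).aestronglyMeasurable, lintegral_atomResidual_sq,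
    ENNReal.toReal_mul]
  rfl

lemma memLp_atomResidual {c z lo hi : ℝ} (hlo : 0 < lo) (h : condVariance κm c z ∈ Icc lo hi) :
    MemLp (atomResidual κm c z) 2 (PX ⊗ₘ κm) := by
  rw [memLp_two_iff_integrable_sq (measurable_atomResidual c z).aestronglyMeasurable]
  refine ⟨((measurable_atomResidual c z).pow_const 2).aestronglyMeasurable, ?_⟩
  rw [hasFiniteIntegral_iff_ofReal (Eventually.of_forall fun w => sq_nonneg _)]
  rw [lintegral_atomResidual_sq]
  exact ENNReal.mul_lt_top (measure_lt_top _ _) (evariance_outcome_ne_top hlo h).lt_top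

lemma integral_atomResidual {c z lo hi : ℝ} (hlo : 0 < lo)
    (h : condVariance κm c z ∈ Icc lo hi) :
    ∫ w, atomResidual κm c z w ∂(PX ⊗ₘ κm) = 0 := by
  rw [Measure.integral_compProd ((memLp_atomResidual hlo h).integrable one_le_two)]
  refine integral_eq_zero_of_ae (Eventually.of_forall fun x => ?_)
  by_cases hx : x = z
  · subst hx
    simp only [atomResidual, mem_singleton_iff, Set.indicator_of_mem, Pi.zero_apply]
    rw [integral_sub ((memLp_outcome hlo h).integrable one_le_two) (integrable_const _)]
    simp [condMean]
  · simp [atomResidual, hx]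

/-- The residual lives on the atom, whose probability is at most one. For q > 2 its square has a
moment of order above one, as `exists_uniform_wlln` demands. -/
lemma lintegral_atomResidual_rpow {q : ℝ} (hq : 0 < q) (c z : ℝ) :
    ∫⁻ w, ENNReal.ofReal ((atomResidual κm c z w ^ 2) ^ (q / 2)) ∂(PX ⊗ₘ κm) ≤
      condCentralMoment κm c q z := by
  have h1 : ∀ r : ℝ, (r ^ 2) ^ (q / 2) = |r| ^ q := fun r => by
    rw [← sq_abs, ← Real.rpow_natCast, ← Real.rpow_mul (abs_nonneg r)]
    congr 1
    push_cast; ring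
  have h2 : ∫⁻ w, ENNReal.ofReal ((atomResidual κm c z w ^ 2) ^ (q / 2)) ∂(PX ⊗ₘ κm) =
      PX {z} * condCentralMoment κm c q z := by
    rw [condCentralMoment, ← lintegral_atom (κm := κm) z (by
      have := measurable_outcome c
      fun_prop)]
    refine lintegral_congr fun w => ?_
    rw [h1]
    by_cases hw : w.1 = z
    · simp [atomResidual, hw]
    · simp [atomResidual, hw, Real.zero_rpow hq.ne']
  rw [h2]
  calc _ ≤ 1 * condCentralMoment κm c q z := by gcongr; exact prob_le_one
    _ = _ := one_mul _

end Atom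

/-! ### Consistency for a discrete running variable -/

section DiscreteConsistency

variable {PX : Measure ℝ} [IsProbabilityMeasure PX]
  {κ : (ℝ → ℝ) × (ℝ → ℝ) → Kernel ℝ (ℝ × ℝ)} [∀ m, IsMarkovKernel (κ m)]
  {F : Set ((ℝ → ℝ) × (ℝ → ℝ))}

/-- The observations at the point `z`. -/
noncomputable def atPoint {n : ℕ} (X : Fin n → ℝ) (z : ℝ) : Finset (Fin n) :=
  Finset.univ.filter fun i => X i = z

lemma mem_atPoint {n : ℕ} {X : Fin n → ℝ} {z : ℝ} {i : Fin n} : i ∈ atPoint X z ↔ X i = z := by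
  simp [atPoint]

lemma unifNegligible_count_atPoint (z : ℝ) {τ : ℝ} (hτ : 0 < τ) :
    UnifNegligible PX κ F fun _ n =>
      {S | τ * n ≤ |((atPoint (runVar S) z).card : ℝ) - n * PX.real {z}|} := by
  classical
  refine unifNegligible_of_bound (fun n => PX.real {z} / τ ^ 2 * (n : ℝ)⁻¹) ?_ ?_
  · simpa using tendsto_inv_atTop_nhds_zero_nat.const_mul (PX.real {z} / τ ^ 2)
  · filter_upwards [eventually_gt_atTop 0] with n hn m _
    have hn' : (0 : ℝ) < n := by exact_mod_cast hn
    have h1 := sampleLaw_count (PX := PX) (κ := κ) m n (measurableSet_singleton z)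
      (show 0 < τ * n by positivity)
    have e : n * PX.real {z} / (τ * n) ^ 2 = PX.real {z} / τ ^ 2 * (n : ℝ)⁻¹ := by field_simp
    rw [e] at h1
    refine le_trans (measure_mono fun S hS => ?_) h1
    have : (Finset.univ.filter fun i => runVar S i ∈ ({z} : Set ℝ)) = atPoint (runVar S) z := by
      ext i; simp [atPoint]
    simpa only [mem_ofPred_eq, this] using hS

lemma sum_atomResidual {n : ℕ} (κm : Kernel ℝ (ℝ × ℝ)) (c z : ℝ) (S : Fin n → Obs)
    (f : ℝ → ℝ) (hf : f 0 = 0) :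
    ∑ i, f (atomResidual κm c z (S i)) =
      ∑ i ∈ atPoint (runVar S) z, f (sampleOutcome c S i - condMean κm c z) := by
  rw [atPoint, Finset.sum_filter]
  refine Finset.sum_congr rfl fun i _ => ?_
  by_cases h : (S i).1 = z
  · simp [atomResidual, runVar, sampleOutcome, h]
  · simp [atomResidual, runVar, h, hf]

/-- Deterministic bound for the error of a degrees-of-freedom corrected variance. -/
lemma abs_corrected_variance_sub_le {N' n p t τ hi σ s1 s2 : ℝ} (hn : 0 < n) (hp0 : 0 < p)
    (hτ : 0 < τ) (ht0 : 0 < t) (t2 : t ≤ 1) (t3 : t ≤ τ / 16) (t4 : t ≤ τ / (16 * hi))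
    (t5 : t ≤ τ * p / 32) (hhi : 0 < hi) (hσ0 : 0 ≤ σ) (hσ1 : σ ≤ hi) (b1 : 8 * hi < n * τ)
    (b3' : 8 < n * p) (hlow : 3 / 4 * p * n ≤ N') (c1 : |N' - n * p| ≤ t * n)
    (c2 : |s2 - n * (p * σ)| ≤ t * n) (c3 : |s1| ≤ t * n) :
    |N' / (N' - 1) * (s2 - s1 ^ 2 / N') - N' * σ| ≤ τ * n := by
  have hN2 : p * n / 2 ≤ N' - 1 := by linarith
  have hN1 : 0 < N' - 1 := by nlinarith
  -- Three errors: the deviations of the sum of squares and of the count, the degrees-of-freedom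
  -- factor, and the squared mean. Each takes at most a quarter of `τ * n`.
  have e : N' / (N' - 1) * (s2 - s1 ^ 2 / N') - N' * σ =
      N' / (N' - 1) * ((s2 - n * (p * σ)) - (N' - n * p) * σ) + N' / (N' - 1) * σ
        - s1 ^ 2 / (N' - 1) := by
    have : N' ≠ 0 := by linarith
    field_simp
    ring
  rw [e]
  have hratio : N' / (N' - 1) ≤ 2 := by
    rw [div_le_iff₀ hN1]; nlinarith
  have hratio0 : 0 ≤ N' / (N' - 1) := by
    have : 0 ≤ N' := by linarith
    positivity
  have f1 : |N' / (N' - 1) * ((s2 - n * (p * σ)) - (N' - n * p) * σ)| ≤ τ * n / 4 := by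
    rw [abs_mul, abs_of_nonneg hratio0]
    have g1 : |(s2 - n * (p * σ)) - (N' - n * p) * σ| ≤ τ / 16 * n + τ / 16 * n := by
      refine (abs_sub _ _).trans (add_le_add (c2.trans (by gcongr)) ?_)
      rw [abs_mul, abs_of_nonneg (hσ0)]
      calc |N' - n * p| * σ ≤ (t * n) * hi := by
            gcongr
        _ ≤ (τ / (16 * hi) * n) * hi := by gcongr
        _ = τ / 16 * n := by field_simp
    calc N' / (N' - 1) * _ ≤ 2 * (τ / 16 * n + τ / 16 * n) := by gcongr
      _ = τ * n / 4 := by ring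
  have f2 : |N' / (N' - 1) * σ| ≤ τ * n / 4 := by
    rw [abs_of_nonneg (mul_nonneg hratio0 (hσ0))]
    calc N' / (N' - 1) * σ ≤ 2 * hi := by
          gcongr
      _ ≤ τ * n / 4 := by linarith
  have f3 : |s1 ^ 2 / (N' - 1)| ≤ τ * n / 4 := by
    rw [abs_of_nonneg (by positivity), div_le_iff₀ hN1]
    have g1 : s1 ^ 2 ≤ (t * n) ^ 2 := by
      rw [← sq_abs]
      gcongr
    have g2 : (t * n) ^ 2 ≤ (τ * p / 32 * n) * (1 * n) := by
      rw [sq]; gcongr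
    have g3 : τ * n / 4 * (p * n / 2) ≤ τ * n / 4 * (N' - 1) := by gcongr
    have g4 : 0 ≤ τ * p * n * n := by positivity
    nlinarith
  have hfin := (abs_sub (N' / (N' - 1) * ((s2 - n * (p * σ)) - (N' - n * p) * σ) +
    N' / (N' - 1) * σ) (s1 ^ 2 / (N' - 1))).trans (add_le_add (abs_add_le _ _) le_rfl)
  linarith

/-- The average of the variance estimator over the observations at an atom is consistent. -/
lemma unifNegligible_nnVariance_atPoint (hmom : MomentConditions PX κ F) (c : ℝ) {R : ℕ}
    (hR : 1 ≤ R) {z : ℝ} (hz : z ≠ 0) (hatom : PX {z} ≠ 0) {τ : ℝ} (hτ : 0 < τ) :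
    UnifNegligible PX κ F fun m n =>
      {S | τ * n < |∑ i ∈ atPoint (runVar S) z,
        (nnVariance R (runVar S) (sampleOutcome c S) i - condVariance (κ m) c z)|} := by
  obtain ⟨q, hq, hC⟩ := hmom.moment
  obtain ⟨C, hC⟩ := hC c
  obtain ⟨lo, hi, hlo, hvar⟩ := hmom.variance c
  -- An almost sure property holds at every atom.
  have at_z : ∀ {P : ℝ → Prop}, (∀ᵐ x ∂PX, P x) → P z := fun h => by
    by_contra hc
    exact hatom (measure_mono_null (fun x hx => by
      rw [mem_singleton_iff] at hx; rw [hx]; exact hc) h)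
  set p := PX.real {z} with hp
  have hp0 : 0 < p := by
    rw [hp, measureReal_def]
    exact ENNReal.toReal_pos hatom (measure_ne_top _ _)
  rcases F.eq_empty_or_nonempty with hF | ⟨m₀, hm₀⟩
  · rw [unifNegligible_iff]
    intro ε _
    exact Eventually.of_forall fun n m hm => by rw [hF] at hm; exact absurd hm (by simp)
  have hhi : 0 < hi := hlo.trans_le ((at_z (hvar m₀ hm₀)).1.trans (at_z (hvar m₀ hm₀)).2)
  -- tolerances
  set t := min (min (p / 4) 1) (min (τ / 16) (min (τ / (16 * hi)) (τ * p / 32))) with ht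
  have ht0 : 0 < t := by positivity
  have t1 : t ≤ p / 4 := (min_le_left _ _).trans (min_le_left _ _)
  have t2 : t ≤ 1 := (min_le_left _ _).trans (min_le_right _ _)
  have t3 : t ≤ τ / 16 := (min_le_right _ _).trans (min_le_left _ _)
  have t4 : t ≤ τ / (16 * hi) := (min_le_right _ _).trans ((min_le_right _ _).trans
    (min_le_left _ _))
  have t5 : t ≤ τ * p / 32 := (min_le_right _ _).trans ((min_le_right _ _).trans
    (min_le_right _ _))
  have E1 := unifNegligible_count_atPoint (PX := PX) (κ := κ) (F := F) z ht0
  have E2 : UnifNegligible PX κ F fun m n =>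
      {S | t * n < |∑ i, atomResidual (κ m) c z (S i) ^ 2 - n * (p * condVariance (κ m) c z)|} := by
    rw [unifNegligible_iff]
    intro ε hε
    obtain ⟨ε', hε', hεle⟩ : ∃ ε' : ℝ, 0 < ε' ∧ ENNReal.ofReal ε' ≤ ε := by
      rcases eq_or_ne ε ⊤ with h | h
      · exact ⟨1, one_pos, by rw [h]; exact le_top⟩
      · exact ⟨ε.toReal, ENNReal.toReal_pos hε.ne' h, (ENNReal.ofReal_toReal h).le⟩
    -- The weak law is applied to the squared residuals with exponent `q / 2 > 1`; fourth moments
    -- are not available here.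
    obtain ⟨N, hN⟩ := exists_uniform_wlln (Z := Obs) (p := q / 2) (C := C) (by linarith) ht0 hε'
    filter_upwards [eventually_ge_atTop N] with n hn m hm
    have h1 := hN n hn (PX ⊗ₘ κ m) (fun w => atomResidual (κ m) c z w ^ 2)
      ((measurable_atomResidual c z).pow_const 2) (fun w => sq_nonneg _)
      ((lintegral_atomResidual_rpow (by linarith) c z).trans (at_z (hC m hm)))
    rw [integral_atomResidual_sq] at h1
    exact h1.trans hεle
  have E3 : UnifNegligible PX κ F fun m n =>
      {S | t * n ≤ |∑ i, atomResidual (κ m) c z (S i)|} := by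
    refine unifNegligible_of_bound (fun n => hi / t ^ 2 * (n : ℝ)⁻¹) ?_ ?_
    · simpa using tendsto_inv_atTop_nhds_zero_nat.const_mul (hi / t ^ 2)
    · filter_upwards [eventually_gt_atTop 0] with n hn m hm
      have hn' : (0 : ℝ) < n := by exact_mod_cast hn
      have hv := at_z (hvar m hm)
      have h1 := pi_chebyshev (fun _ : Fin n => PX ⊗ₘ κ m) (f := fun _ => atomResidual (κ m) c z)
        (fun _ => memLp_atomResidual hlo hv) (show 0 < t * n by positivity)
      simp only [integral_atomResidual hlo hv, Finset.sum_const_zero, sub_zero] at h1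
      refine h1.trans (ENNReal.ofReal_le_ofReal ?_)
      have h2 : Var[atomResidual (κ m) c z; PX ⊗ₘ κ m] ≤ hi := by
        refine (variance_le_expectation_sq (measurable_atomResidual c z).aestronglyMeasurable).trans
          ?_
        have e := integral_atomResidual_sq (PX := PX) (κm := κ m) c z
        have e2 : ∫ w, (atomResidual (κ m) c z ^ 2) w ∂(PX ⊗ₘ κ m) =
          PX.real {z} * condVariance (κ m) c z := e
        rw [e2]
        calc _ ≤ 1 * hi := by
              gcongr
              · exact hlo.le.trans hv.1
              · exact measureReal_le_one
              · exact hv.2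
          _ = hi := one_mul _
      rw [Finset.sum_const, Finset.card_univ, Fintype.card_fin, nsmul_eq_mul]
      calc n * Var[atomResidual (κ m) c z; PX ⊗ₘ κ m] / (t * n) ^ 2 ≤ n * hi / (t * n) ^ 2 := by
            gcongr
        _ = _ := by field_simp
  refine ((E1.union E2).union E3).mono ?_
  obtain ⟨N, hN⟩ := exists_nat_gt ((8 * hi / τ + 4 * (R + 1) / p) + 2 / p * 4)
  filter_upwards [eventually_ge_atTop N, eventually_gt_atTop 0] with n hnN hn0 m hm
  refine Eventually.of_forall fun S hS => ?_
  by_contra hcon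
  simp only [mem_union, mem_ofPred_eq, not_or, not_le, not_lt] at hcon hS
  obtain ⟨⟨c1, c2⟩, c3⟩ := hcon
  have hn : (0 : ℝ) < n := by exact_mod_cast hn0
  have hnN' : (N : ℝ) ≤ n := by exact_mod_cast hnN
  set G := atPoint (runVar S) z with hG
  set σ := condVariance (κ m) c z with hσ
  have hσb := at_z (hvar m hm)
  rw [← hσ] at hσb
  set s2 := ∑ i ∈ G, (sampleOutcome c S i - condMean (κ m) c z) ^ 2 with hs2
  set s1 := ∑ i ∈ G, (sampleOutcome c S i - condMean (κ m) c z) with hs1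
  rw [sum_atomResidual (κ m) c z S (fun r => r ^ 2) (by norm_num), ← hs2] at c2
  rw [sum_atomResidual (κ m) c z S (fun r => r) rfl, ← hs1] at c3
  set N' : ℝ := (G.card : ℝ) with hN'
  have hlow : 3 / 4 * p * n ≤ N' := by
    have := (abs_lt.1 c1).1
    nlinarith
  have b1 : 8 * hi / τ < n := by
    have : 0 ≤ 4 * ((R : ℝ) + 1) / p := by positivity
    have : 0 ≤ 2 / p * 4 := by positivity
    linarith
  have b2 : 4 * (R + 1) / p < n := by
    have : 0 ≤ 8 * hi / τ := by positivity
    have : 0 ≤ 2 / p * 4 := by positivity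
    linarith
  have b3 : 2 / p * 4 < n := by
    have : 0 ≤ 8 * hi / τ := by positivity
    have : 0 ≤ 4 * ((R : ℝ) + 1) / p := by positivity
    linarith
  rw [div_lt_iff₀ hτ] at b1
  rw [div_lt_iff₀ hp0] at b2
  have b3' : 8 < n * p := by
    have : 2 / p * 4 * p = 8 := by field_simp; norm_num
    nlinarith
  have hcardR : R + 1 ≤ G.card := by
    have : ((R + 1 : ℕ) : ℝ) ≤ N' := by push_cast; nlinarith
    rw [hN'] at this
    exact_mod_cast this
  have hsum : ∑ i ∈ G, (nnVariance R (runVar S) (sampleOutcome c S) i - σ) =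
      N' / (N' - 1) * (s2 - s1 ^ 2 / N') - N' * σ := by
    rw [Finset.sum_sub_distrib, Finset.sum_const, nsmul_eq_mul,
      sum_nnVariance_of_ties hR (sampleOutcome c S) hz (fun j => mem_atPoint) hcardR
        (condMean (κ m) c z)]
  rw [hsum] at hS
  exact absurd (abs_corrected_variance_sub_le hn hp0 hτ ht0 t2 t3 t4 t5 hhi (hlo.le.trans hσb.1)
    hσb.2 b1 b3' hlow c1.le c2 c3.le) (not_le.2 hS)

lemma weight_congr {n : ℕ} {K : ℝ → ℝ} {X : Fin n → ℝ} {h : ℝ} {i j : Fin n} (hij : X i = X j) :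
    weight K X h i = weight K X h j := by
  simp only [weight, sideWeight, hij]

end DiscreteConsistency

/-! ### Lower bound for the sum of squared weights, and differences of squares -/

section Comparison

variable {n : ℕ} {K : ℝ → ℝ} {X : Fin n → ℝ}

lemma one_le_card_mul_sum_weight_sq (hK : IsRegKernel K) {h H N : ℝ} (hh : h ∈ admissible K X)
    (hH : h ≤ H) (hN : ((shell indPos X 0 H).card : ℝ) ≤ N) :
    1 ≤ N * ∑ i, weight K X h i ^ 2 := by
  obtain ⟨hh0, hDp, -⟩ := mem_admissible_iff.1 hh
  have hMB := massBound (X := X) hK isSide_indPos hh0 hH hN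
  refine (hMB.one_le_card_mul_sum_sq hDp).trans ?_
  rw [sum_weight_sq]
  have h8 : 0 ≤ ∑ i, wNeg K X h i ^ 2 := Finset.sum_nonneg fun i _ => sq_nonneg _
  exact mul_le_mul_of_nonneg_left (le_add_of_nonneg_right h8) hMB.N_nonneg

lemma abs_sq_sub_sq_le {a b u v : ℝ} (hab : |a - b| ≤ u) (ha : |a| ≤ v) (hb : |b| ≤ v) :
    |a ^ 2 - b ^ 2| ≤ 2 * u * v := by
  have e : a ^ 2 - b ^ 2 = (a - b) * (a + b) := by ring
  rw [e, abs_mul]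
  calc |a - b| * |a + b| ≤ u * (v + v) :=
        mul_le_mul hab ((abs_add_le _ _).trans (add_le_add ha hb)) (abs_nonneg _)
          ((abs_nonneg _).trans hab)
    _ = 2 * u * v := by ring

end Comparison

/-! ### Assembly of the discrete case -/

section DiscreteConsistency

variable {PX : Measure ℝ} [IsProbabilityMeasure PX]
  {κ : (ℝ → ℝ) × (ℝ → ℝ) → Kernel ℝ (ℝ × ℝ)} [∀ m, IsMarkovKernel (κ m)]
  {F : Set ((ℝ → ℝ) × (ℝ → ℝ))}

lemma grp_indPos {n : ℕ} {X : Fin n → ℝ} {z : ℝ} (hz : 0 < z) : grp indPos X z = atPoint X z := by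
  ext i
  rw [mem_grp, mem_atPoint]
  constructor
  · rintro ⟨h1, h2⟩
    have : 0 ≤ X i := by
      by_contra hc
      rw [indPos, if_neg hc] at h1
      exact zero_ne_one h1
    rwa [abs_of_nonneg this] at h2
  · rintro h
    rw [h, indPos, if_pos hz.le, abs_of_pos hz]
    exact ⟨rfl, rfl⟩

lemma grp_indNeg {n : ℕ} {X : Fin n → ℝ} {z : ℝ} (hz : 0 < z) :
    grp indNeg X z = atPoint X (-z) := by
  ext i
  rw [mem_grp, mem_atPoint]
  constructor
  · rintro ⟨h1, h2⟩
    have : X i < 0 := by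
      by_contra hc
      rw [indNeg, if_neg hc] at h1
      exact zero_ne_one h1
    rw [abs_of_neg this] at h2
    linarith
  · rintro h
    have : -z < 0 := by linarith
    rw [h, indNeg, if_pos this, abs_neg, abs_of_pos hz]
    exact ⟨rfl, rfl⟩

/-- Weighted sums over observations at finitely many points are controlled by the unweighted sums
at each of the points. -/
lemma abs_sum_weight_sq_mul_le {n : ℕ} {K : ℝ → ℝ} {X : Fin n → ℝ} {h v τ : ℝ} {e : Fin n → ℝ}
    (Γ : Finset ℝ) (hΓ : ∀ i, weight K X h i ≠ 0 → X i ∈ Γ) (hv : ∀ i, |weight K X h i| ≤ v)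
    (hτ : 0 ≤ τ) (he : ∀ z ∈ Γ, |∑ i ∈ atPoint X z, e i| ≤ τ) :
    |∑ i, weight K X h i ^ 2 * e i| ≤ Γ.card * (v ^ 2 * τ) := by
  classical
  have h1 : ∑ i, weight K X h i ^ 2 * e i =
      ∑ z ∈ Γ, ∑ i ∈ atPoint X z, weight K X h i ^ 2 * e i := by
    rw [← Finset.sum_filter_of_ne (p := fun i => X i ∈ Γ), ← Finset.sum_fiberwise_of_maps_to
      (t := Γ) (g := X) (fun i hi => (Finset.mem_filter.1 hi).2)]
    · refine Finset.sum_congr rfl fun z hz => Finset.sum_congr ?_ fun _ _ => rfl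
      ext i
      simp only [Finset.mem_filter, Finset.mem_univ, true_and, mem_atPoint]
      constructor
      · exact fun h => h.2
      · exact fun h => ⟨h ▸ hz, h⟩
    · intro i _ hi
      exact hΓ i fun h0 => hi (by rw [h0]; ring)
  rw [h1]
  refine (Finset.abs_sum_le_sum_abs _ _).trans ?_
  rw [← nsmul_eq_mul]
  refine Finset.sum_le_card_nsmul _ _ _ fun z hz => ?_
  rcases (atPoint X z).eq_empty_or_nonempty with h0 | ⟨j, hj⟩
  · rw [h0, Finset.sum_empty, abs_zero]; positivity
  -- Weights coincide among ties and factor out. The bandwidth may therefore depend on the outcomes: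
  -- only the unweighted sums have to be small.
  · have h2 : ∑ i ∈ atPoint X z, weight K X h i ^ 2 * e i =
        weight K X h j ^ 2 * ∑ i ∈ atPoint X z, e i := by
      rw [Finset.mul_sum]
      refine Finset.sum_congr rfl fun i hi => ?_
      rw [weight_congr ((mem_atPoint.1 hi).trans (mem_atPoint.1 hj).symm)]
    rw [h2, abs_mul, abs_of_nonneg (sq_nonneg _), ← sq_abs]
    have := hv j
    have := he z hz
    gcongr

set_option maxHeartbeats 1000000 in
theorem unifRatioConsistent_stdErr_discrete {BY BT α : ℝ} (hBY : 0 < BY) (hBT : 0 < BT)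
    (hα : α ∈ Ioo (0 : ℝ) 1) {K : ℝ → ℝ} {R : ℕ} (hmom : MomentConditions PX κ F)
    (hK : IsRegKernel K) (hR : 1 ≤ R) (hX : DiscreteRunning PX) (c : ℝ)
    {hM : (ℝ → ℝ) × (ℝ → ℝ) → (n : ℕ) → (Fin n → ℝ) → ℝ}
    (hM_opt : ∀ m ∈ F, ∀ (n : ℕ) (X : Fin n → ℝ),
      (optimalBandwidths BY BT α K (κ m) c X).Nonempty →
        hM m n X ∈ optimalBandwidths BY BT α K (κ m) c X)
    {hhat : (n : ℕ) → (Fin n → Obs) → ℝ}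
    (hhat_adm : UnifNegligible PX κ F fun _ n => {S | hhat n S ∉ admissible K (runVar S)})
    (hhat_cons : UnifRatioConsistent PX κ F
      (fun _ n S => hhat n S) (fun m n S => hM m n (runVar S))) :
    UnifRatioConsistent PX κ F (fun _ n S => stdErr R K c S (hhat n S))
      (fun m n S => stdDev K (κ m) c (runVar S) (hM m n (runVar S))) := by
  classical
  obtain ⟨x₁, x₂, x₃, x₄, h₁, h₂, h₃, h₄, hval, a1, a2, a3, a4, athird⟩ := hX.exists_points
  obtain ⟨lo, hi, hlo, hvar⟩ := hmom.variance c
  obtain ⟨a, ha, ha1, hapos, hazero⟩ := hK.exists_cutoff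
  have hx₂ : 0 < x₂ := by linarith
  have hx₃ : 0 < x₃ := by linarith
  have hx₄ : 0 < x₄ := by linarith
  have hx21 : 0 < x₂ - x₁ := by linarith
  set Γ₀ : Finset ℝ := {x₁, -x₁, x₂, -x₂, x₃, -x₃} with hΓ₀
  -- Far from the cutoff the support need not be symmetric, so only one of `±x₃` may be an atom.
  set Γ := Γ₀.filter fun z => PX {z} ≠ 0 with hΓ
  have m1 : x₁ ∈ Γ := Finset.mem_filter.2 ⟨by simp [hΓ₀], a1⟩
  have m2 : x₂ ∈ Γ := Finset.mem_filter.2 ⟨by simp [hΓ₀], a2⟩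
  have m3 : -x₁ ∈ Γ := Finset.mem_filter.2 ⟨by simp [hΓ₀], a3⟩
  have m4 : -x₂ ∈ Γ := Finset.mem_filter.2 ⟨by simp [hΓ₀], a4⟩
  have hΓ0 : ∀ z ∈ Γ, z ≠ 0 := by
    intro z hz
    have := (Finset.mem_filter.1 hz).1
    simp only [hΓ₀, Finset.mem_insert, Finset.mem_singleton] at this
    rcases this with h | h | h | h | h | h <;> rw [h] <;> simp [h₁.ne', hx₂.ne', hx₃.ne']
  have hΓat : ∀ z ∈ Γ, PX {z} ≠ 0 := fun z hz => (Finset.mem_filter.1 hz).2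
  obtain ⟨z₀, hz₀, hz₀min⟩ := Γ.exists_min_image (fun z => PX.real {z}) ⟨x₁, m1⟩
  set p := PX.real {z₀} / 2 with hp
  have hp0 : 0 < p := half_pos (by
    rw [measureReal_def]
    exact ENNReal.toReal_pos (hΓat z₀ hz₀) (measure_ne_top _ _))
  obtain ⟨C, hC, hweights⟩ := exists_abs_weight_sub_lineW_le (x₄ := x₄) hK h₁ h₂ h₃ hp0
  set D := x₂ / (x₂ - x₁) / p + x₂ / (x₂ - x₁) / p + C with hD
  have hD0 : 0 < D := by positivity
  intro ε hε
  -- A bandwidth whose kernel at `x₃` is below `κ₀` satisfies `b < x₄ / a` and hence puts no mass at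
  -- distances from `x₄` on.
  set κ₀ := K (a * x₃ / x₄) with hκ₀
  have hκ0 : 0 < κ₀ := hapos _ (by
    rw [abs_of_pos (by positivity), div_lt_iff₀ hx₄]; gcongr)
  set τ := ε * lo / (2 * (Γ.card * D ^ 2 + 1)) with hτdef
  have hτ : 0 < τ := by positivity
  -- Entry 1 bounds the weights by `D / n`, entry `κ₀ / 2` removes all mass from `x₄` on, and the
  -- last entry makes the error from changing the bandwidth at most `ε * lo / 2 / n`. The tolerance
  -- `τ` does the same for the error of the variance estimator.
  set τ₁ := min (min 1 (κ₀ / 2)) (ε * lo / (2 * (4 * C * D * (|hi| + 1)))) with hτ₁def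
  have hτ₁ : 0 < τ₁ := by positivity
  have hτ₁1 : τ₁ ≤ 1 := (min_le_left _ _).trans (min_le_left _ _)
  have hτ₁κ : τ₁ < κ₀ := ((min_le_left _ _).trans (min_le_right _ _)).trans_lt (by linarith)
  -- Half of `τ₁` is for the kernel at the optimal bandwidth, half for passing to the empirical one.
  obtain ⟨δ, hδ, hδ2, hmod⟩ := hK.exists_modulus (half_pos hτ₁)
  obtain ⟨N, hN⟩ := exists_optimalBandwidths_discrete (x₄ := x₄) hK h₁ h₂ h₃ hp0 hBY hBT hα c
    (hi := hi) hlo (half_pos hτ₁)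
  have E1 : UnifNegligible PX κ F fun _ n => ⋃ z ∈ Γ,
      {S | p * n ≤ |((atPoint (runVar S) z).card : ℝ) - n * PX.real {z}|} :=
    UnifNegligible.biUnion Γ fun z _ => unifNegligible_count_atPoint z hp0
  have E2 : UnifNegligible PX κ F fun m n => ⋃ z ∈ Γ,
      {S | τ * n < |∑ i ∈ atPoint (runVar S) z,
        (nnVariance R (runVar S) (sampleOutcome c S) i - condVariance (κ m) c z)|} :=
    UnifNegligible.biUnion Γ fun z hz =>
      unifNegligible_nnVariance_atPoint hmom c hR (hΓ0 z hz) (hΓat z hz) hτ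
  refine (((E1.union E2).union hhat_adm).union (hhat_cons δ hδ)).mono ?_
  filter_upwards [eventually_ge_atTop N, eventually_gt_atTop 0] with n hnN hn0 m hm
  have hn : (0 : ℝ) < n := by exact_mod_cast hn0
  have hnull : ∀ᵐ x ∂PX, ∀ z ∈ Γ₀, x = z → z ∈ Γ := by
    refine (Finset.eventually_all Γ₀).2 fun z hz => ?_
    by_cases hz0 : PX {z} = 0
    · have : ∀ᵐ x ∂PX, x ≠ z := by
        rw [ae_iff]; simpa using hz0
      filter_upwards [this] with x hx h
      exact absurd h hx
    · exact Eventually.of_forall fun x _ => Finset.mem_filter.2 ⟨hz, hz0⟩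
  have hthird : ∀ᵐ x ∂PX, (PX {x₃} = 0 ∧ PX {-x₃} = 0) → |x| = x₁ ∨ |x| = x₂ := by
    rcases athird with h | h | h
    · filter_upwards [h] with x hx _; exact hx
    · exact Eventually.of_forall fun x h0 => absurd h0.1 h
    · exact Eventually.of_forall fun x h0 => absurd h0.2 h
  filter_upwards [ae_sampleLaw (κ := κ) (m := m) hval n,
    ae_sampleLaw (κ := κ) (m := m) (hvar m hm) n, ae_sampleLaw (κ := κ) (m := m) hnull n,
    ae_sampleLaw (κ := κ) (m := m) hthird n] with S sval svar snull sthird hS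
  by_contra hcon
  simp only [mem_union, mem_iUnion, mem_ofPred_eq, not_or, not_exists, not_le, not_lt,
    not_not] at hcon
  obtain ⟨⟨⟨c1, c2⟩, cadm⟩, ccons⟩ := hcon
  change ε * |_| < |_ - _| at hS
  set X := runVar S with hXdef
  set g := hhat n S with hg
  have hcount : ∀ z ∈ Γ, p * n ≤ (atPoint X z).card := by
    intro z hz
    have h5 := (abs_lt.1 (c1 z hz)).1
    have h6 := hz₀min z hz
    have h7 : n * (2 * p) ≤ n * PX.real {z} := by
      gcongr; rw [hp]; linarith
    nlinarith
  have HD : DiscreteDesign X x₁ x₂ x₃ x₄ p := by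
    refine ⟨h₁, h₂, h₃, h₄, hp0, hn0, sval, ?_, ?_, ?_, ?_, ?_⟩
    · rw [grp_indPos h₁]; exact hcount _ m1
    · rw [grp_indPos hx₂]; exact hcount _ m2
    · rw [grp_indNeg h₁]; exact hcount _ m3
    · rw [grp_indNeg hx₂]; exact hcount _ m4
    · rw [grp_indPos hx₃, grp_indNeg hx₃]
      by_cases hp3 : PX {x₃} = 0
      · by_cases hn3 : PX {-x₃} = 0
        · exact Or.inl fun i => sthird i ⟨hp3, hn3⟩
        · exact Or.inr (Or.inr (hcount _ (Finset.mem_filter.2 ⟨by simp [hΓ₀], hn3⟩)))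
      · exact Or.inr (Or.inl (hcount _ (Finset.mem_filter.2 ⟨by simp [hΓ₀], hp3⟩)))
  obtain ⟨hne, hopt⟩ := hN n X hnN HD (κ m) svar
  have hmem := hM_opt m hm n X hne
  set h := hM m n X with hh
  have hadm : h ∈ admissible K X := hmem.1
  have hh0 : 0 < h := hadm.1
  have hKh : ∀ i, x₃ ≤ |X i| → K (X i / h) ≤ τ₁ := fun i hi =>
    (hopt h hmem i hi).trans (by linarith)
  have hKg : ∀ i, x₃ ≤ |X i| → K (X i / g) ≤ τ₁ := fun i hi => by
    have h5 := hmod h g hh0 (by rwa [abs_of_pos hh0] at ccons) (X i)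
    have h6 := hopt h hmem i hi
    have h7 := (abs_le.1 h5).2
    linarith
  have hfar : ∀ b, 0 < b → (∀ i, x₃ ≤ |X i| → K (X i / b) ≤ τ₁) →
      ∀ i, x₄ ≤ |X i| → K (X i / b) = 0 := by
    intro b hb hKb i hi
    have hex : ∃ j, |X j| = x₃ := by
      rcases HD.third with h5 | h5 | h5
      · rcases h5 i with h6 | h6 <;> rw [h6] at hi <;> linarith
      · obtain ⟨j, hj⟩ := Finset.card_pos.1 (by exact_mod_cast HD.pn_pos.trans_le h5)
        exact ⟨j, (mem_grp.1 hj).2⟩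
      · obtain ⟨j, hj⟩ := Finset.card_pos.1 (by exact_mod_cast HD.pn_pos.trans_le h5)
        exact ⟨j, (mem_grp.1 hj).2⟩
    obtain ⟨j, hj⟩ := hex
    have h5 := hKb j hj.ge
    have h6 : a * x₃ / x₄ < x₃ / b := by
      by_contra! hc
      have : κ₀ ≤ K (X j / b) := by
        rw [hκ₀]
        refine hK.le_apply_of_abs_le ?_
        rwa [abs_div, abs_of_pos hb, hj, abs_of_pos (by positivity)]
      linarith
    refine hazero _ ?_
    rw [abs_div, abs_of_pos hb, le_div_iff₀ hb]
    rw [div_lt_div_iff₀ hx₄ hb] at h6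
    have : a * b < x₄ := by nlinarith
    linarith
  have hg0 : 0 < g := cadm.1
  have wh := hweights n X HD h hadm τ₁ hτ₁.le hKh (hfar h hh0 hKh)
  have wg := hweights n X HD g cadm τ₁ hτ₁.le hKg (hfar g hg0 hKg)
  have hline : ∀ i, |lineW X x₁ x₂ i| ≤ (x₂ / (x₂ - x₁) / p + x₂ / (x₂ - x₁) / p) / n := fun i => by
    rw [add_div]
    exact (abs_sub _ _).trans (add_le_add (abs_interpW_le HD (Or.inl rfl) i)
      (abs_interpW_le HD (Or.inr rfl) i))
  have hbd : ∀ b, (∀ i, |weight K X b i - lineW X x₁ x₂ i| ≤ C * τ₁ / n) →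
      ∀ i, |weight K X b i| ≤ D / n := by
    intro b hb i
    have e : weight K X b i = (weight K X b i - lineW X x₁ x₂ i) + lineW X x₁ x₂ i := by ring
    rw [e]
    refine (abs_add_le _ _).trans ((add_le_add (hb i) (hline i)).trans ?_)
    rw [← add_div]
    have : C * τ₁ ≤ C := by nlinarith
    gcongr
    rw [hD]; linarith
  have bh := hbd h wh
  have bg := hbd g wg
  have hdiff : ∀ i, |weight K X g i - weight K X h i| ≤ 2 * C * τ₁ / n := fun i => by
    have e : weight K X g i - weight K X h i = (weight K X g i - lineW X x₁ x₂ i) -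
      (weight K X h i - lineW X x₁ x₂ i) := by ring
    rw [e]
    refine (abs_sub _ _).trans ((add_le_add (wg i) (wh i)).trans (le_of_eq ?_))
    ring
  -- the two error terms
  have t1 : |∑ i, weight K X g i ^ 2 * (nnVariance R X (sampleOutcome c S) i -
      condVariance (κ m) c (X i))| ≤ Γ.card * ((D / n) ^ 2 * (τ * n)) := by
    refine abs_sum_weight_sq_mul_le Γ ?_ bg (by positivity) ?_
    · intro i hi
      have hlt : |X i| = x₁ ∨ |X i| = x₂ ∨ |X i| = x₃ := by
        rcases sval i with h5 | h5 | h5 | h5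
        · exact Or.inl h5
        · exact Or.inr (Or.inl h5)
        · exact Or.inr (Or.inr h5)
        · refine absurd ?_ hi
          rw [weight, sideWeight, sideWeight, hfar g hg0 hKg i h5]
          ring
      have hin : X i ∈ Γ₀ := by
        simp only [hΓ₀, Finset.mem_insert, Finset.mem_singleton]
        rcases hlt with h5 | h5 | h5 <;> rcases abs_choice (X i) with h6 | h6 <;> rw [h6] at h5
        · exact Or.inl h5
        · exact Or.inr (Or.inl (by linarith))
        · exact Or.inr (Or.inr (Or.inl h5))
        · exact Or.inr (Or.inr (Or.inr (Or.inl (by linarith))))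
        · exact Or.inr (Or.inr (Or.inr (Or.inr (Or.inl h5))))
        · exact Or.inr (Or.inr (Or.inr (Or.inr (Or.inr (by linarith)))))
      exact snull i (X i) hin rfl
    · intro z hz
      refine le_of_eq_of_le ?_ (c2 z hz)
      congr 1
      exact Finset.sum_congr rfl fun i hi => by rw [mem_atPoint.1 hi]
  have t2 : |∑ i, (weight K X g i ^ 2 - weight K X h i ^ 2) * condVariance (κ m) c (X i)| ≤
      n * (2 * (2 * C * τ₁ / n) * (D / n) * |hi|) := by
    refine (Finset.abs_sum_le_sum_abs _ _).trans ?_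
    refine (Finset.sum_le_card_nsmul _ _ (2 * (2 * C * τ₁ / n) * (D / n) * |hi|) fun i _ => ?_).trans
      (le_of_eq (by rw [Finset.card_univ, Fintype.card_fin, nsmul_eq_mul]))
    rw [abs_mul]
    refine mul_le_mul (abs_sq_sub_sq_le (hdiff i) (bg i) (bh i)) ?_ (abs_nonneg _) (by positivity)
    rw [abs_of_nonneg (hlo.le.trans (svar i).1)]
    exact (svar i).2.trans (le_abs_self _)
  -- At most `n` observations carry weight, so `lo / n` is the scale against which both error terms
  -- are measured.
  have hB : lo / n ≤ stdDev K (κ m) c X h ^ 2 := by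
    refine le_trans ?_ (stdDev_sq_bounds svar).1
    have := one_le_card_mul_sum_weight_sq hK hadm le_rfl (card_shell_le (side := indPos) (X := X))
    rw [div_le_iff₀ hn]
    calc lo = lo * 1 := (mul_one _).symm
      _ ≤ lo * (n * ∑ i, weight K X h i ^ 2) := by gcongr
      _ = _ := by ring
  rw [stdErr, stdDev, abs_of_nonneg (Real.sqrt_nonneg _)] at hS
  refine absurd (abs_sqrt_sub_sqrt_le (ε := ε) ?_ ?_) (not_le.2 hS)
  · rw [← stdDev_sq]; exact (by positivity : 0 < lo / n).trans_le hB
  · rw [← stdDev_sq]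
    refine le_trans ?_ (mul_le_mul_of_nonneg_left hB hε.le)
    rw [stdDev_sq]
    have e : ∑ i, weight K X g i ^ 2 * nnVariance R X (sampleOutcome c S) i -
        ∑ i, weight K X h i ^ 2 * condVariance (κ m) c (X i) =
        ∑ i, weight K X g i ^ 2 * (nnVariance R X (sampleOutcome c S) i -
          condVariance (κ m) c (X i)) +
        ∑ i, (weight K X g i ^ 2 - weight K X h i ^ 2) * condVariance (κ m) c (X i) := by
      rw [← Finset.sum_sub_distrib, ← Finset.sum_add_distrib]
      exact Finset.sum_congr rfl fun i _ => by ring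
    rw [e]
    refine (abs_add_le _ _).trans ((add_le_add t1 t2).trans ?_)
    have f1 : Γ.card * ((D / n) ^ 2 * (τ * n)) ≤ ε * lo / 2 / n := by
      have : Γ.card * ((D / n) ^ 2 * (τ * n)) = (Γ.card * D ^ 2) * τ / n := by field_simp
      rw [this]
      gcongr
      rw [hτdef, mul_div_assoc', div_le_div_iff₀ (by positivity) (by positivity)]
      have : 0 < ε * lo := by positivity
      nlinarith
    have f2 : n * (2 * (2 * C * τ₁ / n) * (D / n) * |hi|) ≤ ε * lo / 2 / n := by
      have : n * (2 * (2 * C * τ₁ / n) * (D / n) * |hi|) = (4 * C * D * |hi|) * τ₁ / n := by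
        field_simp; ring
      rw [this]
      gcongr
      calc (4 * C * D * |hi|) * τ₁ ≤ (4 * C * D * (|hi| + 1)) *
            (ε * lo / (2 * (4 * C * D * (|hi| + 1)))) := by
            refine mul_le_mul ?_ (min_le_right _ _) hτ₁.le (by positivity)
            gcongr; linarith
        _ = ε * lo / 2 := by field_simp
    calc _ ≤ ε * lo / 2 / n + ε * lo / 2 / n := add_le_add f1 f2
      _ = ε * (lo / n) := by ring

end DiscreteConsistency

/-! ### Concentration of sums of locally dependent quadratic forms -/

section LocalDependence

variable {n : ℕ} {Ω : Type*} [MeasurableSpace Ω] [Inhabited Ω] (μ : Fin n → Measure Ω)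
  [∀ i, IsProbabilityMeasure (μ i)]

/-- Each function factors through the restriction to its own coordinates, the others being filled
with a default value, and restrictions to disjoint sets are independent under a product measure. -/
lemma indepFun_of_dependsOn_disjoint {S T : Finset (Fin n)} (hST : Disjoint S T)
    {f g : (Fin n → Ω) → ℝ} (hf : Measurable f) (hg : Measurable g)
    (hfS : DependsOn f (S : Set (Fin n))) (hgT : DependsOn g (T : Set (Fin n))) :
    IndepFun f g (Measure.pi μ) := by
  classical
  have h1 := (iIndepFun_pi (μ := μ) (X := fun _ => id) fun _ => aemeasurable_id).indepFun_finset
    S T hST fun i => measurable_pi_apply i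
  have ext_meas : ∀ U : Finset (Fin n),
      Measurable fun (y : U → Ω) (i : Fin n) => if h : i ∈ U then y ⟨i, h⟩ else default := by
    intro U
    refine measurable_pi_lambda _ fun i => ?_
    by_cases h : i ∈ U
    · simpa [h] using measurable_pi_apply _
    · simp [h]
  have h2 := h1.comp (hf.comp (ext_meas S)) (hg.comp (ext_meas T))
  have key : ∀ (U : Finset (Fin n)) (k : (Fin n → Ω) → ℝ), DependsOn k (U : Set (Fin n)) →
      (k ∘ fun (y : U → Ω) (i : Fin n) => if h : i ∈ U then y ⟨i, h⟩ else default) ∘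
        (fun (ω : Fin n → Ω) (i : U) => id (ω i)) = k := by
    intro U k hk
    funext ω
    refine hk fun i hi => ?_
    have : i ∈ U := hi
    simp [this]
  rwa [key S f hfS, key T g hgT] at h2

lemma covariance_le_half_add {Ω' : Type*} [MeasurableSpace Ω'] {P : Measure Ω'}
    [IsProbabilityMeasure P] {f g : Ω' → ℝ} (hf : MemLp f 2 P) (hg : MemLp g 2 P) :
    cov[f, g; P] ≤ (Var[f; P] + Var[g; P]) / 2 := by
  have h1 := variance_sub hf hg
  have h2 := variance_nonneg (f - g) P
  linarith

/-- The variance of a sum of locally dependent variables. -/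
lemma variance_sum_le_of_dependsOn {f : Fin n → (Fin n → Ω) → ℝ} {I : Finset (Fin n)}
    {T : Fin n → Finset (Fin n)} {D : ℕ} {Γ : ℝ} (hΓ : 0 ≤ Γ) (hf : ∀ i ∈ I, Measurable (f i))
    (hL : ∀ i ∈ I, MemLp (f i) 2 (Measure.pi μ))
    (hdep : ∀ i ∈ I, DependsOn (f i) (T i : Set (Fin n)))
    (hT : ∀ i ∈ I, (T i).card ≤ D) (hT' : ∀ j, (I.filter fun i => j ∈ T i).card ≤ D)
    (hvar : ∀ i ∈ I, Var[f i; Measure.pi μ] ≤ Γ) :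
    Var[fun ω => ∑ i ∈ I, f i ω; Measure.pi μ] ≤ I.card * (D ^ 2 * Γ) := by
  classical
  rw [variance_fun_sum' hL, ← nsmul_eq_mul]
  refine Finset.sum_le_card_nsmul _ _ _ fun i hi => ?_
  have h1 : ∀ k ∈ I, cov[f i, f k; Measure.pi μ] ≤ if Disjoint (T i) (T k) then 0 else Γ := by
    intro k hk
    split_ifs with h
    · exact ((indepFun_of_dependsOn_disjoint μ h (hf i hi) (hf k hk) (hdep i hi)
        (hdep k hk)).covariance_eq_zero (hL i hi) (hL k hk)).le
    · have := covariance_le_half_add (hL i hi) (hL k hk)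
      have := hvar i hi
      have := hvar k hk
      linarith
  refine (Finset.sum_le_sum h1).trans ?_
  rw [Finset.sum_ite, Finset.sum_const_zero, zero_add, Finset.sum_const, nsmul_eq_mul]
  refine mul_le_mul_of_nonneg_right ?_ hΓ
  -- Only overlapping index sets can be correlated. Each of the at most `D` indices in `T i` lies in
  -- at most `D` sets, which leaves at most `D ^ 2` covariances per row.
  have h2 : (I.filter fun k => ¬ Disjoint (T i) (T k)) ⊆
      (T i).biUnion fun j => I.filter fun k => j ∈ T k := by
    intro k hk
    obtain ⟨hk1, hk2⟩ := Finset.mem_filter.1 hk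
    obtain ⟨j, hj1, hj2⟩ := Finset.not_disjoint_iff.1 hk2
    exact Finset.mem_biUnion.2 ⟨j, hj1, Finset.mem_filter.2 ⟨hk1, hj2⟩⟩
  have h3 := (Finset.card_le_card h2).trans (Finset.card_biUnion_le_card_mul _ _ D fun j _ => hT' j)
  have h4 : (I.filter fun k => ¬ Disjoint (T i) (T k)).card ≤ D ^ 2 :=
    h3.trans (by rw [sq]; exact Nat.mul_le_mul_right D (hT i hi))
  exact_mod_cast h4

/-- The normalized square of a linear form with offset. -/
noncomputable def normSq (e : Fin n → Ω → ℝ) (γ : Fin n → ℝ) (b : ℝ) (ω : Fin n → Ω) : ℝ :=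
  (b + ∑ j, γ j * e j (ω j)) ^ 2 / ∑ j, γ j ^ 2

variable {μ} {e : Fin n → Ω → ℝ} {γ : Fin n → ℝ} {b : ℝ} {T : Finset (Fin n)}

lemma measurable_normSq (he : ∀ j, Measurable (e j)) : Measurable (normSq e γ b) := by
  unfold normSq
  have : ∀ j, Measurable fun ω : Fin n → Ω => e j (ω j) :=
    fun j => (he j).comp (measurable_pi_apply j)
  fun_prop

lemma dependsOn_normSq (hγ : ∀ j ∉ T, γ j = 0) : DependsOn (normSq e γ b) (T : Set (Fin n)) := by
  intro ω ω' h
  have : ∑ j, γ j * e j (ω j) = ∑ j, γ j * e j (ω' j) := by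
    refine Finset.sum_congr rfl fun j _ => ?_
    by_cases hj : j ∈ T
    · rw [h j hj]
    · rw [hγ j hj, zero_mul, zero_mul]
  rw [normSq, normSq, this]

lemma normSq_nonneg (ω : Fin n → Ω) : 0 ≤ normSq e γ b ω :=
  div_nonneg (sq_nonneg _) (Finset.sum_nonneg fun _ _ => sq_nonneg _)

/-- Cauchy-Schwarz against the normalizing sum of squares. Apart from the offset term, the bound is
free of the coefficients, which is essential because extrapolation from nearly coinciding neighbors
makes them arbitrarily large. -/
lemma normSq_le (hγ : ∀ j ∉ T, γ j = 0) (hD : 1 ≤ ∑ j, γ j ^ 2) (ω : Fin n → Ω) :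
    normSq e γ b ω ≤ 2 * (b ^ 2 / ∑ j, γ j ^ 2) + 2 * ∑ j ∈ T, e j (ω j) ^ 2 := by
  set G := ∑ j, γ j ^ 2 with hG
  have hG0 : 0 < G := by linarith
  have h1 : ∑ j, γ j * e j (ω j) = ∑ j ∈ T, γ j * e j (ω j) :=
    (Finset.sum_subset (Finset.subset_univ T) fun j _ hj => by rw [hγ j hj, zero_mul]).symm
  have h2 : (∑ j, γ j * e j (ω j)) ^ 2 ≤ G * ∑ j ∈ T, e j (ω j) ^ 2 := by
    rw [h1]
    refine (Finset.sum_mul_sq_le_sq_mul_sq T γ _).trans ?_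
    refine mul_le_mul_of_nonneg_right ?_ (Finset.sum_nonneg fun _ _ => sq_nonneg _)
    exact Finset.sum_le_univ_sum_of_nonneg fun _ => sq_nonneg _
  rw [normSq, ← hG, div_le_iff₀ hG0]
  have h3 : (2 * (b ^ 2 / G) + 2 * ∑ j ∈ T, e j (ω j) ^ 2) * G =
      2 * b ^ 2 + 2 * (G * ∑ j ∈ T, e j (ω j) ^ 2) := by field_simp
  rw [h3]
  nlinarith [sq_nonneg (b - ∑ j, γ j * e j (ω j))]

lemma normSq_sq_le (hγ : ∀ j ∉ T, γ j = 0) (hD : 1 ≤ ∑ j, γ j ^ 2)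
    (hb : b ^ 2 / ∑ j, γ j ^ 2 ≤ 1) (ω : Fin n → Ω) :
    normSq e γ b ω ^ 2 ≤ 8 + 8 * (T.card * ∑ j ∈ T, e j (ω j) ^ 4) := by
  have h1 := normSq_le (e := e) (b := b) hγ hD ω
  have h2 := normSq_nonneg (e := e) (γ := γ) (b := b) ω
  have h3 : (∑ j ∈ T, e j (ω j) ^ 2) ^ 2 ≤ T.card * ∑ j ∈ T, e j (ω j) ^ 4 := by
    refine sq_sum_le_card_mul_sum_sq.trans (le_of_eq ?_)
    congr 1
    exact Finset.sum_congr rfl fun j _ => by ring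
  have h4 : 0 ≤ ∑ j ∈ T, e j (ω j) ^ 2 := Finset.sum_nonneg fun _ _ => sq_nonneg _
  have h5 : normSq e γ b ω ≤ 2 + 2 * ∑ j ∈ T, e j (ω j) ^ 2 := by linarith
  nlinarith [sq_nonneg (1 - ∑ j ∈ T, e j (ω j) ^ 2)]

section Moments

variable {C : ℝ} (he : ∀ j, Measurable (e j))
  (h4 : ∀ j, ∫⁻ x, ENNReal.ofReal (e j x ^ 4) ∂(μ j) ≤ ENNReal.ofReal C)

include he h4 in
lemma integrable_fourth (j : Fin n) : Integrable (fun x => e j x ^ 4) (μ j) := by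
  refine ⟨((he j).pow_const 4).aestronglyMeasurable, ?_⟩
  rw [hasFiniteIntegral_iff_ofReal (Eventually.of_forall fun x => by positivity)]
  exact (h4 j).trans_lt ENNReal.ofReal_lt_top

include he h4 in
lemma integral_fourth_le (hC : 0 ≤ C) (j : Fin n) : ∫ x, e j x ^ 4 ∂(μ j) ≤ C := by
  rw [integral_eq_lintegral_of_nonneg_ae (Eventually.of_forall fun x => by positivity)
    ((he j).pow_const 4).aestronglyMeasurable]
  exact ENNReal.toReal_le_of_le_ofReal hC (h4 j)

include he h4 in
lemma memLp_two_of_fourth (j : Fin n) : MemLp (e j) 2 (μ j) := by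
  rw [memLp_two_iff_integrable_sq (he j).aestronglyMeasurable]
  refine ((integrable_const (1 : ℝ)).add (integrable_fourth he h4 j)).mono'
    ((he j).pow_const 2).aestronglyMeasurable (Eventually.of_forall fun x => ?_)
  rw [Real.norm_eq_abs, abs_of_nonneg (sq_nonneg _), Pi.add_apply]
  nlinarith [sq_nonneg (e j x ^ 2 - 1)]

include he h4 in
lemma memLp_normSq (hγ : ∀ j ∉ T, γ j = 0) (hD : 1 ≤ ∑ j, γ j ^ 2)
    (hb : b ^ 2 / ∑ j, γ j ^ 2 ≤ 1) (hC : 0 ≤ C) :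
    MemLp (normSq e γ b) 2 (Measure.pi μ) ∧
      ∫ ω, normSq e γ b ω ^ 2 ∂(Measure.pi μ) ≤ 8 + 8 * (T.card ^ 2 * C) := by
  have i4 : ∀ j, Integrable (fun ω : Fin n → Ω => e j (ω j) ^ 4) (Measure.pi μ) := fun j =>
    (measurePreserving_eval μ j).integrable_comp_of_integrable (integrable_fourth he h4 j)
  have iR : Integrable (fun ω : Fin n → Ω => 8 + 8 * (T.card * ∑ j ∈ T, e j (ω j) ^ 4))
      (Measure.pi μ) :=
    (integrable_const _).add (((integrable_finsetSum _ fun j _ => i4 j).const_mul _).const_mul _)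
  have hm := measurable_normSq (γ := γ) (b := b) he
  have iQ : Integrable (fun ω => normSq e γ b ω ^ 2) (Measure.pi μ) := by
    refine iR.mono' (hm.pow_const 2).aestronglyMeasurable (Eventually.of_forall fun ω => ?_)
    rw [Real.norm_eq_abs, abs_of_nonneg (sq_nonneg _)]
    exact normSq_sq_le hγ hD hb ω
  refine ⟨(memLp_two_iff_integrable_sq hm.aestronglyMeasurable).2 iQ, ?_⟩
  refine (integral_mono iQ iR fun ω => normSq_sq_le hγ hD hb ω).trans ?_
  rw [integral_add (integrable_const _)
    (((integrable_finsetSum _ fun j _ => i4 j).const_mul _).const_mul _), integral_const_mul,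
    integral_const_mul, integral_finsetSum _ fun j _ => i4 j]
  simp only [integral_const, probReal_univ, smul_eq_mul, one_mul]
  have h5 : ∑ j ∈ T, ∫ ω, e j (ω j) ^ 4 ∂(Measure.pi μ) ≤ T.card * C := by
    rw [← nsmul_eq_mul]
    refine Finset.sum_le_card_nsmul _ _ _ fun j _ => ?_
    have : ∫ ω, e j (ω j) ^ 4 ∂(Measure.pi μ) = ∫ x, e j x ^ 4 ∂(μ j) :=
      integral_comp_eval (μ := μ) (f := fun x => e j x ^ 4) ((he j).pow_const 4).aestronglyMeasurable
    rw [this]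
    exact integral_fourth_le he h4 hC j
  have h6 : (T.card : ℝ) * ∑ j ∈ T, ∫ ω, e j (ω j) ^ 4 ∂(Measure.pi μ) ≤ T.card * (T.card * C) :=
    mul_le_mul_of_nonneg_left h5 (Nat.cast_nonneg _)
  linarith

include he h4 in
-- Cross terms vanish by independence and centering. Up to the offset the mean is an average of
-- variances with weights `γ j ^ 2`, which is what dividing the squared error by one plus the
-- leverage achieves.
lemma integral_normSq (h0 : ∀ j, ∫ x, e j x ∂(μ j) = 0) :
    ∫ ω, normSq e γ b ω ∂(Measure.pi μ) =
      (b ^ 2 + ∑ j, γ j ^ 2 * ∫ x, e j x ^ 2 ∂(μ j)) / ∑ j, γ j ^ 2 := by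
  have hL := memLp_two_of_fourth he h4
  have hL1 : ∀ j, MemLp (fun x => γ j * e j x) 2 (μ j) := fun j => (hL j).const_mul _
  have hLω : ∀ j, MemLp (fun ω : Fin n → Ω => γ j * e j (ω j)) 2 (Measure.pi μ) := fun j =>
    (hL1 j).comp_measurePreserving (measurePreserving_eval μ j)
  set f : (Fin n → Ω) → ℝ := fun ω => ∑ j, γ j * e j (ω j) with hf
  have hfL : MemLp f 2 (Measure.pi μ) := memLp_finsetSum _ fun j _ => hLω j
  have hfint : ∫ ω, f ω ∂(Measure.pi μ) = 0 := by
    rw [hf, integral_finsetSum _ fun j _ => (hLω j).integrable one_le_two]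
    refine Finset.sum_eq_zero fun j _ => ?_
    have : ∫ ω, γ j * e j (ω j) ∂(Measure.pi μ) = ∫ x, γ j * e j x ∂(μ j) :=
      integral_comp_eval (μ := μ) (f := fun x => γ j * e j x) (hL1 j).aestronglyMeasurable
    rw [this, integral_const_mul, h0, mul_zero]
  have hfsq : ∫ ω, f ω ^ 2 ∂(Measure.pi μ) = ∑ j, γ j ^ 2 * ∫ x, e j x ^ 2 ∂(μ j) := by
    have h1 := variance_sum_pi hL1
    have h2 : (∑ j, fun ω : Fin n → Ω => γ j * e j (ω j)) = f := by
      funext ω; simp [hf]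
    have h3 := variance_of_integral_eq_zero hfL.aestronglyMeasurable.aemeasurable hfint
    rw [h2] at h1
    rw [← h3, h1]
    refine Finset.sum_congr rfl fun j _ => ?_
    rw [variance_const_mul, variance_of_integral_eq_zero (he j).aemeasurable (h0 j)]
  unfold normSq
  rw [integral_div]
  congr 1
  have e1 : ∀ ω, (b + ∑ j, γ j * e j (ω j)) ^ 2 = (b ^ 2 + 2 * b * f ω) + f ω ^ 2 := fun ω => by
    rw [hf]; ring
  simp_rw [e1]
  have if1 := hfL.integrable one_le_two
  have i1 : Integrable (fun ω => b ^ 2 + 2 * b * f ω) (Measure.pi μ) :=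
    (integrable_const _).add (if1.const_mul _)
  rw [integral_add i1 hfL.integrable_sq, integral_add (integrable_const _) (if1.const_mul _), integral_const_mul, hfint, hfsq]
  simp

include he h4 in
/-- Up to bias, weighted sums of locally dependent normalized squares concentrate around the
weighted sum of the variances. -/
lemma measure_abs_sum_normSq_sub_ge_le (h0 : ∀ j, ∫ x, e j x ∂(μ j) = 0) (hC : 0 ≤ C)
    {γ : Fin n → Fin n → ℝ} {b v σ : Fin n → ℝ} {T : Fin n → Finset (Fin n)}
    {I : Finset (Fin n)} {D : ℕ} {β V t : ℝ} (hσ : ∀ j, σ j = ∫ x, e j x ^ 2 ∂(μ j))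
    (hγ : ∀ i ∈ I, ∀ j ∉ T i, γ i j = 0) (hD : ∀ i ∈ I, 1 ≤ ∑ j, γ i j ^ 2)
    (hT : ∀ i ∈ I, (T i).card ≤ D) (hT' : ∀ j, (I.filter fun i => j ∈ T i).card ≤ D)
    (hb : ∀ i ∈ I, b i ^ 2 / ∑ j, γ i j ^ 2 ≤ β) (hβ : β ≤ 1)
    (hσβ : ∀ i ∈ I, ∀ j ∈ T i, |σ j - σ i| ≤ β) (hV : 0 ≤ V) (hv : ∀ i ∈ I, |v i| ≤ V)
    (ht : 0 < t) :
    Measure.pi μ {ω | t + 2 * β * V * I.card ≤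
        |∑ i ∈ I, v i * (normSq e (γ i) (b i) ω - σ i)|} ≤
      ENNReal.ofReal (I.card * (D ^ 2 * (V ^ 2 * (8 + 8 * (D ^ 2 * C)))) / t ^ 2) := by
  have hQ : ∀ i ∈ I, _ := fun i hi => memLp_normSq he h4 (hγ i hi) (hD i hi)
    ((hb i hi).trans hβ) hC
  set f : Fin n → (Fin n → Ω) → ℝ := fun i ω => v i * normSq e (γ i) (b i) ω with hf
  have hfL : ∀ i ∈ I, MemLp (f i) 2 (Measure.pi μ) := fun i hi => (hQ i hi).1.const_mul _
  have hvar : ∀ i ∈ I, Var[f i; Measure.pi μ] ≤ V ^ 2 * (8 + 8 * (D ^ 2 * C)) := by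
    intro i hi
    rw [hf, variance_const_mul, ← sq_abs]
    have h1 : Var[normSq e (γ i) (b i); Measure.pi μ] ≤ 8 + 8 * (D ^ 2 * C) := by
      refine (variance_le_expectation_sq (hQ i hi).1.aestronglyMeasurable).trans ?_
      refine (hQ i hi).2.trans ?_
      have : ((T i).card : ℝ) ≤ D := by exact_mod_cast hT i hi
      gcongr
    have := hv i hi
    exact mul_le_mul (by gcongr) h1 (variance_nonneg _ _) (by positivity)
  have hS := variance_sum_le_of_dependsOn μ (f := f) (T := T)
    (Γ := V ^ 2 * (8 + 8 * (D ^ 2 * C))) (by positivity)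
    (fun i _ => (measurable_normSq he).const_mul _) hfL
    (fun i hi ω ω' h => by rw [hf]; exact congrArg _ (dependsOn_normSq (hγ i hi) h)) hT hT' hvar
  have hSL : MemLp (fun ω => ∑ i ∈ I, f i ω) 2 (Measure.pi μ) := memLp_finsetSum _ hfL
  have hbias : |∫ ω, ∑ i ∈ I, f i ω ∂(Measure.pi μ) - ∑ i ∈ I, v i * σ i| ≤
      2 * β * V * I.card := by
    rw [integral_finsetSum _ fun i hi => (hfL i hi).integrable one_le_two,
      ← Finset.sum_sub_distrib]
    refine (Finset.abs_sum_le_sum_abs _ _).trans ?_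
    refine (Finset.sum_le_card_nsmul _ _ (2 * β * V) fun i hi => ?_).trans
      (le_of_eq (by rw [nsmul_eq_mul, mul_comm]))
    set G := ∑ j, γ i j ^ 2 with hG
    have hG0 : 0 < G := one_pos.trans_le (hD i hi)
    -- Two sources of bias, the squared offset and an average of the differences `σ j - σ i`. Each
    -- is at most `β`, hence the factor 2.
    have h1 : ∫ ω, normSq e (γ i) (b i) ω ∂(Measure.pi μ) - σ i =
        b i ^ 2 / G + (∑ j, γ i j ^ 2 * (σ j - σ i)) / G := by
      rw [integral_normSq he h4 h0, ← hG]
      simp only [mul_sub, Finset.sum_sub_distrib, ← hσ]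
      rw [← Finset.sum_mul, ← hG]
      field_simp
      ring
    have hβ0 : 0 ≤ β := (by positivity : 0 ≤ b i ^ 2 / G).trans (hb i hi)
    have h2 : |(∑ j, γ i j ^ 2 * (σ j - σ i)) / G| ≤ β := by
      rw [abs_div, abs_of_pos hG0, div_le_iff₀ hG0, hG, Finset.mul_sum]
      refine (Finset.abs_sum_le_sum_abs _ _).trans (Finset.sum_le_sum fun j _ => ?_)
      by_cases hj : j ∈ T i
      · rw [abs_mul, abs_of_nonneg (sq_nonneg _), mul_comm β]
        exact mul_le_mul_of_nonneg_left (hσβ i hi j hj) (sq_nonneg _)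
      · rw [hγ i hi j hj]; simp
    have h3 : ∫ ω, f i ω ∂(Measure.pi μ) - v i * σ i =
        v i * (∫ ω, normSq e (γ i) (b i) ω ∂(Measure.pi μ) - σ i) := by
      rw [hf, integral_const_mul]; ring
    rw [h3, abs_mul, h1]
    have h4 : |b i ^ 2 / G + (∑ j, γ i j ^ 2 * (σ j - σ i)) / G| ≤ 2 * β := by
      refine (abs_add_le _ _).trans ?_
      rw [abs_of_nonneg (by positivity : 0 ≤ b i ^ 2 / G)]
      have := hb i hi
      linarith
    calc |v i| * _ ≤ V * (2 * β) := mul_le_mul (hv i hi) h4 (abs_nonneg _) hV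
      _ = 2 * β * V := by ring
  refine le_trans (measure_mono fun ω hω => ?_) ((meas_ge_le_variance_div_sq hSL ht).trans
    (ENNReal.ofReal_le_ofReal (by gcongr)))
  rw [mem_ofPred_eq] at hω ⊢
  have h5 : ∑ i ∈ I, v i * (normSq e (γ i) (b i) ω - σ i) =
      (∑ i ∈ I, f i ω - ∫ ω, ∑ i ∈ I, f i ω ∂(Measure.pi μ)) +
      (∫ ω, ∑ i ∈ I, f i ω ∂(Measure.pi μ) - ∑ i ∈ I, v i * σ i) := by
    simp only [hf, mul_sub, Finset.sum_sub_distrib]; ring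
  rw [h5] at hω
  have h6 := hω.trans (abs_add_le _ _)
  linarith

end Moments

end LocalDependence

/-! ### Nearest neighbors without ties -/

section NearestNeighbors

variable {n R : ℕ} {X M : Fin n → ℝ} {i j : Fin n}

/-- The candidates that are closer to unit `i` than unit `j` is. -/
noncomputable def closer (X : Fin n → ℝ) (i j : Fin n) : Finset (Fin n) :=
  (candidates X i).filter fun s => |X s - X i| < |X j - X i|

lemma mem_closer {s : Fin n} :
    s ∈ closer X i j ↔ s ∈ candidates X i ∧ |X s - X i| < |X j - X i| := by simp [closer]

lemma neighbors_subset : neighbors R X i ⊆ candidates X i := Finset.filter_subset _ _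

lemma distRank_le_of_le {s : Fin n} (h : |X s - X i| ≤ |X j - X i|) :
    distRank X s i ≤ distRank X j i :=
  Finset.card_le_card (Finset.monotone_filter_right _ fun _ _ hd => le_trans hd h)

lemma distRank_lt_of_lt {s : Fin n} (hj : j ∈ candidates X i) (h : |X s - X i| < |X j - X i|) :
    distRank X s i < distRank X j i := by
  refine Finset.card_lt_card ((Finset.ssubset_iff_of_subset
    (Finset.monotone_filter_right _ fun _ _ hd => le_trans hd h.le)).2 ⟨|X j - X i|, ?_, ?_⟩)
  · exact Finset.mem_filter.2 ⟨Finset.mem_image_of_mem _ hj, le_rfl⟩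
  · intro hc
    exact absurd (Finset.mem_filter.1 hc).2 (not_le.2 h)

lemma closer_eq_withinRank (hj : j ∈ candidates X i) :
    closer X i j = withinRank X i (distRank X j i - 1) := by
  have h1 := one_le_distRank hj
  ext s
  rw [mem_closer, mem_withinRank]
  refine and_congr_right fun _ => ⟨fun h => ?_, fun h => ?_⟩
  · have := distRank_lt_of_lt hj h
    omega
  · by_contra! hc
    have := distRank_le_of_le (X := X) hc
    omega

lemma withinRank_card : withinRank X i n = candidates X i := by
  refine Finset.filter_true_of_mem fun j _ => ?_
  calc distRank X j i ≤ _ := Finset.card_filter_le _ _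
    _ ≤ (candidates X i).card := Finset.card_image_le
    _ ≤ n := (Finset.card_le_univ _).trans_eq (Fintype.card_fin n)

/-- The cutoff rank is the first at which `R` candidates are collected, and the candidates of
smaller rank than `j` are those of `closer X i j`. With fewer than `R` candidates the infimum is `0`
by convention, and there are no neighbors. -/
lemma mem_neighbors_iff : j ∈ neighbors R X i ↔
    j ∈ candidates X i ∧ R ≤ (candidates X i).card ∧ (closer X i j).card < R := by
  rw [neighbors, mem_withinRank]
  refine and_congr_right fun hj => ?_
  have h1 := one_le_distRank hj
  rw [closer_eq_withinRank hj]
  by_cases hR : R ≤ (candidates X i).card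
  · have hne : {Q : ℕ | R ≤ (withinRank X i Q).card}.Nonempty :=
      ⟨n, by change R ≤ _; rwa [withinRank_card]⟩
    have hmem : R ≤ (withinRank X i (sInf {Q : ℕ | R ≤ (withinRank X i Q).card})).card :=
      Nat.sInf_mem hne
    refine ⟨fun h => ⟨hR, ?_⟩, fun h => ?_⟩
    · by_contra! hc
      have : sInf {Q : ℕ | R ≤ (withinRank X i Q).card} ≤ distRank X j i - 1 := Nat.sInf_le hc
      omega
    · by_contra! hc
      have hsub : withinRank X i (sInf {Q : ℕ | R ≤ (withinRank X i Q).card}) ⊆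
          withinRank X i (distRank X j i - 1) :=
        Finset.monotone_filter_right _ fun s _ hs => by omega
      have := Finset.card_le_card hsub
      omega
  · have hemp : {Q : ℕ | R ≤ (withinRank X i Q).card} = ∅ := by
      rw [Set.eq_empty_iff_forall_notMem]
      intro Q hQ
      exact hR (le_trans hQ (Finset.card_le_card (Finset.filter_subset _ _)))
    rw [hemp, Nat.sInf_empty]
    exact ⟨fun h => by omega, fun h => absurd h.1 hR⟩

lemma le_card_neighbors (hR : R ≤ (candidates X i).card) : R ≤ (neighbors R X i).card := by
  have hne : {Q : ℕ | R ≤ (withinRank X i Q).card}.Nonempty :=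
    ⟨n, by change R ≤ _; rwa [withinRank_card]⟩
  exact Nat.sInf_mem hne

/-- Neighbors are within any distance within which there are sufficiently many candidates. -/
lemma abs_sub_le_of_mem_neighbors {d : ℝ} {T : Finset (Fin n)} (hT : T ⊆ candidates X i)
    (hR : R ≤ T.card) (hd : ∀ s ∈ T, |X s - X i| ≤ d) (hj : j ∈ neighbors R X i) :
    |X j - X i| ≤ d := by
  by_contra! hc
  have h1 := (mem_neighbors_iff.1 hj).2.2
  have h2 : T ⊆ closer X i j := fun s hs => mem_closer.2 ⟨hT hs, (hd s hs).trans_lt hc⟩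
  have := Finset.card_le_card h2
  omega

/-- All other elements of `A` lie strictly below the one with the largest value. -/
lemma card_le_of_card_lt {Y : Fin n → ℝ} (hY : Function.Injective Y) {A : Finset (Fin n)}
    (hA : ∀ k ∈ A, (A.filter fun s => Y s < Y k).card < R) : A.card ≤ R := by
  rcases A.eq_empty_or_nonempty with h | h
  · simp [h]
  · obtain ⟨k, hk, hmax⟩ := A.exists_max_image Y h
    have h1 : A.erase k ⊆ A.filter fun s => Y s < Y k := fun s hs => by
      obtain ⟨h2, h3⟩ := Finset.mem_erase.1 hs
      exact Finset.mem_filter.2 ⟨h3, lt_of_le_of_ne (hmax s h3) fun h => h2 (hY h)⟩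
    have h2 := Finset.card_le_card h1
    rw [Finset.card_erase_of_mem hk] at h2
    have := hA k hk
    omega

/-- Treat the neighbors to the left and to the right of `X i` separately: for the farthest on one
side, all others on that side are strictly closer. -/
lemma card_neighbors_le (hX : Function.Injective X) : (neighbors R X i).card ≤ 2 * R := by
  have h1 : ((neighbors R X i).filter fun j => X i < X j).card ≤ R := by
    refine card_le_of_card_lt hX fun k hk => ?_
    obtain ⟨hk1, hk2⟩ := Finset.mem_filter.1 hk
    refine lt_of_le_of_lt (Finset.card_le_card fun s hs => ?_) (mem_neighbors_iff.1 hk1).2.2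
    obtain ⟨hs1, hs2⟩ := Finset.mem_filter.1 hs
    obtain ⟨hs3, hs4⟩ := Finset.mem_filter.1 hs1
    refine mem_closer.2 ⟨neighbors_subset hs3, ?_⟩
    rw [abs_of_pos (by linarith), abs_of_pos (by linarith)]; linarith
  have h2 : ((neighbors R X i).filter fun j => ¬ X i < X j).card ≤ R := by
    refine card_le_of_card_lt (neg_injective.comp hX) fun k hk => ?_
    obtain ⟨hk1, hk2⟩ := Finset.mem_filter.1 hk
    refine lt_of_le_of_lt (Finset.card_le_card fun s hs => ?_) (mem_neighbors_iff.1 hk1).2.2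
    obtain ⟨hs1, hs2⟩ := Finset.mem_filter.1 hs
    obtain ⟨hs3, hs4⟩ := Finset.mem_filter.1 hs1
    simp only [Function.comp_apply, neg_lt_neg_iff] at hs2
    refine mem_closer.2 ⟨neighbors_subset hs3, ?_⟩
    rw [abs_of_nonpos (by linarith), abs_of_nonpos (by linarith)]; linarith
  have := Finset.card_filter_add_card_filter_not (s := neighbors R X i) (fun j => X i < X j)
  omega

/-- Of the units on one side of `X j` that have `j` as a neighbor, the farthest sees all others
between itself and `X j`. They are closer candidates, and fewer than `R` of these are allowed. -/
lemma card_neighbor_of_le (hX : Function.Injective X) (j : Fin n) :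
    (Finset.univ.filter fun i => j ∈ neighbors R X i).card ≤ 2 * R := by
  set A := Finset.univ.filter fun i => j ∈ neighbors R X i with hA
  have memA : ∀ k, k ∈ A ↔ j ∈ neighbors R X k := fun k => by simp [hA]
  have sgn : ∀ k s, k ∈ A → (X j < X s ∧ X s < X k ∨ X k < X s ∧ X s < X j) →
      s ∈ closer X k j := by
    intro k s hk hs
    have h1 := (mem_candidates.1 (neighbors_subset ((memA k).1 hk))).2
    refine mem_closer.2 ⟨mem_candidates.2 ⟨?_, ?_⟩, ?_⟩
    · rintro rfl
      rcases hs with h | h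
      · exact lt_irrefl _ h.2
      · exact lt_irrefl _ h.1
    · rcases mul_pos_iff.1 h1 with ⟨h2, h3⟩ | ⟨h2, h3⟩
      · exact mul_pos (by rcases hs with h | h <;> linarith) h3
      · exact mul_pos_of_neg_of_neg (by rcases hs with h | h <;> linarith) h3
    · rcases hs with h | h
      · rw [abs_of_neg (by linarith), abs_of_neg (by linarith)]; linarith
      · rw [abs_of_pos (by linarith), abs_of_pos (by linarith)]; linarith
  have h1 : (A.filter fun i => X j < X i).card ≤ R := by
    refine card_le_of_card_lt hX fun k hk => ?_
    obtain ⟨hk1, hk2⟩ := Finset.mem_filter.1 hk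
    refine lt_of_le_of_lt (Finset.card_le_card fun s hs => ?_)
      (mem_neighbors_iff.1 ((memA k).1 hk1)).2.2
    obtain ⟨hs1, hs2⟩ := Finset.mem_filter.1 hs
    exact sgn k s hk1 (Or.inl ⟨(Finset.mem_filter.1 hs1).2, hs2⟩)
  have h2 : (A.filter fun i => ¬ X j < X i).card ≤ R := by
    refine card_le_of_card_lt (neg_injective.comp hX) fun k hk => ?_
    obtain ⟨hk1, hk2⟩ := Finset.mem_filter.1 hk
    refine lt_of_le_of_lt (Finset.card_le_card fun s hs => ?_)
      (mem_neighbors_iff.1 ((memA k).1 hk1)).2.2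
    obtain ⟨hs1, hs2⟩ := Finset.mem_filter.1 hs
    simp only [Function.comp_apply, neg_lt_neg_iff] at hs2
    obtain ⟨hs3, hs4⟩ := Finset.mem_filter.1 hs1
    refine sgn k s hk1 (Or.inr ⟨hs2, lt_of_le_of_ne (not_lt.1 hs4) fun h => ?_⟩)
    rw [hX h] at hs3
    exact (mem_candidates.1 (neighbors_subset ((memA j).1 hs3))).1 rfl
  have := Finset.card_filter_add_card_filter_not (s := A) (fun i => X j < X i)
  omega

/-! ### The prediction error as a linear form -/

/-- The coefficients of the local linear prediction from the units in `N`. -/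
noncomputable def predW (X : Fin n → ℝ) (N : Finset (Fin n)) (i : Fin n) : Fin n → ℝ :=
  llW (fun j => if j ∈ N then 1 else 0) (fun j => X j - X i)

/-- The coefficients of the local linear prediction error. -/
noncomputable def errW (X : Fin n → ℝ) (N : Finset (Fin n)) (i j : Fin n) : ℝ :=
  if j = i then 1 else -predW X N i j

variable {N : Finset (Fin n)}

lemma powSum_indicator (y : Fin n → ℝ) (p : ℕ) :
    powSum (fun j => if j ∈ N then (1 : ℝ) else 0) y p = ∑ j ∈ N, y j ^ p := by
  simp [powSum, Finset.sum_ite_mem]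

lemma predW_of_notMem (hj : j ∉ N) : predW X N i j = 0 := by
  simp [predW, llW, hj]

lemma errW_of_notMem (hj : j ∉ insert i N) : errW X N i j = 0 := by
  rw [Finset.mem_insert, not_or] at hj
  rw [errW, if_neg hj.1, predW_of_notMem hj.2, neg_zero]

lemma sum_errW_mul (hi : i ∉ N) (f : Fin n → ℝ) :
    ∑ j, errW X N i j * f j = f i - ∑ j, predW X N i j * f j := by
  have : ∀ j, errW X N i j * f j = (if j = i then f j else 0) - predW X N i j * f j := by
    intro j
    rw [errW]
    split_ifs with h
    · rw [h, predW_of_notMem hi]; ring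
    · ring
  simp_rw [this, Finset.sum_sub_distrib, Finset.sum_ite_eq', Finset.mem_univ, if_true]

lemma sum_errW_sq (hi : i ∉ N) :
    ∑ j, errW X N i j ^ 2 = 1 + ∑ j, predW X N i j ^ 2 := by
  have : ∀ j, errW X N i j ^ 2 = (if j = i then 1 else 0) + predW X N i j ^ 2 := by
    intro j
    rw [errW]
    split_ifs with h
    · rw [h, predW_of_notMem hi]; ring
    · ring
  simp_rw [this, Finset.sum_add_distrib, Finset.sum_ite_eq', Finset.mem_univ, if_true]

lemma llDet_indicator_ne_zero (hX : Function.Injective X) (hN : 2 ≤ N.card) :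
    llDet (fun j => if j ∈ N then (1 : ℝ) else 0) (fun j => X j - X i) ≠ 0 := by
  obtain ⟨a, ha, b, hb, hab⟩ := Finset.one_lt_card.1 hN
  have h1 := two_mul_llDet (k := fun j => if j ∈ N then (1 : ℝ) else 0)
    (y := fun j => X j - X i)
  have hnn : ∀ s t : Fin n, (0 : ℝ) ≤ (if s ∈ N then (1 : ℝ) else 0) * (if t ∈ N then 1 else 0) *
      ((X s - X i) - (X t - X i)) ^ 2 := fun s t => by
    refine mul_nonneg (mul_nonneg ?_ ?_) (sq_nonneg _) <;> split_ifs <;> norm_num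
  have h2 : 0 < (X a - X b) ^ 2 := by
    have := sub_ne_zero.2 (hX.ne hab)
    positivity
  have h3 : (X a - X b) ^ 2 ≤ ∑ s, ∑ t, (if s ∈ N then (1 : ℝ) else 0) *
      (if t ∈ N then 1 else 0) * ((X s - X i) - (X t - X i)) ^ 2 := by
    calc (X a - X b) ^ 2 = (if a ∈ N then (1 : ℝ) else 0) *
          (if b ∈ N then 1 else 0) * ((X a - X i) - (X b - X i)) ^ 2 := by
          rw [if_pos ha, if_pos hb]; ring
      _ ≤ ∑ t, (if a ∈ N then (1 : ℝ) else 0) *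
          (if t ∈ N then 1 else 0) * ((X a - X i) - (X t - X i)) ^ 2 :=
          Finset.single_le_sum (fun t _ => hnn a t) (Finset.mem_univ b)
      _ ≤ _ := Finset.single_le_sum (f := fun s => ∑ t, (if s ∈ N then (1 : ℝ) else 0) *
          (if t ∈ N then 1 else 0) * ((X s - X i) - (X t - X i)) ^ 2)
          (fun s _ => Finset.sum_nonneg fun t _ => hnn s t) (Finset.mem_univ a)
  intro h0
  rw [h0] at h1
  linarith

/-- Centering the regressor at `X i` preserves the determinant and turns the prediction at `X i`
into an intercept, so that the theory of `llW` applies. -/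
lemma det_regMatrix : (regMatrix (fun j => lin (X j)) N).det =
    llDet (fun j => if j ∈ N then (1 : ℝ) else 0) (fun j => X j - X i) := by
  rw [Matrix.det_fin_two, llDet, powSum_indicator, powSum_indicator, powSum_indicator]
  simp only [regMatrix, Matrix.sum_apply, Matrix.vecMulVec_apply, lin, Matrix.cons_val_zero,
    Matrix.cons_val_one, mul_one, one_mul, pow_zero, pow_one, sub_sq, Finset.sum_add_distrib,
    Finset.sum_sub_distrib, Finset.sum_const, nsmul_eq_mul, ← Finset.sum_mul, ← Finset.mul_sum]
  simp only [← sq]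
  ring

lemma dotProduct_regMatrix_inv (v : Fin 2 → ℝ) : dotProduct (lin (X i))
    ((regMatrix (fun j => lin (X j)) N)⁻¹.mulVec v) =
    ((∑ j ∈ N, (X j - X i) ^ 2) * v 0 - (∑ j ∈ N, (X j - X i)) * (v 1 - X i * v 0)) /
      llDet (fun j => if j ∈ N then (1 : ℝ) else 0) (fun j => X j - X i) := by
  rw [Matrix.inv_def, Ring.inverse_eq_inv', det_regMatrix (i := i), Matrix.adjugate_fin_two,
    Matrix.smul_mulVec, dotProduct_smul, div_eq_inv_mul, smul_eq_mul]
  congr 1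
  simp only [regMatrix, Matrix.sum_apply, Matrix.vecMulVec_apply, lin, Matrix.cons_val_zero,
    Matrix.cons_val_one, mul_one, one_mul, sub_sq, Finset.sum_add_distrib, dotProduct,
    Fin.sum_univ_two, Matrix.mulVec, Matrix.of_apply, Matrix.cons_val', Matrix.cons_val_fin_one,
    Finset.sum_sub_distrib, Finset.sum_const, nsmul_eq_mul, ← Finset.sum_mul, ← Finset.mul_sum]
  simp only [← sq]
  ring

lemma linPred_eq : linPred (fun j => lin (X j)) N M i = ∑ j, predW X N i j * M j := by
  rw [linPred, dotProduct_regMatrix_inv]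
  have e : ∀ j, predW X N i j * M j = if j ∈ N then
      ((∑ s ∈ N, (X s - X i) ^ 2) - (∑ s ∈ N, (X s - X i)) * (X j - X i)) /
      llDet (fun j => if j ∈ N then (1 : ℝ) else 0) (fun j => X j - X i) * M j else 0 := by
    intro j
    rw [predW, llW, powSum_indicator, powSum_indicator]
    split_ifs <;> simp
  simp_rw [e]
  rw [Finset.sum_ite_mem, Finset.univ_inter]
  simp only [Finset.sum_apply, Pi.smul_apply, smul_eq_mul, lin, Matrix.cons_val_zero,
    Matrix.cons_val_one, mul_one]
  rw [Finset.mul_sum, Finset.mul_sum, ← Finset.sum_sub_distrib, Finset.mul_sum,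
    ← Finset.sum_sub_distrib, Finset.sum_div]
  refine Finset.sum_congr rfl fun j _ => ?_
  ring

/-- Writing out one factor of each squared weight and using that the weights have total one and
first moment zero, the sum of squares reduces to S₂ / D. The leverage at the centered origin is the
same. -/
lemma leverage_eq (hD : llDet (fun j => if j ∈ N then (1 : ℝ) else 0) (fun j => X j - X i) ≠ 0) :
    leverage (fun j => lin (X j)) N i = ∑ j, predW X N i j ^ 2 := by
  rw [leverage, dotProduct_regMatrix_inv]
  have e : ∀ j, predW X N i j ^ 2 = (llW (fun j => if j ∈ N then (1 : ℝ) else 0)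
      (fun j => X j - X i) j * (∑ s ∈ N, (X s - X i) ^ 2) - (∑ s ∈ N, (X s - X i)) *
      (llW (fun j => if j ∈ N then (1 : ℝ) else 0)
      (fun j => X j - X i) j * (X j - X i))) /
      llDet (fun j => if j ∈ N then (1 : ℝ) else 0) (fun j => X j - X i) := by
    intro j
    rw [predW, llW, powSum_indicator, powSum_indicator]
    by_cases h : j ∈ N
    · simp only [h, if_true, pow_one, one_mul]; ring
    · simp [h]
  generalize (∑ s ∈ N, (X s - X i) ^ 2) = s₂ at e ⊢
  generalize (∑ s ∈ N, (X s - X i)) = s₁ at e ⊢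
  simp_rw [e]
  rw [← Finset.sum_div, Finset.sum_sub_distrib, ← Finset.sum_mul, ← Finset.mul_sum, sum_llW hD,
    sum_llW_mul]
  simp [lin]

/-- Without ties, the variance estimator is the normalized square of the prediction error. -/
lemma nnVariance_eq (hX : Function.Injective X) (hR : 2 ≤ R) (hc : R ≤ (candidates X i).card) :
    nnVariance R X M i = (∑ j, errW X (neighbors R X i) i j * M j) ^ 2 /
      ∑ j, errW X (neighbors R X i) i j ^ 2 := by
  have h2 : 2 ≤ (neighbors R X i).card := hR.trans (le_card_neighbors hc)
  have hi : i ∉ neighbors R X i := fun h => (mem_candidates.1 (neighbors_subset h)).1 rfl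
  rw [nnVariance, if_pos (by rwa [Finset.card_image_of_injective _ hX]), scaledSqError, linPred_eq,
    leverage_eq (llDet_indicator_ne_zero hX h2), sum_errW_mul hi, sum_errW_sq hi, div_mul_eq_mul_div,
    one_mul]

/-- The bias of the prediction is of second order. -/
lemma sq_sum_errW_mul_div_le (hX : Function.Injective X) (hi : i ∉ N) (hN : 2 ≤ N.card)
    {f : Fin n → ℝ} {s B d : ℝ} (hf : ∀ j ∈ N, |f j - f i - s * (X j - X i)| ≤ B * d ^ 2) :
    (∑ j, errW X N i j * f j) ^ 2 / ∑ j, errW X N i j ^ 2 ≤ N.card * (B * d ^ 2) ^ 2 := by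
  have hD := llDet_indicator_ne_zero (i := i) hX hN
  have h1 : ∑ j, predW X N i j = 1 := sum_llW hD
  have h2 : ∑ j, predW X N i j * (X j - X i) = 0 := sum_llW_mul
  -- The prediction reproduces linear functions, so only second-order remainders survive.
  -- Cauchy-Schwarz against the normalization then makes the size of the coefficients irrelevant.
  have h3 : ∑ j, errW X N i j * f j = -∑ j ∈ N, predW X N i j * (f j - f i - s * (X j - X i)) := by
    have : ∑ j ∈ N, predW X N i j * (f j - f i - s * (X j - X i)) =
        ∑ j, predW X N i j * (f j - f i - s * (X j - X i)) :=
      Finset.sum_subset (Finset.subset_univ N) fun j _ hj => by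
        rw [predW_of_notMem hj, zero_mul]
    rw [this, sum_errW_mul hi]
    have e : ∀ j, predW X N i j * (f j - f i - s * (X j - X i)) = predW X N i j * f j -
        predW X N i j * f i - s * (predW X N i j * (X j - X i)) := fun j => by ring
    simp_rw [e, Finset.sum_sub_distrib, ← Finset.sum_mul, ← Finset.mul_sum, h1, h2]
    ring
  have hS := sum_errW_sq (X := X) hi
  have hH : 0 ≤ ∑ j, predW X N i j ^ 2 := Finset.sum_nonneg fun _ _ => sq_nonneg _
  have hpos : 0 < ∑ j, errW X N i j ^ 2 := by rw [hS]; linarith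
  rw [div_le_iff₀ hpos, h3, neg_sq]
  refine (Finset.sum_mul_sq_le_sq_mul_sq N _ _).trans ?_
  rw [mul_comm]
  refine mul_le_mul ?_ ?_ (Finset.sum_nonneg fun _ _ => sq_nonneg _) (by positivity)
  · rw [← nsmul_eq_mul]
    refine Finset.sum_le_card_nsmul _ _ _ fun j hj => ?_
    rw [← sq_abs]
    exact pow_le_pow_left₀ (abs_nonneg _) (hf j hj) 2
  · rw [hS]
    refine le_trans ?_ (le_add_of_nonneg_left zero_le_one)
    exact Finset.sum_le_univ_sum_of_nonneg fun _ => sq_nonneg _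

end NearestNeighbors

/-! ### Conditioning on the running variable -/

section Conditioning

variable {PX : Measure ℝ} [IsProbabilityMeasure PX]
  {κ : (ℝ → ℝ) × (ℝ → ℝ) → Kernel ℝ (ℝ × ℝ)} [∀ m, IsMarkovKernel (κ m)]

lemma ae_pi_of_ae {p : ℝ → Prop} (hp : ∀ᵐ x ∂PX, p x) (n : ℕ) :
    ∀ᵐ X ∂(Measure.pi fun _ : Fin n => PX), ∀ i, p (X i) :=
  ae_all_iff.2 fun i => (Measure.tendsto_eval_ae_ae (μ := fun _ : Fin n => PX) (i := i)) hp

lemma ae_injective [NullSingletonClass PX] (n : ℕ) :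
    ∀ᵐ X ∂(Measure.pi fun _ : Fin n => PX), Function.Injective X := by
  have h : ∀ i j : Fin n, ∀ᵐ X ∂(Measure.pi fun _ : Fin n => PX), i ≠ j → X i ≠ X j := by
    intro i j
    by_cases hij : i = j
    · exact Eventually.of_forall fun X h => absurd hij h
    have hind : IndepFun (fun X : Fin n → ℝ => X i) (fun X => X j)
        (Measure.pi fun _ : Fin n => PX) :=
      (iIndepFun_pi (μ := fun _ : Fin n => PX) (X := fun _ => id)
        fun _ => aemeasurable_id).indepFun hij
    have hmap := (indepFun_iff_map_prod_eq_prod_map_map (measurable_pi_apply i).aemeasurable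
      (measurable_pi_apply j).aemeasurable).1 hind
    have e : ∀ k : Fin n, (Measure.pi fun _ : Fin n => PX).map (fun X => X k) = PX := fun k =>
      (measurePreserving_eval (fun _ : Fin n => PX) k).map_eq
    rw [e, e] at hmap
    have h1 : ∀ᵐ z ∂(PX.prod PX), z.1 ≠ z.2 := by
      have hm : MeasurableSet {z : ℝ × ℝ | z.1 ≠ z.2} :=
        (measurableSet_eq_fun measurable_fst measurable_snd).compl
      rw [Measure.ae_prod_iff_ae_ae hm]
      exact Eventually.of_forall fun x => by
        rw [ae_iff]
        have : {y : ℝ | ¬ x ≠ y} = {x} := by ext y; simp [eq_comm]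
        rw [this, measure_singleton]
    rw [← hmap] at h1
    filter_upwards [ae_of_ae_map (by fun_prop) h1] with X hX _ using hX
  have h2 : ∀ᵐ X ∂(Measure.pi fun _ : Fin n => PX), ∀ i j, i ≠ j → X i ≠ X j :=
    ae_all_iff.2 fun i => ae_all_iff.2 fun j => h i j
  filter_upwards [h2] with X hX i j hij
  by_contra hne
  exact hX i j hne hij

/-- Disintegration of the law of the sample with respect to the running variable. -/
lemma sampleLaw_eq_lintegral (m : (ℝ → ℝ) × (ℝ → ℝ)) (n : ℕ) {E : Set (Fin n → Obs)}
    (hE : MeasurableSet E) : sampleLaw PX κ m n E =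
      ∫⁻ X, Measure.pi (fun i => κ m (X i)) {y | (fun i => (X i, y i)) ∈ E}
        ∂(Measure.pi fun _ => PX) := by
  -- Outcomes are written as `g x u` with uniform noise `u` independent of `x`. The sample law
  -- becomes the image of a product measure, and the disintegration is Tonelli's theorem.
  obtain ⟨g, hg, hgκ⟩ := Kernel.exists_measurable_map_eq_unitInterval (κ m)
  have hgx : ∀ x, Measurable (g x) := fun x => hg.comp (measurable_const.prodMk measurable_id)
  have hψ : Measurable fun z : ℝ × unitInterval => (z.1, g z.1 z.2) :=
    measurable_fst.prodMk hg
  have hmap : PX ⊗ₘ κ m = (PX.prod volume).map fun z : ℝ × unitInterval => (z.1, g z.1 z.2) := by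
    ext s hs
    rw [Measure.compProd_apply hs, Measure.map_apply hψ hs, Measure.prod_apply (hψ hs)]
    refine lintegral_congr fun x => ?_
    rw [← hgκ x, Measure.map_apply (hgx x) (measurable_prodMk_left hs)]
    rfl
  have h1 : sampleLaw PX κ m n = (Measure.pi fun _ : Fin n => PX.prod volume).map
      fun (z : Fin n → ℝ × unitInterval) i => ((z i).1, g (z i).1 (z i).2) := by
    rw [sampleLaw, Measure.pi_map_pi (fun _ => hψ.aemeasurable)]
    simp only [hmap]
  have hΨ : Measurable fun (z : Fin n → ℝ × unitInterval) i => ((z i).1, g (z i).1 (z i).2) :=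
    measurable_pi_lambda _ fun i => hψ.comp (measurable_pi_apply i)
  have hmp := measurePreserving_arrowProdEquivProdArrow ℝ unitInterval (Fin n) (fun _ => PX)
    (fun _ => volume)
  have hΦ : Measurable fun (w : (Fin n → ℝ) × (Fin n → unitInterval)) (i : Fin n) =>
      (w.1 i, g (w.1 i) (w.2 i)) :=
    measurable_pi_lambda _ fun i => hψ.comp
      (show Measurable fun w : (Fin n → ℝ) × (Fin n → unitInterval) => (w.1 i, w.2 i) by fun_prop)
  rw [h1, Measure.map_apply hΨ hE]
  have h2 : (fun (z : Fin n → ℝ × unitInterval) i => ((z i).1, g (z i).1 (z i).2)) ⁻¹' E =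
      (MeasurableEquiv.arrowProdEquivProdArrow ℝ unitInterval (Fin n)) ⁻¹'
        ((fun (w : (Fin n → ℝ) × (Fin n → unitInterval)) (i : Fin n) =>
          (w.1 i, g (w.1 i) (w.2 i))) ⁻¹' E) := rfl
  rw [h2, hmp.measure_preimage (hΦ hE).nullMeasurableSet, Measure.prod_apply (hΦ hE)]
  refine lintegral_congr fun X => ?_
  have h3 : Measure.pi (fun i => κ m (X i)) = (Measure.pi fun _ : Fin n => volume).map
      fun (u : Fin n → unitInterval) i => g (X i) (u i) := by
    rw [Measure.pi_map_pi (fun i => (hgx (X i)).aemeasurable)]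
    simp only [hgκ]
  have hu : Measurable fun (u : Fin n → unitInterval) i => g (X i) (u i) :=
    measurable_pi_lambda _ fun i => (hgx (X i)).comp (measurable_pi_apply i)
  have hEX : MeasurableSet {y : Fin n → ℝ × ℝ | (fun i => (X i, y i)) ∈ E} :=
    (show Measurable fun (y : Fin n → ℝ × ℝ) i => (X i, y i) by fun_prop) hE
  rw [h3, Measure.map_apply hu hEX]
  rfl

lemma sampleLaw_le_of_ae (m : (ℝ → ℝ) × (ℝ → ℝ)) (n : ℕ) {E : Set (Fin n → Obs)}
    (hE : MeasurableSet E) {ε : ℝ≥0∞}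
    (h : ∀ᵐ X ∂(Measure.pi fun _ : Fin n => PX),
      Measure.pi (fun i => κ m (X i)) {y | (fun i => (X i, y i)) ∈ E} ≤ ε) :
    sampleLaw PX κ m n E ≤ ε := by
  rw [sampleLaw_eq_lintegral m n hE]
  refine (lintegral_mono_ae h).trans ?_
  simp

lemma ae_runVar {m : (ℝ → ℝ) × (ℝ → ℝ)} {n : ℕ} {p : (Fin n → ℝ) → Prop}
    (hp : ∀ᵐ X ∂(Measure.pi fun _ : Fin n => PX), p X) :
    ∀ᵐ S ∂(sampleLaw PX κ m n), p (runVar S) := by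
  have h1 : (sampleLaw PX κ m n).map runVar = Measure.pi fun _ : Fin n => PX := by
    rw [sampleLaw]
    have h2 : (PX ⊗ₘ κ m).map Prod.fst = PX := Measure.fst_compProd PX (κ m)
    have : SigmaFinite ((PX ⊗ₘ κ m).map Prod.fst) := by rw [h2]; infer_instance
    have := Measure.pi_map_pi (μ := fun _ : Fin n => PX ⊗ₘ κ m) (f := fun _ => Prod.fst)
      (fun _ => measurable_fst.aemeasurable)
    rw [h2] at this
    exact this
  rw [← h1] at hp
  refine ae_of_ae_map ?_ hp
  exact (measurable_pi_lambda _ fun i => measurable_fst.comp (measurable_pi_apply i)).aemeasurable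

end Conditioning

/-! ### Measurability -/

section Measurability

variable {n : ℕ}

lemma measurable_card_filter {α : Type*} [MeasurableSpace α] {p : Fin n → α → Prop}
    [∀ x, DecidablePred fun s => p s x] (hp : ∀ s, MeasurableSet {x | p s x}) :
    Measurable fun x => (Finset.univ.filter fun s => p s x).card := by
  classical
  have : (fun x => (Finset.univ.filter fun s => p s x).card) =
      fun x => ∑ s, if p s x then 1 else 0 := by
    funext x
    rw [Finset.card_filter]
  rw [this]
  exact Finset.measurable_fun_sum _ fun s _ =>
    Measurable.ite (hp s) measurable_const measurable_const

lemma measurableSet_mem_candidates (i s : Fin n) :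
    MeasurableSet {X : Fin n → ℝ | s ∈ candidates X i} := by
  simp only [mem_candidates]
  refine (MeasurableSet.const _).inter ?_
  exact measurableSet_lt measurable_const
    (show Measurable fun X : Fin n → ℝ => X s * X i by fun_prop)

lemma measurableSet_mem_neighbors (R : ℕ) (i j : Fin n) :
    MeasurableSet {X : Fin n → ℝ | j ∈ neighbors R X i} := by
  classical
  simp only [mem_neighbors_iff]
  have h1 : ∀ X : Fin n → ℝ, candidates X i = Finset.univ.filter fun s => s ∈ candidates X i :=
    fun X => by ext s; simp
  have h2 : ∀ X : Fin n → ℝ, closer X i j = Finset.univ.filter fun s =>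
      s ∈ candidates X i ∧ |X s - X i| < |X j - X i| := fun X => by
    ext s; simp [mem_closer]
  have m1 : Measurable fun X : Fin n → ℝ => (candidates X i).card := by
    rw [show (fun X : Fin n → ℝ => (candidates X i).card) = _ from
      funext fun X => congrArg Finset.card (h1 X)]
    exact measurable_card_filter fun s => measurableSet_mem_candidates i s
  have m2 : Measurable fun X : Fin n → ℝ => (closer X i j).card := by
    rw [show (fun X : Fin n → ℝ => (closer X i j).card) = _ from
      funext fun X => congrArg Finset.card (h2 X)]
    refine measurable_card_filter fun s => (measurableSet_mem_candidates i s).inter ?_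
    exact measurableSet_lt (show Measurable fun X : Fin n → ℝ => |X s - X i| by fun_prop)
      (show Measurable fun X : Fin n → ℝ => |X j - X i| by fun_prop)
  exact (measurableSet_mem_candidates i j).inter
    ((measurableSet_le measurable_const m1).inter (measurableSet_lt m2 measurable_const))

lemma measurableSet_neighbors_eq (R : ℕ) (i : Fin n) (N : Finset (Fin n)) :
    MeasurableSet {X : Fin n → ℝ | neighbors R X i = N} := by
  have : {X : Fin n → ℝ | neighbors R X i = N} =
      ⋂ j, {X | j ∈ neighbors R X i ↔ j ∈ N} := by
    ext X
    simp only [mem_ofPred_eq, mem_iInter]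
    exact Finset.ext_iff
  rw [this]
  exact MeasurableSet.iInter fun j => (measurableSet_mem_neighbors R i j).iff (MeasurableSet.const _)

lemma measurable_llW {α : Type*} [MeasurableSpace α] {k y : α → Fin n → ℝ}
    (hk : ∀ i, Measurable fun x => k x i) (hy : ∀ i, Measurable fun x => y x i) (i : Fin n) :
    Measurable fun x => llW (k x) (y x) i := by
  have h : ∀ p, Measurable fun x => powSum (k x) (y x) p := fun p =>
    Finset.measurable_fun_sum _ fun j _ => (hk j).mul ((hy j).pow_const p)
  unfold llW llDet
  exact ((hk i).mul ((h 2).sub ((h 1).mul (hy i)))).div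
    (((h 0).mul (h 2)).sub ((h 1).pow_const 2))

lemma measurable_weight {K : ℝ → ℝ} (hK : IsRegKernel K) (h : ℝ) (i : Fin n) :
    Measurable fun X : Fin n → ℝ => weight K X h i := by
  have hKm := hK.continuous.measurable
  have hside : Measurable indPos ∧ Measurable indNeg :=
    ⟨Measurable.ite measurableSet_Ici measurable_const measurable_const,
      Measurable.ite measurableSet_Iio measurable_const measurable_const⟩
  have hd : ∀ i, Measurable fun X : Fin n → ℝ => dist₀ X i := fun i => by
    unfold dist₀; fun_prop
  have hmass : ∀ side : ℝ → ℝ, Measurable side → ∀ i,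
      Measurable fun X : Fin n → ℝ => mass K side X h i := fun side hs i => by
    unfold mass
    exact (hKm.comp (show Measurable fun X : Fin n → ℝ => X i / h by fun_prop)).mul
      (hs.comp (measurable_pi_apply i))
  simp_rw [weight_eq]
  exact (measurable_llW (hmass _ hside.1) hd i).sub (measurable_llW (hmass _ hside.2) hd i)

/-- The normalized squared prediction error from the neighbors. -/
noncomputable def nnError (R : ℕ) (X M : Fin n → ℝ) (i : Fin n) : ℝ :=
  (∑ j, errW X (neighbors R X i) i j * M j) ^ 2 / ∑ j, errW X (neighbors R X i) i j ^ 2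

lemma measurable_nnError (R : ℕ) (i : Fin n) :
    Measurable fun z : (Fin n → ℝ) × (Fin n → ℝ) => nnError R z.1 z.2 i := by
  classical
  have h1 : ∀ N : Finset (Fin n), ∀ j,
      Measurable fun z : (Fin n → ℝ) × (Fin n → ℝ) => errW z.1 N i j := by
    intro N j
    unfold errW predW
    by_cases hj : j = i
    · simp [hj]
    · simp only [hj, if_false]
      exact (measurable_llW (α := (Fin n → ℝ) × (Fin n → ℝ))
        (k := fun _ j => if j ∈ N then 1 else 0) (y := fun z j => z.1 j - z.1 i)
        (fun _ => measurable_const) (fun j => by fun_prop) j).neg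
  have h2 : ∀ N : Finset (Fin n), Measurable fun z : (Fin n → ℝ) × (Fin n → ℝ) =>
      (∑ j, errW z.1 N i j * z.2 j) ^ 2 / ∑ j, errW z.1 N i j ^ 2 := by
    intro N
    refine Measurable.div (Measurable.pow_const (Finset.measurable_fun_sum _ fun j _ => ?_) 2)
      (Finset.measurable_fun_sum _ fun j _ => (h1 N j).pow_const 2)
    exact (h1 N j).mul (by fun_prop)
  -- The neighborhood takes finitely many values, each on a measurable set, and for a fixed
  -- neighborhood the error is a rational expression.
  have h3 : (fun z : (Fin n → ℝ) × (Fin n → ℝ) => nnError R z.1 z.2 i) = fun z =>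
      ∑ N : Finset (Fin n), if neighbors R z.1 i = N then
        (∑ j, errW z.1 N i j * z.2 j) ^ 2 / ∑ j, errW z.1 N i j ^ 2 else 0 := by
    funext z
    rw [Finset.sum_ite_eq, if_pos (Finset.mem_univ _), nnError]
  rw [h3]
  refine Finset.measurable_fun_sum _ fun N _ => Measurable.ite ?_ (h2 N) measurable_const
  exact measurable_fst (measurableSet_neighbors_eq R i N)

lemma measurable_condMean (κm : Kernel ℝ (ℝ × ℝ)) [IsMarkovKernel κm] (c : ℝ) :
    Measurable (condMean κm c) := by
  have : StronglyMeasurable fun z : ℝ × (ℝ × ℝ) => outcome c z.2 :=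
    ((measurable_outcome c).comp measurable_snd).stronglyMeasurable
  exact (this.integral_kernel_prod_right' (κ := κm)).measurable

lemma measurable_condVariance (κm : Kernel ℝ (ℝ × ℝ)) [IsMarkovKernel κm] (c : ℝ) :
    Measurable (condVariance κm c) := by
  have h1 : Measurable fun z : ℝ × (ℝ × ℝ) => ‖outcome c z.2 - condMean κm c z.1‖ₑ ^ 2 :=
    ((((measurable_outcome c).comp measurable_snd).sub
      ((measurable_condMean κm c).comp measurable_fst)).enorm).pow_const 2
  exact (h1.lintegral_kernel_prod_right' (κ := κm)).ennreal_toReal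

end Measurability

/-! ### The variance estimator for a continuous running variable -/

section ConditionalBound

variable {n R : ℕ} {X : Fin n → ℝ} {κm : Kernel ℝ (ℝ × ℝ)} [IsMarkovKernel κm] {c : ℝ}

lemma nnError_eq_normSq (y : Fin n → ℝ × ℝ) (i : Fin n) :
    nnError R X (fun j => outcome c (y j)) i =
      normSq (fun j yt => outcome c yt - condMean κm c (X j)) (errW X (neighbors R X i) i)
        (∑ j, errW X (neighbors R X i) i j * condMean κm c (X j)) y := by
  rw [nnError, normSq, ← Finset.sum_add_distrib]
  congr 2
  exact Finset.sum_congr rfl fun j _ => by ring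

/-- Every observation near the cutoff has candidates within the distance `H`, provided both sides
have sufficiently many observations. -/
lemma exists_near_candidates (hX0 : ∀ i, X i ≠ 0) {H : ℝ}
    (hpos : R + 1 ≤ (shell indPos X 0 H).card) (hneg : R + 1 ≤ (shell indNeg X 0 H).card)
    {i : Fin n} (hi : |X i| ≤ H) : ∃ T ⊆ candidates X i, R ≤ T.card ∧
      ∀ s ∈ T, |X s - X i| ≤ H := by
  classical
  rcases lt_or_gt_of_ne (hX0 i) with h | h
  · refine ⟨(shell indNeg X 0 H).erase i, fun s hs => ?_, ?_, fun s hs => ?_⟩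
    · obtain ⟨h1, h2⟩ := Finset.mem_erase.1 hs
      refine mem_candidates.2 ⟨h1, mul_pos_of_neg_of_neg ?_ h⟩
      by_contra hc
      have := (mem_shell.1 h2).1
      rw [indNeg, if_neg hc] at this
      exact zero_ne_one this
    · have := Finset.pred_card_le_card_erase (s := shell indNeg X 0 H) (a := i)
      omega
    · obtain ⟨h1, h2⟩ := Finset.mem_erase.1 hs
      obtain ⟨h3, -, h4⟩ := mem_shell.1 h2
      have h5 : X s < 0 := by
        by_contra hc
        rw [indNeg, if_neg hc] at h3
        exact zero_ne_one h3
      rw [abs_of_neg h] at hi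
      rw [abs_of_neg h5] at h4
      rw [abs_le]; constructor <;> linarith
  · refine ⟨(shell indPos X 0 H).erase i, fun s hs => ?_, ?_, fun s hs => ?_⟩
    · obtain ⟨h1, h2⟩ := Finset.mem_erase.1 hs
      refine mem_candidates.2 ⟨h1, mul_pos (lt_of_le_of_ne ?_ (hX0 s).symm) h⟩
      by_contra hc
      have := (mem_shell.1 h2).1
      rw [indPos, if_neg hc] at this
      exact zero_ne_one this
    · have := Finset.pred_card_le_card_erase (s := shell indPos X 0 H) (a := i)
      omega
    · obtain ⟨h1, h2⟩ := Finset.mem_erase.1 hs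
      obtain ⟨h3, -, h4⟩ := mem_shell.1 h2
      have h5 : 0 ≤ X s := by
        by_contra hc
        rw [indPos, if_neg hc] at h3
        exact zero_ne_one h3
      rw [abs_of_pos h] at hi
      rw [abs_of_nonneg h5] at h4
      rw [abs_le]; constructor <;> linarith

/-- Given X, the error of unit `i` depends on `i` and its neighbors only. `2 * R + 1` bounds both
their number and the number of errors that any one observation enters, so the concentration bound
for locally dependent squares applies. `β` collects the second-order bias of the prediction and the
variation of the conditional variance over distances up to `2 * H`. -/
lemma measure_abs_sum_nnError_sub_ge_le (hX : Function.Injective X) (hX0 : ∀ i, X i ≠ 0)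
    (hR : 2 ≤ R) {H B L C V N b τ β : ℝ} {v : Fin n → ℝ}
    (hpos : R + 1 ≤ (shell indPos X 0 H).card) (hneg : R + 1 ≤ (shell indNeg X 0 H).card)
    (hcard : ((Finset.univ.filter fun i => |X i| ≤ H).card : ℝ) ≤ b * N)
    (hv : ∀ i, |v i| ≤ V) (hv0 : ∀ i, H < |X i| → v i = 0)
    (hmean : ∀ i, ∃ s, ∀ j, 0 < X i * X j →
      |condMean κm c (X j) - condMean κm c (X i) - s * (X j - X i)| ≤ B * (X j - X i) ^ 2)
    (hlip : ∀ i j, |X i| ≤ 2 * H → |X j| ≤ 2 * H → 0 < X i * X j →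
      |condVariance κm c (X i) - condVariance κm c (X j)| ≤ L * |X i - X j|)
    (hint : ∀ i, Integrable (outcome c) (κm (X i)))
    (h4 : ∀ i, condCentralMoment κm c 4 (X i) ≤ ENNReal.ofReal C)
    (hC : 0 ≤ C) (hB : 0 ≤ B) (hL : 0 ≤ L) (hV : 0 < V) (hN : 0 < N) (hτ : 0 < τ) (hb : 0 < b)
    (hβ : 2 * R * (B * (2 * H) ^ 2) ^ 2 + L * (2 * H) ≤ β) (hβ1 : β ≤ 1) (hβτ : 4 * β * b ≤ τ) :
    Measure.pi (fun i => κm (X i)) {y | τ * (V * N) ≤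
        |∑ i, v i * (nnError R X (fun j => outcome c (y j)) i - condVariance κm c (X i))|} ≤
      ENNReal.ofReal (4 * b * ((2 * R + 1 : ℕ) ^ 2 * (8 + 8 * ((2 * R + 1 : ℕ) ^ 2 * C))) / τ ^ 2
        * N⁻¹) := by
  classical
  set I := Finset.univ.filter fun i => |X i| ≤ H with hI
  have hIm : ∀ i, i ∈ I ↔ |X i| ≤ H := fun i => by simp [hI]
  have hself : ∀ i, i ∉ neighbors R X i := fun i h => (mem_candidates.1 (neighbors_subset h)).1 rfl
  have hnear : ∀ i ∈ I, R ≤ (neighbors R X i).card ∧ ∀ j ∈ neighbors R X i,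
      |X j| ≤ 2 * H ∧ |X j - X i| ≤ H := by
    intro i hi
    obtain ⟨T, hT1, hT2, hT3⟩ := exists_near_candidates hX0 hpos hneg ((hIm i).1 hi)
    refine ⟨le_card_neighbors (hT2.trans (Finset.card_le_card hT1)), fun j hj => ?_⟩
    have h1 := abs_sub_le_of_mem_neighbors hT1 hT2 (hT3) hj
    have := abs_sub_abs_le_abs_sub (X j) (X i)
    have := (hIm i).1 hi
    exact ⟨by linarith, h1⟩
  have hsame : ∀ i, ∀ j ∈ neighbors R X i, 0 < X i * X j := fun i j hj => by
    rw [mul_comm]; exact (mem_candidates.1 (neighbors_subset hj)).2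
  set D := 2 * R + 1 with hD
  set e : Fin n → ℝ × ℝ → ℝ := fun j yt => outcome c yt - condMean κm c (X j) with he
  have hem : ∀ j, Measurable (e j) := fun j => (measurable_outcome c).sub_const _
  have he4 : ∀ j, ∫⁻ yt, ENNReal.ofReal (e j yt ^ 4) ∂(κm (X j)) ≤ ENNReal.ofReal C := fun j => by
    refine le_of_eq_of_le (lintegral_congr fun yt => ?_) (h4 j)
    have : (4 : ℝ) = ((4 : ℕ) : ℝ) := by norm_num
    rw [this, Real.rpow_natCast, Even.pow_abs (by decide)]
  have he0 : ∀ j, ∫ yt, e j yt ∂(κm (X j)) = 0 := fun j => by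
    rw [he, integral_sub (hint j) (integrable_const _)]
    simp [condMean]
  have hσ : ∀ j, condVariance κm c (X j) = ∫ yt, e j yt ^ 2 ∂(κm (X j)) := fun j => by
    rw [condVariance, variance_eq_integral (measurable_outcome c).aemeasurable]
    rfl
  have hT' : ∀ j, (I.filter fun i => j ∈ insert i (neighbors R X i)).card ≤ D := by
    intro j
    have h1 : (I.filter fun i => j ∈ insert i (neighbors R X i)) ⊆
        insert j (Finset.univ.filter fun i => j ∈ neighbors R X i) := by
      intro i hi
      rcases Finset.mem_insert.1 (Finset.mem_filter.1 hi).2 with h | h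
      · exact Finset.mem_insert.2 (Or.inl h.symm)
      · exact Finset.mem_insert_of_mem (Finset.mem_filter.2 ⟨Finset.mem_univ _, h⟩)
    refine (Finset.card_le_card h1).trans ((Finset.card_insert_le _ _).trans ?_)
    have := card_neighbor_of_le (R := R) hX j
    omega
  have hH0 : ∀ i ∈ I, 0 ≤ H := fun i hi => (abs_nonneg _).trans ((hIm i).1 hi)
  have hβ1' : ∀ i ∈ I, 2 * R * (B * (2 * H) ^ 2) ^ 2 ≤ β ∧ L * (2 * H) ≤ β := fun i hi => by
    have h0 := hH0 i hi
    have h1 : 0 ≤ L * (2 * H) := by positivity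
    have h2 : 0 ≤ 2 * R * (B * (2 * H) ^ 2) ^ 2 := by positivity
    constructor <;> linarith
  have hbias : ∀ i ∈ I, (∑ j, errW X (neighbors R X i) i j * condMean κm c (X j)) ^ 2 /
      ∑ j, errW X (neighbors R X i) i j ^ 2 ≤ β := by
    intro i hi
    obtain ⟨s, hs⟩ := hmean i
    refine (sq_sum_errW_mul_div_le hX (hself i) (hR.trans (hnear i hi).1)
      (f := fun j => condMean κm c (X j)) (s := s) (B := B) (d := 2 * H) fun j hj => ?_).trans ?_
    · refine (hs j (hsame i j hj)).trans (mul_le_mul_of_nonneg_left ?_ hB)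
      rw [← sq_abs]
      have := ((hnear i hi).2 j hj).2
      have := hH0 i hi
      exact pow_le_pow_left₀ (abs_nonneg _) (by linarith) 2
    · refine le_trans ?_ (hβ1' i hi).1
      have : ((neighbors R X i).card : ℝ) ≤ 2 * R := by exact_mod_cast card_neighbors_le hX
      gcongr
  have hmain := measure_abs_sum_normSq_sub_ge_le (μ := fun i => κm (X i)) hem he4 he0 hC
    (γ := fun i => errW X (neighbors R X i) i)
    (b := fun i => ∑ j, errW X (neighbors R X i) i j * condMean κm c (X j)) (v := v)
    (σ := fun j => condVariance κm c (X j)) (T := fun i => insert i (neighbors R X i)) (I := I)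
    (D := D) (β := β) (V := V) (t := τ * (V * N) / 2) hσ
    (fun i _ j hj => errW_of_notMem hj)
    (fun i _ => by
      rw [sum_errW_sq (hself i)]
      exact le_add_of_nonneg_right (Finset.sum_nonneg fun _ _ => sq_nonneg _))
    (fun i _ => (Finset.card_insert_le _ _).trans (by
      have := card_neighbors_le (R := R) (i := i) hX
      omega)) hT' hbias hβ1
    (fun i hi j hj => by
      rcases Finset.mem_insert.1 hj with rfl | hj
      · rw [sub_self, abs_zero]
        have := hH0 _ hi
        exact (by positivity : 0 ≤ L * (2 * H)).trans (hβ1' _ hi).2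
      · rw [abs_sub_comm]
        have h0 := hH0 i hi
        refine (hlip i j (by have := (hIm i).1 hi; linarith) ((hnear i hi).2 j hj).1
          (hsame i j hj)).trans (le_trans (mul_le_mul_of_nonneg_left ?_ hL) (hβ1' i hi).2)
        rw [abs_sub_comm]
        have := ((hnear i hi).2 j hj).2
        linarith) hV.le
    (fun i _ => hv i) (by positivity)
  refine (measure_mono fun y hy => ?_).trans (hmain.trans (ENNReal.ofReal_le_ofReal ?_))
  · rw [mem_ofPred_eq] at hy ⊢
    have h1 : ∑ i, v i * (nnError R X (fun j => outcome c (y j)) i - condVariance κm c (X i)) =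
        ∑ i ∈ I, v i * (normSq e (errW X (neighbors R X i) i)
          (∑ j, errW X (neighbors R X i) i j * condMean κm c (X j)) y -
          condVariance κm c (X i)) := by
      rw [← Finset.sum_subset (Finset.subset_univ I) fun i _ hi => by
        rw [hv0 i (not_le.1 fun h => hi ((hIm i).2 h)), zero_mul]]
      exact Finset.sum_congr rfl fun i _ => by rw [nnError_eq_normSq (κm := κm)]
    rw [h1] at hy
    refine le_trans ?_ hy
    rcases I.eq_empty_or_nonempty with h0 | ⟨i, hi⟩
    · rw [h0]; simp only [Finset.card_empty, Nat.cast_zero, mul_zero, add_zero]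
      have : 0 < τ * (V * N) := by positivity
      linarith
    · have hβ0 : 0 ≤ β := by
        have := hH0 i hi
        exact (by positivity : 0 ≤ L * (2 * H)).trans (hβ1' i hi).2
      -- Half of `τ * (V * N)` is reserved for the random deviation; `4 * β * b ≤ τ` fits the bias
      -- into the other half.
      have h2 : 2 * β * V * I.card ≤ 2 * β * V * (b * N) := by gcongr
      have h3 : 4 * β * b * (V * N) ≤ τ * (V * N) := by gcongr
      linarith
  · calc _ ≤ b * N * ((D : ℝ) ^ 2 * (V ^ 2 * (8 + 8 * ((D : ℝ) ^ 2 * C)))) /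
          (τ * (V * N) / 2) ^ 2 := by gcongr
      _ = _ := by field_simp; ring

end ConditionalBound

/-! ### Consequences of the smoothness conditions -/

/-- Mean value theorem and the Lipschitz derivative. The constant `B` in place of Taylor's `B / 2`
suffices. -/
lemma SecondDerivBounded.abs_sub_sub_le {B : ℝ} {f : ℝ → ℝ} (hf : SecondDerivBounded B f)
    (hB : 0 ≤ B) (x y : ℝ) : |f y - f x - deriv f x * (y - x)| ≤ B * (y - x) ^ 2 := by
  have key : ∀ a b : ℝ, a < b → ∃ z, |z - x| ≤ |a - x| ⊔ |b - x| ∧ f b - f a = deriv f z * (b - a) := by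
    intro a b hab
    obtain ⟨z, hz, hz2⟩ := exists_deriv_eq_slope f hab hf.1.continuous.continuousOn
      hf.1.differentiableOn
    refine ⟨z, ?_, ?_⟩
    · rw [abs_le]
      obtain ⟨h1, h2⟩ := hz
      constructor
      · have := neg_le_of_abs_le (le_max_left |a - x| |b - x|)
        linarith
      · have := le_of_abs_le (le_max_right |a - x| |b - x|)
        linarith
    · rw [hz2, div_mul_cancel₀]
      exact (sub_pos.2 hab).ne'
  have fin : ∀ z, |z - x| ≤ |y - x| → f y - f x = deriv f z * (y - x) →
      |f y - f x - deriv f x * (y - x)| ≤ B * (y - x) ^ 2 := by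
    intro z hz h
    rw [h, ← sub_mul, abs_mul, ← sq_abs (y - x), sq, ← mul_assoc]
    refine mul_le_mul_of_nonneg_right ((hf.2 z x).trans ?_) (abs_nonneg _)
    exact mul_le_mul_of_nonneg_left hz hB
  rcases lt_trichotomy x y with h | h | h
  · obtain ⟨z, h1, h2⟩ := key x y h
    exact fin z (by simpa using h1) h2
  · rw [h]; simp
  · obtain ⟨z, h1, h2⟩ := key y x h
    exact fin z (by simpa using h1) (by linarith)

lemma exists_slope_of_mem_holderClass {B : ℝ} {f : ℝ → ℝ} (hf : f ∈ holderClass B) (hB : 0 ≤ B)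
    (x : ℝ) : ∃ s, ∀ y, 0 < x * y → |f y - f x - s * (y - x)| ≤ B * (y - x) ^ 2 := by
  obtain ⟨f₀, f₁, h0, h1, hfe⟩ := hf
  rcases le_or_gt 0 x with hx | hx
  · refine ⟨deriv f₁ x, fun y hxy => ?_⟩
    have hy : 0 ≤ y := by
      by_contra! hc
      exact absurd hxy (not_lt.2 (mul_nonpos_of_nonneg_of_nonpos hx hc.le))
    rw [hfe, hfe, if_pos hx, if_pos hy]
    exact h1.abs_sub_sub_le hB x y
  · refine ⟨-deriv f₀ x, fun y hxy => ?_⟩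
    have hy : ¬ 0 ≤ y := by
      intro hc
      exact absurd hxy (not_lt.2 (mul_nonpos_of_nonpos_of_nonneg hx.le hc))
    rw [hfe, hfe, if_neg (not_le.2 hx), if_neg hy]
    have := h0.abs_sub_sub_le hB x y
    rw [← abs_neg]
    convert this using 2
    ring

/-! ### Consequences of the population and density conditions -/

section Population

variable {PX : Measure ℝ} [IsProbabilityMeasure PX]
  {κ : (ℝ → ℝ) × (ℝ → ℝ) → Kernel ℝ (ℝ × ℝ)} [∀ m, IsMarkovKernel (κ m)]
  {F : Set ((ℝ → ℝ) × (ℝ → ℝ))}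

lemma IsPopulation.condMean_eq (hpop : IsPopulation PX κ F) {m : (ℝ → ℝ) × (ℝ → ℝ)} (hm : m ∈ F)
    (c : ℝ) : ∀ᵐ x ∂PX, Integrable (outcome c) (κ m x) ∧
      condMean (κ m) c x = m.1 x - c * m.2 x := by
  filter_upwards [hpop m hm] with x ⟨h1, h2, h3, h4⟩
  have hT : Integrable (fun yt : ℝ × ℝ => yt.2) (κ m x) := by
    refine Integrable.of_bound measurable_snd.aestronglyMeasurable 1 ?_
    filter_upwards [h1] with yt h
    rcases h with h | h <;> rw [h] <;> simp
  refine ⟨h2.sub (hT.const_mul c), ?_⟩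
  rw [condMean]
  unfold outcome
  rw [integral_sub h2 (hT.const_mul c), integral_const_mul, h3, h4]

lemma ContinuousRunning.exists_density_bounds (h : ContinuousRunning PX κ F) :
    NullSingletonClass PX ∧ ∃ δ lo hi : ℝ, 0 < δ ∧ 0 < lo ∧ 0 < hi ∧ ∀ a b : ℝ, -δ ≤ a → a ≤ b →
      b ≤ δ → lo * (b - a) ≤ PX.real (Ioo a b) ∧ PX.real (Icc a b) ≤ hi * (b - a) := by
  obtain ⟨f, hf, hPX, δ, lo, hi, hδ, hlo, hbd⟩ := h.density
  have hna : NullSingletonClass PX := by rw [hPX]; infer_instance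
  refine ⟨hna, δ, lo, max hi 1, hδ, hlo, by positivity, fun a b ha hab hb => ?_⟩
  have hIcc : PX (Icc a b) = PX (Ioo a b) := measure_congr Ioo_ae_eq_Icc.symm
  have hI : PX (Ioo a b) = ∫⁻ x in Ioo a b, f x := by
    rw [hPX, withDensity_apply _ measurableSet_Ioo]
  have hsub : Ioo a b ⊆ Ioo (-δ) δ := Ioo_subset_Ioo ha hb
  have hbd' : ∀ᵐ x ∂(volume.restrict (Ioo a b)),
      f x ∈ Icc (ENNReal.ofReal lo) (ENNReal.ofReal hi) :=
    ae_restrict_of_ae_restrict_of_subset hsub hbd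
  have hba : 0 ≤ b - a := sub_nonneg.2 hab
  have hcst : ∀ t : ℝ, ∫⁻ _ in Ioo a b, ENNReal.ofReal t =
      ENNReal.ofReal t * ENNReal.ofReal (b - a) := fun t => by
    rw [lintegral_const, Measure.restrict_apply_univ, Real.volume_Ioo]
  constructor
  · rw [measureReal_def, ← ENNReal.ofReal_le_iff_le_toReal (measure_ne_top _ _), hI,
      ENNReal.ofReal_mul hlo.le, ← hcst]
    exact lintegral_mono_ae (hbd'.mono fun x hx => hx.1)
  · rw [measureReal_def]
    refine ENNReal.toReal_le_of_le_ofReal (by positivity) ?_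
    rw [hIcc, hI, ENNReal.ofReal_mul (by positivity), ← hcst]
    exact lintegral_mono_ae (hbd'.mono fun x hx =>
      hx.2.trans (ENNReal.ofReal_le_ofReal (le_max_left _ _)))

/-- The conditional variance is Lipschitz on either side of the cutoff, on a set of full measure. -/
lemma ContinuousRunning.exists_lipschitz (h : ContinuousRunning PX κ F) (c : ℝ) :
    ∃ δ L : ℝ, 0 < δ ∧ 0 ≤ L ∧ ∀ m ∈ F, ∃ p : ℝ → Prop, (∀ᵐ x ∂PX, p x) ∧
      ∀ x y, p x → p y → |x| < δ → |y| < δ → 0 < x * y →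
        |condVariance (κ m) c x - condVariance (κ m) c y| ≤ L * |x - y| := by
  obtain ⟨-, δ, lo, hi, hδ, hlo, -, hdens⟩ := h.exists_density_bounds
  obtain ⟨L, hL⟩ := h.lipschitz c
  refine ⟨δ, |L|, hδ, abs_nonneg _, fun m hm => ⟨_, hL m hm, ?_⟩⟩
  have main : ∀ x y, x < y → |x| < δ → |y| < δ → 0 < x * y →
      (∀ᵐ z ∂PX, 0 < x * z → |condVariance (κ m) c x - condVariance (κ m) c z| ≤ L * |x - z|) →
      (∀ᵐ z ∂PX, 0 < y * z → |condVariance (κ m) c y - condVariance (κ m) c z| ≤ L * |y - z|) →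
      |condVariance (κ m) c x - condVariance (κ m) c y| ≤ |L| * |x - y| := by
    intro x y hxy hx hy h0 px py
    have hpos : 0 < PX (Ioo x y) := by
      have h1 := (hdens x y (abs_lt.1 hx).1.le hxy.le (abs_lt.1 hy).2.le).1
      have h2 : 0 < lo * (y - x) := mul_pos hlo (sub_pos.2 hxy)
      exact (ENNReal.toReal_pos_iff.1 (h2.trans_le h1)).1
    -- A good point is one comparable with almost every other point. Two good points are compared
    -- through a common `z` between them; its position makes the two distances add up, so the
    -- constant is kept.
    obtain ⟨z, hz, hz1, hz2⟩ : ∃ z ∈ Ioo x y,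
        (0 < x * z → |condVariance (κ m) c x - condVariance (κ m) c z| ≤ L * |x - z|) ∧
        (0 < y * z → |condVariance (κ m) c y - condVariance (κ m) c z| ≤ L * |y - z|) := by
      by_contra! hc
      refine hpos.ne' (measure_mono_null (fun z hz => ?_) (ae_iff.1 (px.and py)))
      intro hzz
      exact absurd (hzz.2) (by
        obtain ⟨h3, h4⟩ := hc z hz hzz.1
        exact fun h5 => absurd (h5 h3) (not_le.2 h4))
    have hxz : 0 < x * z ∧ 0 < y * z := by
      rcases mul_pos_iff.1 h0 with ⟨h3, h4⟩ | ⟨h3, h4⟩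
      · have : 0 < z := h3.trans hz.1
        exact ⟨mul_pos h3 this, mul_pos h4 this⟩
      · have : z < 0 := hz.2.trans h4
        exact ⟨mul_pos_of_neg_of_neg h3 this, mul_pos_of_neg_of_neg h4 this⟩
    have h6 := hz1 hxz.1
    have h7 := hz2 hxz.2
    rw [abs_of_neg (sub_neg.2 hz.1)] at h6
    rw [abs_of_pos (sub_pos.2 hz.2)] at h7
    have h8 : |condVariance (κ m) c x - condVariance (κ m) c y| ≤ L * (y - x) := by
      calc _ ≤ |condVariance (κ m) c x - condVariance (κ m) c z| +
            |condVariance (κ m) c z - condVariance (κ m) c y| := abs_sub_le _ _ _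
        _ ≤ L * -(x - z) + L * (y - z) := add_le_add h6 (by rwa [abs_sub_comm])
        _ = _ := by ring
    rw [abs_of_neg (sub_neg.2 hxy), neg_sub]
    exact h8.trans (mul_le_mul_of_nonneg_right (le_abs_self L) (by linarith))
  intro x y px py hx hy h0
  rcases lt_trichotomy x y with hxy | hxy | hxy
  · exact main x y hxy hx hy h0 px py
  · rw [hxy]; simp
  · rw [abs_sub_comm, abs_sub_comm x]
    exact main y x hxy hy hx (by rwa [mul_comm]) py px

/-! ### Weighted averages of the variance estimator -/

/-- The conditions on the running variable under which weighted averages of the variance estimator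
over the observations within the distance `H` of the cutoff are considered. -/
structure LocalDesign (R : ℕ) (H V N : ℝ) {n : ℕ} (X v : Fin n → ℝ) : Prop where
  card_pos : R + 1 ≤ (shell indPos X 0 H).card
  card_neg : R + 1 ≤ (shell indNeg X 0 H).card
  card_le : ((Finset.univ.filter fun i => |X i| ≤ H).card : ℝ) ≤ N
  abs_le : ∀ i, |v i| ≤ V
  eq_zero : ∀ i, H < |X i| → v i = 0

lemma measurableSet_localDesign {R : ℕ} {H V N : ℝ} {n : ℕ} {v : (Fin n → ℝ) → Fin n → ℝ}
    (hv : ∀ i, Measurable fun X => v X i) :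
    MeasurableSet {X : Fin n → ℝ | LocalDesign R H V N X (v X)} := by
  classical
  have hside : Measurable indPos ∧ Measurable indNeg :=
    ⟨Measurable.ite measurableSet_Ici measurable_const measurable_const,
      Measurable.ite measurableSet_Iio measurable_const measurable_const⟩
  have habs : ∀ i, Measurable fun X : Fin n → ℝ => |X i| := fun i => by fun_prop
  have h1 : ∀ side : ℝ → ℝ, Measurable side →
      MeasurableSet {X : Fin n → ℝ | R + 1 ≤ (shell side X 0 H).card} := by
    intro side hs
    refine measurableSet_le measurable_const ?_
    refine measurable_card_filter fun s => ?_
    exact (measurableSet_eq_fun (hs.comp (measurable_pi_apply s)) measurable_const).inter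
      ((measurableSet_le measurable_const (habs s)).inter
        (measurableSet_le (habs s) measurable_const))
  have h2 : MeasurableSet {X : Fin n → ℝ |
      ((Finset.univ.filter fun i => |X i| ≤ H).card : ℝ) ≤ N} := by
    refine measurableSet_le (measurable_from_top.comp (g := fun k : ℕ => (k : ℝ)) ?_)
      measurable_const
    exact measurable_card_filter fun s => measurableSet_le (habs s) measurable_const
  have h3 : MeasurableSet {X : Fin n → ℝ | ∀ i, |v X i| ≤ V} := by
    rw [show {X : Fin n → ℝ | ∀ i, |v X i| ≤ V} = ⋂ i, {X | |v X i| ≤ V} by ext; simp]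
    exact MeasurableSet.iInter fun i => measurableSet_le
      (continuous_abs.measurable.comp (hv i)) measurable_const
  have h4 : MeasurableSet {X : Fin n → ℝ | ∀ i, H < |X i| → v X i = 0} := by
    rw [show {X : Fin n → ℝ | ∀ i, H < |X i| → v X i = 0} =
      ⋂ i, ({X | H < |X i|}ᶜ ∪ {X | v X i = 0}) by ext; simp [imp_iff_not_or]]
    exact MeasurableSet.iInter fun i => (measurableSet_lt measurable_const (habs i)).compl.union
      (measurableSet_eq_fun (hv i) measurable_const)
  have : {X : Fin n → ℝ | LocalDesign R H V N X (v X)} =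
      {X | R + 1 ≤ (shell indPos X 0 H).card} ∩ ({X | R + 1 ≤ (shell indNeg X 0 H).card} ∩
      ({X | ((Finset.univ.filter fun i => |X i| ≤ H).card : ℝ) ≤ N} ∩
      ({X | ∀ i, |v X i| ≤ V} ∩ {X | ∀ i, H < |X i| → v X i = 0}))) := by
    ext X
    exact ⟨fun h => ⟨h.1, h.2, h.3, h.4, h.5⟩, fun h => ⟨h.1, h.2.1, h.2.2.1, h.2.2.2.1, h.2.2.2.2⟩⟩
  rw [this]
  exact (h1 _ hside.1).inter ((h1 _ hside.2).inter (h2.inter (h3.inter h4)))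

lemma measurable_runVar {n : ℕ} : Measurable (runVar : (Fin n → Obs) → Fin n → ℝ) :=
  measurable_pi_lambda _ fun i => measurable_fst.comp (measurable_pi_apply i)

lemma measurable_sampleOutcome {n : ℕ} (c : ℝ) :
    Measurable (sampleOutcome c : (Fin n → Obs) → Fin n → ℝ) :=
  measurable_pi_lambda _ fun i =>
    (measurable_outcome c).comp (measurable_snd.comp (measurable_pi_apply i))

/-- Weighted averages of the variance estimator near the cutoff are consistent. -/
lemma unifNegligible_weighted_nnVariance {BY BT : ℝ} (hBY : 0 < BY) (hBT : 0 < BT)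
    (hpop : IsPopulation PX κ (regClass BY BT PX))
    (hX : ContinuousRunning PX κ (regClass BY BT PX)) {R : ℕ} (hR : 2 ≤ R) (c : ℝ)
    {v : (n : ℕ) → (Fin n → ℝ) → Fin n → ℝ} (hv : ∀ n i, Measurable fun X => v n X i)
    {H V N : ℕ → ℝ} (hH : Tendsto H atTop (𝓝 0)) (hN : Tendsto N atTop atTop)
    (hV : ∀ᶠ n in atTop, 0 < V n) {b τ : ℝ} (hb : 0 < b) (hτ : 0 < τ) :
    UnifNegligible PX κ (regClass BY BT PX) fun m n =>
      {S | LocalDesign R (H n) (V n) (b * N n) (runVar S) (v n (runVar S)) ∧ τ * (V n * N n) <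
        |∑ i, v n (runVar S) i * (nnVariance R (runVar S) (sampleOutcome c S) i -
          condVariance (κ m) c (runVar S i))|} := by
  obtain ⟨δ, L, hδ, hL0, hL⟩ := hX.exists_lipschitz c
  obtain ⟨C, hC⟩ := hX.fourth_moment c
  have hnull := hX.exists_density_bounds.1
  set B := BY + |c| * BT with hB
  have hB0 : 0 ≤ B := by positivity
  set β : ℕ → ℝ := fun n => 2 * R * (B * (2 * H n) ^ 2) ^ 2 + L * (2 * H n) with hβ
  have hβ0 : Tendsto β atTop (𝓝 0) := by
    have h1 : Tendsto (fun n => 2 * R * (B * (2 * H n) ^ 2) ^ 2 + L * (2 * H n)) atTop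
        (𝓝 (2 * R * (B * (2 * 0) ^ 2) ^ 2 + L * (2 * 0))) := by
      exact (((((hH.const_mul 2).pow 2).const_mul B).pow 2).const_mul _).add
        ((hH.const_mul 2).const_mul L)
    simpa using h1
  -- First for `nnError`, whose explicit measurability permits conditioning on X; almost surely it
  -- agrees with the estimator where the weights do not vanish.
  have key : UnifNegligible PX κ (regClass BY BT PX) fun m n =>
      {S | LocalDesign R (H n) (V n) (b * N n) (runVar S) (v n (runVar S)) ∧ τ * (V n * N n) ≤
        |∑ i, v n (runVar S) i * (nnError R (runVar S) (sampleOutcome c S) i -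
          condVariance (κ m) c (runVar S i))|} := by
    refine unifNegligible_of_bound (fun n => 4 * b * ((2 * R + 1 : ℕ) ^ 2 *
      (8 + 8 * ((2 * R + 1 : ℕ) ^ 2 * max C 0))) / τ ^ 2 * (N n)⁻¹) ?_ ?_
    · simpa using (tendsto_inv_atTop_zero.comp hN).const_mul (4 * b * ((2 * R + 1 : ℕ) ^ 2 *
        (8 + 8 * ((2 * R + 1 : ℕ) ^ 2 * max C 0))) / τ ^ 2)
    filter_upwards [hβ0.eventually (gt_mem_nhds (show 0 < min 1 (τ / (4 * b)) by positivity)),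
      hH.eventually (gt_mem_nhds (show 0 < δ / 2 by positivity)), hN.eventually_gt_atTop 0, hV]
      with n h1 h2 h3 h4 m hm
    have hβ1 : β n ≤ 1 := h1.le.trans (min_le_left _ _)
    have hβ2 : 4 * β n * b ≤ τ := by
      have := h1.le.trans (min_le_right _ _)
      rw [le_div_iff₀ (by positivity)] at this
      linarith
    refine sampleLaw_le_of_ae m n ?_ ?_
    · refine (measurable_runVar (measurableSet_localDesign (hv n))).inter ?_
      have hmeas : Measurable fun S : Fin n → Obs => ∑ i, v n (runVar S) i *
          (nnError R (runVar S) (sampleOutcome c S) i - condVariance (κ m) c (runVar S i)) := ?_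
      · exact measurableSet_le measurable_const (continuous_abs.measurable.comp hmeas)
      refine Finset.measurable_fun_sum _ fun i _ => ((hv n i).comp measurable_runVar).mul ?_
      exact ((measurable_nnError R i).comp
        (measurable_runVar.prodMk (measurable_sampleOutcome c))).sub
        ((measurable_condVariance (κ m) c).comp ((measurable_pi_apply i).comp measurable_runVar))
    · obtain ⟨p, hp, hpL⟩ := hL m hm
      have hx0 : ∀ᵐ x ∂PX, x ≠ 0 := by
        rw [ae_iff]
        simp
      filter_upwards [ae_injective (PX := PX) n, ae_pi_of_ae hx0 n, ae_pi_of_ae hp n,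
        ae_pi_of_ae (hC m hm) n, ae_pi_of_ae (hpop.condMean_eq hm c) n] with X x1 x2 x3 x4 x5
      -- The design condition involves X alone, so if it fails the conditional event is empty.
      by_cases hG : LocalDesign R (H n) (V n) (b * N n) X (v n X)
      swap
      · refine le_of_eq_of_le ?_ zero_le
        rw [show {y : Fin n → ℝ × ℝ | _} = ∅ from ?_, measure_empty]
        rw [Set.eq_empty_iff_forall_notMem]
        intro y hy
        exact hG hy.1
      refine (measure_mono fun y hy => hy.2).trans
        (measure_abs_sum_nnError_sub_ge_le (κm := κ m) (c := c) (L := L) (B := B)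
          (β := β n) x1 x2 hR hG.card_pos hG.card_neg hG.card_le hG.abs_le hG.eq_zero
          ?_ ?_ (fun i => (x5 i).1) (fun i => (x4 i).trans (ENNReal.ofReal_le_ofReal
            (le_max_left _ _))) (le_max_right _ _) hB0 hL0 h4 h3 hτ hb le_rfl hβ1 hβ2)
      · intro i
        obtain ⟨sY, hsY⟩ := exists_slope_of_mem_holderClass hm.1 hBY.le (X i)
        obtain ⟨sT, hsT⟩ := exists_slope_of_mem_holderClass hm.2.1.1 hBT.le (X i)
        refine ⟨sY - c * sT, fun j hj => ?_⟩
        rw [(x5 i).2, (x5 j).2]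
        have e : m.1 (X j) - c * m.2 (X j) - (m.1 (X i) - c * m.2 (X i)) -
            (sY - c * sT) * (X j - X i) = (m.1 (X j) - m.1 (X i) - sY * (X j - X i)) -
            c * (m.2 (X j) - m.2 (X i) - sT * (X j - X i)) := by ring
        rw [e]
        refine (abs_sub _ _).trans ?_
        rw [abs_mul, hB, add_mul, mul_assoc]
        exact add_le_add (hsY _ hj) (mul_le_mul_of_nonneg_left (hsT _ hj) (abs_nonneg c))
      · intro i j hi hj hij
        exact hpL _ _ (x3 i) (x3 j) (by linarith) (by linarith) hij
  refine key.mono (Eventually.of_forall fun n m hm => ?_)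
  have hx0 : ∀ᵐ x ∂PX, x ≠ 0 := by
    rw [ae_iff]
    simp
  filter_upwards [ae_runVar (m := m) (κ := κ) (ae_injective (PX := PX) n),
    ae_runVar (m := m) (κ := κ) (ae_pi_of_ae hx0 n)] with S s1 s2 hS
  refine ⟨hS.1, hS.2.le.trans (le_of_eq ?_)⟩
  congr 1
  refine Finset.sum_congr rfl fun i _ => ?_
  by_cases hi : |runVar S i| ≤ H n
  · obtain ⟨T, hT1, hT2, -⟩ := exists_near_candidates s2 hS.1.card_pos hS.1.card_neg hi
    rw [nnVariance_eq s1 hR (hT2.trans (Finset.card_le_card hT1)), nnError]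
  · rw [hS.1.eq_zero i (not_le.1 hi), zero_mul, zero_mul]

end Population

/-! ### Localization of the bandwidth for a continuous running variable -/

section Localization

variable {n : ℕ}

/-- On both sides of the cutoff, the number of observations at a distance between `a r` and `b r`
is of the order `(b - a) n r`, for finitely many pairs `(a, b)`. -/
structure CountDesign (c₁ c₂ : ℝ) (A : Finset (ℝ × ℝ)) (X : Fin n → ℝ) (r : ℝ) : Prop where
  n_pos : 0 < n
  r_pos : 0 < r
  card : ∀ ab ∈ A, ∀ side, (side = indPos ∨ side = indNeg) →
    c₁ * (ab.2 - ab.1) * (n * r) ≤ (shell side X (ab.1 * r) (ab.2 * r)).card ∧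
      (shell side X (ab.1 * r) (ab.2 * r)).card ≤ c₂ * (ab.2 - ab.1) * (n * r)

variable {K side : ℝ → ℝ} {X : Fin n → ℝ} {c₁ c₂ l u r : ℝ} {A A' : Finset (ℝ × ℝ)}

lemma CountDesign.mono (H : CountDesign c₁ c₂ A X r) (h : A' ⊆ A) : CountDesign c₁ c₂ A' X r :=
  ⟨H.n_pos, H.r_pos, fun ab hab => H.card ab (h hab)⟩

lemma CountDesign.nr_pos (H : CountDesign c₁ c₂ A X r) : 0 < n * r :=
  mul_pos (by exact_mod_cast H.n_pos) H.r_pos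

lemma CountDesign.le_card (H : CountDesign c₁ c₂ A X r) {a b : ℝ} (hab : (a, b) ∈ A)
    (hside : side = indPos ∨ side = indNeg) :
    c₁ * (b - a) * (n * r) ≤ (shell side X (a * r) (b * r)).card := (H.card _ hab side hside).1

lemma CountDesign.card_le (H : CountDesign c₁ c₂ A X r) {a b : ℝ} (hab : (a, b) ∈ A)
    (hside : side = indPos ∨ side = indNeg) :
    (shell side X (a * r) (b * r)).card ≤ c₂ * (b - a) * (n * r) := (H.card _ hab side hside).2

lemma le_mass_of_mem_shell {t₀ κ h a b : ℝ} (hκ : ∀ t, |t| ≤ t₀ → κ ≤ K t)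
    (hh : 0 < h) (hb : b ≤ t₀ * h) {i : Fin n} (hi : i ∈ shell side X a b) :
    κ ≤ mass K side X h i := by
  obtain ⟨h1, -, h2⟩ := mem_shell.1 hi
  rw [mass_eq_of_side h1]
  refine hκ _ ?_
  rw [abs_div, abs_of_pos hh, div_le_iff₀ hh]
  exact h2.trans hb

/-- The determinant is of the order `(n r)² r²`. -/
lemma exists_llDet_ge (hK : IsRegKernel K) (hc₁ : 0 < c₁) (hc₂ : 0 < c₂) (hl : 0 < l)
    (hlu : l ≤ u) : ∃ (d : ℝ) (A : Finset (ℝ × ℝ)), 0 < d ∧ (∀ ab ∈ A, 0 ≤ ab.1 ∧ ab.1 < ab.2) ∧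
      (0, u) ∈ A ∧ ∀ (n : ℕ) (X : Fin n → ℝ) (r : ℝ), CountDesign c₁ c₂ A X r →
        ∀ h ∈ Icc (l * r) (u * r), ∀ side, (side = indPos ∨ side = indNeg) →
          d * (c₂ * u * (n * r)) ^ 2 * (u * r) ^ 2 ≤ llDet (mass K side X h) (dist₀ X) := by
  obtain ⟨t₀, κ, ht₀, ht₁, hκ, hlow⟩ := hK.exists_lower_bound
  have hu : 0 < u := hl.trans_le hlu
  -- For every bandwidth from `l * r` on, points up to `s * r` have mass at least `κ`. The shells up
  -- to `s / 4` and from `s / 2` to `s` are separated by `s / 4`, in units of `r`.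
  set s := t₀ * l with hs
  have hs0 : 0 < s := by positivity
  refine ⟨κ ^ 2 * (s / 4) ^ 2 * (c₁ * (s / 4)) * (c₁ * (s / 2)) / (2 * c₂ ^ 2 * u ^ 4),
    {(0, u), (0, s / 4), (s / 2, s)}, by positivity, ?_, by simp, ?_⟩
  · intro ab hab
    simp only [Finset.mem_insert, Finset.mem_singleton] at hab
    rcases hab with rfl | rfl | rfl
    · exact ⟨le_rfl, hu⟩
    · exact ⟨le_rfl, by positivity⟩
    · exact ⟨by positivity, by dsimp only; linarith⟩
  · intro n X r H h hh side hside
    obtain ⟨e, hside'⟩ := isSide_of hside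
    have hr := H.r_pos
    have hnr := H.nr_pos
    have hh0 : 0 < h := (mul_pos hl hr).trans_le hh.1
    have hsr : s * r ≤ t₀ * h := by
      rw [hs, mul_assoc]; exact mul_le_mul_of_nonneg_left hh.1 ht₀.le
    have hP := H.le_card (a := 0) (b := s / 4) (by simp) hside
    have hQ := H.le_card (a := s / 2) (b := s) (by simp) hside
    have h1 := llDet_ge (y := dist₀ X) (mass_nonneg (X := X) (h := h) hK hside') hκ.le
      (show 0 ≤ s / 4 * r by positivity) (shell side X (0 * r) (s / 4 * r))
      (shell side X (s / 2 * r) (s * r))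
      (fun i hi => le_mass_of_mem_shell hlow hh0
        (le_trans (mul_le_mul_of_nonneg_right (by linarith) hr.le) hsr) hi)
      (fun i hi => le_mass_of_mem_shell hlow hh0 hsr hi)
      (fun i hi j hj => by
        have h2 := (mem_shell.1 hi).2.2
        have h3 := (mem_shell.1 hj).2.1
        rw [dist₀, dist₀]; linarith)
    have h2 : κ ^ 2 * (s / 4 * r) ^ 2 * (c₁ * (s / 4 - 0) * (n * r)) * (c₁ * (s - s / 2) * (n * r)) ≤
        2 * llDet (mass K side X h) (dist₀ X) := by
      refine le_trans ?_ h1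
      have h3 : 0 ≤ c₁ * (s - s / 2) * (n * r) := by
        have : 0 < s - s / 2 := by linarith
        positivity
      gcongr
    have h3 : 2 * (κ ^ 2 * (s / 4) ^ 2 * (c₁ * (s / 4)) * (c₁ * (s / 2)) / (2 * c₂ ^ 2 * u ^ 4) *
        (c₂ * u * (n * r)) ^ 2 * (u * r) ^ 2) =
        κ ^ 2 * (s / 4 * r) ^ 2 * (c₁ * (s / 4 - 0) * (n * r)) * (c₁ * (s - s / 2) * (n * r)) := by
      field_simp
      ring
    linarith

/-- Bounds for the weights at bandwidths of the order `r`. -/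
lemma exists_weight_bounds (hK : IsRegKernel K) (hc₁ : 0 < c₁) (hc₂ : 0 < c₂) (hl : 0 < l)
    (hlu : l ≤ u) : ∃ (C : ℝ) (A : Finset (ℝ × ℝ)), 0 < C ∧ (∀ ab ∈ A, 0 ≤ ab.1 ∧ ab.1 < ab.2) ∧
      ∀ (n : ℕ) (X : Fin n → ℝ) (r : ℝ), CountDesign c₁ c₂ A X r →
        (∀ h ∈ Icc (l * r) (u * r), h ∈ admissible K X ∧ (∀ i, |weight K X h i| ≤ C / (n * r)) ∧
          1 / C / (n * r) ≤ ∑ i, weight K X h i ^ 2 ∧ ∑ i, weight K X h i ^ 2 ≤ C / (n * r)) ∧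
        ∀ h ∈ Icc (l * r) (u * r), ∀ g ∈ Icc (l * r) (u * r), ∀ ω : ℝ, 0 ≤ ω →
          (∀ y, |K (y / h) - K (y / g)| ≤ ω) → ∀ i,
            |weight K X h i - weight K X g i| ≤ ω * C / (n * r) := by
  obtain ⟨d, A, hd, hA, huA, hdet⟩ := exists_llDet_ge hK hc₁ hc₂ hl hlu
  have hu : 0 < u := hl.trans_le hlu
  have hK0 := hK.apply_zero_pos
  set M := c₂ * u with hM
  have hM0 : 0 < M := by positivity
  set E := K 0 ^ 2 / d with hE
  set E' := 3 * K 0 / d + 4 * K 0 ^ 3 / d ^ 2 with hE'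
  have hE0 : 0 < E := by positivity
  have hE0' : 0 < E' := by positivity
  set C := 2 * (E / M) + 2 * (E' / M) + 2 * (E ^ 2 / M) + M with hC
  refine ⟨C, A, by positivity, hA, fun n X r H => ?_⟩
  have hr := H.r_pos
  have hnr := H.nr_pos
  have hN0 : 0 < M * (n * r) := by positivity
  have hur : 0 < u * r := by positivity
  have hMB : ∀ h ∈ Icc (l * r) (u * r), ∀ side, (side = indPos ∨ side = indNeg) →
      MassBound (mass K side X h) (dist₀ X) (K 0) (M * (n * r)) (u * r)
        (shell side X 0 (u * r)) := by
    intro h hh side hside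
    obtain ⟨e, hs⟩ := isSide_of hside
    refine massBound hK hs ((mul_pos hl hr).trans_le hh.1) hh.2 ?_
    have := H.card_le huA hside
    rwa [zero_mul, sub_zero] at this
  have hdet0 : ∀ h ∈ Icc (l * r) (u * r), ∀ side, (side = indPos ∨ side = indNeg) →
      llDet (mass K side X h) (dist₀ X) ≠ 0 := by
    intro h hh side hside
    have := hdet n X r H h hh side hside
    exact ((by positivity : 0 < d * (M * (n * r)) ^ 2 * (u * r) ^ 2).trans_le this).ne'
  have hW : ∀ h ∈ Icc (l * r) (u * r), ∀ side, (side = indPos ∨ side = indNeg) →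
      ∀ i, |llW (mass K side X h) (dist₀ X) i| ≤ E / (M * (n * r)) :=
    fun h hh side hside => (hMB h hh side hside).abs_llW_le hN0 hur hd
      (hdet n X r H h hh side hside)
  have hSq : ∀ h ∈ Icc (l * r) (u * r), ∀ side, (side = indPos ∨ side = indNeg) →
      ∑ i, llW (mass K side X h) (dist₀ X) i ^ 2 ≤ E ^ 2 / (M * (n * r)) := by
    intro h hh side hside
    have H1 := hMB h hh side hside
    rw [← Finset.sum_subset (Finset.subset_univ (shell side X 0 (u * r))) fun i _ hi => by
      rw [H1.llW_eq_zero hi]; ring]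
    refine (Finset.sum_le_card_nsmul _ _ ((E / (M * (n * r))) ^ 2) fun i _ => ?_).trans ?_
    · rw [← sq_abs]
      exact pow_le_pow_left₀ (abs_nonneg _) (hW h hh side hside i) 2
    · rw [nsmul_eq_mul]
      refine (mul_le_mul_of_nonneg_right H1.card_le (sq_nonneg _)).trans (le_of_eq ?_)
      field_simp
  have hCdiv : ∀ x, x ≤ C → x / (n * r) ≤ C / (n * r) := fun x hx => by gcongr
  have q1 : 0 < E / M := by positivity
  have q2 : 0 < E' / M := by positivity
  have q3 : 0 < E ^ 2 / M := by positivity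
  refine ⟨fun h hh => ⟨?_, fun i => ?_, ?_, ?_⟩, fun h hh g hg ω hω hKω i => ?_⟩
  · exact mem_admissible_iff.2 ⟨(mul_pos hl hr).trans_le hh.1, hdet0 h hh _ (Or.inl rfl),
      hdet0 h hh _ (Or.inr rfl)⟩
  · rw [weight_eq]
    refine (abs_sub _ _).trans ((add_le_add (hW h hh _ (Or.inl rfl) i)
      (hW h hh _ (Or.inr rfl) i)).trans ?_)
    rw [← div_div, ← add_div]
    exact hCdiv _ (by rw [hC]; linarith)
  · have hadm : h ∈ admissible K X := mem_admissible_iff.2 ⟨(mul_pos hl hr).trans_le hh.1,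
      hdet0 h hh _ (Or.inl rfl), hdet0 h hh _ (Or.inr rfl)⟩
    have h1 := one_le_card_mul_sum_weight_sq hK hadm hh.2 (hMB h hh _ (Or.inl rfl)).card_le
    have h2 : 0 ≤ ∑ i, weight K X h i ^ 2 := Finset.sum_nonneg fun _ _ => sq_nonneg _
    have hMC : M ≤ C := by rw [hC]; linarith
    rw [div_div, div_le_iff₀ (by positivity)]
    refine h1.trans ?_
    rw [mul_comm]
    gcongr
  · rw [sum_weight_sq]
    refine (add_le_add (hSq h hh _ (Or.inl rfl)) (hSq h hh _ (Or.inr rfl))).trans ?_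
    rw [← div_div, ← add_div]
    exact hCdiv _ (by rw [hC]; linarith)
  · have hkk : ∀ side, (side = indPos ∨ side = indNeg) → ∀ i,
        |mass K side X h i - mass K side X g i| ≤ ω := by
      intro side hside i
      obtain ⟨e, hs⟩ := isSide_of hside
      rw [mass, mass, ← sub_mul, abs_mul, abs_of_nonneg (hs.nonneg _)]
      exact (mul_le_mul (hKω _) (hs.le_one _) (hs.nonneg _) hω).trans_eq (mul_one _)
    have main : ∀ side, (side = indPos ∨ side = indNeg) → ∀ i,
        |llW (mass K side X h) (dist₀ X) i - llW (mass K side X g) (dist₀ X) i| ≤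
          ω * E' / (M * (n * r)) := fun side hside i =>
      (hMB h hh side hside).abs_llW_sub_le hω (hMB g hg side hside) (hkk side hside) hN0 hur hd
        (hdet n X r H h hh side hside) (hdet n X r H g hg side hside) i
    rw [weight_eq, weight_eq, wPos, wPos, wNeg, wNeg, sub_sub_sub_comm]
    refine (abs_sub _ _).trans ((add_le_add (main _ (Or.inl rfl) i)
      (main _ (Or.inr rfl) i)).trans ?_)
    have e1 : ω * E' / (M * (n * r)) + ω * E' / (M * (n * r)) = ω * (2 * (E' / M)) / (n * r) := by
      field_simp
      ring
    rw [e1]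
    have : 2 * (E' / M) ≤ C := by rw [hC]; linarith
    gcongr

set_option maxHeartbeats 1000000 in
/-- The minimizers of the length exist and are of the order `n ^ (-1 / 5)`. -/
lemma exists_localization (hK : IsRegKernel K) (hc₁ : 0 < c₁) (hc₂ : 0 < c₂) {BY BT α : ℝ}
    (hBY : 0 < BY) (hBT : 0 < BT) (hα : α ∈ Ioo (0 : ℝ) 1) (c : ℝ) {lo hi : ℝ} (hlo : 0 < lo) :
    ∃ (l u : ℝ) (A : Finset (ℝ × ℝ)), 0 < l ∧ l ≤ u ∧ (∀ ab ∈ A, 0 ≤ ab.1 ∧ ab.1 < ab.2) ∧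
      ∀ (n : ℕ) (X : Fin n → ℝ) (r : ℝ), CountDesign c₁ c₂ A X r → n * r ^ 5 = 1 →
        ∀ κm : Kernel ℝ (ℝ × ℝ), (∀ i, condVariance κm c (X i) ∈ Icc lo hi) →
          (optimalBandwidths BY BT α K κm c X).Nonempty ∧
          ∀ h ∈ optimalBandwidths BY BT α K κm c X, h ∈ Icc (l * r) (u * r) := by
  classical
  obtain ⟨c₀, C₀, hc₀, hC₀, hbounds⟩ := exists_ciLength_bounds hα
  obtain ⟨t₀, κ, ht₀, ht₁, hκ, hlow⟩ := hK.exists_lower_bound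
  obtain ⟨C₁, A₁, hC₁, hA₁, hw₁⟩ := exists_weight_bounds hK hc₁ hc₂ one_pos (le_refl (1 : ℝ))
  have hK0 := hK.apply_zero_pos
  set B := (BY + |c| * BT) / 2 with hB
  have hB0 : 0 < B := by positivity
  -- The length at `r` is at most Q r²: the bias is at most 2 B r², and the variance is O(1/(n r)) =
  -- O(r⁴) because n r⁵ = 1.
  set Q := C₀ * (2 * B + √(|hi| * C₁)) with hQ
  have hQ0 : 0 < Q := by positivity
  -- Below `l * r` at most `c₂ * l * (n * r)` observations on the right carry weight, and `l` is so
  -- small that the standard deviation alone makes the length exceed Q r².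
  set l := min 1 (lo * c₀ ^ 2 / (2 * c₂ * (Q ^ 2 + 1))) with hl
  have hl0 : 0 < l := by positivity
  have hl1 : l ≤ 1 := min_le_left _ _
  set ρ := 3 * c₂ / c₁ with hρ
  have hρ0 : 0 < ρ := by positivity
  set G := 1 + 18 * ρ * K 0 / κ + 18 * ρ ^ 2 * K 0 ^ 2 / κ ^ 2 with hG
  have hG0 : 0 < G := by positivity
  -- `G` is the constant of `sq_le_mul_llBias` at scale `w * r`, and `w` is so large that the
  -- resulting bias beats Q r². Beyond `u * r` with `u = 4 * w / t₀`, all points up to `4 * w * r`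
  -- have mass at least `κ`.
  set w := Q * G / (c₀ * B) + 1 with hw
  have hw1 : 1 ≤ w := by rw [hw]; linarith [show 0 < Q * G / (c₀ * B) by positivity]
  have hw0 : 0 < w := by linarith
  set u := 4 * w / t₀ with hu
  have hu1 : 1 ≤ u := by rw [hu, le_div_iff₀ ht₀]; linarith
  obtain ⟨C₂, A₂, hC₂, hA₂, hw₂⟩ := exists_weight_bounds hK hc₁ hc₂ hl0 (hl1.trans hu1)
  set A₃ : Finset (ℝ × ℝ) := {(0, l), (0, 3 * w), (w, 2 * w), (3 * w, 4 * w)} with hA₃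
  refine ⟨l, u, A₁ ∪ A₂ ∪ A₃, hl0, hl1.trans hu1, ?_, ?_⟩
  · intro ab hab
    rcases Finset.mem_union.1 hab with h | h
    · rcases Finset.mem_union.1 h with h | h
      · exact hA₁ ab h
      · exact hA₂ ab h
    · simp only [hA₃, Finset.mem_insert, Finset.mem_singleton] at h
      rcases h with rfl | rfl | rfl | rfl <;> constructor <;> dsimp only <;> linarith
  intro n X r H hnr5 κm hvar
  have H₁ := H.mono (A' := A₁) fun ab h => by simp [h]
  have H₂ := H.mono (A' := A₂) fun ab h => by simp [h]
  have H₃ := H.mono (A' := A₃) fun ab h => Finset.mem_union_right _ h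
  have hr := H.r_pos
  have hnr := H.nr_pos
  have hinv : 1 / (n * r) = r ^ 4 := by
    rw [div_eq_iff hnr.ne', ← hnr5]; ring
  have hpos : ∀ h ∈ admissible K X, 0 < stdDev K κm c X h := by
    intro h hh
    refine lt_of_le_of_ne stdDev_nonneg fun h0 => ?_
    have h5 := (stdDev_sq_bounds (K := K) (h := h) hvar).1
    rw [← h0] at h5
    have h6 := one_le_card_mul_sum_weight_sq hK hh le_rfl
      (card_shell_le (side := indPos) (X := X))
    have h7 : 0 < ∑ i, weight K X h i ^ 2 := by
      by_contra! hc
      have := mul_nonpos_of_nonneg_of_nonpos (Nat.cast_nonneg (α := ℝ) n) hc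
      linarith
    have : 0 < lo * ∑ i, weight K X h i ^ 2 := by positivity
    norm_num at h5
    linarith
  have hDpos : ∀ h ∈ admissible K X, ∀ side, (side = indPos ∨ side = indNeg) →
      0 < llDet (mass K side X h) (dist₀ X) := by
    intro h hh side hside
    obtain ⟨e, hs⟩ := isSide_of hside
    obtain ⟨-, hDp, hDn⟩ := mem_admissible_iff.1 hh
    refine lt_of_le_of_ne (llDet_nonneg (mass_nonneg hK hs)) (Ne.symm ?_)
    rcases hside with rfl | rfl
    · exact hDp
    · exact hDn
  have hbn : ∀ h ∈ admissible K X, ∀ side, (side = indPos ∨ side = indNeg) →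
      0 ≤ llBias (mass K side X h) (dist₀ X) := by
    intro h hh side hside
    obtain ⟨e, hs⟩ := isSide_of hside
    exact llBias_nonneg (mass_nonneg hK hs) dist₀_nonneg (hDpos h hh side hside)
  have hbias0 : ∀ h ∈ admissible K X, 0 ≤ biasBound BY BT K c X h := by
    intro h hh
    rw [biasBound_eq]
    exact mul_nonneg hB0.le (add_nonneg (hbn h hh _ (Or.inl rfl)) (hbn h hh _ (Or.inr rfl)))
  have hci : ∀ h ∈ admissible K X, c₀ * (biasBound BY BT K c X h + stdDev K κm c X h) ≤
      ciLength BY BT α K κm c X h ∧ ciLength BY BT α K κm c X h ≤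
        C₀ * (biasBound BY BT K c X h + stdDev K κm c X h) := fun h hh =>
    ⟨(hbounds _ _ (hbias0 h hh) (hpos h hh)).1, (hbounds _ _ (hbias0 h hh) (hpos h hh)).2.1⟩
  -- the value at the bandwidth `r`
  have hrm : r ∈ Icc (1 * r) (1 * r) := by simp
  obtain ⟨hradm, -, -, hrsq⟩ := (hw₁ n X r H₁).1 r hrm
  have hval : ciLength BY BT α K κm c X r ≤ Q * r ^ 2 := by
    refine (hci r hradm).2.trans ?_
    have b1 : biasBound BY BT K c X r ≤ 2 * B * r ^ 2 := by
      rw [biasBound_eq]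
      have h1 : ∀ side, (side = indPos ∨ side = indNeg) →
          llBias (mass K side X r) (dist₀ X) ≤ r ^ 2 := by
        intro side hside
        obtain ⟨e, hs⟩ := isSide_of hside
        refine llBias_le (mass_nonneg hK hs) dist₀_nonneg (hDpos r hradm side hside) hr.le
          fun i hi => ?_
        by_contra! hc
        exact hi (mass_eq_zero hK hr hc.le)
      have h2 := h1 _ (Or.inl rfl)
      have h3 := h1 _ (Or.inr rfl)
      calc _ ≤ B * (r ^ 2 + r ^ 2) := by gcongr
        _ = _ := by ring
    have b2 : stdDev K κm c X r ≤ √(|hi| * C₁) * r ^ 2 := by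
      refine le_of_sq_le_sq ?_ (by positivity)
      rw [mul_pow, Real.sq_sqrt (by positivity)]
      refine (stdDev_sq_bounds hvar).2.trans ?_
      calc hi * ∑ i, weight K X r i ^ 2 ≤ |hi| * (C₁ / (n * r)) :=
            mul_le_mul (le_abs_self _) hrsq (Finset.sum_nonneg fun _ _ => sq_nonneg _)
              (abs_nonneg _)
        _ = |hi| * C₁ * (1 / (n * r)) := by ring
        _ = _ := by rw [hinv]; ring
    calc _ ≤ C₀ * (2 * B * r ^ 2 + √(|hi| * C₁) * r ^ 2) := by gcongr
      _ = _ := by rw [hQ]; ring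
  -- larger values elsewhere
  have hout : ∀ h ∈ admissible K X, h ∉ Icc (l * r) (u * r) →
      Q * r ^ 2 < ciLength BY BT α K κm c X h := by
    intro h hh hnot
    have hh0 : 0 < h := hh.1
    refine lt_of_lt_of_le ?_ (hci h hh).1
    rcases lt_or_ge h (l * r) with hlt | hge
    · have h1 := H₃.card_le (a := 0) (b := l) (by simp [hA₃]) (Or.inl rfl)
      rw [zero_mul, sub_zero] at h1
      have h2 := one_le_card_mul_sum_weight_sq hK hh hlt.le h1
      have h3 := (stdDev_sq_bounds (K := K) (h := h) hvar).1
      have h4 : (Q * r ^ 2) ^ 2 < (c₀ * stdDev K κm c X h) ^ 2 := by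
        have h5 : lo * r ^ 4 / (c₂ * l) ≤ stdDev K κm c X h ^ 2 := by
          refine le_trans ?_ h3
          rw [← hinv, div_le_iff₀ (by positivity)]
          have : lo * (1 / (n * r)) ≤ lo * (1 / (n * r)) *
              (c₂ * l * (n * r) * ∑ i, weight K X h i ^ 2) :=
            le_mul_of_one_le_right (by positivity) h2
          have hn0 : (n : ℝ) ≠ 0 := by exact_mod_cast H.n_pos.ne'
          refine this.trans (le_of_eq ?_)
          field_simp
        have h6 : Q ^ 2 < c₀ ^ 2 * (lo / (c₂ * l)) := by
          have h7 : l ≤ lo * c₀ ^ 2 / (2 * c₂ * (Q ^ 2 + 1)) := min_le_right _ _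
          rw [le_div_iff₀ (by positivity)] at h7
          rw [mul_div_assoc', lt_div_iff₀ (by positivity)]
          have : 0 < l * c₂ := by positivity
          nlinarith
        calc (Q * r ^ 2) ^ 2 = Q ^ 2 * r ^ 4 := by ring
          _ < c₀ ^ 2 * (lo / (c₂ * l)) * r ^ 4 := by gcongr
          _ = c₀ ^ 2 * (lo * r ^ 4 / (c₂ * l)) := by ring
          _ ≤ c₀ ^ 2 * stdDev K κm c X h ^ 2 := by gcongr
          _ = _ := by ring
      have h5 := lt_of_pow_lt_pow_left₀ 2 (mul_nonneg hc₀.le stdDev_nonneg) h4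
      refine h5.trans_le ?_
      have := hbias0 h hh
      gcongr
      linarith
    · have hur : u * r < h := by
        by_contra! hc
        exact hnot ⟨hge, hc⟩
      have htw : 4 * w * r ≤ t₀ * h := by
        have : t₀ * (u * r) = 4 * w * r := by rw [hu]; field_simp
        rw [← this]; gcongr
      have hwr : 0 < w * r := by positivity
      have c1 := H₃.card_le (a := 0) (b := 3 * w) (by simp [hA₃]) (Or.inl rfl)
      have c2 := H₃.le_card (a := w) (b := 2 * w) (by simp [hA₃]) (Or.inl rfl)
      have c3 := H₃.le_card (a := 3 * w) (b := 4 * w) (by simp [hA₃]) (Or.inl rfl)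
      rw [zero_mul, sub_zero] at c1
      have hm : 0 < c₁ * w * (n * r) := by positivity
      have c2' : c₁ * w * (n * r) ≤ (shell indPos X (w * r) (2 * w * r)).card := by
        refine le_trans (le_of_eq ?_) c2
        ring
      have c3' : c₁ * w * (n * r) ≤ (shell indPos X (3 * w * r) (4 * w * r)).card := by
        refine le_trans (le_of_eq ?_) c3
        ring
      have hρm : c₂ * (3 * w) * (n * r) = ρ * (c₁ * w * (n * r)) := by
        rw [hρ]; field_simp
      have h1 := sq_le_mul_llBias (k := mass K indPos X h) (y := dist₀ X)
        (mass_nonneg hK isSide_indPos) dist₀_nonneg (mass_le hK isSide_indPos) hκ hwr hρ0.le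
        (shell indPos X 0 (3 * w * r)) (shell indPos X (w * r) (2 * w * r))
        (shell indPos X (3 * w * r) (4 * w * r))
        (fun i hi hlt => mem_shell.2 ⟨side_eq_one_of_mass_ne_zero isSide_indPos hi, abs_nonneg _,
          by rw [dist₀] at hlt; linarith⟩)
        (fun i hi => ⟨le_mass_of_mem_shell hlow hh0 (by linarith) hi, (mem_shell.1 hi).2.1,
          by have := (mem_shell.1 hi).2.2; rw [dist₀]; linarith⟩)
        (fun i hi => ⟨le_mass_of_mem_shell hlow hh0 htw hi,
          by have := (mem_shell.1 hi).2.1; rw [dist₀]; linarith⟩)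
        (by exact_mod_cast hm.trans_le c2') (by exact_mod_cast hm.trans_le c3')
        (by refine c1.trans ?_; rw [hρm]; gcongr) (by refine c1.trans ?_; rw [hρm]; gcongr)
        (hDpos h hh _ (Or.inl rfl))
      rw [← hG] at h1
      have h2 : Q * r ^ 2 < c₀ * (B * llBias (mass K indPos X h) (dist₀ X)) := by
        have h3 : Q * G < c₀ * B * w ^ 2 := by
          have h4 : Q * G / (c₀ * B) < w := by rw [hw]; linarith
          rw [div_lt_iff₀ (by positivity)] at h4
          have h5 : w * (c₀ * B) ≤ w ^ 2 * (c₀ * B) := by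
            gcongr; nlinarith
          linarith
        have h6 : Q * r ^ 2 * G < c₀ * (B * llBias (mass K indPos X h) (dist₀ X)) * G := by
          calc Q * r ^ 2 * G = Q * G * r ^ 2 := by ring
            _ < c₀ * B * w ^ 2 * r ^ 2 := by gcongr
            _ = c₀ * B * (w * r) ^ 2 := by ring
            _ ≤ c₀ * B * (G * llBias (mass K indPos X h) (dist₀ X)) := by gcongr
            _ = _ := by ring
        exact lt_of_mul_lt_mul_right h6 hG0.le
      refine h2.trans_le ?_
      have h7 := hbn h hh _ (Or.inr rfl)
      have h8 := hpos h hh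
      rw [biasBound_eq, ← hB]
      gcongr
      have : 0 ≤ B * llBias (mass K indNeg X h) (dist₀ X) := by positivity
      linarith
  constructor
  · refine optimalBandwidths_nonempty hK hα BY BT κm c (h₁ := l * r) (h₂ := u * r) (h₀ := r)
      ⟨by nlinarith, by nlinarith⟩ (fun h hh => ((hw₂ n X r H₂).1 h hh).1)
      (fun h hh => (hpos h ((hw₂ n X r H₂).1 h hh).1).ne') ?_
    exact fun h hh hnot => hval.trans (hout h hh hnot).le
  · intro h hh
    by_contra hnot
    exact absurd ((hout h hh.1 hnot).trans_le (hh.2 r hradm)) (not_lt.2 hval)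

end Localization

/-! ### Consistency for a continuous running variable -/

/-- The rate `n ^ (-1 / 5)` of the optimal bandwidth. -/
noncomputable def rate (n : ℕ) : ℝ := (n : ℝ) ^ (-(1 / 5) : ℝ)

lemma rate_pos {n : ℕ} (hn : 0 < n) : 0 < rate n := Real.rpow_pos_of_pos (by exact_mod_cast hn) _

lemma mul_rate_pow {n : ℕ} (hn : 0 < n) : n * rate n ^ 5 = 1 := by
  have hn' : (0 : ℝ) < n := by exact_mod_cast hn
  rw [rate, ← Real.rpow_natCast, ← Real.rpow_mul hn'.le]
  norm_num
  rw [Real.rpow_neg_one, mul_inv_cancel₀ hn'.ne']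

lemma tendsto_rate : Tendsto rate atTop (𝓝 0) :=
  (tendsto_rpow_neg_atTop (by norm_num)).comp tendsto_natCast_atTop_atTop

lemma tendsto_mul_rate : Tendsto (fun n : ℕ => n * rate n) atTop atTop := by
  have h1 : Tendsto (fun n : ℕ => (n : ℝ) ^ (4 / 5 : ℝ)) atTop atTop :=
    (tendsto_rpow_atTop (by norm_num)).comp tendsto_natCast_atTop_atTop
  refine h1.congr' ?_
  filter_upwards [eventually_gt_atTop 0] with n hn
  have hn' : (0 : ℝ) < n := by exact_mod_cast hn
  rw [rate]
  nth_rewrite 2 [← Real.rpow_one (n : ℝ)]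
  rw [← Real.rpow_add hn']
  norm_num

section ContinuousConsistency

variable {PX : Measure ℝ} [IsProbabilityMeasure PX]
  {κ : (ℝ → ℝ) × (ℝ → ℝ) → Kernel ℝ (ℝ × ℝ)} [∀ m, IsMarkovKernel (κ m)]
  {F : Set ((ℝ → ℝ) × (ℝ → ℝ))}

/-- Mean and variance of the count are both of the order of its number (b - a) n r, which tends to
infinity, so Chebyshev's inequality controls deviations of the same order. -/
lemma unifNegligible_card_shell {δ lo hi : ℝ} (hδ : 0 < δ) (hlo : 0 < lo) (hhi : 0 < hi)
    (hdens : ∀ a b : ℝ, -δ ≤ a → a ≤ b → b ≤ δ →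
      lo * (b - a) ≤ PX.real (Ioo a b) ∧ PX.real (Icc a b) ≤ hi * (b - a))
    {a b : ℝ} (ha : 0 ≤ a) (hab : a < b) {side : ℝ → ℝ} (hside : side = indPos ∨ side = indNeg) :
    UnifNegligible PX κ F fun _ n => {S |
      ¬ (lo / 2 * (b - a) * (n * rate n) ≤ (shell side (runVar S) (a * rate n) (b * rate n)).card ∧
        (shell side (runVar S) (a * rate n) (b * rate n)).card ≤
          (hi + lo / 2) * (b - a) * (n * rate n))} := by
  classical
  have hba : 0 < b - a := sub_pos.2 hab
  have hb : 0 < b := ha.trans_lt hab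
  refine unifNegligible_of_bound
    (fun n => 4 * hi / (lo ^ 2 * (b - a)) * (n * rate n)⁻¹) ?_ ?_
  · simpa using (tendsto_inv_atTop_zero.comp tendsto_mul_rate).const_mul
      (4 * hi / (lo ^ 2 * (b - a)))
  filter_upwards [eventually_gt_atTop 0,
    tendsto_rate.eventually (gt_mem_nhds (show 0 < δ / b by positivity))] with n hn hrδ m _
  have hn' : (0 : ℝ) < n := by exact_mod_cast hn
  have hr := rate_pos hn
  set r := rate n with hrdef
  have hbr : b * r ≤ δ := by
    rw [lt_div_iff₀ hb] at hrδ; linarith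
  have har : 0 ≤ a * r := by positivity
  have habr : a * r ≤ b * r := by gcongr
  set I : Set ℝ := {x | side x = 1 ∧ a * r ≤ |x| ∧ |x| ≤ b * r} with hI
  have hIm : MeasurableSet I := by
    have hs : Measurable side := by
      rcases hside with rfl | rfl
      · exact Measurable.ite measurableSet_Ici measurable_const measurable_const
      · exact Measurable.ite measurableSet_Iio measurable_const measurable_const
    exact (measurableSet_eq_fun hs measurable_const).inter
      ((measurableSet_le measurable_const continuous_abs.measurable).inter
        (measurableSet_le continuous_abs.measurable measurable_const))
  have hPI : lo * (b - a) * r ≤ PX.real I ∧ PX.real I ≤ hi * (b - a) * r := by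
    rcases hside with rfl | rfl
    · obtain ⟨h1, h2⟩ := hdens (a * r) (b * r) (by linarith) habr hbr
      constructor
      · calc _ = lo * (b * r - a * r) := by ring
          _ ≤ _ := h1.trans (measureReal_mono fun x hx => by
            have hx0 : 0 < x := har.trans_lt hx.1
            refine ⟨if_pos hx0.le, ?_⟩
            rw [abs_of_pos hx0]
            exact ⟨hx.1.le, hx.2.le⟩)
      · refine (measureReal_mono fun x hx => ?_).trans (h2.trans (le_of_eq (by ring)))
        have hx0 : 0 ≤ x := by
          by_contra hc
          have := hx.1
          rw [indPos, if_neg hc] at this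
          exact zero_ne_one this
        have := hx.2
        rwa [abs_of_nonneg hx0] at this
    · obtain ⟨h1, h2⟩ := hdens (-(b * r)) (-(a * r)) (by linarith) (by linarith) (by linarith)
      constructor
      · calc _ = lo * (-(a * r) - -(b * r)) := by ring
          _ ≤ _ := h1.trans (measureReal_mono fun x hx => by
            have hx0 : x < 0 := hx.2.trans_le (by linarith)
            refine ⟨if_pos hx0, ?_⟩
            rw [abs_of_neg hx0]
            exact ⟨by linarith [hx.2], by linarith [hx.1]⟩)
      · refine (measureReal_mono fun x hx => ?_).trans (h2.trans (le_of_eq (by ring)))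
        have hx0 : x < 0 := by
          by_contra hc
          have := hx.1
          rw [indNeg, if_neg hc] at this
          exact zero_ne_one this
        have := hx.2
        rw [abs_of_neg hx0] at this
        exact ⟨by linarith [this.2], by linarith [this.1]⟩
  have ht : 0 < lo / 2 * (b - a) * (n * r) := by positivity
  refine le_trans (measure_mono fun S hS => ?_) ((sampleLaw_count (PX := PX) (κ := κ) m n hIm
    ht).trans (ENNReal.ofReal_le_ofReal ?_))
  · rw [mem_ofPred_eq] at hS ⊢
    have e : (Finset.univ.filter fun i => runVar S i ∈ I) =
        shell side (runVar S) (a * r) (b * r) := by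
      ext i; simp [mem_shell, hI]
    rw [e]
    by_contra! hc
    refine hS ?_
    obtain ⟨h1, h2⟩ := abs_lt.1 hc
    have h3 : n * (lo * (b - a) * r) ≤ n * PX.real I := by gcongr; exact hPI.1
    have h4 : n * PX.real I ≤ n * (hi * (b - a) * r) := by gcongr; exact hPI.2
    constructor <;> nlinarith
  · calc n * PX.real I / (lo / 2 * (b - a) * (n * r)) ^ 2 ≤
          n * (hi * (b - a) * r) / (lo / 2 * (b - a) * (n * r)) ^ 2 := by
          gcongr; exact hPI.2
      _ = _ := by field_simp; ring

lemma unifNegligible_not_countDesign {δ lo hi : ℝ} (hδ : 0 < δ) (hlo : 0 < lo) (hhi : 0 < hi)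
    (hdens : ∀ a b : ℝ, -δ ≤ a → a ≤ b → b ≤ δ →
      lo * (b - a) ≤ PX.real (Ioo a b) ∧ PX.real (Icc a b) ≤ hi * (b - a))
    {A : Finset (ℝ × ℝ)} (hA : ∀ ab ∈ A, 0 ≤ ab.1 ∧ ab.1 < ab.2) :
    UnifNegligible PX κ F fun _ n =>
      {S | ¬ CountDesign (lo / 2) (hi + lo / 2) A (runVar S) (rate n)} := by
  have h1 : ∀ side, (side = indPos ∨ side = indNeg) → _ := fun side hside =>
    UnifNegligible.biUnion A fun ab hab => unifNegligible_card_shell (PX := PX) (κ := κ) (F := F)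
      hδ hlo hhi hdens (hA ab hab).1 (hA ab hab).2 hside
  refine ((h1 indPos (Or.inl rfl)).union (h1 indNeg (Or.inr rfl))).mono ?_
  filter_upwards [eventually_gt_atTop 0] with n hn m hm
  refine Eventually.of_forall fun S hS => ?_
  by_contra hc
  simp only [mem_union, mem_iUnion, mem_ofPred_eq, not_or, not_exists, not_not] at hc
  refine hS ⟨hn, rate_pos hn, fun ab hab side hside => ?_⟩
  rcases hside with rfl | rfl
  · exact hc.1 ab hab
  · exact hc.2 ab hab

lemma weight_eq_zero {n : ℕ} {K : ℝ → ℝ} (hK : IsRegKernel K) {X : Fin n → ℝ} {h : ℝ}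
    (hh : 0 < h) {i : Fin n} (hi : h ≤ |X i|) : weight K X h i = 0 := by
  have : K (X i / h) = 0 := hK.apply_eq_zero (by rwa [abs_div, abs_of_pos hh, le_div_iff₀ hh, one_mul])
  rw [weight, sideWeight, sideWeight, this]
  ring

set_option maxHeartbeats 1000000 in
theorem unifRatioConsistent_stdErr_continuous {BY BT α : ℝ} (hBY : 0 < BY) (hBT : 0 < BT)
    (hα : α ∈ Ioo (0 : ℝ) 1) {K : ℝ → ℝ} {R : ℕ} (hpop : IsPopulation PX κ (regClass BY BT PX))
    (hmom : MomentConditions PX κ (regClass BY BT PX)) (hK : IsRegKernel K) (hR : 2 ≤ R)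
    (hX : ContinuousRunning PX κ (regClass BY BT PX)) (c : ℝ)
    {hM : (ℝ → ℝ) × (ℝ → ℝ) → (n : ℕ) → (Fin n → ℝ) → ℝ}
    (hM_opt : ∀ m ∈ regClass BY BT PX, ∀ (n : ℕ) (X : Fin n → ℝ),
      (optimalBandwidths BY BT α K (κ m) c X).Nonempty →
        hM m n X ∈ optimalBandwidths BY BT α K (κ m) c X)
    {hhat : (n : ℕ) → (Fin n → Obs) → ℝ}
    (hhat_cons : UnifRatioConsistent PX κ (regClass BY BT PX)
      (fun _ n S => hhat n S) (fun m n S => hM m n (runVar S))) :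
    UnifRatioConsistent PX κ (regClass BY BT PX)
      (fun _ n S => stdErr R K c S (hhat n S))
      (fun m n S => stdDev K (κ m) c (runVar S) (hM m n (runVar S))) := by
  classical
  obtain ⟨-, δ₀, lf, hf, hδ₀, hlf, hhf, hdens⟩ := hX.exists_density_bounds
  obtain ⟨lo, hi, hlo, hvar⟩ := hmom.variance c
  set c₁ := lf / 2 with hc₁
  set c₂ := hf + lf / 2 with hc₂
  have hc₁0 : 0 < c₁ := by positivity
  have hc₂0 : 0 < c₂ := by positivity
  obtain ⟨l, u, A₁, hl, hlu, hA₁, hloc⟩ :=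
    exists_localization hK hc₁0 hc₂0 hBY hBT hα c (hi := hi) hlo
  have hu : 0 < u := hl.trans_le hlu
  -- The range is doubled in both directions, so that it also contains the empirical bandwidth,
  -- whose relative error is at most 1/2.
  obtain ⟨C, A₂, hC, hA₂, hwt⟩ := exists_weight_bounds hK hc₁0 hc₂0
    (show 0 < l / 2 by positivity) (show l / 2 ≤ 2 * u by linarith)
  set U := 2 * u with hU
  have hU0 : 0 < U := by positivity
  set A := A₁ ∪ A₂ ∪ {(0, U)} with hA
  have hA0 : ∀ ab ∈ A, 0 ≤ ab.1 ∧ ab.1 < ab.2 := by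
    intro ab hab
    rcases Finset.mem_union.1 hab with h | h
    · rcases Finset.mem_union.1 h with h | h
      · exact hA₁ ab h
      · exact hA₂ ab h
    · rw [Finset.mem_singleton] at h
      rw [h]; exact ⟨le_rfl, hU0⟩
  set b := 2 * (c₂ * U) with hb
  have hb0 : 0 < b := by positivity
  intro ε hε
  set τ := min 1 (ε * lo / (2 * C ^ 3)) with hτdef
  have hτ : 0 < τ := by positivity
  have hτ1 : τ ≤ 1 := min_le_left _ _
  set ω := ε * lo / (8 * C ^ 3 * (|hi| * b + 1)) with hωdef
  have hω : 0 < ω := by positivity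
  obtain ⟨δ, hδ, hδ2, hmod⟩ := hK.exists_modulus (half_pos hω)
  -- The empirical bandwidth may depend on the outcomes, which rules out conditioning at it. Laws of
  -- large numbers are proved at the bandwidths `η * rate n` with `η` in a finite net, one of which
  -- is relatively `δ`-close to the optimal bandwidth.
  obtain ⟨G, hGsub, hGfin, hGcov⟩ := (isCompact_Icc (a := l) (b := u)).finite_cover_balls
    (show 0 < δ * l by positivity)
  have E1 := unifNegligible_not_countDesign (PX := PX) (κ := κ) (F := regClass BY BT PX)
    hδ₀ hlf hhf hdens hA0
  have hHlim : Tendsto (fun n => U * rate n) atTop (𝓝 0) := by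
    simpa using tendsto_rate.const_mul U
  have E2 := UnifNegligible.biUnion hGfin.toFinset fun η _ =>
    unifNegligible_weighted_nnVariance hBY hBT hpop hX hR c
      (v := fun n X i => weight K X (η * rate n) i ^ 2)
      (fun n i => (measurable_weight hK _ i).pow_const 2) hHlim tendsto_mul_rate
      (V := fun n => (C / (n * rate n)) ^ 2)
      (by
        filter_upwards [eventually_gt_atTop 0] with n hn
        have := rate_pos hn
        have : (0 : ℝ) < n := by exact_mod_cast hn
        positivity) hb0 hτ
  -- Unit weights: this bounds the sum of the estimated variances near the cutoff, by which the
  -- change of squared weights from the empirical bandwidth to the net is multiplied.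
  have E3 := unifNegligible_weighted_nnVariance hBY hBT hpop hX hR c
      (v := fun n X i => if |X i| ≤ U * rate n then 1 else 0)
      (fun n i => Measurable.ite (measurableSet_le
        (show Measurable fun X : Fin n → ℝ => |X i| by fun_prop) measurable_const)
        measurable_const measurable_const) hHlim tendsto_mul_rate
      (V := fun _ => 1) (Eventually.of_forall fun _ => one_pos) hb0 hτ
  refine (((E1.union E2).union E3).union (hhat_cons δ hδ)).mono ?_
  filter_upwards [eventually_gt_atTop 0,
    tendsto_mul_rate.eventually_ge_atTop ((R + 1) / (c₁ * U))] with n hn0 hnR m hm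
  filter_upwards [ae_sampleLaw (κ := κ) (m := m) (hvar m hm) n] with S svar hS
  by_contra hcon
  simp only [mem_union, mem_iUnion, mem_ofPred_eq, not_or, not_exists, not_lt, not_not,
    not_and, Finite.mem_toFinset] at hcon
  obtain ⟨⟨⟨HC, k2⟩, k3⟩, ccons⟩ := hcon
  change ε * |_| < |_ - _| at hS
  set X := runVar S with hXdef
  set g := hhat n S with hg
  set r := rate n with hrdef
  change CountDesign c₁ c₂ A X r at HC
  have hr : 0 < r := rate_pos hn0
  have hnr := HC.nr_pos
  obtain ⟨hne, hopt⟩ := hloc n X r (HC.mono fun ab h => by simp [hA, h]) (mul_rate_pow hn0)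
    (κ m) svar
  obtain ⟨hwb, hwd⟩ := hwt n X r (HC.mono fun ab h => by simp [hA, h])
  have hmem := hM_opt m hm n X hne
  set h := hM m n X with hh
  obtain ⟨hlr, hur⟩ := hopt h hmem
  have hh0 : 0 < h := (mul_pos hl hr).trans_le hlr
  rw [abs_of_pos hh0] at ccons
  obtain ⟨η, hηG, hη⟩ : ∃ η ∈ G, |h / r - η| < δ * l := by
    have := hGcov (show h / r ∈ Icc l u from ⟨by rwa [le_div_iff₀ hr], by rwa [div_le_iff₀ hr]⟩)
    simpa [Real.dist_eq] using this
  obtain ⟨hη1, hη2⟩ := hGsub hηG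
  have hη0 : 0 < η := hl.trans_le hη1
  set f := η * r with hf'
  have hf0 : 0 < f := by positivity
  have hhf : |h - f| ≤ δ * f := by
    have e : h - f = (h / r - η) * r := by rw [hf']; field_simp
    rw [e, abs_mul, abs_of_pos hr, hf', ← mul_assoc]
    gcongr
    exact hη.le.trans (by gcongr)
  have hl2 : l / 2 * r ≤ l * r := by gcongr; linarith
  have hu2 : u * r ≤ U * r := by gcongr; linarith
  have hIh : h ∈ Icc (l / 2 * r) (U * r) := ⟨hl2.trans hlr, hur.trans hu2⟩
  have hIf : f ∈ Icc (l / 2 * r) (U * r) :=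
    ⟨hl2.trans (mul_le_mul_of_nonneg_right hη1 hr.le),
      (mul_le_mul_of_nonneg_right hη2 hr.le).trans hu2⟩
  have hIg : g ∈ Icc (l / 2 * r) (U * r) := by
    obtain ⟨g1, g2⟩ := abs_le.1 ccons
    have : δ * h ≤ 1 / 2 * h := by gcongr
    rw [hU]
    constructor <;> nlinarith
  have hKgh : ∀ y, |K (y / g) - K (y / h)| ≤ ω / 2 := hmod h g hh0 ccons
  have hKhf : ∀ y, |K (y / h) - K (y / f)| ≤ ω / 2 := hmod f h hf0 hhf
  have hKgf : ∀ y, |K (y / g) - K (y / f)| ≤ ω := fun y =>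
    (abs_sub_le _ (K (y / h)) _).trans (by linarith [hKgh y, hKhf y])
  have hKfh : ∀ y, |K (y / f) - K (y / h)| ≤ ω := fun y => by
    rw [abs_sub_comm]; linarith [hKhf y]
  -- the weights
  set I := Finset.univ.filter fun i => |X i| ≤ U * r with hI
  have hcardI : (I.card : ℝ) ≤ b * (n * r) := by
    have c1 := HC.card_le (a := 0) (b := U) (by simp [hA]) (Or.inl rfl)
    have c2 := HC.card_le (a := 0) (b := U) (by simp [hA]) (Or.inr rfl)
    rw [zero_mul, sub_zero] at c1 c2
    have hsub : I ⊆ shell indPos X 0 (U * r) ∪ shell indNeg X 0 (U * r) := by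
      intro i hi
      have hi' := (Finset.mem_filter.1 hi).2
      rcases le_or_gt 0 (X i) with h1 | h1
      · exact Finset.mem_union_left _ (mem_shell.2 ⟨if_pos h1, abs_nonneg _, hi'⟩)
      · exact Finset.mem_union_right _ (mem_shell.2 ⟨if_pos h1, abs_nonneg _, hi'⟩)
    have h2 : (I.card : ℝ) ≤ (shell indPos X 0 (U * r)).card + (shell indNeg X 0 (U * r)).card := by
      exact_mod_cast (Finset.card_le_card hsub).trans (Finset.card_union_le _ _)
    rw [hb]; linarith
  have hdesign : ∀ (V : ℝ) (v : Fin n → ℝ), (∀ i, |v i| ≤ V) → (∀ i, U * r < |X i| → v i = 0) →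
      LocalDesign R (U * r) V (b * (n * r)) X v := by
    intro V v h1 h2
    have h3 : (R + 1 : ℝ) ≤ c₁ * U * (n * r) := by
      rw [div_le_iff₀ (by positivity)] at hnR
      linarith
    have c1 := HC.le_card (a := 0) (b := U) (by simp [hA]) (Or.inl rfl)
    have c2 := HC.le_card (a := 0) (b := U) (by simp [hA]) (Or.inr rfl)
    rw [zero_mul, sub_zero] at c1 c2
    exact ⟨by exact_mod_cast h3.trans c1, by exact_mod_cast h3.trans c2, hcardI, h1, h2⟩
  have hfar : ∀ t ∈ Icc (l / 2 * r) (U * r), ∀ i, U * r < |X i| → weight K X t i = 0 :=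
    fun t ht i hi => weight_eq_zero hK
      ((show 0 < l / 2 * r by positivity).trans_le ht.1) (ht.2.trans hi.le)
  have d2 := k2 η hηG (hdesign _ _ (fun i => by
    rw [abs_of_nonneg (sq_nonneg _), ← sq_abs]
    exact pow_le_pow_left₀ (abs_nonneg _) ((hwb f hIf).2.1 i) 2)
    (fun i hi => by rw [hfar f hIf i hi]; ring))
  have d3 := k3 (hdesign 1 _ (fun i => by split_ifs <;> simp) (fun i hi => if_neg (not_le.2 hi)))
  have hsq : ∀ s ∈ Icc (l / 2 * r) (U * r), ∀ t ∈ Icc (l / 2 * r) (U * r),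
      (∀ y, |K (y / s) - K (y / t)| ≤ ω) → ∀ i,
      |weight K X s i ^ 2 - weight K X t i ^ 2| ≤ 2 * (ω * C / (n * r)) * (C / (n * r)) :=
    fun s hs t ht hst i => abs_sq_sub_sq_le (hwd s hs t ht ω hω.le hst i) ((hwb s hs).2.1 i)
      ((hwb t ht).2.1 i)
  -- sums of the conditional variances and of their estimators near the cutoff
  have hσsum : ∑ i ∈ I, condVariance (κ m) c (X i) ≤ |hi| * (b * (n * r)) := by
    refine (Finset.sum_le_card_nsmul _ _ |hi| fun i _ => (svar i).2.trans (le_abs_self _)).trans ?_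
    rw [nsmul_eq_mul, mul_comm]
    gcongr
  have hσhsum : ∑ i ∈ I, nnVariance R X (sampleOutcome c S) i ≤ (|hi| * b + 1) * (n * r) := by
    have e : ∑ i, (if |X i| ≤ U * r then (1 : ℝ) else 0) * (nnVariance R X (sampleOutcome c S) i -
        condVariance (κ m) c (X i)) = ∑ i ∈ I, nnVariance R X (sampleOutcome c S) i -
        ∑ i ∈ I, condVariance (κ m) c (X i) := by
      rw [← Finset.sum_sub_distrib, hI, Finset.sum_filter]
      exact Finset.sum_congr rfl fun i _ => by split_ifs <;> simp
    rw [e, one_mul] at d3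
    have := (abs_le.1 d3).2
    have : τ * (n * r) ≤ 1 * (n * r) := by gcongr
    linarith
  have hdiffsum : ∀ s ∈ Icc (l / 2 * r) (U * r), ∀ t ∈ Icc (l / 2 * r) (U * r),
      (∀ y, |K (y / s) - K (y / t)| ≤ ω) → ∀ z : Fin n → ℝ, (∀ i, 0 ≤ z i) →
      ∑ i ∈ I, z i ≤ (|hi| * b + 1) * (n * r) →
      |∑ i, (weight K X s i ^ 2 - weight K X t i ^ 2) * z i| ≤ ε * lo / (4 * C) / (n * r) := by
    intro s hs t ht hst z hz hzsum
    rw [← Finset.sum_subset (Finset.subset_univ I) fun i _ hi => by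
      have hi' : U * r < |X i| := by
        by_contra! hc
        exact hi (Finset.mem_filter.2 ⟨Finset.mem_univ _, hc⟩)
      rw [hfar s hs i hi', hfar t ht i hi']; ring]
    calc _ ≤ ∑ i ∈ I, 2 * (ω * C / (n * r)) * (C / (n * r)) * z i := by
          refine (Finset.abs_sum_le_sum_abs _ _).trans (Finset.sum_le_sum fun i _ => ?_)
          rw [abs_mul, abs_of_nonneg (hz i)]
          exact mul_le_mul_of_nonneg_right (hsq s hs t ht hst i) (hz i)
      _ = 2 * (ω * C / (n * r)) * (C / (n * r)) * ∑ i ∈ I, z i := by rw [Finset.mul_sum]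
      _ ≤ 2 * (ω * C / (n * r)) * (C / (n * r)) * ((|hi| * b + 1) * (n * r)) := by gcongr
      _ = _ := by
          have hn' : (n : ℝ) ≠ 0 := by exact_mod_cast hn0.ne'
          have hb' : |hi| * b + 1 ≠ 0 := by positivity
          rw [hωdef]
          field_simp
          norm_num
  have t1 := hdiffsum g hIg f hIf hKgf (fun i => nnVariance R X (sampleOutcome c S) i)
    (fun i => nnVariance_nonneg) hσhsum
  have t3 := hdiffsum f hIf h hIh hKfh (fun i => condVariance (κ m) c (X i))
    (fun i => hlo.le.trans (svar i).1) (hσsum.trans (by nlinarith))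
  have t2 : |∑ i, weight K X f i ^ 2 * (nnVariance R X (sampleOutcome c S) i -
      condVariance (κ m) c (X i))| ≤ ε * lo / (2 * C) / (n * r) := by
    refine d2.trans ?_
    have e : τ * ((C / (n * r)) ^ 2 * (n * r)) = τ * C ^ 2 / (n * r) := by
      field_simp
    rw [e]
    gcongr
    calc τ * C ^ 2 ≤ ε * lo / (2 * C ^ 3) * C ^ 2 := by gcongr; exact min_le_right _ _
      _ = _ := by field_simp
  have hB : lo / C / (n * r) ≤ stdDev K (κ m) c X h ^ 2 := by
    refine le_trans ?_ (stdDev_sq_bounds svar).1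
    have := mul_le_mul_of_nonneg_left (hwb h hIh).2.2.1 hlo.le
    refine le_trans (le_of_eq ?_) this
    ring
  rw [stdErr, stdDev, abs_of_nonneg (Real.sqrt_nonneg _)] at hS
  refine absurd (abs_sqrt_sub_sqrt_le (ε := ε) ?_ ?_) (not_le.2 hS)
  · rw [← stdDev_sq]; exact (by positivity : 0 < lo / C / (n * r)).trans_le hB
  · rw [← stdDev_sq]
    refine le_trans ?_ (mul_le_mul_of_nonneg_left hB hε.le)
    rw [stdDev_sq]
    -- From the empirical bandwidth `g` to the net point `f` with estimated variances, from
    -- estimated to true variances at `f`, and from `f` to the optimum `h` with true variances. The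
    -- shares of the tolerance are a quarter, a half and a quarter.
    have e : ∑ i, weight K X g i ^ 2 * nnVariance R X (sampleOutcome c S) i -
        ∑ i, weight K X h i ^ 2 * condVariance (κ m) c (X i) =
        ∑ i, (weight K X g i ^ 2 - weight K X f i ^ 2) * nnVariance R X (sampleOutcome c S) i +
        ∑ i, weight K X f i ^ 2 * (nnVariance R X (sampleOutcome c S) i -
          condVariance (κ m) c (X i)) +
        ∑ i, (weight K X f i ^ 2 - weight K X h i ^ 2) * condVariance (κ m) c (X i) := by
      rw [← Finset.sum_sub_distrib, ← Finset.sum_add_distrib, ← Finset.sum_add_distrib]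
      exact Finset.sum_congr rfl fun i _ => by ring
    rw [e]
    refine (abs_add_le _ _).trans ((add_le_add ((abs_add_le _ _).trans (add_le_add t1 t2))
      t3).trans (le_of_eq ?_))
    have hn' : (n : ℝ) ≠ 0 := by exact_mod_cast hn0.ne'
    field_simp
    norm_num

end ContinuousConsistency

end FuzzyRD

theorem theorem4
    (PX : Measure ℝ) [IsProbabilityMeasure PX]
    (κ : (ℝ → ℝ) × (ℝ → ℝ) → Kernel ℝ (ℝ × ℝ)) [∀ m, IsMarkovKernel (κ m)]
    (BY BT α : ℝ) (hBY : 0 < BY) (hBT : 0 < BT) (hα : α ∈ Ioo (0 : ℝ) 1)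
    (K : ℝ → ℝ) (R : ℕ)
    (hpop : IsPopulation PX κ (regClass BY BT PX))
    (hmom : MomentConditions PX κ (regClass BY BT PX))
    (hK : IsRegKernel K)
    (hX : (1 ≤ R ∧ DiscreteRunning PX) ∨
      (2 ≤ R ∧ ContinuousRunning PX κ (regClass BY BT PX)))
    (c : ℝ)
    -- the infeasible optimal bandwidth: any choice of a minimizer, whenever there is one
    (hM : (ℝ → ℝ) × (ℝ → ℝ) → (n : ℕ) → (Fin n → ℝ) → ℝ)
    (hM_opt : ∀ m ∈ regClass BY BT PX, ∀ (n : ℕ) (X : Fin n → ℝ),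
      (optimalBandwidths BY BT α K (κ m) c X).Nonempty →
        hM m n X ∈ optimalBandwidths BY BT α K (κ m) c X)
    -- the empirical bandwidth: a function of the sample, admissible with probability tending to one
    (hhat : (n : ℕ) → (Fin n → Obs) → ℝ)
    (hhat_adm : UnifNegligible PX κ (regClass BY BT PX) fun _ n =>
      {S | hhat n S ∉ admissible K (runVar S)})
    (hhat_cons : UnifRatioConsistent PX κ (regClass BY BT PX)
      (fun _ n S => hhat n S) (fun m n S => hM m n (runVar S))) :
    UnifRatioConsistent PX κ (regClass BY BT PX)
      (fun _ n S => stdErr R K c S (hhat n S))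
      (fun m n S => stdDev K (κ m) c (runVar S) (hM m n (runVar S))) := by
  rcases hX with ⟨hR, hD⟩ | ⟨hR, hC⟩
  · exact FuzzyRD.unifRatioConsistent_stdErr_discrete hBY hBT hα hmom hK hR hD c hM_opt hhat_adm hhat_cons
  · exact FuzzyRD.unifRatioConsistent_stdErr_continuous hBY hBT hα hpop hmom hK hR hC c hM_opt hhat_cons
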